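/- Let $d\ge 2$, $\gamma\in(0,1)$, $\delta>0$, $T>0$, let $p$ be a real number with $2<p+1\le \frac{2d}{d-2\gamma}$, and let $\mathcal O\subset\mathbb R^d$ be a bounded open set (for instance a bounded domain with smooth boundary). Put $$\mathbb H=\{u\in L^2(\mathbb R^d): u=0 \text{ a.e. in } \mathbb R^d\setminus\mathcal O\},\qquad \mathbb V=\{u\in H^\gamma(\mathbb R^d): u=0 \text{ a.e. in } \mathbb R^d\setminus\mathcal O\},$$ with norms $|u|=\|u\|_{L^2}$ and $\|u\|^2=|u|^2+\iint\frac{|u(x)-u(y)|^2}{|x-y|^{d+2\gamma}}\,dx\,dy$, and let $A:\mathbb V\to\mathbb V^*$, $A=(-\Delta)^\gamma+\delta$, be given by $$\langle Av,w\rangle=\delta (v,w)+\tfrac12 C(d,\gamma)\iint\frac{(v(x)-v(y))(w(x)-w(y))}{|x-y|^{d+2\gamma}}\,dx\,dy,\qquad C(d,\gamma)=\frac{\gamma 4^\gamma\Gamma(\frac{d+2\gamma}{2})}{\pi^{d/2}\Gamma(1-\gamma)}.$$ Let $U$ be a separable real Hilbert space with Hilbert--Schmidt operators $\mathcal L_2(U;\mathbb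 H)$, let $E$ be a locally compact Polish space, $\lambda$ a Borel measure on $E$ that is finite on compact sets, and $\lambda_T=dt\otimes\lambda$ on $[0,T]\times E$. Assume: * $F\in C^1(\mathbb R)$ and, for some $k_1,\dots,k_4>0$ and all $r\in\mathbb R$: $|F(r)|\le k_1(1+|r|^p)$, $rF(r)\ge -k_2+k_3|r|^{p+1}$, $F'(r)\ge -k_4$. * $g:[0,T]\times\mathbb H\to\mathcal L_2(U;\mathbb H)$ is measurable in $t$; for every $r>0$ there is $L_g(r)>0$ with $\|g(t,u_1)-g(t,u_2)\|_{\mathcal L_2}^2\le L_g(r)|u_1-u_2|^2$ whenever $|u_1|,|u_2|\le r$, $t\in[0,T]$; and there is $C_g>0$ with $\|g(t,u)\|_{\mathcal L_2}^2\le C_g(1+|u|^2)$ for all $t,u$. * $h:[0,T]\times\mathbb H\times E\to\mathbb H$ is measurable, and there are $L_h',C_h'>0$ with $\int_E|h(t,u_1,\xi)-h(t,u_2,\xi)|^2\lambda(d\xi)\le L'_h|u_1-u_2|^2$ and $\int_E|h(t,u,\xi)|^2\lambda(d\xi)\le C'_h(1+|u|^2)$ for all $t,u,u_1,u_2$. *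 With $\|h(t,\xi)\|_{0}=\sup_{u}\frac{|h(t,u,\xi)|}{1+|u|}$ and $\|h(t,\xi)\|_{1}=\sup_{u_1\ne u_2}\frac{|h(t,u_1,\xi)-h(t,u_2,\xi)|}{|u_1-u_2|}$ (suprema over $\mathbb H$), for $i=0,1$ the function $\|h\|_i$ is $\lambda_T$-measurable and there is $\delta_1^i>0$ such that $\int_X e^{\delta_1^i\|h(s,\xi)\|_i^2}\,\lambda_T(ds\,d\xi)<\infty$ for every Borel $X\subset[0,T]\times E$ with $\lambda_T(X)<\infty$. For $\Upsilon\in\mathbb N$ let $\mathrm S^\Upsilon$ be the set of pairs $\pi=(\sigma,\rho)$ with $\sigma\in L^2(0,T;U)$, $\frac12\int_0^T\|\sigma(t)\|_U^2dt\le\Upsilon$, and $\rho:[0,T]\times E\to[0,\infty)$ measurable, $\int_{[0,T]\times E}(\rho\log\rho-\rho+1)\,d\lambda_T\le\Upsilon$; let $\mathbb S=\bigcup_{\Upsilon}\mathrm S^\Upsilon$. Let $u_0\in\mathbb H$. Then for every $\pi=(\sigma,\rho)\in\mathbb S$ there is a unique $u^\pi\in C([0,T];\mathbb H)\cap L^2(0,T;\mathbb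 V)\cap L^{p+1}(0,T;L^{p+1}(\mathbb R^d))$ such that for all $t\in[0,T]$ $$u^\pi(t)=u_0-\int_0^tAu^\pi(s)\,ds-\int_0^tF(u^\pi(s))\,ds+\int_0^tg(s,u^\pi(s))\sigma(s)\,ds+\int_0^t\int_Eh(s,u^\pi(s),\xi)(\rho(s,\xi)-1)\,\lambda(d\xi)\,ds$$ in the dual of $\mathbb V\cap L^{p+1}(\mathbb R^d)$, i.e. when tested with every $\varphi\in\mathbb V\cap L^{p+1}(\mathbb R^d)$. Moreover, for every $\Upsilon\in\mathbb N$ there is a constant $C_\Upsilon>0$ such that $$\sup_{\pi\in\mathrm S^\Upsilon}\Big(\sup_{t\in[0,T]}|u^\pi(t)|^2+\int_0^T\|u^\pi(t)\|^2\,dt\Big)\le C_\Upsilon .$$ -/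

import Mathlib

open MeasureTheory Set
open scoped ENNReal NNReal

namespace FracSkeleton

noncomputable section

/-- The space `ℍ`: all `u ∈ L²(ℝᵈ)` with `u = 0` a.e. outside `𝒪`. -/
def l2Sub {d : ℕ} (O : Set (EuclideanSpace ℝ (Fin d))) :
    Submodule ℝ (Lp ℝ 2 (volume : Measure (EuclideanSpace ℝ (Fin d)))) where
  carrier := {u | ∀ᵐ x, x ∉ O → u x = 0}
  zero_mem' := by
    filter_upwards [Lp.coeFn_zero ℝ 2 (volume : Measure (EuclideanSpace ℝ (Fin d)))] with x hx _
    rw [hx]; rfl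
  add_mem' := by
    intro u v hu hv
    filter_upwards [hu, hv, Lp.coeFn_add u v] with x h1 h2 h3 hx
    change (u + v : Lp ℝ 2 volume) x = 0
    rw [h3, Pi.add_apply, h1 hx, h2 hx, add_zero]
  smul_mem' := by
    intro c u hu
    filter_upwards [hu, Lp.coeFn_smul c u] with x h1 h2 hx
    change (c • u : Lp ℝ 2 volume) x = 0
    rw [h2, Pi.smul_apply, h1 hx, smul_zero]

/-- `ℍ` as a type, with the norm and inner product of `L²(ℝᵈ)`. -/
abbrev L2O {d : ℕ} (O : Set (EuclideanSpace ℝ (Fin d))) : Type := l2Sub O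

instance {d : ℕ} (O : Set (EuclideanSpace ℝ (Fin d))) : MeasurableSpace (L2O O) :=
  borel _

instance {d : ℕ} (O : Set (EuclideanSpace ℝ (Fin d))) : BorelSpace (L2O O) :=
  ⟨rfl⟩

/-- The function on `ℝᵈ` (defined up to null sets) underlying an element of `ℍ`. -/
def L2O.toFun {d : ℕ} {O : Set (EuclideanSpace ℝ (Fin d))} (u : L2O O) :
    EuclideanSpace ℝ (Fin d) → ℝ :=
  ((u : Lp ℝ 2 (volume : Measure (EuclideanSpace ℝ (Fin d)))) : EuclideanSpace ℝ (Fin d) → ℝ)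

/-- The squared Gagliardo seminorm `∬ |u(x) - u(y)|² / |x - y|^(d + 2γ) dx dy ∈ [0, ∞]`. -/
def gagliardoSq {d : ℕ} (γ : ℝ) (u : EuclideanSpace ℝ (Fin d) → ℝ) : ℝ≥0∞ :=
  ∫⁻ z : EuclideanSpace ℝ (Fin d) × EuclideanSpace ℝ (Fin d),
    ‖u z.1 - u z.2‖ₑ ^ 2 / ‖z.1 - z.2‖ₑ ^ ((d : ℝ) + 2 * γ) ∂(volume.prod volume)

/-- The squared norm `‖u‖² = |u|² + ‖u‖²_{Ḣ^γ}` of `𝕍`, with value `∞` if `u ∉ 𝕍`. -/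
def vNormSq {d : ℕ} {O : Set (EuclideanSpace ℝ (Fin d))} (γ : ℝ) (u : L2O O) : ℝ≥0∞ :=
  ‖u‖ₑ ^ 2 + gagliardoSq γ u.toFun

/-- The space `𝕍`: all `u ∈ H^γ(ℝᵈ)` with `u = 0` a.e. outside `𝒪`. -/
def VSet {d : ℕ} (γ : ℝ) (O : Set (EuclideanSpace ℝ (Fin d))) : Set (L2O O) :=
  {u | gagliardoSq γ u.toFun < ∞}

/-- The constant `C(d, γ)` of the integral fractional Laplacian `(-Δ)^γ`. -/
def fracConst (d : ℕ) (γ : ℝ) : ℝ :=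
  γ * 4 ^ γ * Real.Gamma (((d : ℝ) + 2 * γ) / 2) /
    (Real.pi ^ ((d : ℝ) / 2) * Real.Gamma (1 - γ))

/-- The bilinear form `a(v, w) = ⟨A v, w⟩` (for `v, w ∈ 𝕍`) that defines `A : 𝕍 → 𝕍*`,
`A = (-Δ)^γ + δ`. -/
def formA {d : ℕ} {O : Set (EuclideanSpace ℝ (Fin d))} (γ δ : ℝ) (v w : L2O O) : ℝ :=
  δ * inner ℝ v w + fracConst d γ / 2 *
    ∫ z : EuclideanSpace ℝ (Fin d) × EuclideanSpace ℝ (Fin d),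
      (v.toFun z.1 - v.toFun z.2) * (w.toFun z.1 - w.toFun z.2) /
        ‖z.1 - z.2‖ ^ ((d : ℝ) + 2 * γ) ∂(volume.prod volume)

/-- Growth, dissipativity and one-sided Lipschitz conditions on the `C¹` nonlinearity `F`. -/
def CondF (p : ℝ) (F : ℝ → ℝ) : Prop :=
  ContDiff ℝ 1 F ∧
  (∃ k₁ > 0, ∀ r, |F r| ≤ k₁ * (1 + |r| ^ p)) ∧
  (∃ k₂ > 0, ∃ k₃ > 0, ∀ r, -k₂ + k₃ * |r| ^ (p + 1) ≤ r * F r) ∧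
  (∃ k₄ > 0, ∀ r, -k₄ ≤ deriv F r)

/-- The squared Hilbert-Schmidt norm of `S : U → H`, computed in an orthonormal basis of `U`
(it does not depend on the basis); `S` is Hilbert-Schmidt iff it is finite. -/
def hsNormSq {ι U H : Type*} [NormedAddCommGroup U] [InnerProductSpace ℝ U]
    [NormedAddCommGroup H] [InnerProductSpace ℝ H]
    (a : HilbertBasis ι ℝ U) (S : U →L[ℝ] H) : ℝ≥0∞ :=
  ∑' i, ‖S (a i)‖ₑ ^ 2

/-- Local Lipschitz continuity and linear growth of `g(t, ·) : H → 𝓛₂(U; H)`, uniformly in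
`t ∈ [0, T]`, and measurability of `t ↦ g(t, u)`. As `U` and `H` are separable, Borel measurability
of a map into `𝓛₂(U; H)` is the measurability of its evaluations at all `x ∈ U`. -/
def CondG {ι U H : Type*} [NormedAddCommGroup U] [InnerProductSpace ℝ U]
    [NormedAddCommGroup H] [InnerProductSpace ℝ H] [MeasurableSpace H]
    (T : ℝ) (a : HilbertBasis ι ℝ U) (g : ℝ → H → U →L[ℝ] H) : Prop :=
  (∀ r > 0, ∃ L : ℝ, 0 < L ∧ ∀ t ∈ Icc 0 T, ∀ u₁ u₂ : H, ‖u₁‖ ≤ r → ‖u₂‖ ≤ r →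
    hsNormSq a (g t u₁ - g t u₂) ≤ ENNReal.ofReal (L * ‖u₁ - u₂‖ ^ 2)) ∧
  (∃ C : ℝ, 0 < C ∧ ∀ t ∈ Icc 0 T, ∀ u : H,
    hsNormSq a (g t u) ≤ ENNReal.ofReal (C * (1 + ‖u‖ ^ 2))) ∧
  (∀ (u : H) (x : U), Measurable fun t : Icc (0 : ℝ) T => g t u x)

/-- Joint measurability, and Lipschitz continuity and linear growth of `h(t, ·, ξ)` in the mean
square with respect to the measure `ν` on `E`. -/
def CondH {E H : Type*} [NormedAddCommGroup H] [MeasurableSpace H] [MeasurableSpace E]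
    (T : ℝ) (ν : Measure E) (h : ℝ → H → E → H) : Prop :=
  (Measurable fun z : Icc (0 : ℝ) T × H × E => h z.1 z.2.1 z.2.2) ∧
  (∃ L : ℝ, 0 < L ∧ ∀ t ∈ Icc 0 T, ∀ u₁ u₂ : H,
    ∫⁻ ξ, ‖h t u₁ ξ - h t u₂ ξ‖ₑ ^ 2 ∂ν ≤ ENNReal.ofReal (L * ‖u₁ - u₂‖ ^ 2)) ∧
  (∃ C : ℝ, 0 < C ∧ ∀ t ∈ Icc 0 T, ∀ u : H,
    ∫⁻ ξ, ‖h t u ξ‖ₑ ^ 2 ∂ν ≤ ENNReal.ofReal (C * (1 + ‖u‖ ^ 2)))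

/-- `‖h(t, ξ)‖_{0,H} = sup_u |h(t, u, ξ)| / (1 + |u|) ∈ [0, ∞]`. -/
def hNorm0 {E H : Type*} [NormedAddCommGroup H] (h : ℝ → H → E → H) (t : ℝ) (ξ : E) : ℝ≥0∞ :=
  ⨆ u : H, ‖h t u ξ‖ₑ / (1 + ‖u‖ₑ)

/-- `‖h(t, ξ)‖_{1,H} = sup_{u₁ ≠ u₂} |h(t, u₁, ξ) - h(t, u₂, ξ)| / |u₁ - u₂| ∈ [0, ∞]`. -/
def hNorm1 {E H : Type*} [NormedAddCommGroup H] (h : ℝ → H → E → H) (t : ℝ) (ξ : E) : ℝ≥0∞ :=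
  ⨆ (u₁ : H) (u₂ : H) (_ : u₁ ≠ u₂), ‖h t u₁ ξ - h t u₂ ξ‖ₑ / ‖u₁ - u₂‖ₑ

/-- The measure `λ_T = L_T ⊗ ν` on `[0, T] × E`. -/
def timeMeasure {E : Type*} [MeasurableSpace E] (T : ℝ) (ν : Measure E) : Measure (ℝ × E) :=
  (volume.restrict (Icc 0 T)).prod ν

/-- Exponential integrability of a function `n : [0, T] × E → [0, ∞]`: it is measurable (up to a
null set) and, for some `κ > 0`, `exp (κ n²)` is integrable over all sets of finite measure. -/
def ExpIntegrable {E : Type*} [MeasurableSpace E] (T : ℝ) (ν : Measure E)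
    (n : ℝ → E → ℝ≥0∞) : Prop :=
  AEMeasurable (Function.uncurry n) (timeMeasure T ν) ∧
  ∃ κ : ℝ, 0 < κ ∧ ∀ X : Set (ℝ × E), MeasurableSet X → timeMeasure T ν X < ∞ →
    ∫⁻ z in X, EReal.exp ((ENNReal.ofReal κ * n z.1 z.2 ^ 2 : ℝ≥0∞) : EReal) ∂(timeMeasure T ν) < ∞

/-- The set `S^Υ` of controls `(σ, ρ)` with `½ ∫ ‖σ‖² dt ≤ Υ` and `∫ l(ρ) dλ_T ≤ Υ`, where
`l(r) = r log r - r + 1`. -/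
def IsControl {E U : Type*} [MeasurableSpace E] [NormedAddCommGroup U]
    (T : ℝ) (ν : Measure E) (Υ : ℕ) (σ : ℝ → U) (ρ : ℝ → E → ℝ≥0) : Prop :=
  MemLp σ 2 (volume.restrict (Icc 0 T)) ∧
  (1 / 2 : ℝ) * ∫ t in Icc 0 T, ‖σ t‖ ^ 2 ≤ (Υ : ℝ) ∧
  AEMeasurable (Function.uncurry ρ) (timeMeasure T ν) ∧
  ∫⁻ z, ENNReal.ofReal (InformationTheory.klFun (ρ z.1 z.2)) ∂(timeMeasure T ν) ≤ (Υ : ℝ≥0∞)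

/-- `u` belongs to `C([0,T]; ℍ) ∩ L²(0,T; 𝕍) ∩ L^{p+1}(0,T; L^{p+1}(ℝᵈ))` and solves
`u(t) = u₀ - ∫₀ᵗ A u ds - ∫₀ᵗ F(u) ds + ∫₀ᵗ g(s,u) σ ds + ∫₀ᵗ ∫_E h(s,u,ξ) (ρ - 1) ν(dξ) ds`
for `t ∈ [0, T]`, as an identity in the dual of `𝕍 ∩ L^{p+1}(ℝᵈ)`.
As `u` is continuous into `ℍ` and `𝕍`, `L^{p+1}` are separable, `u` is automatically measurable as
a map into these spaces, so that only the finiteness of the norms has to be required. -/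
structure IsSolution {d : ℕ} {O : Set (EuclideanSpace ℝ (Fin d))} {E U : Type*}
    [MeasurableSpace E] [NormedAddCommGroup U] [InnerProductSpace ℝ U]
    (γ δ p T : ℝ) (F : ℝ → ℝ) (g : ℝ → L2O O → U →L[ℝ] L2O O)
    (h : ℝ → L2O O → E → L2O O) (ν : Measure E) (u₀ : L2O O)
    (σ : ℝ → U) (ρ : ℝ → E → ℝ≥0) (u : ℝ → L2O O) : Prop where
  continuousOn : ContinuousOn u (Icc 0 T)
  memL2V : ∫⁻ t in Icc 0 T, vNormSq γ (u t) < ∞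
  memLp : ∫⁻ t in Icc 0 T, ∫⁻ x, ‖(u t).toFun x‖ₑ ^ (p + 1) < ∞
  integrable_g : IntegrableOn (fun s => g s (u s) (σ s)) (Icc 0 T)
  integrable_h : ∀ᵐ s ∂(volume.restrict (Icc 0 T)),
    Integrable (fun ξ => ((ρ s ξ : ℝ) - 1) • h s (u s) ξ) ν
  integrable_integral_h :
    IntegrableOn (fun s => ∫ ξ, ((ρ s ξ : ℝ) - 1) • h s (u s) ξ ∂ν) (Icc 0 T)
  equation : ∀ φ ∈ VSet γ O, ∫⁻ x, ‖φ.toFun x‖ₑ ^ (p + 1) < ∞ → ∀ t ∈ Icc 0 T,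
    inner ℝ (u t) φ = inner ℝ u₀ φ
      - (∫ s in (0 : ℝ)..t, formA γ δ (u s) φ)
      - (∫ s in (0 : ℝ)..t, ∫ x, F ((u s).toFun x) * φ.toFun x)
      + (∫ s in (0 : ℝ)..t, inner ℝ (g s (u s) (σ s)) φ)
      + ∫ s in (0 : ℝ)..t, inner ℝ (∫ ξ, ((ρ s ξ : ℝ) - 1) • h s (u s) ξ ∂ν) φ

end

end FracSkeleton

open FracSkeleton

/-! The equation is read as u' + A u + f(u) = G(t, u) in ℍ. Here f(r) = F(r) + k r - F(0) is
nondecreasing when -k bounds F' from below, and G collects g σ, the jump integral and the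
compensating affine term k u - F(0) 1_𝒪. The operator A + f is monotone and coercive and comes from
a convex lower semicontinuous energy. For a fixed control, G has linear growth and is Lipschitz on
balls, both at a rate b(t) that is integrable in time.

The problem u' + A u + f(u) = c(t) is solved without compactness. Minimising |u - v|²/2 + τ J(u)
solves the resolvent equation (`exists_resolvent_of_potential`), so implicit Euler sequences exist.
Replacing one step τ by two steps τ/2 moves the solution at time t by O(√(τ t)), because the squared
increments of the slope telescope (`IsEuler.norm_sub_refine_le`). Hence dyadic refinements converge
for step functions c and initial data in the domain. The stability estimate |u - v| ≤ |u₀ - v₀| + 2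
∫ |f - g| (`IsWeakSol.norm_sub_le`) then gives all integrable right-hand sides and all u₀ in ℍ.

Stability, a priori bounds and uniqueness all rest on one energy inequality (`energy_le`): the weak
equation is tested with w(t) frozen, and the error is averaged over t. The dual of 𝕍 ∩ L^{p+1} is
never built. Its role is played by the estimate |⟨A u + f(u), ψ⟩| ≤ C (1 + |u|) |ψ| + a tail_k(u) +
η Λ(ψ), where Λ is the Gagliardo energy plus ∫ |ψ|^{p+1}, and tail_k(u) tends to 0 as k grows.

G enters by Picard iteration in a norm weighted by exp(-K ∫ b). Local Lipschitz continuity suffices,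
since a radial truncation keeps the rate b and therefore the Gronwall bound, which depends on b only
through its integral.

It remains to bound ∫ b uniformly over S^Υ. For g this is Cauchy-Schwarz in σ. For the jumps, with
l(r) = r log r - r + 1: where ρ ≤ 2 one has (ρ - 1)² ≤ 6 l(ρ), and the mean square bounds on h
suffice; where ρ > 2, convex duality gives ρ n ≤ l(ρ) + C exp(κ n²), and {ρ > 2} has measure at most
6Υ. Exponential integrability is assumed set by set. As λ_T has no atoms, it is uniform over all
sets of a given bounded measure (`ExpIntegrable.uniform`). -/

namespace EvolEq

/-! ### Implicit Euler schemes for monotone relations -/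

open Filter Topology

noncomputable section

/-- Monotonicity of a relation `B` on a Hilbert space, the graph of a multivalued operator. -/
def MonotoneRel {H : Type*} [NormedAddCommGroup H] [InnerProductSpace ℝ H]
    (B : H → H → Prop) : Prop :=
  ∀ u z v y, B u z → B v y → 0 ≤ inner ℝ (z - y) (u - v)

/-- An implicit Euler sequence for `u' + B u ∋ c` with time step `τ`. -/
structure IsEuler {H : Type*} [NormedAddCommGroup H] [InnerProductSpace ℝ H]
    (B : H → H → Prop) (τ : ℝ) (c U Z : ℕ → H) : Prop where
  rel : ∀ k, B (U k) (Z k)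
  step : ∀ k, U (k + 1) = U k + τ • (c k - Z (k + 1))

section Euler

variable {H : Type*} [NormedAddCommGroup H] [InnerProductSpace ℝ H]
  {B : H → H → Prop}

theorem norm_le_of_inner_sub_nonneg {x y : H} (h : 0 ≤ inner ℝ (x - y) y) : ‖y‖ ≤ ‖x‖ := by
  have h1 : ‖y‖ ^ 2 ≤ inner ℝ x y := by
    rw [inner_sub_left, real_inner_self_eq_norm_sq] at h; linarith
  have h2 := real_inner_le_norm x y
  by_contra! h3
  nlinarith [norm_nonneg x, norm_nonneg y]

theorem norm_sub_sq_le_of_inner_sub_nonneg {x y : H} (h : 0 ≤ inner ℝ (x - y) y) :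
    ‖x - y‖ ^ 2 ≤ ‖x‖ ^ 2 - ‖y‖ ^ 2 := by
  have h1 : ‖y‖ ^ 2 ≤ inner ℝ x y := by
    rw [inner_sub_left, real_inner_self_eq_norm_sq] at h; linarith
  rw [norm_sub_sq_real]; linarith

namespace IsEuler

variable {τ : ℝ} {c U Z : ℕ → H}

/-- Monotonicity between consecutive states, whose difference is τ times the slope c k - Z (k+1).
With x = c k - Z k and y = c k - Z (k+1) it reads ⟨x - y, y⟩ ≥ 0, which gives both ‖y‖ ≤ ‖x‖ and the
dissipation ‖x - y‖² ≤ ‖x‖² - ‖y‖². -/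
theorem inner_nonneg (hB : MonotoneRel B) (h : IsEuler B τ c U Z) (hτ : 0 < τ) (k : ℕ) :
    0 ≤ inner ℝ ((c k - Z k) - (c k - Z (k + 1))) (c k - Z (k + 1)) := by
  have h1 := hB _ _ _ _ (h.rel (k + 1)) (h.rel k)
  rw [h.step k, add_sub_cancel_left, inner_smul_right] at h1
  have h2 : (c k - Z k) - (c k - Z (k + 1)) = Z (k + 1) - Z k := by abel
  rw [h2]
  exact nonneg_of_mul_nonneg_right h1 hτ

/-- A step never increases the slope; only the jumps of the right-hand side do. -/
theorem norm_slope_le (hB : MonotoneRel B) (h : IsEuler B τ c U Z) (hτ : 0 < τ) (k : ℕ) :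
    ‖c k - Z (k + 1)‖ ≤ ‖c 0 - Z 0‖ + ∑ i ∈ Finset.range k, ‖c (i + 1) - c i‖ := by
  induction k with
  | zero => simpa using norm_le_of_inner_sub_nonneg (h.inner_nonneg hB hτ 0)
  | succ k ih =>
    have h1 := norm_le_of_inner_sub_nonneg (h.inner_nonneg hB hτ (k + 1))
    have h2 : c (k + 1) - Z (k + 1) = (c k - Z (k + 1)) + (c (k + 1) - c k) := by abel
    rw [Finset.sum_range_succ]
    have h3 := norm_add_le (c k - Z (k + 1)) (c (k + 1) - c k)
    rw [← h2] at h3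
    linarith

/-- Since c does not jump inside a pair of steps, the second step of the pair dissipates exactly the
squared increment of Z. The dissipation telescopes, and each jump between pairs costs at most 2M
times its size. -/
theorem sum_sq_le (hB : MonotoneRel B) (h : IsEuler B τ c U Z) (hτ : 0 < τ)
    (hc : ∀ k, c (2 * k + 1) = c (2 * k)) {M : ℝ}
    (hM : ∀ k, ‖c 0 - Z 0‖ + ∑ i ∈ Finset.range k, ‖c (i + 1) - c i‖ ≤ M) (k : ℕ) :
    ∑ j ∈ Finset.range k, ‖Z (2 * j + 1) - Z (2 * j + 2)‖ ^ 2 ≤ 2 * M ^ 2 := by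
  have hsl := h.norm_slope_le hB hτ
  have hM0 : 0 ≤ M := (norm_nonneg _).trans ((hsl 0).trans (hM 0))
  -- Keeping the last squared slope on the left makes the induction close.
  have key : ∑ j ∈ Finset.range k, ‖Z (2 * j + 1) - Z (2 * j + 2)‖ ^ 2
      + ‖c (2 * k) - Z (2 * k + 1)‖ ^ 2 ≤
      2 * M * (‖c 0 - Z 0‖ + ∑ i ∈ Finset.range (2 * k), ‖c (i + 1) - c i‖) := by
    induction k with
    | zero =>
      have h1 := hsl 0
      have h2 := hM 0
      simp only [Finset.range_zero, Finset.sum_empty, add_zero, mul_zero, zero_add] at h1 h2 ⊢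
      nlinarith [norm_nonneg (c 0 - Z 1), norm_nonneg (c 0 - Z 0)]
    | succ k ih =>
      have e1 := norm_sub_sq_le_of_inner_sub_nonneg (h.inner_nonneg hB hτ (2 * k + 1))
      have e2 : c (2 * k + 1) - Z (2 * k + 1) - (c (2 * k + 1) - Z (2 * k + 1 + 1))
        = - (Z (2 * k + 1) - Z (2 * k + 2)) := by abel
      rw [e2, norm_neg, hc k] at e1
      have e3 := norm_le_of_inner_sub_nonneg (h.inner_nonneg hB hτ (2 * k + 2))
      have e4 : c (2 * k + 2) - Z (2 * k + 2)
        = (c (2 * k) - Z (2 * k + 2)) + (c (2 * k + 2) - c (2 * k + 1)) := by rw [hc k]; abel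
      have e5 := norm_add_le (c (2 * k) - Z (2 * k + 2)) (c (2 * k + 2) - c (2 * k + 1))
      rw [← e4] at e5
      have e6 : ‖c (2 * k) - Z (2 * k + 2)‖ ≤ M := by
        have := (hsl (2 * k + 1)).trans (hM _)
        rwa [hc k] at this
      have e7 : ‖c (2 * k + 2) - Z (2 * k + 2 + 1)‖ ≤ M := (hsl (2 * k + 2)).trans (hM _)
      have e8 : 2 * (k + 1) = 2 * k + 1 + 1 := by ring
      rw [Finset.sum_range_succ, e8, Finset.sum_range_succ, Finset.sum_range_succ, hc k, sub_self,
        norm_zero, add_zero]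
      rw [hc k] at e5
      have e9 := norm_nonneg (c (2 * k + 2) - Z (2 * k + 2 + 1))
      have e10 := norm_nonneg (c (2 * k) - Z (2 * k + 2))
      have e11 : ‖c (2 * k + 1 + 1) - Z (2 * k + 1 + 1 + 1)‖ ^ 2 ≤
          ‖c (2 * k) - Z (2 * k + 2)‖ ^ 2 + 2 * M * ‖c (2 * k + 1 + 1) - c (2 * k)‖ := by
        have : ‖c (2 * k + 2) - Z (2 * k + 2 + 1)‖ - ‖c (2 * k) - Z (2 * k + 2)‖ ≤
          ‖c (2 * k + 1 + 1) - c (2 * k)‖ := by linarith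
        change ‖c (2 * k + 2) - Z (2 * k + 2 + 1)‖ ^ 2 ≤ _
        nlinarith [norm_nonneg (c (2 * k + 1 + 1) - c (2 * k))]
      change ‖Z (2 * k + 1) - Z (2 * k + 2)‖ ^ 2 ≤ ‖c (2 * k) - Z (2 * k + 1)‖ ^ 2
        - ‖c (2 * k) - Z (2 * k + 2)‖ ^ 2 at e1
      linarith
  have h5 := hM (2 * k)
  nlinarith [sq_nonneg ‖c (2 * k) - Z (2 * k + 1)‖]

/-- One step τ and two steps τ/2 differ, up to a monotone term, by τ/2 times an increment of Z'.
Summing with Cauchy-Schwarz and `sum_sq_le` gives √k instead of k, so at a fixed time t ≈ k τ the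
error is of order √(τ t). -/
theorem norm_sub_refine_le (hB : MonotoneRel B) (hτ : 0 < τ) (h : IsEuler B τ c U Z)
    {c' U' Z' : ℕ → H} (h' : IsEuler B (τ / 2) c' U' Z') (h0 : U 0 = U' 0)
    (hc0 : ∀ k, c' (2 * k) = c k) (hc1 : ∀ k, c' (2 * k + 1) = c k) {M : ℝ}
    (hM : ∀ k, ‖c' 0 - Z' 0‖ + ∑ i ∈ Finset.range k, ‖c' (i + 1) - c' i‖ ≤ M) (k : ℕ) :
    ‖U k - U' (2 * k)‖ ≤ τ * M * √k := by
  have h1 : ‖U k - U' (2 * k)‖ ≤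
      τ / 2 * ∑ j ∈ Finset.range k, ‖Z' (2 * j + 1) - Z' (2 * j + 2)‖ := by
    induction k with
    | zero => simp [h0]
    | succ k ih =>
      rw [Finset.sum_range_succ]
      have e1 : U' (2 * (k + 1)) = U' (2 * k) + (τ / 2) • (c k - Z' (2 * k + 1))
          + (τ / 2) • (c k - Z' (2 * k + 2)) := by
        rw [show 2 * (k + 1) = 2 * k + 1 + 1 by ring, h'.step, h'.step, hc0, hc1]
      have e2 := h.step k
      have e3 := hB _ _ _ _ (h.rel (k + 1)) (h'.rel (2 * (k + 1)))
      set w := U (k + 1) - U' (2 * (k + 1)) with hw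
      have e4 : w = (U k - U' (2 * k)) + (τ / 2) • (Z' (2 * k + 1) - Z' (2 * k + 2))
          - τ • (Z (k + 1) - Z' (2 * (k + 1))) := by
        rw [hw, e1, e2, show 2 * (k + 1) = 2 * k + 2 by ring]
        module
      -- Pairing the recursion with `w` itself discards the last term by monotonicity.
      have e5 : ‖w‖ ^ 2 ≤ inner ℝ (U k - U' (2 * k)) w
          + (τ / 2) * inner ℝ (Z' (2 * k + 1) - Z' (2 * k + 2)) w := by
        have e : inner ℝ w w = inner ℝ (U k - U' (2 * k)) w
            + (τ / 2) * inner ℝ (Z' (2 * k + 1) - Z' (2 * k + 2)) w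
            - τ * inner ℝ (Z (k + 1) - Z' (2 * (k + 1))) w := by
          rw [← real_inner_smul_left, ← real_inner_smul_left, ← inner_add_left, ← inner_sub_left,
            ← e4]
        rw [← real_inner_self_eq_norm_sq, e]
        linarith [mul_nonneg hτ.le e3]
      have e6 := real_inner_le_norm (U k - U' (2 * k)) w
      have e7 := real_inner_le_norm (Z' (2 * k + 1) - Z' (2 * k + 2)) w
      have e8 : ‖w‖ ^ 2 ≤ (‖U k - U' (2 * k)‖
          + τ / 2 * ‖Z' (2 * k + 1) - Z' (2 * k + 2)‖) * ‖w‖ := by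
        nlinarith
      have e9 : ‖w‖ ≤ ‖U k - U' (2 * k)‖ + τ / 2 * ‖Z' (2 * k + 1) - Z' (2 * k + 2)‖ := by
        rcases (norm_nonneg w).eq_or_lt with hz | hz
        · rw [← hz]; positivity
        · rw [pow_two] at e8; exact le_of_mul_le_mul_right e8 hz
      linarith
  have h2 := h'.sum_sq_le hB (half_pos hτ) (fun k => by rw [hc0, hc1]) hM k
  have hM0 : 0 ≤ M := le_trans (by positivity) (hM 0)
  have h3 := sq_sum_le_card_mul_sum_sq (s := Finset.range k)
    (f := fun j => ‖Z' (2 * j + 1) - Z' (2 * j + 2)‖)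
  rw [Finset.card_range] at h3
  have h4 : ∑ j ∈ Finset.range k, ‖Z' (2 * j + 1) - Z' (2 * j + 2)‖ ≤ 2 * M * √k := by
    apply le_of_sq_le_sq _ (by positivity)
    rw [mul_pow, Real.sq_sqrt (by positivity)]
    have : (k : ℝ) * ∑ j ∈ Finset.range k, ‖Z' (2 * j + 1) - Z' (2 * j + 2)‖ ^ 2
        ≤ k * (2 * M ^ 2) := by gcongr
    nlinarith [sq_nonneg M, (Nat.cast_nonneg k : (0 : ℝ) ≤ k), mul_nonneg (Nat.cast_nonneg k : (0 : ℝ) ≤ k) (sq_nonneg M)]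
  nlinarith

theorem norm_sub_le (hB : MonotoneRel B) (h : IsEuler B τ c U Z) (hτ : 0 < τ) {M : ℝ}
    (hM : ∀ k, ‖c 0 - Z 0‖ + ∑ i ∈ Finset.range k, ‖c (i + 1) - c i‖ ≤ M) (k l : ℕ) :
    ‖U k - U l‖ ≤ M * (τ * |(k : ℝ) - l|) := by
  wlog hkl : l ≤ k generalizing k l
  · rw [norm_sub_rev, abs_sub_comm]; exact this _ _ (by omega)
  obtain ⟨m, rfl⟩ := Nat.exists_eq_add_of_le hkl
  have e : ((l + m : ℕ) : ℝ) - l = m := by push_cast; ring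
  rw [e, Nat.abs_cast]
  clear hkl e
  induction m with
  | zero => simp
  | succ m ih =>
    have h1 : ‖U (l + m + 1) - U (l + m)‖ ≤ τ * M := by
      rw [h.step, add_sub_cancel_left, norm_smul, Real.norm_of_nonneg hτ.le]
      exact mul_le_mul_of_nonneg_left ((h.norm_slope_le hB hτ _).trans (hM _)) hτ.le
    have h2 := norm_sub_le_norm_sub_add_norm_sub (U (l + m + 1)) (U (l + m)) (U l)
    rw [← add_assoc]
    push_cast
    linarith

end IsEuler

theorem exists_isEuler (hR : ∀ τ : ℝ, 0 < τ → ∀ f, ∃ u z, B u z ∧ u + τ • z = f)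
    {τ : ℝ} (hτ : 0 < τ) (c : ℕ → H) {u₀ z₀ : H} (h0 : B u₀ z₀) :
    ∃ U Z, IsEuler B τ c U Z ∧ U 0 = u₀ ∧ Z 0 = z₀ := by
  choose! ru rz hr using hR
  let P : ℕ → H × H := fun n => Nat.rec (u₀, z₀)
    (fun k q => (ru τ (q.1 + τ • c k), rz τ (q.1 + τ • c k))) n
  refine ⟨fun n => (P n).1, fun n => (P n).2, ⟨fun k => ?_, fun k => ?_⟩, rfl, rfl⟩
  · cases k with
    | zero => exact h0
    | succ k => exact (hr τ hτ _).1
  · have := (hr τ hτ ((P k).1 + τ • c k)).2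
    change ru τ ((P k).1 + τ • c k) = (P k).1 + τ • (c k - rz τ ((P k).1 + τ • c k))
    rw [smul_sub, ← add_sub_assoc, eq_sub_iff_add_eq, this]

/-- Repeating every value N times creates no new jumps: the index i / N moves only when N divides i
+ 1. The slope bound is thus the same at all refinement levels. -/
theorem sum_norm_div_sub_le {H : Type*} [NormedAddCommGroup H] {c : ℕ → H} {V : ℝ}
    (hV : ∀ m, ∑ i ∈ Finset.range m, ‖c (i + 1) - c i‖ ≤ V) (N k : ℕ) :
    ∑ i ∈ Finset.range k, ‖c ((i + 1) / N) - c (i / N)‖ ≤ V := by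
  have : ∑ i ∈ Finset.range k, ‖c ((i + 1) / N) - c (i / N)‖
      = ∑ i ∈ Finset.range (k / N), ‖c (i + 1) - c i‖ := by
    induction k with
    | zero => simp
    | succ k ih =>
      rw [Finset.sum_range_succ, ih, Nat.succ_div]
      split_ifs with hd
      · rw [Finset.sum_range_succ]
      · simp
  rw [this]; exact hV _

/-- Convergence of the implicit Euler scheme under dyadic refinement, for a piecewise constant
right-hand side and an initial value in the domain of the operator. -/
theorem exists_euler_limit [CompleteSpace H] (hB : MonotoneRel B)
    (hR : ∀ τ : ℝ, 0 < τ → ∀ f, ∃ u z, B u z ∧ u + τ • z = f) {u₀ z₀ : H} (h0 : B u₀ z₀)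
    (c : ℕ → H) {V : ℝ} (hV : ∀ m, ∑ i ∈ Finset.range m, ‖c (i + 1) - c i‖ ≤ V)
    {τ₀ : ℝ} (hτ₀ : 0 < τ₀) :
    ∃ (U Z : ℕ → ℕ → H) (u : ℝ → H),
      (∀ n, IsEuler B (τ₀ / 2 ^ n) (fun k => c (k / 2 ^ n)) (U n) (Z n)) ∧
      (∀ n, U n 0 = u₀) ∧
      (∀ n k, ‖c (k / 2 ^ n) - Z n (k + 1)‖ ≤ ‖c 0 - z₀‖ + V) ∧
      (∀ s, 0 ≤ s → ∀ t, 0 ≤ t → ‖u s - u t‖ ≤ (‖c 0 - z₀‖ + V) * |s - t|) ∧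
      ∀ t, 0 ≤ t →
        Tendsto (fun n : ℕ => U n (⌊t / (τ₀ / 2 ^ n)⌋₊ + 1)) atTop (𝓝 (u t)) := by
  have hτ : ∀ n : ℕ, 0 < τ₀ / 2 ^ n := fun n => by positivity
  choose U Z hE hU hZ using fun n : ℕ => exists_isEuler hR (hτ n) (fun k => c (k / 2 ^ n)) h0
  set M := ‖c 0 - z₀‖ + V with hMdef
  have hM : ∀ n k, ‖c (0 / 2 ^ n) - Z n 0‖
      + ∑ i ∈ Finset.range k, ‖c ((i + 1) / 2 ^ n) - c (i / 2 ^ n)‖ ≤ M := by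
    intro n k
    rw [Nat.zero_div, hZ n]
    exact add_le_add le_rfl (sum_norm_div_sub_le hV _ _)
  have hM0 : 0 ≤ M := le_trans (by positivity) (hM 0 0)
  have hslope : ∀ n k, ‖c (k / 2 ^ n) - Z n (k + 1)‖ ≤ M := fun n k =>
    ((hE n).norm_slope_le hB (hτ n) k).trans (hM n k)
  -- The refinement error is of order √(τ₀ / 2ⁿ), hence geometric with this ratio.
  set r : ℝ := √(1 / 2) with hr
  have hr1 : r < 1 := by
    rw [hr, Real.sqrt_lt' one_pos]; norm_num
  have hsq : ∀ n : ℕ, √(τ₀ / 2 ^ n) = √τ₀ * r ^ n := by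
    intro n
    have hrr : r * r = 1 / 2 := Real.mul_self_sqrt (by norm_num)
    have e : √τ₀ * r ^ n * (√τ₀ * r ^ n) = τ₀ / 2 ^ n := by
      rw [mul_mul_mul_comm, Real.mul_self_sqrt hτ₀.le, ← mul_pow, hrr, one_div, inv_pow]; rfl
    rw [← e, Real.sqrt_mul_self (by positivity)]
  have hle : ∀ n : ℕ, τ₀ / 2 ^ n ≤ τ₀ := fun n => div_le_self hτ₀.le (one_le_pow₀ (by norm_num))
  -- The state is read at index floor + 1, the end of the step containing t: the step started at
  -- index k uses Z (k+1), which belongs to the state with index k + 1.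
  have hcauchy : ∀ t, 0 ≤ t → ∃ v, Tendsto (fun n : ℕ => U n (⌊t / (τ₀ / 2 ^ n)⌋₊ + 1)) atTop (𝓝 v) := by
    intro t ht
    apply cauchySeq_tendsto_of_complete
    apply cauchySeq_of_le_geometric r (M * (√(t + τ₀) + √τ₀) * √τ₀) hr1
    intro n
    set k := ⌊t / (τ₀ / 2 ^ n)⌋₊ with hk
    set k' := ⌊t / (τ₀ / 2 ^ (n + 1))⌋₊ with hk'
    have hkk : k = k' / 2 := by
      rw [hk, hk', ← Nat.cast_two (R := ℕ), ← Nat.floor_div_natCast]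
      congr 1
      push_cast
      field_simp
      ring
    have href := (hE n).norm_sub_refine_le hB (hτ n) (c' := fun k => c (k / 2 ^ (n + 1)))
      (U' := U (n + 1)) (Z' := Z (n + 1))
      (by have := hE (n + 1); rwa [pow_succ, ← div_div] at this) (by rw [hU, hU])
      (fun k => by simp only [pow_succ']; rw [← Nat.div_div_eq_div_mul]; congr 2; omega)
      (fun k => by simp only [pow_succ']; rw [← Nat.div_div_eq_div_mul]; congr 2; omega)
      (hM (n + 1)) (k + 1)
    -- As k' is 2k or 2k + 1, the indices 2(k+1) and k' + 1 differ by at most one, which costs one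
    -- fine time step.
    have hloc := (hE (n + 1)).norm_sub_le hB (hτ (n + 1)) (hM (n + 1)) (2 * (k + 1)) (k' + 1)
    have habs : |((2 * (k + 1) : ℕ) : ℝ) - ((k' + 1 : ℕ) : ℝ)| ≤ 1 := by
      have h1 : 2 * k ≤ k' ∧ k' ≤ 2 * k + 1 := by omega
      have h2 : (2 * k : ℝ) ≤ k' := by exact_mod_cast h1.1
      have h3 : (k' : ℝ) ≤ 2 * k + 1 := by exact_mod_cast h1.2
      rw [abs_le]; push_cast; constructor <;> linarith
    have hkle : (k : ℝ) * (τ₀ / 2 ^ n) ≤ t := by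
      have := Nat.floor_le (a := t / (τ₀ / 2 ^ n)) (by positivity)
      rwa [← hk, le_div_iff₀ (hτ n)] at this
    have hs1 : τ₀ / 2 ^ n * M * √((k + 1 : ℕ) : ℝ) ≤ M * √(t + τ₀) * (√τ₀ * r ^ n) := by
      rw [← hsq]
      have e1 : τ₀ / 2 ^ n = √(τ₀ / 2 ^ n) * √(τ₀ / 2 ^ n) := (Real.mul_self_sqrt (hτ n).le).symm
      have e2 : √(τ₀ / 2 ^ n) * √((k + 1 : ℕ) : ℝ) ≤ √(t + τ₀) := by
        rw [← Real.sqrt_mul (hτ n).le]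
        apply Real.sqrt_le_sqrt
        push_cast
        linarith [hle n]
      calc τ₀ / 2 ^ n * M * √((k + 1 : ℕ) : ℝ)
          = M * (√(τ₀ / 2 ^ n) * √((k + 1 : ℕ) : ℝ)) * √(τ₀ / 2 ^ n) := by
            conv_lhs => rw [e1]
            ring
        _ ≤ _ := by gcongr
    have hs2 : M * (τ₀ / 2 ^ (n + 1) * |((2 * (k + 1) : ℕ) : ℝ) - ((k' + 1 : ℕ) : ℝ)|)
        ≤ M * √τ₀ * (√τ₀ * r ^ n) := by
      rw [← hsq]
      have e1 : τ₀ / 2 ^ n = √(τ₀ / 2 ^ n) * √(τ₀ / 2 ^ n) := (Real.mul_self_sqrt (hτ n).le).symm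
      have e2 : √(τ₀ / 2 ^ n) ≤ √τ₀ := Real.sqrt_le_sqrt (hle n)
      have e3 : τ₀ / 2 ^ (n + 1) ≤ τ₀ / 2 ^ n := by
        apply div_le_div_of_nonneg_left hτ₀.le (by positivity)
        exact pow_le_pow_right₀ (by norm_num) (by omega)
      calc _ ≤ M * (τ₀ / 2 ^ n * 1) := by gcongr
        _ = M * √(τ₀ / 2 ^ n) * √(τ₀ / 2 ^ n) := by rw [mul_one, mul_assoc, ← e1]
        _ ≤ _ := by gcongr
    rw [dist_eq_norm]
    have := norm_sub_le_norm_sub_add_norm_sub (U n (k + 1)) (U (n + 1) (2 * (k + 1)))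
      (U (n + 1) (k' + 1))
    calc _ ≤ _ := this
      _ ≤ M * √(t + τ₀) * (√τ₀ * r ^ n) + M * √τ₀ * (√τ₀ * r ^ n) := by linarith
      _ = _ := by ring
  choose! u hu using hcauchy
  refine ⟨U, Z, u, hE, hU, hslope, fun s hs t ht => ?_, hu⟩
  -- Rounding s and t to the grid adds at most one step to |s - t|, and that step disappears in the
  -- limit.
  have hlim : Tendsto (fun n : ℕ => M * (|s - t| + τ₀ / 2 ^ n)) atTop (𝓝 (M * (|s - t| + 0))) := by
    refine Tendsto.const_mul _ (Tendsto.const_add _ ?_)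
    have := (tendsto_pow_atTop_nhds_zero_of_lt_one (r := (1 / 2 : ℝ)) (by norm_num)
      (by norm_num)).const_mul τ₀
    simpa [div_eq_mul_inv] using this
  rw [add_zero] at hlim
  refine le_of_tendsto_of_tendsto ((hu s hs).sub (hu t ht)).norm hlim (Eventually.of_forall ?_)
  intro n
  refine ((hE n).norm_sub_le hB (hτ n) (hM n) _ _).trans ?_
  refine mul_le_mul_of_nonneg_left ?_ hM0
  have a1 := Nat.floor_le (a := s / (τ₀ / 2 ^ n)) (by positivity)
  have a2 := Nat.lt_floor_add_one (s / (τ₀ / 2 ^ n))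
  have b1 := Nat.floor_le (a := t / (τ₀ / 2 ^ n)) (by positivity)
  have b2 := Nat.lt_floor_add_one (t / (τ₀ / 2 ^ n))
  rw [le_div_iff₀ (hτ n)] at a1 b1
  rw [div_lt_iff₀ (hτ n)] at a2 b2
  push_cast
  rw [← abs_of_pos (hτ n), ← abs_mul, abs_of_pos (hτ n), abs_le]
  have := le_abs_self (s - t)
  have := neg_abs_le (s - t)
  constructor <;> nlinarith

end Euler

end

end EvolEq

/-! ### Monotone forms and the energy inequality -/

namespace EvolEq

open Filter Topology

noncomputable section

/-- A continuous function whose increments are bounded by the integral of `m`, up to errors that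
are small in the mean, grows at most by the integral of `m`. -/
theorem sub_le_integral_of_approx {T : ℝ} {y m : ℝ → ℝ}
    (hy : ContinuousOn y (Icc 0 T)) (hm : IntegrableOn m (Icc 0 T))
    (happ : ∀ η > 0, ∃ e : ℝ → ℝ, IntegrableOn e (Icc 0 T) ∧ (∀ t, 0 ≤ e t) ∧
      ∫ t in Icc 0 T, e t ≤ η ∧ ∃ τ₀ > 0, ∀ᵐ t ∂(volume.restrict (Icc 0 T)), ∀ s ∈ Icc 0 T,
        s ≤ t → t - s ≤ τ₀ → y t - y s ≤ (∫ r in s..t, (m r + e r)) + (t - s) * e t) :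
    ∀ t ∈ Icc 0 T, y t - y 0 ≤ ∫ r in (0 : ℝ)..t, m r := by
  intro t₁ ht₁
  rcases ht₁.1.eq_or_lt with h0 | h0
  · simp [← h0]
  apply le_of_forall_pos_le_add
  intro η' hη'
  obtain ⟨η, hη, hηη'⟩ : ∃ η > 0, 4 * η ≤ η' := ⟨η' / 4, by positivity, by linarith⟩
  obtain ⟨e, he, he0, heη, τ₀, hτ₀, hinc⟩ := happ η hη
  have hIcc : ∀ s ∈ Icc 0 T, ∀ t ∈ Icc 0 T, uIcc s t ⊆ Icc 0 T := fun s hs t ht =>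
    uIcc_subset_Icc hs ht
  have hII : ∀ (k : ℝ → ℝ), IntegrableOn k (Icc 0 T) → ∀ s ∈ Icc 0 T, ∀ t ∈ Icc 0 T,
      IntervalIntegrable k volume s t := fun k hk s hs t ht =>
    (hk.mono_set (hIcc s hs t ht)).intervalIntegrable
  have h0m : (0 : ℝ) ∈ Icc 0 T := ⟨le_rfl, ht₁.1.trans ht₁.2⟩
  have hme : IntegrableOn (fun r => m r + e r) (Icc 0 T) := hm.add he
  set Q : ℝ → ℝ := fun t => y t - ∫ r in (0 : ℝ)..t, (m r + e r) with hQ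
  have hTnn : (0 : ℝ) ≤ T := h0m.2
  have hQc : ContinuousOn Q (Icc 0 T) := by
    refine hy.sub ?_
    have := intervalIntegral.continuousOn_primitive_interval (μ := volume) (a := 0) (b := T)
      (f := fun r => m r + e r) (by rwa [uIcc_of_le hTnn])
    rwa [uIcc_of_le hTnn] at this
  -- The hypothesis says Q t - Q (t - τ) ≤ τ e(t) for almost every t. Integrating over t in [τ, t₁]
  -- leaves the averages of Q over the last and the first interval of length τ, which approach Q t₁
  -- and Q 0 by continuity. No pointwise differentiation is needed, and exceptional times are
  -- harmless.
  have hmain : ∀ ε > 0, Q t₁ - Q 0 ≤ η + 2 * ε := by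
    intro ε hε
    obtain ⟨d1, hd1, hc1⟩ := Metric.continuousOn_iff.mp hQc t₁ ht₁ ε hε
    obtain ⟨d0, hd0, hc0⟩ := Metric.continuousOn_iff.mp hQc 0 h0m ε hε
    obtain ⟨τ, hτ, hτ1, hτ2, hτ3, hτ4⟩ : ∃ τ > 0, τ ≤ τ₀ ∧ τ ≤ t₁ ∧ τ < d1 ∧ τ < d0 := by
      refine ⟨min (min τ₀ t₁) (min (d1 / 2) (d0 / 2)), by positivity, ?_, ?_, ?_, ?_⟩
      · exact (min_le_left _ _).trans (min_le_left _ _)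
      · exact (min_le_left _ _).trans (min_le_right _ _)
      · exact ((min_le_right _ _).trans (min_le_left _ _)).trans_lt (by linarith)
      · exact ((min_le_right _ _).trans (min_le_right _ _)).trans_lt (by linarith)
    have hQi : ∀ s ∈ Icc 0 T, ∀ t ∈ Icc 0 T, IntervalIntegrable Q volume s t := fun s hs t ht =>
      (hQc.mono (hIcc s hs t ht)).intervalIntegrable
    have hτm : τ ∈ Icc 0 T := ⟨hτ.le, hτ2.trans ht₁.2⟩
    have ht1τ : t₁ - τ ∈ Icc 0 T := ⟨by linarith, by linarith [ht₁.2]⟩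
    have hshift : ∫ t in τ..t₁, Q (t - τ) = ∫ t in (0 : ℝ)..(t₁ - τ), Q t := by
      rw [intervalIntegral.integral_comp_sub_right]; simp
    have hshiftI : IntervalIntegrable (fun t => Q (t - τ)) volume τ t₁ := by
      have := (hQi 0 h0m _ ht1τ).comp_sub_right τ
      simpa using this
    have hle : ∫ t in τ..t₁, (Q t - Q (t - τ)) ≤ ∫ t in τ..t₁, τ * e t := by
      apply intervalIntegral.integral_mono_ae_restrict hτ2
        ((hQi _ hτm _ ht₁).sub hshiftI) ((hII e he _ hτm _ ht₁).const_mul τ)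
      have hsub : Icc τ t₁ ⊆ Icc 0 T := Icc_subset_Icc hτ.le ht₁.2
      have h1 := ae_restrict_of_ae_restrict_of_subset hsub hinc
      filter_upwards [h1, ae_restrict_mem measurableSet_Icc] with t ht htm
      have htT := hsub htm
      have htτ : t - τ ∈ Icc 0 T := ⟨by linarith [htm.1], by linarith [htT.2]⟩
      have h2 := ht (t - τ) htτ (by linarith) (by linarith)
      have h3 := intervalIntegral.integral_interval_sub_left (hII _ hme 0 h0m t htT)
        (hII _ hme 0 h0m _ htτ)
      rw [← h3] at h2
      simp only [hQ, sub_sub_cancel] at h2 ⊢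
      linarith
    rw [intervalIntegral.integral_sub (hQi _ hτm _ ht₁) hshiftI, hshift,
      intervalIntegral.integral_const_mul] at hle
    have hsplit1 := intervalIntegral.integral_add_adjacent_intervals (hQi 0 h0m _ hτm)
      (hQi _ hτm _ ht₁)
    have hsplit2 := intervalIntegral.integral_add_adjacent_intervals (hQi 0 h0m _ ht1τ)
      (hQi _ ht1τ _ ht₁)
    have he1 : ∫ t in τ..t₁, e t ≤ η := by
      refine le_trans ?_ heη
      rw [intervalIntegral.integral_of_le hτ2]
      exact setIntegral_mono_set he (Eventually.of_forall he0)
        (Ioc_subset_Icc_self.trans (Icc_subset_Icc hτ.le ht₁.2)).eventuallyLE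
    have hend : τ * (Q t₁ - ε) ≤ ∫ t in (t₁ - τ)..t₁, Q t := by
      have := intervalIntegral.integral_mono_on (a := t₁ - τ) (b := t₁) (μ := volume)
        (f := fun _ => Q t₁ - ε) (g := Q) (by linarith) (by simp) (hQi _ ht1τ _ ht₁) (by
          intro x hx
          have hxT : x ∈ Icc 0 T := ⟨by linarith [hx.1], hx.2.trans ht₁.2⟩
          have := hc1 x hxT (by rw [Real.dist_eq, abs_lt]; constructor <;> linarith [hx.1, hx.2])
          rw [Real.dist_eq, abs_lt] at this
          linarith [this.1])
      rwa [intervalIntegral.integral_const, smul_eq_mul, sub_sub_cancel] at this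
    have hbeg : ∫ t in (0 : ℝ)..τ, Q t ≤ τ * (Q 0 + ε) := by
      have := intervalIntegral.integral_mono_on (a := 0) (b := τ) (μ := volume)
        (g := fun _ => Q 0 + ε) (f := Q) hτ.le (hQi _ h0m _ hτm) (by simp) (by
          intro x hx
          have hxT : x ∈ Icc 0 T := ⟨hx.1, hx.2.trans hτm.2⟩
          have := hc0 x hxT (by rw [Real.dist_eq, abs_lt]; constructor <;> linarith [hx.1, hx.2])
          rw [Real.dist_eq, abs_lt] at this
          linarith [this.2])
      rwa [intervalIntegral.integral_const, smul_eq_mul, sub_zero] at this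
    have : τ * (Q t₁ - Q 0) ≤ τ * (η + 2 * ε) := by nlinarith
    exact le_of_mul_le_mul_left this hτ
  have hfin := hmain (η / 2) (by positivity)
  have h2 := intervalIntegral.integral_add (hII m hm 0 h0m t₁ ht₁) (hII e he 0 h0m t₁ ht₁)
  have he1 : ∫ t in (0 : ℝ)..t₁, e t ≤ η := by
    refine le_trans ?_ heη
    rw [intervalIntegral.integral_of_le ht₁.1]
    exact setIntegral_mono_set he (Eventually.of_forall he0)
      (Ioc_subset_Icc_self.trans (Icc_subset_Icc le_rfl ht₁.2)).eventuallyLE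
  simp only [hQ, intervalIntegral.integral_same, sub_zero] at hfin
  linarith

theorem exists_norm_bound {H : Type*} [NormedAddCommGroup H] {T : ℝ} {u : ℝ → H} (hu : ContinuousOn u (Icc 0 T)) :
    ∃ M, 0 ≤ M ∧ ∀ t ∈ Icc 0 T, ‖u t‖ ≤ M := by
  obtain ⟨M, hM⟩ := isCompact_Icc.exists_bound_of_continuousOn hu
  exact ⟨max M 0, le_max_right _ _, fun t ht => (hM t ht).trans (le_max_left _ _)⟩

/-- A monotone, coercive, demicontinuous form `⟨A u, φ⟩ = form u φ` on the subspace
`{u | Lam u < ∞}` of a Hilbert space, together with the quantitative continuity properties that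
the evolution equation `u' + A u = f` needs. -/
structure MonotoneForm (H : Type*) [NormedAddCommGroup H] [InnerProductSpace ℝ H] where
  Lam : H → ℝ≥0∞
  form : H → H → ℝ
  -- The part of `Lam u` that the norm of H does not control at level k: small distances, far away
  -- points and large values in the application.
  tail : ℕ → H → ℝ≥0∞
  addConst : ℝ≥0
  coer : ℝ
  coerConst : ℝ
  coer_pos : 0 < coer
  Lam_lsc : LowerSemicontinuous Lam
  Lam_zero : Lam 0 = 0
  Lam_neg : ∀ u, Lam (-u) = Lam u
  Lam_add : ∀ u v, Lam (u + v) ≤ addConst * (Lam u + Lam v)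
  form_sub : ∀ u φ ψ, Lam u < ∞ → Lam φ < ∞ → Lam ψ < ∞ →
    form u (φ - ψ) = form u φ - form u ψ
  tail_lsc : ∀ k, LowerSemicontinuous (tail k)
  tail_le : ∀ k u, tail k u ≤ Lam u
  tail_tendsto : ∀ u, Lam u < ∞ → Tendsto (fun k => tail k u) atTop (𝓝 0)
  -- Substitute for a bound in the dual space. It matters that `a` is chosen before k: along a path,
  -- k can then be taken so large that `a` times the integrated tail is small, at the price of a
  -- large C.
  bound : ∀ η > 0, ∃ a : ℝ, 0 ≤ a ∧ ∀ k, ∃ C : ℝ, 0 ≤ C ∧ ∀ u ψ, Lam u < ∞ → Lam ψ < ∞ →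
    |form u ψ| ≤ C * (1 + ‖u‖) * ‖ψ‖ + a * (tail k u).toReal + η * (Lam ψ).toReal
  -- Continuity of u ↦ form u φ on the sublevel sets of `Lam` for the norm of H. It replaces weak
  -- convergence when passing to the limit.
  modulus : ∀ φ, Lam φ < ∞ → ∀ η > 0, ∃ C : ℝ, 0 ≤ C ∧ ∀ u v, Lam u < ∞ → Lam v < ∞ →
    |form u φ - form v φ| ≤ C * ‖u - v‖ + η * (1 + (Lam u).toReal + (Lam v).toReal)
  mono : ∀ u v, Lam u < ∞ → Lam v < ∞ → 0 ≤ form u (u - v) - form v (u - v)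
  coercive : ∀ u, Lam u < ∞ → coer * (‖u‖ ^ 2 + (Lam u).toReal) ≤ form u u + coerConst
  resolvent : ∀ τ : ℝ, 0 < τ → ∀ f, ∃ u, Lam u < ∞ ∧ ∀ φ, Lam φ < ∞ →
    inner ℝ u φ + τ * form u φ = inner ℝ f φ
  dense : Dense {u | Lam u < ∞}

namespace MonotoneForm

variable {H : Type*} [NormedAddCommGroup H] [InnerProductSpace ℝ H] (A : MonotoneForm H)

theorem Lam_sub_le (u v : H) : A.Lam (u - v) ≤ A.addConst * (A.Lam u + A.Lam v) := by
  rw [sub_eq_add_neg, ← A.Lam_neg v]; exact A.Lam_add u (-v)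

variable {A} in
theorem Lam_sub_lt {u v : H} (hu : A.Lam u < ∞) (hv : A.Lam v < ∞) : A.Lam (u - v) < ∞ :=
  (A.Lam_sub_le u v).trans_lt
    (ENNReal.mul_lt_top ENNReal.coe_lt_top (ENNReal.add_lt_top.2 ⟨hu, hv⟩))

theorem Lam_zero_lt : A.Lam 0 < ∞ := by rw [A.Lam_zero]; exact ENNReal.zero_lt_top

variable {A} in
theorem toReal_Lam_sub_le {u v : H} (hu : A.Lam u < ∞) (hv : A.Lam v < ∞) :
    (A.Lam (u - v)).toReal ≤ A.addConst * ((A.Lam u).toReal + (A.Lam v).toReal) := by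
  have h := A.Lam_sub_le u v
  have h2 : (A.addConst * (A.Lam u + A.Lam v) : ℝ≥0∞) ≠ ∞ :=
    (ENNReal.mul_lt_top ENNReal.coe_lt_top (ENNReal.add_lt_top.2 ⟨hu, hv⟩)).ne
  have h3 := ENNReal.toReal_mono h2 h
  rwa [ENNReal.toReal_mul, ENNReal.toReal_add hu.ne hv.ne, ENNReal.coe_toReal] at h3

/-- The graph of the realisation in `H` of the operator associated with the form. -/
def graph (u z : H) : Prop :=
  A.Lam u < ∞ ∧ ∀ φ, A.Lam φ < ∞ → A.form u φ = inner ℝ z φ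

theorem monotoneRel_graph : MonotoneRel A.graph := by
  rintro u z v y ⟨hu, hz⟩ ⟨hv, hy⟩
  have hw := Lam_sub_lt hu hv
  rw [inner_sub_left, ← hz _ hw, ← hy _ hw]
  exact A.mono u v hu hv

theorem exists_graph (τ : ℝ) (hτ : 0 < τ) (f : H) : ∃ u z, A.graph u z ∧ u + τ • z = f := by
  obtain ⟨u, hu, h⟩ := A.resolvent τ hτ f
  refine ⟨u, τ⁻¹ • (f - u), ⟨hu, fun φ hφ => ?_⟩, ?_⟩
  · rw [real_inner_smul_left, inner_sub_left, ← h φ hφ]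
    field_simp
    ring
  · rw [smul_inv_smul₀ hτ.ne']; abel

/-- Weak solutions of `u' + A u = f`, `u(0) = u₀` on `[0, T]`. -/
structure IsWeakSol (T : ℝ) (f : ℝ → H) (u₀ : H) (u : ℝ → H) : Prop where
  cont : ContinuousOn u (Icc 0 T)
  lam : ∫⁻ t in Icc 0 T, A.Lam (u t) < ∞
  eqn : ∀ φ, A.Lam φ < ∞ → ∀ t ∈ Icc 0 T, inner ℝ (u t) φ = inner ℝ u₀ φ
    - (∫ s in (0 : ℝ)..t, A.form (u s) φ) + ∫ s in (0 : ℝ)..t, inner ℝ (f s) φ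

theorem initial_eq {A : MonotoneForm H} {T : ℝ} (hT : 0 ≤ T) {f : ℝ → H} {u₀ : H} {u : ℝ → H}
    (hu : A.IsWeakSol T f u₀ u) : u 0 = u₀ := by
  apply A.dense.eq_of_inner_left (𝕜 := ℝ)
  intro φ hφ
  simpa using hu.eqn φ hφ 0 ⟨le_rfl, hT⟩

section Measurability

variable [MeasurableSpace H] [BorelSpace H]

theorem aemeasurable_Lam {A : MonotoneForm H} {T : ℝ} {u : ℝ → H}
    (hu : ContinuousOn u (Icc 0 T)) :
    AEMeasurable (fun t => A.Lam (u t)) (volume.restrict (Icc 0 T)) :=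
  A.Lam_lsc.measurable.comp_aemeasurable (hu.aemeasurable measurableSet_Icc)

theorem ae_Lam_lt {A : MonotoneForm H} {T : ℝ} {u : ℝ → H} (hu : ContinuousOn u (Icc 0 T))
    (hΛ : ∫⁻ t in Icc 0 T, A.Lam (u t) < ∞) :
    ∀ᵐ t ∂(volume.restrict (Icc 0 T)), A.Lam (u t) < ∞ :=
  ae_lt_top' (aemeasurable_Lam hu) hΛ.ne

theorem integrableOn_Lam {A : MonotoneForm H} {T : ℝ} {u : ℝ → H}
    (hu : ContinuousOn u (Icc 0 T)) (hΛ : ∫⁻ t in Icc 0 T, A.Lam (u t) < ∞) :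
    IntegrableOn (fun t => (A.Lam (u t)).toReal) (Icc 0 T) :=
  integrable_toReal_of_lintegral_ne_top (aemeasurable_Lam hu) hΛ.ne

/-- Functionals that are continuous on the sublevel sets of `Lam` are integrable along paths. -/
theorem integrableOn_of_modulus {A : MonotoneForm H} {T : ℝ} {u : ℝ → H}
    (hu : ContinuousOn u (Icc 0 T)) (hΛ : ∫⁻ t in Icc 0 T, A.Lam (u t) < ∞) {L : H → ℝ}
    (hL : ∀ η > 0, ∃ C : ℝ, 0 ≤ C ∧ ∀ u v, A.Lam u < ∞ → A.Lam v < ∞ →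
      |L u - L v| ≤ C * ‖u - v‖ + η * (1 + (A.Lam u).toReal + (A.Lam v).toReal)) :
    IntegrableOn (fun t => L (u t)) (Icc 0 T) := by
  have hae := ae_Lam_lt hu hΛ
  have hmeas : AEStronglyMeasurable (fun t => L (u t)) (volume.restrict (Icc 0 T)) := by
    -- By lower semicontinuity these sets are closed, L ∘ u is continuous on each of them, and they
    -- exhaust almost all of [0, T]. Measurability follows by gluing.
    set S : ℕ → Set ℝ := fun k => Icc 0 T ∩ u ⁻¹' {v | A.Lam v ≤ k} with hS
    have hcl : ∀ k, IsClosed (S k) := fun k =>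
      hu.preimage_isClosed_of_isClosed isClosed_Icc (A.Lam_lsc.isClosed_preimage _)
    have hr : volume.restrict (Icc 0 T) = volume.restrict (⋃ k, S k) := by
      apply Measure.restrict_congr_set
      have hsub : (⋃ k, S k) ⊆ Icc 0 T := iUnion_subset fun k => inter_subset_left
      refine (Filter.EventuallyLE.antisymm ?_ hsub.eventuallyLE)
      filter_upwards [(ae_restrict_iff' measurableSet_Icc).1 hae] with t ht htm
      have h1 : A.Lam (u t) < ∞ := ht htm
      obtain ⟨k, hk⟩ := ENNReal.exists_nat_gt h1.ne
      exact mem_iUnion.2 ⟨k, htm, hk.le⟩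
    rw [hr, aestronglyMeasurable_iUnion_iff]
    intro k
    apply ContinuousOn.aestronglyMeasurable _ (hcl k).measurableSet
    rw [Metric.continuousOn_iff]
    intro t ht ε hε
    have hfin : ∀ s ∈ S k, A.Lam (u s) < ∞ ∧ (A.Lam (u s)).toReal ≤ k := fun s hs =>
      ⟨hs.2.trans_lt (ENNReal.natCast_lt_top k), ENNReal.toReal_le_of_le_ofReal (by positivity)
        (by rw [ENNReal.ofReal_natCast]; exact hs.2)⟩
    obtain ⟨C, hC, hCL⟩ := hL (ε / (2 * (1 + k + k))) (by positivity)
    obtain ⟨d, hd, hcont⟩ := Metric.continuousOn_iff.1 (hu.mono (inter_subset_left : S k ⊆ _)) t ht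
      (ε / (2 * (C + 1))) (by positivity)
    refine ⟨d, hd, fun s hs hst => ?_⟩
    have h1 := hcont s hs hst
    have h2 := hCL (u s) (u t) (hfin s hs).1 (hfin t ht).1
    rw [dist_eq_norm] at h1
    rw [Real.dist_eq]
    have h3 : C * ‖u s - u t‖ < ε / 2 := by
      rw [lt_div_iff₀ (by positivity)] at h1
      nlinarith [norm_nonneg (u s - u t)]
    have h4 : ε / (2 * (1 + k + k)) * (1 + (A.Lam (u s)).toReal + (A.Lam (u t)).toReal) ≤ ε / 2 := by
      calc _ ≤ ε / (2 * (1 + k + k)) * (1 + k + k) := by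
            gcongr
            · exact (hfin s hs).2
            · exact (hfin t ht).2
        _ = ε / 2 := by field_simp
    linarith
  obtain ⟨M, hM0, hM⟩ := exists_norm_bound hu
  obtain ⟨C, hC, hCL⟩ := hL 1 one_pos
  refine Integrable.mono' (g := fun t => |L 0| + C * M + 1 + (A.Lam (u t)).toReal) ?_ hmeas ?_
  · exact (integrable_const (|L 0| + C * M + 1)).add (integrableOn_Lam hu hΛ)
  · filter_upwards [hae, ae_restrict_mem measurableSet_Icc] with t ht htm
    have h1 := hCL (u t) 0 ht A.Lam_zero_lt
    rw [A.Lam_zero, sub_zero, ENNReal.toReal_zero] at h1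
    have h2 : C * ‖u t‖ ≤ C * M := mul_le_mul_of_nonneg_left (hM t htm) hC
    have h3 := abs_sub_abs_le_abs_sub (L (u t)) (L 0)
    rw [Real.norm_eq_abs]
    linarith

theorem integrableOn_form {A : MonotoneForm H} {T : ℝ} {u : ℝ → H}
    (hu : ContinuousOn u (Icc 0 T)) (hΛ : ∫⁻ t in Icc 0 T, A.Lam (u t) < ∞) {φ : H}
    (hφ : A.Lam φ < ∞) : IntegrableOn (fun t => A.form (u t) φ) (Icc 0 T) :=
  integrableOn_of_modulus hu hΛ (L := fun v => A.form v φ) (A.modulus φ hφ)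

/-- The energy inequality for paths with a time derivative `n` in the dual space. -/
theorem energy_le {A : MonotoneForm H} {T : ℝ} {w : ℝ → H} (hw : ContinuousOn w (Icc 0 T))
    (hΛ : ∫⁻ t in Icc 0 T, A.Lam (w t) < ∞) {n : ℝ → H → ℝ}
    (hni : ∀ ψ, A.Lam ψ < ∞ → IntegrableOn (fun r => n r ψ) (Icc 0 T))
    (hns : ∀ᵐ r ∂(volume.restrict (Icc 0 T)), ∀ ψ χ, A.Lam ψ < ∞ → A.Lam χ < ∞ →
      n r (ψ - χ) = n r ψ - n r χ)
    (hnb : ∀ η > 0, ∃ a e : ℝ → ℝ, IntegrableOn a (Icc 0 T) ∧ IntegrableOn e (Icc 0 T) ∧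
      (∀ t, 0 ≤ a t) ∧ (∀ t, 0 ≤ e t) ∧ ∫ t in Icc 0 T, e t ≤ η ∧
      ∀ᵐ r ∂(volume.restrict (Icc 0 T)), ∀ ψ, A.Lam ψ < ∞ →
        |n r ψ| ≤ a r * ‖ψ‖ + e r + η * (A.Lam ψ).toReal)
    (heq : ∀ ψ, A.Lam ψ < ∞ → ∀ t ∈ Icc 0 T,
      inner ℝ (w t) ψ = inner ℝ (w 0) ψ + ∫ r in (0 : ℝ)..t, n r ψ)
    {m : ℝ → ℝ} (hm : IntegrableOn m (Icc 0 T))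
    (hmn : ∀ᵐ r ∂(volume.restrict (Icc 0 T)), n r (w r) ≤ m r) :
    ∀ t ∈ Icc 0 T, ‖w t‖ ^ 2 / 2 - ‖w 0‖ ^ 2 / 2 ≤ ∫ r in (0 : ℝ)..t, m r := by
  apply sub_le_integral_of_approx (y := fun t => ‖w t‖ ^ 2 / 2)
    ((hw.norm.pow 2).div_const 2) hm
  intro η' hη'
  have hlami := integrableOn_Lam hw hΛ
  set I := ∫ t in Icc 0 T, (A.Lam (w t)).toReal with hI
  have hI0 : 0 ≤ I := integral_nonneg fun t => ENNReal.toReal_nonneg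
  have hK0 : (0 : ℝ) ≤ A.addConst := A.addConst.2
  -- The total error has integral κ ∫ a + ∫ e + η K ∫ Lam, with K the constant `addConst`. The
  -- constants give one half of η' to the first term and the other half to the last two.
  set η := η' / (2 * (1 + A.addConst * I)) with hηdef
  have hη : 0 < η := by positivity
  obtain ⟨a, e, ha, he, ha0, he0, heη, hb⟩ := hnb η hη
  set κ := η' / (2 * (1 + ∫ t in Icc 0 T, a t)) with hκdef
  have hia0 : 0 ≤ ∫ t in Icc 0 T, a t := integral_nonneg ha0
  have hκ : 0 < κ := by positivity
  have huc := isCompact_Icc.uniformContinuousOn_of_continuous hw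
  obtain ⟨τ₀, hτ₀, hmod⟩ := Metric.uniformContinuousOn_iff.1 huc κ hκ
  refine ⟨fun t => κ * a t + e t + η * A.addConst * (A.Lam (w t)).toReal, ?_, ?_, ?_,
    τ₀ / 2, by positivity, ?_⟩
  · exact ((ha.const_mul κ).add he).add (hlami.const_mul _)
  · intro t
    have := ha0 t; have := he0 t
    positivity
  · have i1 : IntegrableOn (fun t => κ * a t + e t) (Icc 0 T) := (ha.const_mul κ).add he
    beta_reduce
    rw [integral_add i1 (hlami.const_mul _),
      integral_add (ha.const_mul κ) he, integral_const_mul, integral_const_mul, ← hI]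
    have h1 : κ * ∫ t in Icc 0 T, a t ≤ η' / 2 := by
      rw [hκdef, div_mul_eq_mul_div, div_le_div_iff₀ (by positivity) (by positivity)]
      nlinarith
    have h2 : η + η * A.addConst * I = η' / 2 := by
      rw [hηdef]; field_simp
    linarith
  · filter_upwards [ae_Lam_lt hw hΛ, ae_restrict_mem measurableSet_Icc] with t ht htm s hsm hst hsτ
    have hsub : Ioc s t ⊆ Icc 0 T := fun r hr => ⟨hsm.1.trans hr.1.le, hr.2.trans htm.2⟩
    have hII : ∀ k : ℝ → ℝ, IntegrableOn k (Icc 0 T) → ∀ s ∈ Icc 0 T, ∀ t ∈ Icc 0 T,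
        IntervalIntegrable k volume s t := fun k hk s hs t ht =>
      (hk.mono_set (uIcc_subset_Icc hs ht)).intervalIntegrable
    have h0m : (0 : ℝ) ∈ Icc 0 T := ⟨le_rfl, hsm.1.trans hsm.2⟩
    -- The weak equation is tested with the frozen vector w t, and ‖x‖²/2 - ‖y‖²/2 ≤ ⟨x - y, x⟩.
    have h1 : ‖w t‖ ^ 2 / 2 - ‖w s‖ ^ 2 / 2 ≤ ∫ r in s..t, n r (w t) := by
      rw [← intervalIntegral.integral_interval_sub_left (hII _ (hni _ ht) 0 h0m t htm)
        (hII _ (hni _ ht) 0 h0m s hsm)]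
      have e1 := heq (w t) ht t htm
      have e2 := heq (w t) ht s hsm
      have e3 := real_inner_le_norm (w s) (w t)
      rw [real_inner_self_eq_norm_sq] at e1
      nlinarith [sq_nonneg (‖w s‖ - ‖w t‖)]
    refine h1.trans ?_
    have hce : (t - s) * (κ * a t + e t + η * A.addConst * (A.Lam (w t)).toReal)
        = ∫ r in s..t, (κ * a t + e t + η * A.addConst * (A.Lam (w t)).toReal) := by
      rw [intervalIntegral.integral_const, smul_eq_mul]
    rw [hce]
    have hie : IntegrableOn (fun r => m r + (κ * a r + e r + η * A.addConst * (A.Lam (w r)).toReal))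
      (Icc 0 T) := hm.add (((ha.const_mul κ).add he).add (hlami.const_mul _))
    rw [← intervalIntegral.integral_add (hII _ hie s hsm t htm) (by simp)]
    refine intervalIntegral.integral_mono_ae_restrict hst (hII _ (hni _ ht) s hsm t htm)
      ((hII _ hie s hsm t htm).add (by simp)) ?_
    have hsub' : Icc s t ⊆ Icc 0 T := Icc_subset_Icc hsm.1 htm.2
    filter_upwards [ae_restrict_of_ae_restrict_of_subset hsub' hns,
      ae_restrict_of_ae_restrict_of_subset hsub' hb, ae_restrict_of_ae_restrict_of_subset hsub' hmn,
      ae_restrict_of_ae_restrict_of_subset hsub' (ae_Lam_lt hw hΛ),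
      ae_restrict_mem measurableSet_Icc] with r hr1 hr2 hr3 hr4 hrm
    -- Now n r (w t) = n r (w r) + n r (w t - w r). The first term is at most m r. The second is an
    -- error: w t - w r is small in H by uniform continuity, and its `Lam` is bounded by those of w
    -- t and w r.
    have e1 := hr1 (w t) (w r) ht hr4
    have e2 := hr2 (w t - w r) (Lam_sub_lt ht hr4)
    have e3 := toReal_Lam_sub_le ht hr4
    have e4 : ‖w t - w r‖ ≤ κ := by
      rw [← dist_eq_norm]
      refine (hmod t htm r (hsub' hrm) ?_).le
      rw [Real.dist_eq, abs_lt]; constructor <;> linarith [hrm.1, hrm.2]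
    have e5 : a r * ‖w t - w r‖ ≤ κ * a r := by nlinarith [ha0 r]
    have e6 := le_abs_self (n r (w t - w r))
    have e7 : 0 ≤ κ * a t + e t := by have := ha0 t; have := he0 t; positivity
    have e8 : η * (A.Lam (w t - w r)).toReal
        ≤ η * (A.addConst * ((A.Lam (w t)).toReal + (A.Lam (w r)).toReal)) :=
      mul_le_mul_of_nonneg_left e3 hη.le
    nlinarith

end Measurability

end MonotoneForm

end

end EvolEq

/-! ### Weak solutions: energy, stability, step data -/

namespace EvolEq

open Filter Topology

noncomputable section

namespace MonotoneForm

variable {H : Type*} [NormedAddCommGroup H] [InnerProductSpace ℝ H]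
  [MeasurableSpace H] [BorelSpace H] {A : MonotoneForm H}

theorem integrableOn_norm_mul_norm {H : Type*} [NormedAddCommGroup H] {T : ℝ} {f u : ℝ → H}
    (hf : IntegrableOn f (Icc 0 T)) (hu : ContinuousOn u (Icc 0 T)) :
    IntegrableOn (fun r => ‖f r‖ * ‖u r‖) (Icc 0 T) := by
  obtain ⟨M, hM0, hM⟩ := exists_norm_bound hu
  refine Integrable.mono' (hf.norm.mul_const M)
    (hf.norm.aestronglyMeasurable.mul (hu.norm.aestronglyMeasurable measurableSet_Icc)) ?_
  filter_upwards [ae_restrict_mem measurableSet_Icc] with r hr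
  rw [Real.norm_of_nonneg (by positivity)]
  exact mul_le_mul_of_nonneg_left (hM r hr) (norm_nonneg _)

theorem integrableOn_inner {H : Type*} [NormedAddCommGroup H] [InnerProductSpace ℝ H]
    {T : ℝ} {f : ℝ → H} (hf : IntegrableOn f (Icc 0 T)) (φ : H) :
    IntegrableOn (fun r => inner ℝ (f r) φ) (Icc 0 T) := hf.inner_const φ

/-- Turns `bound` into the hypothesis of `energy_le`. The integrated tails tend to zero by dominated
convergence, so some level k makes `a` times their integral at most η. -/
theorem dual_bound {T : ℝ} {u f : ℝ → H}
    (hu : ContinuousOn u (Icc 0 T)) (hΛ : ∫⁻ t in Icc 0 T, A.Lam (u t) < ∞)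
    (hf : IntegrableOn f (Icc 0 T)) (η : ℝ) (hη : 0 < η) :
    ∃ a e : ℝ → ℝ, IntegrableOn a (Icc 0 T) ∧ IntegrableOn e (Icc 0 T) ∧
      (∀ t, 0 ≤ a t) ∧ (∀ t, 0 ≤ e t) ∧ ∫ t in Icc 0 T, e t ≤ η ∧
      ∀ᵐ r ∂(volume.restrict (Icc 0 T)), ∀ ψ, A.Lam ψ < ∞ →
        |-A.form (u r) ψ + inner ℝ (f r) ψ| ≤ a r * ‖ψ‖ + e r + η * (A.Lam ψ).toReal := by
  obtain ⟨a, ha, hb⟩ := A.bound η hη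
  have hae := ae_Lam_lt hu hΛ
  have htm : ∀ k, AEMeasurable (fun t => A.tail k (u t)) (volume.restrict (Icc 0 T)) := fun k =>
    (A.tail_lsc k).measurable.comp_aemeasurable (hu.aemeasurable measurableSet_Icc)
  have hti : ∀ k, IntegrableOn (fun t => (A.tail k (u t)).toReal) (Icc 0 T) := fun k =>
    integrable_toReal_of_lintegral_ne_top (htm k)
      ((lintegral_mono fun t => A.tail_le k (u t)).trans_lt hΛ).ne
  have hlim : Tendsto (fun k => ∫ t in Icc 0 T, (A.tail k (u t)).toReal) atTop
      (𝓝 (∫ t in Icc 0 T, (0 : ℝ))) := by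
    refine tendsto_integral_of_dominated_convergence (fun t => (A.Lam (u t)).toReal)
      (fun k => (hti k).aestronglyMeasurable) (integrableOn_Lam hu hΛ) (fun k => ?_) ?_
    · filter_upwards [hae] with t ht
      rw [Real.norm_of_nonneg ENNReal.toReal_nonneg]
      exact ENNReal.toReal_mono ht.ne (A.tail_le k _)
    · filter_upwards [hae] with t ht
      have := (ENNReal.tendsto_toReal ENNReal.zero_ne_top).comp (A.tail_tendsto _ ht)
      simpa [Function.comp_def] using this
  rw [integral_zero] at hlim
  obtain ⟨k, hk⟩ := ((tendsto_order.1 hlim).2 (η / (a + 1)) (by positivity)).exists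
  obtain ⟨C, hC, hCb⟩ := hb k
  have hun : IntegrableOn (fun r => ‖u r‖) (Icc 0 T) := hu.norm.integrableOn_Icc
  refine ⟨fun r => C * (1 + ‖u r‖) + ‖f r‖, fun r => a * (A.tail k (u r)).toReal, ?_,
    (hti k).const_mul a, fun t => by positivity, fun t => by positivity, ?_, ?_⟩
  · exact (((integrable_const 1).add hun).const_mul C).add hf.norm
  · rw [integral_const_mul]
    rw [lt_div_iff₀ (by positivity)] at hk
    have : 0 ≤ ∫ t in Icc 0 T, (A.tail k (u t)).toReal :=
      integral_nonneg fun t => ENNReal.toReal_nonneg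
    nlinarith
  · filter_upwards [hae] with r hr ψ hψ
    have h1 := hCb (u r) ψ hr hψ
    have h2 := abs_real_inner_le_norm (f r) ψ
    have h3 := abs_add_le (-A.form (u r) ψ) (inner ℝ (f r) ψ)
    rw [abs_neg] at h3
    linarith

theorem intervalIntegrable_of_Icc {T : ℝ} {k : ℝ → ℝ} (hk : IntegrableOn k (Icc 0 T))
    {s t : ℝ} (hs : s ∈ Icc 0 T) (ht : t ∈ Icc 0 T) : IntervalIntegrable k volume s t :=
  (hk.mono_set (uIcc_subset_Icc hs ht)).intervalIntegrable

namespace IsWeakSol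

variable {T : ℝ} {f g : ℝ → H} {u₀ v₀ : H} {u v : ℝ → H}

theorem eqn_add (hu : A.IsWeakSol T f u₀ u) (hf : IntegrableOn f (Icc 0 T)) {φ : H}
    (hφ : A.Lam φ < ∞) {t : ℝ} (ht : t ∈ Icc 0 T) :
    inner ℝ (u t) φ
      = inner ℝ u₀ φ + ∫ s in (0 : ℝ)..t, (-A.form (u s) φ + inner ℝ (f s) φ) := by
  have h0 : (0 : ℝ) ∈ Icc 0 T := ⟨le_rfl, ht.1.trans ht.2⟩
  have hi := integrableOn_form hu.cont hu.lam hφ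
  rw [intervalIntegral.integral_add
    (intervalIntegrable_of_Icc (k := fun s => -A.form (u s) φ) hi.neg h0 ht)
    (intervalIntegrable_of_Icc (integrableOn_inner hf φ) h0 ht), intervalIntegral.integral_neg,
    hu.eqn φ hφ t ht]
  ring

/-- The energy estimate for a weak solution. -/
theorem energy (hu : A.IsWeakSol T f u₀ u) (hf : IntegrableOn f (Icc 0 T)) {t : ℝ}
    (ht : t ∈ Icc 0 T) :
    ‖u t‖ ^ 2 / 2 + A.coer * ∫ s in (0 : ℝ)..t, (‖u s‖ ^ 2 + (A.Lam (u s)).toReal) ≤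
      ‖u₀‖ ^ 2 / 2 + ∫ s in (0 : ℝ)..t, (A.coerConst + ‖f s‖ * ‖u s‖) := by
  have h0 : (0 : ℝ) ∈ Icc 0 T := ⟨le_rfl, ht.1.trans ht.2⟩
  have hini := initial_eq h0.2 hu
  have i1 : IntegrableOn (fun s => ‖u s‖ ^ 2 + (A.Lam (u s)).toReal) (Icc 0 T) :=
    (hu.cont.norm.pow 2).integrableOn_Icc.add (integrableOn_Lam hu.cont hu.lam)
  have i2 : IntegrableOn (fun s => A.coerConst + ‖f s‖ * ‖u s‖) (Icc 0 T) :=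
    (integrable_const _).add (integrableOn_norm_mul_norm hf hu.cont)
  have key := energy_le (A := A) hu.cont hu.lam
    (n := fun r ψ => -A.form (u r) ψ + inner ℝ (f r) ψ)
    (fun ψ hψ => (integrableOn_form hu.cont hu.lam hψ).neg.add (integrableOn_inner hf ψ))
    (by
      filter_upwards [ae_Lam_lt hu.cont hu.lam] with r hr ψ χ hψ hχ
      rw [A.form_sub _ _ _ hr hψ hχ, inner_sub_right]; ring)
    (dual_bound hu.cont hu.lam hf)
    (fun ψ hψ t ht => by rw [hini]; exact hu.eqn_add hf hψ ht)
    (m := fun s => (A.coerConst + ‖f s‖ * ‖u s‖)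
      - A.coer * (‖u s‖ ^ 2 + (A.Lam (u s)).toReal)) (i2.sub (i1.const_mul _))
    (by
      filter_upwards [ae_Lam_lt hu.cont hu.lam] with r hr
      have := A.coercive _ hr
      have := real_inner_le_norm (f r) (u r)
      linarith) t ht
  rw [intervalIntegral.integral_sub (intervalIntegrable_of_Icc i2 h0 ht)
    ((intervalIntegrable_of_Icc i1 h0 ht).const_mul _), intervalIntegral.integral_const_mul,
    hini] at key
  linarith

/-- The energy inequality for the difference of two solutions, where monotonicity discards the form.
-/
theorem norm_sub_sq_le (hu : A.IsWeakSol T f u₀ u) (hf : IntegrableOn f (Icc 0 T))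
    (hv : A.IsWeakSol T g v₀ v) (hg : IntegrableOn g (Icc 0 T)) {t : ℝ} (ht : t ∈ Icc 0 T) :
    ‖u t - v t‖ ^ 2 ≤ ‖u₀ - v₀‖ ^ 2 + 2 * ∫ s in (0 : ℝ)..t, ‖f s - g s‖ * ‖u s - v s‖ := by
  have h0 : (0 : ℝ) ∈ Icc 0 T := ⟨le_rfl, ht.1.trans ht.2⟩
  have hini := initial_eq h0.2 hu
  have hini' := initial_eq h0.2 hv
  have hwc : ContinuousOn (fun t => u t - v t) (Icc 0 T) := hu.cont.sub hv.cont
  have hsum : ∫⁻ t in Icc 0 T, A.addConst * (A.Lam (u t) + A.Lam (v t)) < ∞ := by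
    rw [lintegral_const_mul' _ _ ENNReal.coe_ne_top, lintegral_add_left' (aemeasurable_Lam hu.cont)]
    exact ENNReal.mul_lt_top ENNReal.coe_lt_top (ENNReal.add_lt_top.2 ⟨hu.lam, hv.lam⟩)
  have hwl : ∫⁻ t in Icc 0 T, A.Lam (u t - v t) < ∞ :=
    (lintegral_mono fun t => A.Lam_sub_le (u t) (v t)).trans_lt hsum
  have hfg : IntegrableOn (fun s => f s - g s) (Icc 0 T) := hf.sub hg
  have i1 := integrableOn_norm_mul_norm hfg hwc
  have key := energy_le (A := A) hwc hwl
    (n := fun r ψ => (-A.form (u r) ψ + inner ℝ (f r) ψ) - (-A.form (v r) ψ + inner ℝ (g r) ψ))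
    (fun ψ hψ => ((integrableOn_form hu.cont hu.lam hψ).neg.add (integrableOn_inner hf ψ)).sub
      ((integrableOn_form hv.cont hv.lam hψ).neg.add (integrableOn_inner hg ψ)))
    (by
      filter_upwards [ae_Lam_lt hu.cont hu.lam, ae_Lam_lt hv.cont hv.lam] with r hr hr' ψ χ hψ hχ
      rw [A.form_sub _ _ _ hr hψ hχ, A.form_sub _ _ _ hr' hψ hχ, inner_sub_right, inner_sub_right]
      ring)
    (by
      intro η hη
      obtain ⟨a, e, h1, h2, h3, h4, h5, h6⟩ := dual_bound hu.cont hu.lam hf (η / 2) (by positivity)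
      obtain ⟨a', e', h1', h2', h3', h4', h5', h6'⟩ :=
        dual_bound hv.cont hv.lam hg (η / 2) (by positivity)
      refine ⟨fun r => a r + a' r, fun r => e r + e' r, h1.add h1', h2.add h2',
        fun t => add_nonneg (h3 t) (h3' t), fun t => add_nonneg (h4 t) (h4' t), ?_, ?_⟩
      · rw [integral_add h2 h2']; linarith
      · filter_upwards [h6, h6'] with r hr hr' ψ hψ
        have := hr ψ hψ
        have := hr' ψ hψ
        have := abs_sub (-A.form (u r) ψ + inner ℝ (f r) ψ) (-A.form (v r) ψ + inner ℝ (g r) ψ)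
        linarith)
    (fun ψ hψ t ht => by
      have i : ∀ {f : ℝ → H} {u : ℝ → H} {u₀ : H}, A.IsWeakSol T f u₀ u →
          IntegrableOn f (Icc 0 T) →
          IntervalIntegrable (fun r => -A.form (u r) ψ + inner ℝ (f r) ψ) volume 0 t :=
        fun hu hf => intervalIntegrable_of_Icc
          ((integrableOn_form hu.cont hu.lam hψ).neg.add (integrableOn_inner hf ψ)) h0 ht
      rw [intervalIntegral.integral_sub (i hu hf) (i hv hg), inner_sub_left, inner_sub_left,
        hu.eqn_add hf hψ ht, hv.eqn_add hg hψ ht, hini, hini']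
      ring)
    (m := fun s => ‖f s - g s‖ * ‖u s - v s‖) i1
    (by
      filter_upwards [ae_Lam_lt hu.cont hu.lam, ae_Lam_lt hv.cont hv.lam] with r hr hr'
      have h1 := A.mono _ _ hr hr'
      have h2 := real_inner_le_norm (f r - g r) (u r - v r)
      rw [inner_sub_left] at h2
      linarith) t ht
  simp only [hini, hini'] at key
  linarith

/-- The squared estimate, taken at a time where ‖u - v‖ attains its maximum M over [0, t], reads M²
≤ ‖u₀ - v₀‖² + 2 M ∫ ‖f - g‖. As ‖u₀ - v₀‖ ≤ M, one may divide by M. -/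
theorem norm_sub_le (hu : A.IsWeakSol T f u₀ u) (hf : IntegrableOn f (Icc 0 T))
    (hv : A.IsWeakSol T g v₀ v) (hg : IntegrableOn g (Icc 0 T)) {t : ℝ} (ht : t ∈ Icc 0 T) :
    ‖u t - v t‖ ≤ ‖u₀ - v₀‖ + 2 * ∫ s in (0 : ℝ)..t, ‖f s - g s‖ := by
  have h0 : (0 : ℝ) ∈ Icc 0 T := ⟨le_rfl, ht.1.trans ht.2⟩
  have hfg : IntegrableOn (fun s => ‖f s - g s‖) (Icc 0 T) := (hf.sub hg).norm
  have hwc : ContinuousOn (fun t => u t - v t) (Icc 0 T) := hu.cont.sub hv.cont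
  obtain ⟨t', ht', hmax⟩ := isCompact_Icc.exists_isMaxOn (nonempty_Icc.2 ht.1)
    ((hwc.mono (Icc_subset_Icc le_rfl ht.2)).norm)
  have hle : ∀ s ∈ Icc 0 t, ‖u s - v s‖ ≤ ‖u t' - v t'‖ := fun s hs => hmax hs
  have ht'T : t' ∈ Icc 0 T := ⟨ht'.1, ht'.2.trans ht.2⟩
  set M := ‖u t' - v t'‖ with hM
  have hI : ∫ s in (0 : ℝ)..t', ‖f s - g s‖ ≤ ∫ s in (0 : ℝ)..t, ‖f s - g s‖ :=
    intervalIntegral.integral_mono_interval le_rfl ht'.1 ht'.2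
      (Eventually.of_forall fun _ => norm_nonneg _) (intervalIntegrable_of_Icc hfg h0 ht)
  have h1 := norm_sub_sq_le hu hf hv hg ht'T
  have h2 : ∫ s in (0 : ℝ)..t', ‖f s - g s‖ * ‖u s - v s‖
      ≤ (∫ s in (0 : ℝ)..t', ‖f s - g s‖) * M := by
    rw [← intervalIntegral.integral_mul_const]
    refine intervalIntegral.integral_mono_on ht'.1 (intervalIntegrable_of_Icc
      (integrableOn_norm_mul_norm (hf.sub hg) hwc) h0 ht'T)
      ((intervalIntegrable_of_Icc hfg h0 ht'T).mul_const _) fun s hs => ?_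
    exact mul_le_mul_of_nonneg_left (hle s ⟨hs.1, hs.2.trans ht'.2⟩) (norm_nonneg _)
  have h3 : ‖u₀ - v₀‖ ≤ M := by
    have := hle 0 ⟨le_rfl, ht.1⟩
    rwa [initial_eq h0.2 hu, initial_eq h0.2 hv] at this
  have hM0 : 0 ≤ M := norm_nonneg _
  have h4 : M ≤ ‖u₀ - v₀‖ + 2 * ∫ s in (0 : ℝ)..t, ‖f s - g s‖ := by
    rcases hM0.eq_or_lt with hz | hz
    · rw [← hz]
      have : 0 ≤ ∫ s in (0 : ℝ)..t, ‖f s - g s‖ :=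
        intervalIntegral.integral_nonneg ht.1 fun _ _ => norm_nonneg _
      positivity
    · refine le_of_mul_le_mul_right ?_ hz
      nlinarith [norm_nonneg (u₀ - v₀)]
  exact (hle t ⟨ht.1, le_rfl⟩).trans h4

end IsWeakSol

theorem integral_step {D : ℕ → ℝ} {M τ : ℝ} (hD : ∀ k, |D k| ≤ M) (hτ : 0 < τ) (k : ℕ) :
    ∫ s in (0 : ℝ)..(k * τ), D ⌊s / τ⌋₊ = ∑ j ∈ Finset.range k, τ * D j := by
  have hint : ∀ a b : ℝ, IntervalIntegrable (fun s => D ⌊s / τ⌋₊) volume a b := by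
    intro a b
    refine IntervalIntegrable.mono_fun (g := fun s => D ⌊s / τ⌋₊) (f := fun _ => M) (by simp) ?_ ?_
    · exact ((measurable_from_nat (f := D)).comp
        (Nat.measurable_floor.comp (measurable_id.div_const τ))).aestronglyMeasurable
    · refine Eventually.of_forall fun s => ?_
      exact (hD _).trans (le_abs_self M)
  induction k with
  | zero => simp
  | succ k ih =>
    rw [← intervalIntegral.integral_add_adjacent_intervals (hint 0 (k * τ)) (hint _ _), ih,
      Finset.sum_range_succ]
    congr 1
    have hle : (k : ℝ) * τ ≤ ((k + 1 : ℕ) : ℝ) * τ := by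
      push_cast; nlinarith
    have : ∫ s in ((k : ℝ) * τ)..(((k + 1 : ℕ) : ℝ) * τ), D ⌊s / τ⌋₊
        = ∫ s in ((k : ℝ) * τ)..(((k + 1 : ℕ) : ℝ) * τ), D k := by
      apply intervalIntegral.integral_congr_uIoo
      rw [uIoo_of_le hle]
      intro s hs
      beta_reduce
      congr 1
      rw [Nat.floor_eq_iff (div_nonneg ((by positivity : (0 : ℝ) ≤ k * τ).trans hs.1.le) hτ.le)]
      constructor
      · rw [le_div_iff₀ hτ]; exact hs.1.le
      · rw [div_lt_iff₀ hτ]; have := hs.2; push_cast at this; exact this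
    rw [this, intervalIntegral.integral_const, smul_eq_mul]
    push_cast
    ring

/-- Weak solutions exist for piecewise constant right-hand sides and initial values in the domain
of the operator. -/
theorem exists_isWeakSol_step [CompleteSpace H] {u₀ z₀ : H} (h0 : A.graph u₀ z₀) (c : ℕ → H)
    {V : ℝ} (hV : ∀ m, ∑ i ∈ Finset.range m, ‖c (i + 1) - c i‖ ≤ V) {τ₀ : ℝ} (hτ₀ : 0 < τ₀)
    (T : ℝ) : ∃ u, A.IsWeakSol T (fun s => c ⌊s / τ₀⌋₊) u₀ u := by
  obtain ⟨U, Z, u, hE, hU0, hsl, hlip, hlim⟩ :=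
    exists_euler_limit A.monotoneRel_graph A.exists_graph h0 c hV hτ₀
  set M := ‖c 0 - z₀‖ + V with hMdef
  have hM0 : 0 ≤ M := (norm_nonneg _).trans (hsl 0 0)
  have hτ : ∀ n : ℕ, 0 < τ₀ / 2 ^ n := fun n => by positivity
  have hτlim : Tendsto (fun n : ℕ => τ₀ / 2 ^ n) atTop (𝓝 0) := by
    have := (tendsto_pow_atTop_nhds_zero_of_lt_one (r := (1 / 2 : ℝ)) (by norm_num)
      (by norm_num)).const_mul τ₀
    simpa [div_eq_mul_inv] using this
  have hcont : ContinuousOn u (Icc 0 T) := by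
    rw [Metric.continuousOn_iff]
    intro t ht ε hε
    refine ⟨ε / (M + 1), by positivity, fun s hs hst => ?_⟩
    rw [dist_eq_norm]
    rw [Real.dist_eq, lt_div_iff₀ (by positivity)] at hst
    have := hlip s hs.1 t ht.1
    nlinarith [abs_nonneg (s - t)]
  have hcb : ∀ k, ‖c k‖ ≤ ‖c 0‖ + V := by
    intro k
    refine le_trans ?_ (add_le_add le_rfl (hV k))
    induction k with
    | zero => simp
    | succ k ih =>
      rw [Finset.sum_range_succ]
      have := norm_add_le (c k) (c (k + 1) - c k)
      rw [add_sub_cancel] at this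
      linarith
  have hZb : ∀ n k, ‖Z n (k + 1)‖ ≤ M + (‖c 0‖ + V) := by
    intro n k
    have h1 := norm_sub_le (c (k / 2 ^ n)) (c (k / 2 ^ n) - Z n (k + 1))
    rw [sub_sub_cancel] at h1
    linarith [hcb (k / 2 ^ n), hsl n k]
  set M₂ := M + (‖c 0‖ + V) with hM₂
  have hM₂0 : 0 ≤ M₂ := (norm_nonneg _).trans (hZb 0 0)
  obtain ⟨R, hR0, hR⟩ := exists_norm_bound hcont
  -- The elements Z of the graph are bounded, so coercivity applied to form U U = ⟨Z, U⟩ bounds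
  -- `Lam` along the scheme.
  set K := (M₂ * (R + 1) + |A.coerConst|) / A.coer with hK
  have hK0 : 0 ≤ K := div_nonneg (by positivity) A.coer_pos.le
  have hlamU : ∀ t ∈ Icc 0 T, ∀ᶠ n : ℕ in atTop,
      (A.Lam (U n (⌊t / (τ₀ / 2 ^ n)⌋₊ + 1))).toReal ≤ K := by
    intro t ht
    filter_upwards [(hlim t ht.1).norm.eventually_lt_const
      (show ‖u t‖ < R + 1 by linarith [hR t ht])] with n hn
    set k := ⌊t / (τ₀ / 2 ^ n)⌋₊
    obtain ⟨h1, h2⟩ := (hE n).rel (k + 1)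
    have h3 := A.coercive _ h1
    rw [h2 _ h1] at h3
    have h4 := real_inner_le_norm (Z n (k + 1)) (U n (k + 1))
    have h5 : ‖Z n (k + 1)‖ * ‖U n (k + 1)‖ ≤ M₂ * (R + 1) :=
      mul_le_mul (hZb n k) hn.le (norm_nonneg _) hM₂0
    rw [hK, le_div_iff₀ A.coer_pos]
    nlinarith [A.coer_pos, sq_nonneg ‖U n (k + 1)‖, le_abs_self A.coerConst,
      mul_nonneg A.coer_pos.le (sq_nonneg ‖U n (k + 1)‖)]
  have hlamu : ∀ t ∈ Icc 0 T, A.Lam (u t) ≤ ENNReal.ofReal K := by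
    intro t ht
    refine (A.Lam_lsc.isClosed_preimage (ENNReal.ofReal K)).mem_of_tendsto (hlim t ht.1) ?_
    filter_upwards [hlamU t ht] with n hn
    exact (ENNReal.le_ofReal_iff_toReal_le ((hE n).rel _).1.ne hK0).2 hn
  have hlamu' : ∀ t ∈ Icc 0 T, A.Lam (u t) < ∞ := fun t ht =>
    (hlamu t ht).trans_lt ENNReal.ofReal_lt_top
  have hΛ : ∫⁻ t in Icc 0 T, A.Lam (u t) < ∞ := by
    refine (setLIntegral_mono' measurableSet_Icc hlamu).trans_lt ?_
    rw [setLIntegral_const]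
    exact ENNReal.mul_lt_top ENNReal.ofReal_lt_top measure_Icc_lt_top
  refine ⟨u, hcont, hΛ, fun φ hφ t ht => ?_⟩
  have h0m : (0 : ℝ) ∈ Icc 0 T := ⟨le_rfl, ht.1.trans ht.2⟩
  -- The slopes tested with φ. Their integral as step functions is the Euler sum, and they converge
  -- pointwise to ⟨c, φ⟩ - form (u s) φ by `modulus`.
  set D : ℕ → ℕ → ℝ := fun n k => inner ℝ (c (k / 2 ^ n) - Z n (k + 1)) φ with hD
  have hDb : ∀ n k, |D n k| ≤ M * ‖φ‖ := fun n k =>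
    (abs_real_inner_le_norm _ _).trans (mul_le_mul_of_nonneg_right (hsl n k) (norm_nonneg _))
  have hDm : ∀ n, Measurable fun s : ℝ => D n ⌊s / (τ₀ / 2 ^ n)⌋₊ := fun n =>
    (measurable_from_nat (f := D n)).comp (Nat.measurable_floor.comp (measurable_id.div_const _))
  have hDi : ∀ n a b, IntervalIntegrable (fun s : ℝ => D n ⌊s / (τ₀ / 2 ^ n)⌋₊) volume a b :=
    fun n a b => IntervalIntegrable.mono_fun (f := fun _ => M * ‖φ‖) (by simp)
      (hDm n).aestronglyMeasurable
      (Eventually.of_forall fun s => (hDb n _).trans (le_abs_self _))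
  have hUk : ∀ n k, inner ℝ (U n k) φ = inner ℝ u₀ φ
      + ∑ j ∈ Finset.range k, (τ₀ / 2 ^ n) * D n j := by
    intro n k
    induction k with
    | zero => simp [hU0]
    | succ k ih =>
      rw [Finset.sum_range_succ, (hE n).step, inner_add_left, ih, real_inner_smul_left]
      ring
  have hfloor : ∀ (n : ℕ) (s : ℝ), ⌊s / (τ₀ / 2 ^ n)⌋₊ / 2 ^ n = ⌊s / τ₀⌋₊ := by
    intro n s
    have := Nat.floor_div_natCast (s / (τ₀ / 2 ^ n)) (2 ^ n)
    rw [← this]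
    congr 1
    push_cast
    field_simp
  have hDlim : ∀ s ∈ Icc 0 T, Tendsto (fun n => D n ⌊s / (τ₀ / 2 ^ n)⌋₊) atTop
      (𝓝 (inner ℝ (c ⌊s / τ₀⌋₊) φ - A.form (u s) φ)) := by
    intro s hs
    have e : ∀ n, D n ⌊s / (τ₀ / 2 ^ n)⌋₊ = inner ℝ (c ⌊s / τ₀⌋₊) φ
        - A.form (U n (⌊s / (τ₀ / 2 ^ n)⌋₊ + 1)) φ := by
      intro n
      simp only [hD]
      rw [inner_sub_left, hfloor, ((hE n).rel _).2 φ hφ]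
    simp_rw [e]
    refine Tendsto.const_sub _ ?_
    rw [Metric.tendsto_atTop']
    intro ε hε
    obtain ⟨C, hC, hCm⟩ := A.modulus φ hφ (ε / (2 * (1 + K + K))) (by positivity)
    have h1 : ∀ᶠ n : ℕ in atTop, ‖U n (⌊s / (τ₀ / 2 ^ n)⌋₊ + 1) - u s‖ < ε / (2 * (C + 1)) := by
      have := (tendsto_iff_norm_sub_tendsto_zero.1 (hlim s hs.1))
      exact this.eventually_lt_const (by positivity)
    obtain ⟨N, hN⟩ := eventually_atTop.1 (h1.and (hlamU s hs))
    refine ⟨N, fun n hn => ?_⟩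
    obtain ⟨h2, h3⟩ := hN n hn.le
    have h4 := hCm _ (u s) ((hE n).rel (⌊s / (τ₀ / 2 ^ n)⌋₊ + 1)).1 (hlamu' s hs)
    have h5 : (A.Lam (u s)).toReal ≤ K := ENNReal.toReal_le_of_le_ofReal hK0 (hlamu s hs)
    rw [lt_div_iff₀ (by positivity)] at h2
    rw [Real.dist_eq]
    have h6 : ε / (2 * (1 + K + K)) * (1 + (A.Lam (U n (⌊s / (τ₀ / 2 ^ n)⌋₊ + 1))).toReal
        + (A.Lam (u s)).toReal) ≤ ε / 2 := by
      calc _ ≤ ε / (2 * (1 + K + K)) * (1 + K + K) := by gcongr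
        _ = ε / 2 := by field_simp
    nlinarith [norm_nonneg (U n (⌊s / (τ₀ / 2 ^ n)⌋₊ + 1) - u s)]
  have hIlim : Tendsto (fun n => ∫ s in (0 : ℝ)..t, D n ⌊s / (τ₀ / 2 ^ n)⌋₊) atTop
      (𝓝 (∫ s in (0 : ℝ)..t, (inner ℝ (c ⌊s / τ₀⌋₊) φ - A.form (u s) φ))) := by
    refine intervalIntegral.tendsto_integral_filter_of_dominated_convergence (fun _ => M * ‖φ‖)
      (Eventually.of_forall fun n => (hDm n).aestronglyMeasurable)
      (Eventually.of_forall fun n => Eventually.of_forall fun s _ => hDb n _) (by simp) ?_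
    refine Eventually.of_forall fun s hs => hDlim s ?_
    rw [uIoc_of_le ht.1] at hs
    exact ⟨hs.1.le, hs.2.trans ht.2⟩
  -- The Euler sum ends at the grid point after t, the integral at t. A full step and a fractional
  -- one account for the two errors of size M ‖φ‖ τ.
  have hdiff : ∀ n, |inner ℝ (U n (⌊t / (τ₀ / 2 ^ n)⌋₊ + 1)) φ - (inner ℝ u₀ φ
      + ∫ s in (0 : ℝ)..t, D n ⌊s / (τ₀ / 2 ^ n)⌋₊)| ≤ 2 * (M * ‖φ‖) * (τ₀ / 2 ^ n) := by
    intro n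
    set τ := τ₀ / 2 ^ n with hτn
    set k := ⌊t / τ⌋₊ with hk
    have e1 : (k : ℝ) * τ ≤ t := by
      have := Nat.floor_le (a := t / τ) (div_nonneg ht.1 (hτ n).le)
      rwa [← hk, le_div_iff₀ (hτ n)] at this
    have e2 : t < (k + 1) * τ := by
      have := Nat.lt_floor_add_one (t / τ)
      rwa [← hk, div_lt_iff₀ (hτ n)] at this
    have e3 := intervalIntegral.integral_add_adjacent_intervals (hDi n 0 (k * τ)) (hDi n (k * τ) t)
    have e4 := integral_step (hDb n) (hτ n) k
    have e5 : ‖∫ s in (k * τ)..t, D n ⌊s / τ⌋₊‖ ≤ M * ‖φ‖ * |t - k * τ| :=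
      intervalIntegral.norm_integral_le_of_norm_le_const fun s _ => hDb n _
    rw [Real.norm_eq_abs, abs_of_nonneg (by linarith : 0 ≤ t - k * τ)] at e5
    have e6 := hUk n (k + 1)
    rw [Finset.sum_range_succ, ← e4] at e6
    rw [e6, ← e3]
    have e7 := hDb n k
    have e8 : 0 ≤ M * ‖φ‖ := by positivity
    have e9 : M * ‖φ‖ * (t - k * τ) ≤ M * ‖φ‖ * τ := by
      apply mul_le_mul_of_nonneg_left _ e8; linarith
    have e10 : |τ * D n k| ≤ M * ‖φ‖ * τ := by
      rw [abs_mul, abs_of_pos (hτ n), mul_comm]; exact mul_le_mul_of_nonneg_right e7 (hτ n).le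
    simp only [← hτn] at e6 ⊢
    rw [abs_le] at e5 e10 ⊢
    constructor <;> linarith [e5.1, e5.2, e10.1, e10.2]
  have hL : Tendsto (fun n : ℕ => inner ℝ (U n (⌊t / (τ₀ / 2 ^ n)⌋₊ + 1)) φ) atTop
      (𝓝 (inner ℝ (u t) φ)) := (hlim t ht.1).inner tendsto_const_nhds
  have hz : Tendsto (fun n => inner ℝ (U n (⌊t / (τ₀ / 2 ^ n)⌋₊ + 1)) φ - (inner ℝ u₀ φ
      + ∫ s in (0 : ℝ)..t, D n ⌊s / (τ₀ / 2 ^ n)⌋₊)) atTop (𝓝 0) := by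
    apply squeeze_zero_norm hdiff
    simpa using hτlim.const_mul (2 * (M * ‖φ‖))
  have huniq := tendsto_nhds_unique hz (hL.sub (hIlim.const_add _))
  have hci : IntervalIntegrable (fun s => inner ℝ (c ⌊s / τ₀⌋₊) φ) volume 0 t :=
    IntervalIntegrable.mono_fun (f := fun _ => (‖c 0‖ + V) * ‖φ‖) (by simp)
      ((measurable_from_nat (f := fun k => inner ℝ (c k) φ)).comp
        (Nat.measurable_floor.comp (measurable_id.div_const τ₀))).aestronglyMeasurable
      (Eventually.of_forall fun s => ((abs_real_inner_le_norm _ _).trans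
        (mul_le_mul_of_nonneg_right (hcb _) (norm_nonneg _))).trans (le_abs_self _))
  rw [intervalIntegral.integral_sub hci
    (intervalIntegrable_of_Icc (integrableOn_form hcont hΛ hφ) h0m ht)] at huniq
  linarith

end MonotoneForm

end

end EvolEq

/-! ### Weak solutions for arbitrary initial data and integrable right-hand sides -/

namespace EvolEq

open Filter Topology

noncomputable section

/-- Integrable functions on `[0, T]` are approximated in the mean by step functions on a uniform
grid. -/
theorem exists_step_approx {H : Type*} [NormedAddCommGroup H] [NormedSpace ℝ H] {T : ℝ}
    (hT : 0 ≤ T) {f : ℝ → H} (hf : IntegrableOn f (Icc 0 T)) {ε : ℝ} (hε : 0 < ε) :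
    ∃ (τ : ℝ) (c : ℕ → H) (V : ℝ), 0 < τ ∧ (∀ m, ∑ i ∈ Finset.range m, ‖c (i + 1) - c i‖ ≤ V) ∧
      IntegrableOn (fun s => c ⌊s / τ⌋₊) (Icc 0 T) ∧
      ∫ s in Icc 0 T, ‖f s - c ⌊s / τ⌋₊‖ ≤ ε := by
  obtain ⟨g, hg, hgi⟩ := Integrable.exists_boundedContinuous_integral_sub_le
    (μ := volume.restrict (Icc 0 T)) hf (half_pos hε)
  have hκ : 0 < ε / (2 * (T + 1)) := by positivity
  obtain ⟨d, hd, huc⟩ := Metric.uniformContinuousOn_iff.1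
    (isCompact_Icc.uniformContinuousOn_of_continuous (g.continuous.continuousOn (s := Icc 0 T)))
    _ hκ
  obtain ⟨N, hN⟩ := exists_nat_gt (T / (d / 2))
  rw [div_lt_iff₀ (by positivity)] at hN
  -- The minimum with T makes c constant from index N on, so that its variation is finite.
  set c : ℕ → H := fun k => g (min (k * (d / 2)) T) with hc
  have hci : IntegrableOn (fun s => c ⌊s / (d / 2)⌋₊) (Icc 0 T) := by
    refine Integrable.mono' (g := fun _ => ‖g‖) (integrable_const _) ?_
      (Eventually.of_forall fun s => g.norm_coe_le_norm _)
    exact ((StronglyMeasurable.of_discrete (f := c)).comp_measurable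
        (Nat.measurable_floor.comp (measurable_id.div_const (d / 2)))).aestronglyMeasurable
  refine ⟨d / 2, c, ∑ i ∈ Finset.range N, ‖c (i + 1) - c i‖, by positivity, fun m => ?_, hci, ?_⟩
  · have hsub : Finset.range m ⊆ Finset.range (max m N) := by
      intro i; simp only [Finset.mem_range]; omega
    refine (Finset.sum_le_sum_of_subset_of_nonneg hsub fun _ _ _ => norm_nonneg _).trans ?_
    refine le_of_eq (Finset.sum_subset (s₁ := Finset.range N) ?_ ?_).symm
    · intro i; simp only [Finset.mem_range]; omega
    · intro i _ hi
      have hi' : (N : ℝ) ≤ i := by exact_mod_cast not_lt.1 (fun h => hi (Finset.mem_range.2 h))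
      have h1 : T ≤ i * (d / 2) := hN.le.trans (mul_le_mul_of_nonneg_right hi' (by positivity))
      have h2 : T ≤ ((i + 1 : ℕ) : ℝ) * (d / 2) := by push_cast; nlinarith
      simp only [hc]
      rw [min_eq_right h1, min_eq_right h2, sub_self, norm_zero]
  · have h1 : ∀ s ∈ Icc 0 T, ‖f s - c ⌊s / (d / 2)⌋₊‖ ≤ ‖f s - g s‖ + ε / (2 * (T + 1)) := by
      intro s hs
      have e1 := Nat.floor_le (a := s / (d / 2)) (div_nonneg hs.1 (by positivity))
      have e2 := Nat.lt_floor_add_one (s / (d / 2))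
      rw [le_div_iff₀ (by positivity)] at e1
      rw [div_lt_iff₀ (by positivity)] at e2
      have e3 : c ⌊s / (d / 2)⌋₊ = g (⌊s / (d / 2)⌋₊ * (d / 2)) := by
        simp only [hc]; rw [min_eq_left (e1.trans hs.2)]
      rw [e3]
      have e4 := huc s hs (⌊s / (d / 2)⌋₊ * (d / 2)) ⟨by positivity, e1.trans hs.2⟩
        (by rw [Real.dist_eq, abs_lt]; constructor <;> linarith)
      rw [dist_eq_norm] at e4
      linarith [norm_sub_le_norm_sub_add_norm_sub (f s) (g s) (g (⌊s / (d / 2)⌋₊ * (d / 2)))]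
    have i1 : IntegrableOn (fun s => ‖f s - g s‖) (Icc 0 T) := (hf.sub hgi).norm
    calc ∫ s in Icc 0 T, ‖f s - c ⌊s / (d / 2)⌋₊‖
        ≤ ∫ s in Icc 0 T, (‖f s - g s‖ + ε / (2 * (T + 1))) :=
          setIntegral_mono_on (hf.sub hci).norm (i1.add (integrable_const _)) measurableSet_Icc h1
      _ = (∫ s in Icc 0 T, ‖f s - g s‖) + T * (ε / (2 * (T + 1))) := by
          rw [integral_add i1 (integrable_const _)]; simp [hT]
      _ ≤ ε / 2 + ε / 2 := by
          refine add_le_add hg ?_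
          rw [mul_div_assoc', div_le_div_iff₀ (by positivity) (by positivity)]
          nlinarith
      _ = ε := by ring

namespace MonotoneForm

variable {H : Type*} [NormedAddCommGroup H] [InnerProductSpace ℝ H] {A : MonotoneForm H}

variable (A) in
-- The domain of the operator in H is dense: approximate u₀ by x with finite `Lam`, then x by the
-- resolvent at x with a small step. The convergence rests on `bound` at x and on coercivity, which
-- keeps τ Lam u bounded.
theorem exists_graph_near (u₀ : H) {ε : ℝ} (hε : 0 < ε) : ∃ u z, A.graph u z ∧ ‖u₀ - u‖ ≤ ε := by
  obtain ⟨x, hx, hxd⟩ := A.dense.exists_dist_lt u₀ (half_pos hε)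
  have hx : A.Lam x < ∞ := hx
  have hK0 : (0 : ℝ) ≤ A.addConst := A.addConst.2
  have hc := A.coer_pos
  set lx := (A.Lam x).toReal with hlx
  have hlx0 : 0 ≤ lx := ENNReal.toReal_nonneg
  set B := (‖x‖ ^ 2 + |A.coerConst|) / A.coer + lx with hB
  have hB0 : 0 ≤ B := by positivity
  set η := ε ^ 2 / (16 * (A.addConst * B + 1)) with hη
  have hη0 : 0 < η := by positivity
  have hηB : η * (A.addConst * B) ≤ ε ^ 2 / 16 := by
    rw [hη, div_mul_eq_mul_div, div_le_div_iff₀ (by positivity) (by positivity)]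
    nlinarith [sq_nonneg ε, mul_nonneg hK0 hB0]
  obtain ⟨a, ha, hb⟩ := A.bound η hη0
  obtain ⟨C, hC, hCb⟩ := hb 0
  set C' := C * (1 + ‖x‖) with hC'
  set A' := a * (A.tail 0 x).toReal with hA'
  have hA'0 : 0 ≤ A' := by positivity
  have hC'0 : 0 ≤ C' := by positivity
  -- Chosen for the end of the proof: absorbing half of q² there leaves q² ≤ τ (C'² + 2A') + ε²/8.
  obtain ⟨τ, hτ, hτ1, hτ2⟩ : ∃ τ > 0, τ ≤ 1 ∧ τ * (C' ^ 2 + 2 * A') ≤ ε ^ 2 / 8 := by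
    refine ⟨min 1 (ε ^ 2 / (8 * (C' ^ 2 + 2 * A' + 1))), by positivity, min_le_left _ _, ?_⟩
    refine (mul_le_mul_of_nonneg_right (min_le_right _ _) (by positivity)).trans ?_
    rw [div_mul_eq_mul_div, div_le_div_iff₀ (by positivity) (by positivity)]
    nlinarith [sq_nonneg ε]
  obtain ⟨u, hu, hres⟩ := A.resolvent τ hτ x
  refine ⟨u, τ⁻¹ • (x - u), ⟨hu, fun φ hφ => ?_⟩, ?_⟩
  · rw [real_inner_smul_left, inner_sub_left, ← hres φ hφ]
    field_simp
    ring
  have h1 := hres u hu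
  have h2 := A.coercive u hu
  have h3 := real_inner_le_norm x u
  rw [real_inner_self_eq_norm_sq] at h1
  set lu := (A.Lam u).toReal with hlu
  have hlu0 : 0 ≤ lu := ENNReal.toReal_nonneg
  have h4 : τ * lu ≤ (‖x‖ ^ 2 + |A.coerConst|) / A.coer := by
    rw [le_div_iff₀ hc]
    have e1 : τ * (A.coer * (‖u‖ ^ 2 + lu)) ≤ τ * (A.form u u + A.coerConst) :=
      mul_le_mul_of_nonneg_left h2 hτ.le
    have e2 : τ * A.coerConst ≤ |A.coerConst| := by
      calc τ * A.coerConst ≤ τ * |A.coerConst| :=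
            mul_le_mul_of_nonneg_left (le_abs_self _) hτ.le
        _ ≤ 1 * |A.coerConst| := mul_le_mul_of_nonneg_right hτ1 (abs_nonneg _)
        _ = _ := one_mul _
    have e3 : 0 ≤ τ * (A.coer * ‖u‖ ^ 2) := by positivity
    nlinarith [sq_nonneg (‖x‖ - ‖u‖), sq_nonneg ‖u‖, sq_nonneg ‖x‖]
  have hψ := Lam_sub_lt hu hx
  have h5 := hres (u - x) hψ
  have h6 := A.mono u x hu hx
  have h7 := hCb x (u - x) hx hψ
  rw [← hC', ← hA'] at h7
  clear_value A' C'
  have h8 := toReal_Lam_sub_le hu hx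
  -- By the resolvent equation ‖u - x‖² = -τ form u (u - x), and monotonicity replaces form u by
  -- form x, whose first argument is fixed.
  have h9 : ‖u - x‖ ^ 2 ≤ τ * |A.form x (u - x)| := by
    rw [← real_inner_self_eq_norm_sq, inner_sub_left]
    have := neg_abs_le (A.form x (u - x))
    nlinarith
  set q := ‖u - x‖ with hq
  have hq0 : 0 ≤ q := norm_nonneg _
  have h10 : τ * (η * (A.Lam (u - x)).toReal) ≤ η * (A.addConst * B) := by
    have e1 : τ * (A.Lam (u - x)).toReal ≤ A.addConst * B := by
      calc τ * (A.Lam (u - x)).toReal ≤ τ * (A.addConst * (lu + lx)) :=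
            mul_le_mul_of_nonneg_left h8 hτ.le
        _ = A.addConst * (τ * lu + τ * lx) := by ring
        _ ≤ A.addConst * B := by
            refine mul_le_mul_of_nonneg_left ?_ hK0
            rw [hB]
            nlinarith
    calc _ = η * (τ * (A.Lam (u - x)).toReal) := by ring
      _ ≤ _ := mul_le_mul_of_nonneg_left e1 hη0.le
  have h11 : q ^ 2 ≤ τ * C' * q + τ * A' + ε ^ 2 / 16 := by
    have : τ * |A.form x (u - x)| ≤ τ * (C' * q + A' + η * (A.Lam (u - x)).toReal) :=
      mul_le_mul_of_nonneg_left h7 hτ.le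
    linarith
  have h12 : q ^ 2 ≤ (ε / 2) ^ 2 := by
    have e1 : τ * C' * q ≤ q ^ 2 / 2 + τ * C' ^ 2 / 2 := by
      have e2 : (τ * C') ^ 2 ≤ τ * C' ^ 2 := by
        have := mul_le_mul_of_nonneg_right hτ1 (mul_nonneg hτ.le (sq_nonneg C'))
        linarith
      linarith [sq_nonneg (q - τ * C')]
    linarith
  have h13 : q ≤ ε / 2 := le_of_sq_le_sq h12 (by positivity)
  rw [dist_eq_norm] at hxd
  have := norm_sub_le_norm_sub_add_norm_sub u₀ x u
  rw [norm_sub_rev x u] at this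
  linarith

variable [MeasurableSpace H] [BorelSpace H]

/-- Existence of weak solutions of `u' + A u = f` for integrable right-hand sides. -/
theorem exists_isWeakSol [CompleteSpace H] {T : ℝ} (hT : 0 ≤ T) {f : ℝ → H}
    (hf : IntegrableOn f (Icc 0 T)) (u₀ : H) : ∃ u, A.IsWeakSol T f u₀ u := by
  have hε : ∀ j : ℕ, (0 : ℝ) < (1 / 2) ^ j := fun j => by positivity
  choose τ c V hτ hV hci hcf using fun j => exists_step_approx hT hf (hε j)
  choose w z hgr hw using fun j => A.exists_graph_near u₀ (hε j)
  choose v hv using fun j => exists_isWeakSol_step (hgr j) (c j) (hV j) (hτ j) T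
  obtain ⟨F, hF⟩ : ∃ F : ℕ → ℝ → H, ∀ j, F j = fun s => c j ⌊s / τ j⌋₊ :=
    ⟨fun j s => c j ⌊s / τ j⌋₊, fun _ => rfl⟩
  replace hci : ∀ j, IntegrableOn (F j) (Icc 0 T) := fun j => by rw [hF]; exact hci j
  replace hcf : ∀ j, ∫ s in Icc 0 T, ‖f s - F j s‖ ≤ (1 / 2) ^ j := fun j => by
    rw [hF]; exact hcf j
  replace hv : ∀ j, A.IsWeakSol T (F j) (w j) (v j) := fun j => by rw [hF]; exact hv j
  have hfF : ∀ j, IntegrableOn (fun s => ‖f s - F j s‖) (Icc 0 T) := fun j =>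
    (hf.sub (hci j)).norm
  have hTm : T ∈ Icc 0 T := ⟨hT, le_rfl⟩
  have h0m : (0 : ℝ) ∈ Icc 0 T := ⟨le_rfl, hT⟩
  have hsetle : ∀ {k : ℝ → ℝ}, IntegrableOn k (Icc 0 T) → (∀ s, 0 ≤ k s) → ∀ t ∈ Icc 0 T,
      ∫ s in (0 : ℝ)..t, k s ≤ ∫ s in Icc 0 T, k s := by
    intro k hk hk0 t ht
    rw [intervalIntegral.integral_of_le ht.1]
    exact setIntegral_mono_set hk (Eventually.of_forall hk0)
      (Ioc_subset_Icc_self.trans (Icc_subset_Icc le_rfl ht.2)).eventuallyLE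
  -- The initial data of consecutive approximations differ by at most 2 · 2⁻ʲ, and so do their
  -- right-hand sides in the mean. Stability gives 2 + 2 · 2 = 6, and the geometric series doubles
  -- it to 12 below.
  have hstep : ∀ t ∈ Icc 0 T, ∀ j, dist (v j t) (v (j + 1) t) ≤ 6 * (1 / 2) ^ j := by
    intro t ht j
    have h1 := (hv j).norm_sub_le (hci j) (hv (j + 1)) (hci (j + 1)) ht
    have h2 : ‖w j - w (j + 1)‖ ≤ 2 * (1 / 2) ^ j := by
      have e1 := norm_sub_le_norm_sub_add_norm_sub (w j) u₀ (w (j + 1))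
      rw [norm_sub_rev (w j) u₀] at e1
      have e2 := hw j
      have e3 := hw (j + 1)
      rw [pow_succ] at e3
      linarith [hε j]
    have h3 : ∫ s in (0 : ℝ)..t, ‖F j s - F (j + 1) s‖ ≤ 2 * (1 / 2) ^ j := by
      refine (hsetle (k := fun s => ‖F j s - F (j + 1) s‖) ((hci j).sub (hci (j + 1))).norm
        (fun _ => norm_nonneg _) t ht).trans ?_
      have e1 : ∫ s in Icc 0 T, ‖F j s - F (j + 1) s‖
          ≤ ∫ s in Icc 0 T, (‖f s - F j s‖ + ‖f s - F (j + 1) s‖) := by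
        refine integral_mono ((hci j).sub (hci (j + 1))).norm
          ((hfF j).add (hfF (j + 1))) fun s => ?_
        have := norm_sub_le_norm_sub_add_norm_sub (F j s) (f s) (F (j + 1) s)
        rwa [norm_sub_rev (F j s) (f s)] at this
      rw [integral_add (hfF j) (hfF (j + 1))] at e1
      have e2 := hcf j
      have e3 := hcf (j + 1)
      rw [pow_succ] at e3
      linarith [hε j]
    rw [dist_eq_norm]
    linarith
  have hlim : ∀ t ∈ Icc 0 T, ∃ x, Tendsto (fun j => v j t) atTop (𝓝 x) := fun t ht =>
    cauchySeq_tendsto_of_complete (cauchySeq_of_le_geometric (1 / 2) 6 (by norm_num) (hstep t ht))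
  choose! u hu using hlim
  have hdist : ∀ t ∈ Icc 0 T, ∀ j, ‖v j t - u t‖ ≤ 12 * (1 / 2) ^ j := by
    intro t ht j
    rw [← dist_eq_norm]
    refine (dist_le_of_le_geometric_of_tendsto (1 / 2) 6 (by norm_num) (hstep t ht) (hu t ht)
      j).trans (le_of_eq ?_)
    ring
  have hpow : Tendsto (fun j : ℕ => (12 : ℝ) * (1 / 2) ^ j) atTop (𝓝 0) := by
    simpa using (tendsto_pow_atTop_nhds_zero_of_lt_one (r := (1 / 2 : ℝ)) (by norm_num)
      (by norm_num)).const_mul 12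
  have hunif : TendstoUniformlyOn v u atTop (Icc 0 T) := by
    rw [Metric.tendstoUniformlyOn_iff]
    intro ε hε
    filter_upwards [hpow.eventually_lt_const hε] with j hj t ht
    rw [dist_comm, dist_eq_norm]
    exact (hdist t ht j).trans_lt hj
  have hcont : ContinuousOn u (Icc 0 T) :=
    hunif.continuousOn (Eventually.of_forall fun j => (hv j).cont).frequently
  obtain ⟨R, hR0, hR⟩ := exists_norm_bound hcont
  have hpow1 : ∀ j : ℕ, ((1 : ℝ) / 2) ^ j ≤ 1 := fun j => pow_le_one₀ (by norm_num) (by norm_num)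
  have hvR : ∀ j, ∀ t ∈ Icc 0 T, ‖v j t‖ ≤ R + 12 := by
    intro j t ht
    have h1 := norm_sub_norm_le (v j t) (u t)
    have h2 := hdist t ht j
    linarith [hR t ht, hpow1 j]
  set I := ∫ s in Icc 0 T, ‖f s‖ with hI
  have hFI : ∀ j, ∫ s in Icc 0 T, ‖F j s‖ ≤ I + 1 := by
    intro j
    have e1 : ∫ s in Icc 0 T, ‖F j s‖ ≤ ∫ s in Icc 0 T, (‖f s‖ + ‖f s - F j s‖) := by
      refine integral_mono (hci j).norm (hf.norm.add (hfF j)) fun s => ?_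
      have := norm_sub_norm_le (F j s) (f s)
      rw [norm_sub_rev] at this
      linarith
    rw [integral_add hf.norm (hfF j)] at e1
    linarith [hcf j, hpow1 j]
  -- Energy bound for the integral of `Lam`, uniform in j because ‖v j‖ ≤ R + 12 and the mean of ‖F
  -- j‖ is at most I + 1.
  set K := ((‖u₀‖ + 1) ^ 2 / 2 + (|A.coerConst| * T + (I + 1) * (R + 12))) / A.coer with hK
  have hI0 : 0 ≤ I := integral_nonneg fun _ => norm_nonneg _
  have hK0 : 0 ≤ K := div_nonneg (by positivity) A.coer_pos.le
  have hlamj : ∀ j, ∫ t in Icc 0 T, (A.Lam (v j t)).toReal ≤ K := by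
    intro j
    have h1 := (hv j).energy (hci j) hTm
    have i1 : IntegrableOn (fun s => ‖v j s‖ ^ 2) (Icc 0 T) :=
      ((hv j).cont.norm.pow 2).integrableOn_Icc
    have i2 := integrableOn_Lam (hv j).cont (hv j).lam
    rw [intervalIntegral.integral_of_le hT, intervalIntegral.integral_of_le hT,
      ← integral_Icc_eq_integral_Ioc, ← integral_Icc_eq_integral_Ioc, integral_add i1 i2,
      integral_add (integrable_const _) (integrableOn_norm_mul_norm (hci j) (hv j).cont)] at h1
    have h2 : 0 ≤ ∫ t in Icc 0 T, ‖v j t‖ ^ 2 := integral_nonneg fun _ => by positivity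
    have h3 : ∫ s in Icc 0 T, ‖F j s‖ * ‖v j s‖ ≤ (I + 1) * (R + 12) := by
      calc ∫ s in Icc 0 T, ‖F j s‖ * ‖v j s‖ ≤ ∫ s in Icc 0 T, ‖F j s‖ * (R + 12) :=
            setIntegral_mono_on (integrableOn_norm_mul_norm (hci j) (hv j).cont)
              ((hci j).norm.mul_const _) measurableSet_Icc fun s hs =>
                mul_le_mul_of_nonneg_left (hvR j s hs) (norm_nonneg _)
        _ = (∫ s in Icc 0 T, ‖F j s‖) * (R + 12) := integral_mul_const _ _
        _ ≤ _ := mul_le_mul_of_nonneg_right (hFI j) (by positivity)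
    have h4 : ∫ s in Icc 0 T, A.coerConst ≤ |A.coerConst| * T := by
      simp only [integral_const, measureReal_restrict_apply_univ, Real.volume_real_Icc, sub_zero,
        smul_eq_mul]
      rw [max_eq_left hT, mul_comm]
      exact mul_le_mul_of_nonneg_right (le_abs_self _) hT
    have h5 : ‖w j‖ ^ 2 / 2 ≤ (‖u₀‖ + 1) ^ 2 / 2 := by
      have e1 : ‖w j‖ ≤ ‖u₀‖ + 1 := by
        have := norm_sub_norm_le (w j) u₀
        rw [norm_sub_rev] at this
        linarith [hw j, hpow1 j]
      gcongr
    rw [hK, le_div_iff₀ A.coer_pos]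
    nlinarith [sq_nonneg ‖v j T‖, A.coer_pos, mul_nonneg A.coer_pos.le h2]
  have hlamj' : ∀ j, ∫⁻ t in Icc 0 T, A.Lam (v j t) ≤ ENNReal.ofReal K := by
    intro j
    have h1 := integral_toReal (aemeasurable_Lam (hv j).cont) (ae_Lam_lt (hv j).cont (hv j).lam)
    refine (ENNReal.le_ofReal_iff_toReal_le (hv j).lam.ne hK0).2 ?_
    rw [← h1]; exact hlamj j
  -- Fatou's lemma with the lower semicontinuity of `Lam`.
  have hΛ' : ∫⁻ t in Icc 0 T, A.Lam (u t) ≤ ENNReal.ofReal K := by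
    calc ∫⁻ t in Icc 0 T, A.Lam (u t)
        ≤ ∫⁻ t in Icc 0 T, liminf (fun j => A.Lam (v j t)) atTop := by
          refine setLIntegral_mono' measurableSet_Icc fun t ht => ?_
          refine (A.Lam_lsc.le_liminf (u t)).trans ?_
          exact liminf_le_liminf_of_le (hu t ht)
      _ ≤ liminf (fun j => ∫⁻ t in Icc 0 T, A.Lam (v j t)) atTop :=
          lintegral_liminf_le' fun j => aemeasurable_Lam (hv j).cont
      _ ≤ ENNReal.ofReal K := by
          refine liminf_le_of_le (by isBoundedDefault) fun b hb => ?_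
          obtain ⟨j, hj⟩ := hb.exists
          exact hj.trans (hlamj' j)
  have hΛ := hΛ'.trans_lt ENNReal.ofReal_lt_top
  have hlamu : ∫ t in Icc 0 T, (A.Lam (u t)).toReal ≤ K := by
    rw [integral_toReal (aemeasurable_Lam hcont) (ae_Lam_lt hcont hΛ)]
    exact ENNReal.toReal_le_of_le_ofReal hK0 hΛ'
  refine ⟨u, hcont, hΛ, fun φ hφ t ht => ?_⟩
  have l1 : Tendsto (fun j => inner ℝ (v j t) φ) atTop (𝓝 (inner ℝ (u t) φ)) :=
    (hu t ht).inner tendsto_const_nhds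
  have l2 : Tendsto (fun j => inner ℝ (w j) φ) atTop (𝓝 (inner ℝ u₀ φ)) := by
    refine Tendsto.inner ?_ tendsto_const_nhds
    rw [tendsto_iff_norm_sub_tendsto_zero]
    refine squeeze_zero (fun _ => norm_nonneg _) (fun j => ?_)
      (tendsto_pow_atTop_nhds_zero_of_lt_one (r := (1 / 2 : ℝ)) (by norm_num) (by norm_num))
    rw [norm_sub_rev]; exact hw j
  have l3 : Tendsto (fun j => ∫ s in (0 : ℝ)..t, inner ℝ (F j s) φ) atTop
      (𝓝 (∫ s in (0 : ℝ)..t, inner ℝ (f s) φ)) := by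
    rw [tendsto_iff_norm_sub_tendsto_zero]
    have lz : Tendsto (fun j : ℕ => ((1 : ℝ) / 2) ^ j * ‖φ‖) atTop (𝓝 0) := by
      simpa using (tendsto_pow_atTop_nhds_zero_of_lt_one (r := (1 / 2 : ℝ)) (by norm_num)
        (by norm_num)).mul_const ‖φ‖
    refine squeeze_zero (fun _ => norm_nonneg _) (fun j => ?_) lz
    rw [← intervalIntegral.integral_sub
      (intervalIntegrable_of_Icc (integrableOn_inner (hci j) φ) h0m ht)
      (intervalIntegrable_of_Icc (integrableOn_inner hf φ) h0m ht)]
    calc _ ≤ ∫ s in (0 : ℝ)..t, ‖f s - F j s‖ * ‖φ‖ := by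
          refine intervalIntegral.norm_integral_le_of_norm_le ht.1
            (Eventually.of_forall fun s _ => ?_)
            ((intervalIntegrable_of_Icc (hfF j) h0m ht).mul_const _)
          rw [← inner_sub_left, Real.norm_eq_abs, norm_sub_rev]
          exact abs_real_inner_le_norm _ _
      _ = (∫ s in (0 : ℝ)..t, ‖f s - F j s‖) * ‖φ‖ := intervalIntegral.integral_mul_const _ _
      _ ≤ _ := by
          refine mul_le_mul_of_nonneg_right ?_ (norm_nonneg _)
          exact (hsetle (hfF j) (fun _ => norm_nonneg _) t ht).trans (hcf j)
  -- The errors split by `modulus`: uniform convergence in H controls the first part, the common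
  -- bound K on the integrals of `Lam` the second.
  have l4 : Tendsto (fun j => ∫ s in (0 : ℝ)..t, A.form (v j s) φ) atTop
      (𝓝 (∫ s in (0 : ℝ)..t, A.form (u s) φ)) := by
    rw [tendsto_iff_norm_sub_tendsto_zero, tendsto_order]
    refine ⟨fun a ha => Eventually.of_forall fun j => ha.trans_le (norm_nonneg _), fun ε hε => ?_⟩
    obtain ⟨C, hC, hCm⟩ := A.modulus φ hφ (ε / (2 * (T + K + K + 1))) (by positivity)
    have hev : ∀ᶠ j : ℕ in atTop, C * T * (12 * (1 / 2) ^ j) < ε / 2 := by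
      have := hpow.const_mul (C * T)
      rw [mul_zero] at this
      exact this.eventually_lt_const (by positivity)
    filter_upwards [hev] with j hj
    have iv := integrableOn_Lam (hv j).cont (hv j).lam
    have iu := integrableOn_Lam hcont hΛ
    rw [← intervalIntegral.integral_sub
      (intervalIntegrable_of_Icc (integrableOn_form (hv j).cont (hv j).lam hφ) h0m ht)
      (intervalIntegrable_of_Icc (integrableOn_form hcont hΛ hφ) h0m ht)]
    have i3 : IntegrableOn (fun s => C * (12 * (1 / 2) ^ j) + ε / (2 * (T + K + K + 1))
        * (1 + (A.Lam (v j s)).toReal + (A.Lam (u s)).toReal)) (Icc 0 T) :=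
      (integrable_const _).add ((((integrable_const 1).add iv).add iu).const_mul _)
    have e1 : ‖∫ s in (0 : ℝ)..t, (A.form (v j s) φ - A.form (u s) φ)‖ ≤
        ∫ s in (0 : ℝ)..t, (C * (12 * (1 / 2) ^ j) + ε / (2 * (T + K + K + 1))
          * (1 + (A.Lam (v j s)).toReal + (A.Lam (u s)).toReal)) := by
      refine intervalIntegral.norm_integral_le_of_norm_le ht.1 ?_
        (intervalIntegrable_of_Icc i3 h0m ht)
      have a1 := (ae_restrict_iff' measurableSet_Icc).1 (ae_Lam_lt (hv j).cont (hv j).lam)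
      have a2 := (ae_restrict_iff' measurableSet_Icc).1 (ae_Lam_lt hcont hΛ)
      filter_upwards [a1, a2] with s h1 h2 hs
      have hsT : s ∈ Icc 0 T := ⟨hs.1.le, hs.2.trans ht.2⟩
      refine (hCm _ _ (h1 hsT) (h2 hsT)).trans ?_
      gcongr
      exact hdist s hsT j
    refine e1.trans_lt ?_
    refine (hsetle i3 (fun s => by positivity) t ht).trans_lt ?_
    have i4 : IntegrableOn (fun s => 1 + (A.Lam (v j s)).toReal) (Icc 0 T) :=
      (integrable_const 1).add iv
    have e2 : ∫ s in Icc 0 T, (C * (12 * (1 / 2) ^ j) + ε / (2 * (T + K + K + 1))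
        * (1 + (A.Lam (v j s)).toReal + (A.Lam (u s)).toReal))
        = C * T * (12 * (1 / 2) ^ j) + ε / (2 * (T + K + K + 1)) *
          (T + (∫ s in Icc 0 T, (A.Lam (v j s)).toReal)
            + ∫ s in Icc 0 T, (A.Lam (u s)).toReal) := by
      have i5 : IntegrableOn (fun s => 1 + (A.Lam (v j s)).toReal + (A.Lam (u s)).toReal)
        (Icc 0 T) := i4.add iu
      rw [integral_add (integrable_const _) (i5.const_mul _),
        integral_const_mul (ε / (2 * (T + K + K + 1))),
        integral_add i4 iu, integral_add (integrable_const 1) iv]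
      simp only [integral_const, measureReal_restrict_apply_univ, Real.volume_real_Icc, sub_zero,
        smul_eq_mul, max_eq_left hT]
      ring
    rw [e2]
    have e3 : ε / (2 * (T + K + K + 1)) * (T + (∫ s in Icc 0 T, (A.Lam (v j s)).toReal)
            + ∫ s in Icc 0 T, (A.Lam (u s)).toReal) ≤ ε / 2 := by
      calc _ ≤ ε / (2 * (T + K + K + 1)) * (T + K + K + 1) := by
            refine mul_le_mul_of_nonneg_left ?_ (by positivity)
            linarith [hlamj j]
        _ = ε / 2 := by field_simp
    linarith
  refine tendsto_nhds_unique l1 (((l2.sub l4).add l3).congr fun j => ?_)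
  exact ((hv j).eqn φ hφ t ht).symm

end MonotoneForm

end

end EvolEq

/-! ### Gronwall's inequality and perturbations of linear growth -/

namespace EvolEq

open Filter Topology

noncomputable section

/-- The integrand is 1/K times the derivative, almost everywhere, of the exponential. As the
exponential is monotone, the integral of its derivative is at most its increment, and absolute
continuity is not needed. -/
theorem integral_mul_exp_le {T : ℝ} {b : ℝ → ℝ} (hb : IntegrableOn b (Icc 0 T))
    (hb0 : ∀ s, 0 ≤ b s) {K : ℝ} (hK : 0 < K) {t : ℝ} (ht : t ∈ Icc 0 T) :
    ∫ s in (0 : ℝ)..t, b s * Real.exp (K * ∫ r in (0 : ℝ)..s, b r) ≤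
      Real.exp (K * ∫ r in (0 : ℝ)..t, b r) / K := by
  have h0 : (0 : ℝ) ∈ Icc 0 T := ⟨le_rfl, ht.1.trans ht.2⟩
  have hbI : IntervalIntegrable b volume 0 t := MonotoneForm.intervalIntegrable_of_Icc hb h0 ht
  set E : ℝ → ℝ := fun s => Real.exp (K * ∫ r in (0 : ℝ)..s, b r) with hE
  have hmono : MonotoneOn E (uIcc 0 t) := by
    rw [uIcc_of_le ht.1]
    intro x hx y hy hxy
    refine Real.exp_le_exp.2 (mul_le_mul_of_nonneg_left ?_ hK.le)
    refine intervalIntegral.integral_mono_interval le_rfl hx.1 hxy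
      (Eventually.of_forall fun s => hb0 s) ?_
    exact MonotoneForm.intervalIntegrable_of_Icc hb h0 ⟨hy.1, hy.2.trans ht.2⟩
  have h1 := hmono.intervalIntegral_deriv_mem_uIcc
  have hE0 : E 0 = 1 := by simp [hE]
  have hle : E 0 ≤ E t := hmono left_mem_uIcc right_mem_uIcc ht.1
  rw [uIcc_of_le (by linarith), hE0] at h1
  have h2 : ∫ s in (0 : ℝ)..t, deriv E s = ∫ s in (0 : ℝ)..t, K * (b s * E s) := by
    refine intervalIntegral.integral_congr_ae ?_
    filter_upwards [hbI.ae_hasDerivAt_integral] with s hs hst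
    have hs' := hs (uIoc_subset_uIcc hst) 0 left_mem_uIcc
    have := (hs'.const_mul K).exp
    rw [this.deriv]
    ring
  rw [h2, intervalIntegral.integral_const_mul] at h1
  rw [le_div_iff₀ hK, mul_comm]
  linarith [h1.2]

theorem continuousOn_exp_primitive {T : ℝ} {b : ℝ → ℝ} (hb : IntegrableOn b (Icc 0 T)) (K : ℝ) :
    ContinuousOn (fun s => Real.exp (K * ∫ r in (0 : ℝ)..s, b r)) (Icc 0 T) := by
  rcases le_total 0 T with hT | hT
  · have := intervalIntegral.continuousOn_primitive_interval (μ := volume) (a := 0) (b := T)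
      (f := b) (by rwa [uIcc_of_le hT])
    rw [uIcc_of_le hT] at this
    exact (this.const_smul K).rexp
  · rcases hT.eq_or_lt with h | h
    · rw [h, Icc_self]; exact continuousOn_singleton _ _
    · rw [Icc_eq_empty (not_le.2 h)]; exact continuousOn_empty _

theorem integrableOn_mul_of_continuousOn {T : ℝ} {b y : ℝ → ℝ} (hb : IntegrableOn b (Icc 0 T))
    (hy : ContinuousOn y (Icc 0 T)) : IntegrableOn (fun s => b s * y s) (Icc 0 T) :=
  hb.mul_continuousOn hy isCompact_Icc

/-- Gronwall's inequality with an integrable kernel. -/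
theorem gronwall_integrable {T : ℝ} {b y : ℝ → ℝ} (hb : IntegrableOn b (Icc 0 T))
    (hb0 : ∀ s, 0 ≤ b s) (hy : ContinuousOn y (Icc 0 T)) {c k : ℝ}
    (hk : 0 < k) (h : ∀ t ∈ Icc 0 T, y t ≤ c + k * ∫ s in (0 : ℝ)..t, b s * y s) (hc : 0 ≤ c)
    {t : ℝ} (ht : t ∈ Icc 0 T) :
    y t ≤ 2 * c * Real.exp (2 * k * ∫ s in (0 : ℝ)..t, b s) := by
  have h0 : (0 : ℝ) ∈ Icc 0 T := ⟨le_rfl, ht.1.trans ht.2⟩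
  -- Twice the natural exponent: at the maximum of y / E the integral term then takes at most half
  -- of y, and the other half is bounded by c. Hence the factor 2.
  set E : ℝ → ℝ := fun s => Real.exp (2 * k * ∫ r in (0 : ℝ)..s, b r) with hE
  have hEc : ContinuousOn E (Icc 0 T) := continuousOn_exp_primitive hb _
  have hEpos : ∀ s, 0 < E s := fun s => Real.exp_pos _
  obtain ⟨s₀, hs₀, hmax⟩ := isCompact_Icc.exists_isMaxOn ⟨0, h0⟩
    (hy.div hEc fun s _ => (hEpos s).ne')
  set M := y s₀ / E s₀ with hM
  have hyM : ∀ s ∈ Icc 0 T, y s ≤ M * E s := fun s hs => by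
    have : y s / E s ≤ M := hmax hs
    rwa [div_le_iff₀ (hEpos s)] at this
  have hE1 : ∀ s ∈ Icc 0 T, 1 ≤ E s := fun s hs => by
    rw [hE]; refine Real.one_le_exp (mul_nonneg (by positivity) ?_)
    exact intervalIntegral.integral_nonneg hs.1 fun r _ => hb0 r
  have hMc : M ≤ 2 * c := by
    rcases le_or_gt M 0 with hM0 | hM0
    · linarith
    have h1 := h s₀ hs₀
    have h2 : ∫ s in (0 : ℝ)..s₀, b s * y s ≤ M * (E s₀ / (2 * k)) := by
      calc ∫ s in (0 : ℝ)..s₀, b s * y s ≤ ∫ s in (0 : ℝ)..s₀, M * (b s * E s) := by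
            refine intervalIntegral.integral_mono_on hs₀.1
              (MonotoneForm.intervalIntegrable_of_Icc (integrableOn_mul_of_continuousOn hb hy) h0
                hs₀)
              ((MonotoneForm.intervalIntegrable_of_Icc (integrableOn_mul_of_continuousOn hb hEc) h0
                hs₀).const_mul M) fun s hs => ?_
            have := mul_le_mul_of_nonneg_left (hyM s ⟨hs.1, hs.2.trans hs₀.2⟩) (hb0 s)
            linarith
        _ = M * ∫ s in (0 : ℝ)..s₀, b s * E s := intervalIntegral.integral_const_mul _ _
        _ ≤ _ := mul_le_mul_of_nonneg_left
            (integral_mul_exp_le hb hb0 (by positivity) hs₀) hM0.le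
    have h3 : y s₀ = M * E s₀ := by rw [hM, div_mul_cancel₀ _ (hEpos s₀).ne']
    have h4 : k * (M * (E s₀ / (2 * k))) = M * E s₀ / 2 := by field_simp
    have h5 : M * E s₀ ≤ c + M * E s₀ / 2 := by
      rw [← h4, ← h3]; linarith [mul_le_mul_of_nonneg_left h2 hk.le]
    nlinarith [hE1 s₀ hs₀]
  exact (hyM t ht).trans (mul_le_mul_of_nonneg_right hMc (hEpos t).le)

section Truncation

variable {H : Type*} [NormedAddCommGroup H] [NormedSpace ℝ H]

/-- The radial retraction onto the closed ball of radius `R`. -/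
def radial (R : ℝ) (x : H) : H := (R / max R ‖x‖) • x

theorem radial_of_norm_le {R : ℝ} (hR : 0 < R) {x : H} (hx : ‖x‖ ≤ R) : radial R x = x := by
  rw [radial, max_eq_left hx, div_self hR.ne', one_smul]

theorem norm_radial_le {R : ℝ} (hR : 0 < R) (x : H) : ‖radial R x‖ ≤ R := by
  have hm : 0 < max R ‖x‖ := lt_max_of_lt_left hR
  rw [radial, norm_smul, Real.norm_of_nonneg (by positivity), div_mul_eq_mul_div, div_le_iff₀ hm]
  exact mul_le_mul_of_nonneg_left (le_max_right _ _) hR.le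

theorem norm_radial_le_norm {R : ℝ} (hR : 0 < R) (x : H) : ‖radial R x‖ ≤ ‖x‖ := by
  have hm : 0 < max R ‖x‖ := lt_max_of_lt_left hR
  rw [radial, norm_smul, Real.norm_of_nonneg (by positivity)]
  refine mul_le_of_le_one_left (norm_nonneg _) ?_
  rw [div_le_one hm]; exact le_max_left _ _

/-- The scaling factor is frozen at x for one half of the estimate, and its variation pays for the
other. This needs no inner product and gives the constant 2. -/
theorem norm_radial_sub_le {R : ℝ} (hR : 0 < R) (x y : H) :
    ‖radial R x - radial R y‖ ≤ 2 * ‖x - y‖ := by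
  have hx : 0 < max R ‖x‖ := lt_max_of_lt_left hR
  have hy : 0 < max R ‖y‖ := lt_max_of_lt_left hR
  have e : radial R x - radial R y
      = (R / max R ‖x‖) • (x - y) + (R / max R ‖x‖ - R / max R ‖y‖) • y := by
    rw [radial, radial]; module
  have h1 : ‖(R / max R ‖x‖) • (x - y)‖ ≤ ‖x - y‖ := by
    rw [norm_smul, Real.norm_of_nonneg (by positivity)]
    refine mul_le_of_le_one_left (norm_nonneg _) ?_
    rw [div_le_one hx]; exact le_max_left _ _
  have h2 : ‖(R / max R ‖x‖ - R / max R ‖y‖) • y‖ ≤ ‖x - y‖ := by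
    rw [norm_smul, Real.norm_eq_abs]
    have e1 : R / max R ‖x‖ - R / max R ‖y‖
        = (R / max R ‖x‖) * ((max R ‖y‖ - max R ‖x‖) / max R ‖y‖) := by
      field_simp
    rw [e1, abs_mul, abs_div _ (max R ‖y‖), abs_of_pos hy,
      abs_of_nonneg (div_nonneg hR.le hx.le)]
    have e2 : |max R ‖y‖ - max R ‖x‖| ≤ ‖x - y‖ := by
      rw [max_comm R, max_comm R]
      refine (abs_max_sub_max_le_abs ‖y‖ ‖x‖ R).trans ?_
      rw [norm_sub_rev]; exact abs_norm_sub_norm_le y x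
    have e3 : R / max R ‖x‖ ≤ 1 := by rw [div_le_one hx]; exact le_max_left _ _
    calc R / max R ‖x‖ * (|max R ‖y‖ - max R ‖x‖| / max R ‖y‖) * ‖y‖
        ≤ 1 * (|max R ‖y‖ - max R ‖x‖| / max R ‖y‖) * max R ‖y‖ := by
          gcongr; exact le_max_right _ _
      _ = |max R ‖y‖ - max R ‖x‖| := by field_simp
      _ ≤ _ := e2
  rw [e]
  linarith [norm_add_le ((R / max R ‖x‖) • (x - y)) ((R / max R ‖x‖ - R / max R ‖y‖) • y)]

end Truncation

/-- A time-dependent perturbation of linear growth, with an integrable growth rate `b`. -/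
structure IsPerturbation {H : Type*} [NormedAddCommGroup H] (T : ℝ) (b : ℝ → ℝ)
    (G : ℝ → H → H) : Prop where
  nonneg : ∀ s, 0 ≤ b s
  integrable : IntegrableOn b (Icc 0 T)
  meas : ∀ u : ℝ → H, ContinuousOn u (Icc 0 T) →
    AEStronglyMeasurable (fun s => G s (u s)) (volume.restrict (Icc 0 T))
  growth : ∀ᵐ s ∂(volume.restrict (Icc 0 T)), ∀ x, ‖G s x‖ ≤ b s * (1 + ‖x‖)
  lipschitz : ∀ R > 0, ∃ L > 0, ∀ᵐ s ∂(volume.restrict (Icc 0 T)), ∀ x y, ‖x‖ ≤ R → ‖y‖ ≤ R →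
    ‖G s x - G s y‖ ≤ L * b s * ‖x - y‖

theorem IsPerturbation.integrableOn {H : Type*} [NormedAddCommGroup H] {T : ℝ} {b : ℝ → ℝ}
    {G : ℝ → H → H} (hG : IsPerturbation T b G) {u : ℝ → H} (hu : ContinuousOn u (Icc 0 T)) :
    IntegrableOn (fun s => G s (u s)) (Icc 0 T) := by
  obtain ⟨M, hM0, hM⟩ := exists_norm_bound hu
  refine Integrable.mono' (hG.integrable.mul_const (1 + M)) (hG.meas u hu) ?_
  filter_upwards [hG.growth, ae_restrict_mem measurableSet_Icc] with s hs hsm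
  refine (hs (u s)).trans (mul_le_mul_of_nonneg_left ?_ (hG.nonneg s))
  linarith [hM s hsm]

/-- The retraction does not increase norms, so the growth rate b survives, while the Lipschitz
estimate on one ball becomes global. -/
theorem IsPerturbation.radial {H : Type*} [NormedAddCommGroup H] [NormedSpace ℝ H] {T : ℝ}
    {b : ℝ → ℝ} {G : ℝ → H → H} (hG : IsPerturbation T b G) {R : ℝ} (hR : 0 < R) :
    IsPerturbation T b (fun s x => G s (radial R x)) ∧
    ∃ L > 0, ∀ᵐ s ∂(volume.restrict (Icc 0 T)), ∀ x y,
      ‖G s (EvolEq.radial R x) - G s (EvolEq.radial R y)‖ ≤ L * b s * ‖x - y‖ := by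
  obtain ⟨L, hL, hlip⟩ := hG.lipschitz R hR
  have hglob : ∀ᵐ s ∂(volume.restrict (Icc 0 T)), ∀ x y,
      ‖G s (EvolEq.radial R x) - G s (EvolEq.radial R y)‖ ≤ (2 * L) * b s * ‖x - y‖ := by
    filter_upwards [hlip] with s hs x y
    refine (hs _ _ (norm_radial_le hR x) (norm_radial_le hR y)).trans ?_
    have := mul_le_mul_of_nonneg_left (norm_radial_sub_le hR x y) (mul_nonneg hL.le (hG.nonneg s))
    linarith
  refine ⟨⟨hG.nonneg, hG.integrable, fun u hu => ?_, ?_, ?_⟩, 2 * L, by positivity, hglob⟩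
  · refine hG.meas (fun s => EvolEq.radial R (u s)) ?_
    have hc : Continuous (EvolEq.radial R : H → H) := by
      have : LipschitzWith 2 (EvolEq.radial R : H → H) :=
        LipschitzWith.of_dist_le_mul fun x y => by
          rw [dist_eq_norm, dist_eq_norm]; exact norm_radial_sub_le hR x y
      exact this.continuous
    exact hc.comp_continuousOn hu
  · filter_upwards [hG.growth] with s hs x
    refine (hs _).trans (mul_le_mul_of_nonneg_left ?_ (hG.nonneg s))
    linarith [norm_radial_le_norm hR x]
  · exact fun R' _ => ⟨2 * L, by positivity, hglob.mono fun s hs x y _ _ => hs x y⟩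

namespace MonotoneForm

variable {H : Type*} [NormedAddCommGroup H] [InnerProductSpace ℝ H] {A : MonotoneForm H}

theorem IsWeakSol.congr {T : ℝ} {f g : ℝ → H} {u₀ : H} {u : ℝ → H} (hu : A.IsWeakSol T f u₀ u)
    (hfg : EqOn f g (Icc 0 T)) : A.IsWeakSol T g u₀ u := by
  refine ⟨hu.cont, hu.lam, fun φ hφ t ht => ?_⟩
  rw [hu.eqn φ hφ t ht]
  congr 1
  refine intervalIntegral.integral_congr fun s hs => ?_
  rw [uIcc_of_le ht.1] at hs
  rw [hfg ⟨hs.1, hs.2.trans ht.2⟩]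

variable [MeasurableSpace H] [BorelSpace H]

/-- Existence for `u' + A u = G(t, u)` with a globally Lipschitz perturbation. -/
theorem exists_isWeakSol_lipschitz [CompleteSpace H] {T : ℝ} (hT : 0 ≤ T) {b : ℝ → ℝ}
    {G : ℝ → H → H} (hG : IsPerturbation T b G) {L : ℝ} (hL : 0 < L)
    (hlip : ∀ᵐ s ∂(volume.restrict (Icc 0 T)), ∀ x y, ‖G s x - G s y‖ ≤ L * b s * ‖x - y‖)
    (u₀ : H) : ∃ u, A.IsWeakSol T (fun s => G s (u s)) u₀ u := by
  have h0 : (0 : ℝ) ∈ Icc 0 T := ⟨le_rfl, hT⟩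
  have hex : ∀ u : {u : ℝ → H // ContinuousOn u (Icc 0 T)},
      ∃ v : {v : ℝ → H // ContinuousOn v (Icc 0 T)},
        A.IsWeakSol T (fun s => G s (u.1 s)) u₀ v.1 := by
    intro u
    obtain ⟨v, hv⟩ := A.exists_isWeakSol hT (hG.integrableOn u.2) u₀
    exact ⟨⟨v, hv.cont⟩, hv⟩
  choose S hS using hex
  -- The exponent 4L makes the solution map a contraction by 1/2 in the weighted supremum norm:
  -- stability contributes 2, the Lipschitz bound L, and the integral of b E at most E / (4L).
  set E : ℝ → ℝ := fun s => Real.exp (4 * L * ∫ r in (0 : ℝ)..s, b r) with hE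
  have hEc : ContinuousOn E (Icc 0 T) := continuousOn_exp_primitive hG.integrable _
  have hE1 : ∀ s ∈ Icc 0 T, 1 ≤ E s := fun s hs => by
    rw [hE]; refine Real.one_le_exp (mul_nonneg (by positivity) ?_)
    exact intervalIntegral.integral_nonneg hs.1 fun r _ => hG.nonneg r
  have hcontr : ∀ u v : {u : ℝ → H // ContinuousOn u (Icc 0 T)}, ∀ D : ℝ, 0 ≤ D →
      (∀ s ∈ Icc 0 T, ‖u.1 s - v.1 s‖ ≤ D * E s) →
      ∀ t ∈ Icc 0 T, ‖(S u).1 t - (S v).1 t‖ ≤ D / 2 * E t := by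
    intro u v D hD huv t ht
    have h1 := (hS u).norm_sub_le (hG.integrableOn u.2) (hS v) (hG.integrableOn v.2) ht
    rw [sub_self, norm_zero, zero_add] at h1
    have h2 : ∫ s in (0 : ℝ)..t, ‖G s (u.1 s) - G s (v.1 s)‖
        ≤ ∫ s in (0 : ℝ)..t, (L * D) * (b s * E s) := by
      have i1 : IntegrableOn (fun s => ‖G s (u.1 s) - G s (v.1 s)‖) (Icc 0 T) :=
        ((hG.integrableOn u.2).sub (hG.integrableOn v.2)).norm
      refine intervalIntegral.integral_mono_ae_restrict ht.1 (intervalIntegrable_of_Icc i1 h0 ht)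
        ((intervalIntegrable_of_Icc (integrableOn_mul_of_continuousOn hG.integrable hEc) h0
          ht).const_mul _) ?_
      have hsub : Icc 0 t ⊆ Icc 0 T := Icc_subset_Icc le_rfl ht.2
      filter_upwards [ae_restrict_of_ae_restrict_of_subset hsub hlip,
        ae_restrict_mem measurableSet_Icc] with s hs hsm
      refine (hs _ _).trans ?_
      have := mul_le_mul_of_nonneg_left (huv s (hsub hsm)) (mul_nonneg hL.le (hG.nonneg s))
      linarith
    rw [intervalIntegral.integral_const_mul] at h2
    have h3 := integral_mul_exp_le hG.integrable hG.nonneg (K := 4 * L) (by positivity) ht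
    have h4 : L * D * ∫ s in (0 : ℝ)..t, b s * E s ≤ L * D * (E t / (4 * L)) :=
      mul_le_mul_of_nonneg_left h3 (by positivity)
    have h5 : L * D * (E t / (4 * L)) = D / 4 * E t := by field_simp
    linarith
  set w : ℕ → {u : ℝ → H // ContinuousOn u (Icc 0 T)} :=
    fun n => S^[n] ⟨fun _ => u₀, continuousOn_const⟩ with hw
  have hws : ∀ n, w (n + 1) = S (w n) := fun n => Function.iterate_succ_apply' S n _
  obtain ⟨D, hD0, hD⟩ := exists_norm_bound ((w 0).2.sub (w 1).2)
  have hstep : ∀ n, ∀ t ∈ Icc 0 T, ‖(w n).1 t - (w (n + 1)).1 t‖ ≤ D * (1 / 2) ^ n * E t := by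
    intro n
    induction n with
    | zero =>
      intro t ht
      have h1 := hD t ht
      simp only [pow_zero, mul_one]
      exact h1.trans (le_mul_of_one_le_right hD0 (hE1 t ht))
    | succ n ih =>
      intro t ht
      have := hcontr (w n) (w (n + 1)) (D * (1 / 2) ^ n) (by positivity) ih t ht
      rw [← hws, ← hws] at this
      refine this.trans (le_of_eq ?_)
      rw [pow_succ]; ring
  have hlim : ∀ t ∈ Icc 0 T, ∃ x, Tendsto (fun n => (w n).1 t) atTop (𝓝 x) := fun t ht => by
    refine cauchySeq_tendsto_of_complete (cauchySeq_of_le_geometric (1 / 2) (D * E t)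
      (by norm_num) fun n => ?_)
    rw [dist_eq_norm]
    exact (hstep n t ht).trans (le_of_eq (by ring))
  choose! u hu using hlim
  have hdist : ∀ n, ∀ t ∈ Icc 0 T, ‖(w n).1 t - u t‖ ≤ (2 * D * (1 / 2) ^ n) * E t := by
    intro n t ht
    rw [← dist_eq_norm]
    refine (dist_le_of_le_geometric_of_tendsto (1 / 2) (D * E t) (by norm_num) (fun n => ?_)
      (hu t ht) n).trans (le_of_eq (by ring))
    rw [dist_eq_norm]
    exact (hstep n t ht).trans (le_of_eq (by ring))
  have hpow : Tendsto (fun n : ℕ => 2 * D * ((1 : ℝ) / 2) ^ n) atTop (𝓝 0) := by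
    simpa using (tendsto_pow_atTop_nhds_zero_of_lt_one (r := (1 / 2 : ℝ)) (by norm_num)
      (by norm_num)).const_mul (2 * D)
  obtain ⟨ME, hME0, hME⟩ := exists_norm_bound hEc
  have hEM : ∀ t ∈ Icc 0 T, E t ≤ ME := fun t ht => (le_abs_self _).trans (hME t ht)
  have hunif : TendstoUniformlyOn (fun n => (w n).1) u atTop (Icc 0 T) := by
    rw [Metric.tendstoUniformlyOn_iff]
    intro ε hε
    have := hpow.mul_const ME
    rw [zero_mul] at this
    filter_upwards [this.eventually_lt_const hε] with n hn t ht
    rw [dist_comm, dist_eq_norm]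
    refine ((hdist n t ht).trans ?_).trans_lt hn
    exact mul_le_mul_of_nonneg_left (hEM t ht) (by positivity)
  have hcont : ContinuousOn u (Icc 0 T) :=
    hunif.continuousOn (Eventually.of_forall fun n => (w n).2).frequently
  have hfix : EqOn (S ⟨u, hcont⟩).1 u (Icc 0 T) := by
    intro t ht
    refine tendsto_nhds_unique ?_ ((tendsto_add_atTop_iff_nat 1).2 (hu t ht))
    rw [tendsto_iff_norm_sub_tendsto_zero]
    have hz : Tendsto (fun n : ℕ => 2 * D * ((1 : ℝ) / 2) ^ n / 2 * E t) atTop (𝓝 0) := by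
      have := (hpow.div_const 2).mul_const (E t)
      rwa [zero_div, zero_mul] at this
    refine squeeze_zero (fun _ => norm_nonneg _) (fun n => ?_) hz
    rw [hws]
    exact hcontr (w n) ⟨u, hcont⟩ _ (by positivity) (hdist n) t ht
  -- The limit u and its image under S agree on [0, T] only. The image solves the equation driven by
  -- u, and there u may be replaced by the image.
  refine ⟨(S ⟨u, hcont⟩).1, (hS ⟨u, hcont⟩).congr fun s hs => ?_⟩
  beta_reduce
  rw [hfix hs]

/-- The a priori bound for `u' + A u = G(t, u)`: it depends on the growth rate of `G` only through
its integral. -/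
theorem IsWeakSol.bound {T : ℝ} (hT : 0 ≤ T) {b : ℝ → ℝ} {G : ℝ → H → H}
    (hG : IsPerturbation T b G) {B : ℝ} (hB : ∫ s in Icc 0 T, b s ≤ B) {u₀ : H} {u : ℝ → H}
    (hu : A.IsWeakSol T (fun s => G s (u s)) u₀ u) :
    (∀ t ∈ Icc 0 T, ‖u t‖ ^ 2 ≤
      2 * (‖u₀‖ ^ 2 + 2 * |A.coerConst| * T + 2 * B) * Real.exp (8 * B)) ∧
    A.coer * ∫ s in Icc 0 T, (‖u s‖ ^ 2 + (A.Lam (u s)).toReal) ≤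
      ‖u₀‖ ^ 2 / 2 + |A.coerConst| * T + B *
        (1 + 2 * (2 * (‖u₀‖ ^ 2 + 2 * |A.coerConst| * T + 2 * B) * Real.exp (8 * B))) := by
  have h0 : (0 : ℝ) ∈ Icc 0 T := ⟨le_rfl, hT⟩
  have hB0 : 0 ≤ B := (integral_nonneg hG.nonneg).trans hB
  have hbt : ∀ t ∈ Icc 0 T, ∫ s in (0 : ℝ)..t, b s ≤ B := by
    intro t ht
    refine le_trans ?_ hB
    rw [intervalIntegral.integral_of_le ht.1]
    exact setIntegral_mono_set hG.integrable (Eventually.of_forall hG.nonneg)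
      (Ioc_subset_Icc_self.trans (Icc_subset_Icc le_rfl ht.2)).eventuallyLE
  have hyc : ContinuousOn (fun s => ‖u s‖ ^ 2) (Icc 0 T) := hu.cont.norm.pow 2
  have iby := integrableOn_mul_of_continuousOn hG.integrable hyc
  have hGi := hG.integrableOn hu.cont
  have hen : ∀ t ∈ Icc 0 T, ‖u t‖ ^ 2 / 2
      + A.coer * ∫ s in (0 : ℝ)..t, (‖u s‖ ^ 2 + (A.Lam (u s)).toReal) ≤
      ‖u₀‖ ^ 2 / 2 + |A.coerConst| * T + B + 2 * ∫ s in (0 : ℝ)..t, b s * ‖u s‖ ^ 2 := by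
    intro t ht
    have h1 := hu.energy hGi ht
    have ib := intervalIntegrable_of_Icc hG.integrable h0 ht
    have iby' := intervalIntegrable_of_Icc iby h0 ht
    have h2 : ∫ s in (0 : ℝ)..t, (A.coerConst + ‖G s (u s)‖ * ‖u s‖) ≤
        ∫ s in (0 : ℝ)..t, (|A.coerConst| + b s + 2 * (b s * ‖u s‖ ^ 2)) := by
      have i1 : IntegrableOn (fun s => A.coerConst + ‖G s (u s)‖ * ‖u s‖) (Icc 0 T) :=
        (integrable_const _).add (integrableOn_norm_mul_norm hGi hu.cont)
      have i2 : IntegrableOn (fun s => |A.coerConst| + b s + 2 * (b s * ‖u s‖ ^ 2)) (Icc 0 T) :=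
        ((integrable_const _).add hG.integrable).add (iby.const_mul 2)
      refine intervalIntegral.integral_mono_ae_restrict ht.1 (intervalIntegrable_of_Icc i1 h0 ht)
        (intervalIntegrable_of_Icc i2 h0 ht) ?_
      have hsub : Icc 0 t ⊆ Icc 0 T := Icc_subset_Icc le_rfl ht.2
      filter_upwards [ae_restrict_of_ae_restrict_of_subset hsub hG.growth] with s hs
      have e1 := mul_le_mul_of_nonneg_right (hs (u s)) (norm_nonneg (u s))
      have e2 : b s * ((1 + ‖u s‖) * ‖u s‖) ≤ b s * (1 + 2 * ‖u s‖ ^ 2) := by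
        refine mul_le_mul_of_nonneg_left ?_ (hG.nonneg s)
        nlinarith [sq_nonneg (‖u s‖ - 1 / 2)]
      linarith [le_abs_self A.coerConst]
    rw [intervalIntegral.integral_add ((by simp : IntervalIntegrable _ _ _ _).add ib)
      (iby'.const_mul 2), intervalIntegral.integral_add (by simp) ib,
      intervalIntegral.integral_const_mul, intervalIntegral.integral_const, smul_eq_mul,
      sub_zero] at h2
    have h3 : t * |A.coerConst| ≤ |A.coerConst| * T := by
      rw [mul_comm]; exact mul_le_mul_of_nonneg_left ht.2 (abs_nonneg _)
    linarith [hbt t ht]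
  set c := ‖u₀‖ ^ 2 + 2 * |A.coerConst| * T + 2 * B with hc
  have hc0 : 0 ≤ c := by positivity
  have hpos : ∀ t ∈ Icc 0 T,
      0 ≤ A.coer * ∫ s in (0 : ℝ)..t, (‖u s‖ ^ 2 + (A.Lam (u s)).toReal) := fun t ht =>
    mul_nonneg A.coer_pos.le (intervalIntegral.integral_nonneg ht.1 fun s _ => by positivity)
  have hy : ∀ t ∈ Icc 0 T, ‖u t‖ ^ 2 ≤ 2 * c * Real.exp (8 * B) := by
    intro t ht
    -- Doubling the energy inequality gives ‖u‖² ≤ c + 4 ∫ b ‖u‖². With k = 4 the Gronwall exponent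
    -- is 2 · 4 · B.
    have h1 := gronwall_integrable hG.integrable hG.nonneg hyc (c := c) (k := 4) (by norm_num)
      (fun t ht => by linarith [hen t ht, hpos t ht]) hc0 ht
    refine h1.trans (mul_le_mul_of_nonneg_left (Real.exp_le_exp.2 ?_) (by positivity))
    linarith [hbt t ht]
  refine ⟨hy, ?_⟩
  have hTm : T ∈ Icc 0 T := ⟨hT, le_rfl⟩
  have h1 := hen T hTm
  have h2 : ∫ s in (0 : ℝ)..T, b s * ‖u s‖ ^ 2 ≤ B * (2 * c * Real.exp (8 * B)) := by
    calc ∫ s in (0 : ℝ)..T, b s * ‖u s‖ ^ 2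
        ≤ ∫ s in (0 : ℝ)..T, b s * (2 * c * Real.exp (8 * B)) := by
          refine intervalIntegral.integral_mono_on hT (intervalIntegrable_of_Icc iby h0 hTm)
            ((intervalIntegrable_of_Icc hG.integrable h0 hTm).mul_const _) fun s hs => ?_
          exact mul_le_mul_of_nonneg_left (hy s hs) (hG.nonneg s)
      _ = (∫ s in (0 : ℝ)..T, b s) * (2 * c * Real.exp (8 * B)) :=
          intervalIntegral.integral_mul_const _ _
      _ ≤ _ := mul_le_mul_of_nonneg_right (hbt T hTm) (by positivity)
  rw [integral_Icc_eq_integral_Ioc, ← intervalIntegral.integral_of_le hT]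
  nlinarith [sq_nonneg ‖u T‖]

/-- Uniqueness for `u' + A u = G(t, u)`. -/
theorem IsWeakSol.unique {T : ℝ} {b : ℝ → ℝ} {G : ℝ → H → H}
    (hG : IsPerturbation T b G) {u₀ : H} {u v : ℝ → H}
    (hu : A.IsWeakSol T (fun s => G s (u s)) u₀ u) (hv : A.IsWeakSol T (fun s => G s (v s)) u₀ v) :
    EqOn u v (Icc 0 T) := by
  intro t ht
  have h0 : (0 : ℝ) ∈ Icc 0 T := ⟨le_rfl, ht.1.trans ht.2⟩
  obtain ⟨M, hM0, hM⟩ := exists_norm_bound hu.cont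
  obtain ⟨N, hN0, hN⟩ := exists_norm_bound hv.cont
  -- Both paths stay in this ball, so one local Lipschitz constant serves, and Gronwall with c = 0
  -- concludes.
  obtain ⟨L, hL, hlip⟩ := hG.lipschitz (M + N + 1) (by positivity)
  have hwc : ContinuousOn (fun s => u s - v s) (Icc 0 T) := hu.cont.sub hv.cont
  have hyc : ContinuousOn (fun s => ‖u s - v s‖ ^ 2) (Icc 0 T) := hwc.norm.pow 2
  have hgi : IntegrableOn (fun s => G s (u s) - G s (v s)) (Icc 0 T) :=
    (hG.integrableOn hu.cont).sub (hG.integrableOn hv.cont)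
  have iby := integrableOn_mul_of_continuousOn hG.integrable hyc
  have h1 := gronwall_integrable hG.integrable hG.nonneg hyc (c := 0) (k := 2 * L) (by positivity)
    (fun t ht => by
      have h2 := hu.norm_sub_sq_le (hG.integrableOn hu.cont) hv (hG.integrableOn hv.cont) ht
      rw [sub_self, norm_zero] at h2
      have h3 : ∫ s in (0 : ℝ)..t, ‖G s (u s) - G s (v s)‖ * ‖u s - v s‖ ≤
          ∫ s in (0 : ℝ)..t, L * (b s * ‖u s - v s‖ ^ 2) := by
        refine intervalIntegral.integral_mono_ae_restrict ht.1
          (intervalIntegrable_of_Icc (integrableOn_norm_mul_norm hgi hwc) h0 ht)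
          ((intervalIntegrable_of_Icc iby h0 ht).const_mul L) ?_
        have hsub : Icc 0 t ⊆ Icc 0 T := Icc_subset_Icc le_rfl ht.2
        filter_upwards [ae_restrict_of_ae_restrict_of_subset hsub hlip,
          ae_restrict_mem measurableSet_Icc] with s hs hsm
        have e1 := hs (u s) (v s) (by linarith [hM s (hsub hsm)]) (by linarith [hN s (hsub hsm)])
        have e2 := mul_le_mul_of_nonneg_right e1 (norm_nonneg (u s - v s))
        linarith
      rw [intervalIntegral.integral_const_mul] at h3
      linarith) le_rfl ht
  have h2 : ‖u t - v t‖ ^ 2 ≤ 0 := by simpa using h1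
  have h3 : ‖u t - v t‖ = 0 := by
    have := le_antisymm h2 (sq_nonneg _)
    exact pow_eq_zero_iff two_ne_zero |>.1 this
  exact sub_eq_zero.1 (norm_eq_zero.1 h3)

/-- Existence for `u' + A u = G(t, u)` with a locally Lipschitz perturbation. -/
theorem exists_isWeakSol_perturbation [CompleteSpace H] {T : ℝ} (hT : 0 ≤ T) {b : ℝ → ℝ}
    {G : ℝ → H → H} (hG : IsPerturbation T b G) (u₀ : H) :
    ∃ u, A.IsWeakSol T (fun s => G s (u s)) u₀ u := by
  set B := ∫ s in Icc 0 T, b s with hB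
  have hB0 : 0 ≤ B := integral_nonneg hG.nonneg
  set Q := 2 * (‖u₀‖ ^ 2 + 2 * |A.coerConst| * T + 2 * B) * Real.exp (8 * B) with hQ
  have hQ0 : 0 ≤ Q := by positivity
  -- Q bounds ‖u‖² for every radius of truncation, since the truncated perturbation has the same
  -- rate b. At this radius the solution never meets the truncation.
  set R := √Q + 1 with hR
  have hRpos : 0 < R := by positivity
  obtain ⟨hG', L, hL, hlip⟩ := hG.radial hRpos
  obtain ⟨u, hu⟩ := exists_isWeakSol_lipschitz (A := A) hT hG' hL hlip u₀
  have hbd := (IsWeakSol.bound hT hG' hB.symm.le hu).1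
  refine ⟨u, hu.congr fun s hs => ?_⟩
  have h1 : ‖u s‖ ≤ R := by
    have := Real.le_sqrt_of_sq_le (hbd s hs)
    rw [← hQ] at this
    linarith
  beta_reduce
  rw [radial_of_norm_le hRpos h1]

end MonotoneForm

end

end EvolEq

/-! ### Difference quotients and lower semicontinuity on ℍ -/

namespace FracSkeleton

open Filter Topology

noncomputable section

/-- The difference quotient `(u(x) - u(y)) / |x - y|^((d + 2γ) / 2)`, whose `L²` norm is the
Gagliardo seminorm. -/
def quot {d : ℕ} (γ : ℝ) (u : EuclideanSpace ℝ (Fin d) → ℝ)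
    (z : EuclideanSpace ℝ (Fin d) × EuclideanSpace ℝ (Fin d)) : ℝ :=
  (u z.1 - u z.2) / ‖z.1 - z.2‖ ^ (((d : ℝ) + 2 * γ) / 2)

section Basic

variable {d : ℕ} {O : Set (EuclideanSpace ℝ (Fin d))} {γ : ℝ}

theorem enorm_quot_sq (u : EuclideanSpace ℝ (Fin d) → ℝ)
    (z : EuclideanSpace ℝ (Fin d) × EuclideanSpace ℝ (Fin d)) :
    ‖quot γ u z‖ₑ ^ 2 = ‖u z.1 - u z.2‖ₑ ^ 2 / ‖z.1 - z.2‖ₑ ^ ((d : ℝ) + 2 * γ) := by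
  rcases eq_or_ne z.1 z.2 with h | h
  · simp [quot, h]
  · have hr : 0 < ‖z.1 - z.2‖ := norm_pos_iff.2 (sub_ne_zero.2 h)
    rw [quot, Real.enorm_eq_ofReal_abs, abs_div, Real.enorm_eq_ofReal_abs, ← ofReal_norm,
      ENNReal.ofReal_rpow_of_pos hr, ← ENNReal.ofReal_pow (by positivity),
      ← ENNReal.ofReal_pow (by positivity), ← ENNReal.ofReal_div_of_pos (by positivity), div_pow,
      abs_of_nonneg (a := ‖z.1 - z.2‖ ^ (((d : ℝ) + 2 * γ) / 2)) (by positivity),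
      ← Real.rpow_natCast (‖z.1 - z.2‖ ^ (((d : ℝ) + 2 * γ) / 2)), ← Real.rpow_mul hr.le]
    congr 3
    push_cast
    ring_nf

theorem gagliardoSq_eq (u : EuclideanSpace ℝ (Fin d) → ℝ) :
    gagliardoSq γ u = ∫⁻ z, ‖quot γ u z‖ₑ ^ 2 ∂(volume.prod volume) := by
  simp only [gagliardoSq, enorm_quot_sq]

theorem quot_mul_quot (u v : EuclideanSpace ℝ (Fin d) → ℝ)
    (z : EuclideanSpace ℝ (Fin d) × EuclideanSpace ℝ (Fin d)) :
    (u z.1 - u z.2) * (v z.1 - v z.2) / ‖z.1 - z.2‖ ^ ((d : ℝ) + 2 * γ)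
      = quot γ u z * quot γ v z := by
  rcases eq_or_ne z.1 z.2 with h | h
  · simp [quot, h]
  · have hr : 0 < ‖z.1 - z.2‖ := norm_pos_iff.2 (sub_ne_zero.2 h)
    rw [quot, quot, div_mul_div_comm, ← Real.rpow_add hr]
    congr 2
    ring

theorem formA_eq (δ : ℝ) (v w : L2O O) :
    formA γ δ v w = δ * inner ℝ v w + fracConst d γ / 2 *
      ∫ z, quot γ v.toFun z * quot γ w.toFun z ∂(volume.prod volume) := by
  simp only [formA, quot_mul_quot]

theorem measurable_toFun (u : L2O O) : Measurable u.toFun :=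
  (Lp.stronglyMeasurable u.1).measurable

theorem measurable_quot {u : EuclideanSpace ℝ (Fin d) → ℝ} (hu : Measurable u) :
    Measurable (quot γ u) := by
  unfold quot
  fun_prop

theorem memLp_toFun (u : L2O O) : MemLp u.toFun 2 volume := Lp.memLp u.1

theorem toFun_eq_zero (u : L2O O) : ∀ᵐ x, x ∉ O → u.toFun x = 0 := u.2

theorem toFun_add (u v : L2O O) : (u + v).toFun =ᵐ[volume] fun x => u.toFun x + v.toFun x :=
  Lp.coeFn_add u.1 v.1

theorem toFun_sub (u v : L2O O) : (u - v).toFun =ᵐ[volume] fun x => u.toFun x - v.toFun x :=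
  Lp.coeFn_sub u.1 v.1

theorem toFun_neg (u : L2O O) : (-u).toFun =ᵐ[volume] fun x => -u.toFun x :=
  Lp.coeFn_neg u.1

theorem toFun_smul (c : ℝ) (u : L2O O) : (c • u).toFun =ᵐ[volume] fun x => c * u.toFun x :=
  Lp.coeFn_smul c u.1

theorem toFun_zero : (0 : L2O O).toFun =ᵐ[volume] fun _ => 0 :=
  Lp.coeFn_zero ℝ 2 (volume : Measure (EuclideanSpace ℝ (Fin d)))

theorem enorm_sq_eq_lintegral (u : L2O O) : ‖u‖ₑ ^ 2 = ∫⁻ x, ‖u.toFun x‖ₑ ^ 2 := by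
  have h : ‖u‖ₑ = eLpNorm u.toFun 2 volume := Lp.enorm_def u.1
  rw [h, eLpNorm_eq_lintegral_rpow_enorm_toReal (by norm_num) (by norm_num), ← ENNReal.rpow_natCast,
    ← ENNReal.rpow_mul]
  simp

theorem norm_sq_eq_integral (u : L2O O) : ‖u‖ ^ 2 = ∫ x, u.toFun x ^ 2 := by
  have h := enorm_sq_eq_lintegral u
  rw [integral_eq_lintegral_of_nonneg_ae (Eventually.of_forall fun x => sq_nonneg _)
    ((measurable_toFun u).pow_const 2).aestronglyMeasurable]
  have e : ∀ x, ENNReal.ofReal (u.toFun x ^ 2) = ‖u.toFun x‖ₑ ^ 2 := fun x => by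
    rw [Real.enorm_eq_ofReal_abs, ← ENNReal.ofReal_pow (abs_nonneg _), sq_abs]
  simp_rw [e]
  rw [← h, ENNReal.toReal_pow, toReal_enorm]

theorem inner_eq_integral (u v : L2O O) : inner ℝ u v = ∫ x, u.toFun x * v.toFun x := by
  have h : inner ℝ u v = inner ℝ u.1 v.1 := rfl
  rw [h, L2.inner_def]
  refine integral_congr_ae (Eventually.of_forall fun x => ?_)
  change inner ℝ (u.toFun x) (v.toFun x) = _
  rw [real_inner_eq_re_inner]
  simp [mul_comm]

/-- Relations that hold almost everywhere pass to both coordinates of the product. -/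
theorem ae_prod_of_ae {P : EuclideanSpace ℝ (Fin d) → Prop}
    (h : ∀ᵐ x, P x) :
    ∀ᵐ z : EuclideanSpace ℝ (Fin d) × EuclideanSpace ℝ (Fin d) ∂(volume.prod volume),
      P z.1 ∧ P z.2 :=
  (Measure.quasiMeasurePreserving_fst.ae h).and (Measure.quasiMeasurePreserving_snd.ae h)

theorem quot_add (u v : L2O O) : quot γ (u + v).toFun =ᵐ[volume.prod volume]
    fun z => quot γ u.toFun z + quot γ v.toFun z := by
  filter_upwards [ae_prod_of_ae (toFun_add u v)] with z hz
  simp only [quot, hz.1, hz.2]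
  ring

theorem quot_sub (u v : L2O O) : quot γ (u - v).toFun =ᵐ[volume.prod volume]
    fun z => quot γ u.toFun z - quot γ v.toFun z := by
  filter_upwards [ae_prod_of_ae (toFun_sub u v)] with z hz
  simp only [quot, hz.1, hz.2]
  ring

theorem quot_smul (c : ℝ) (u : L2O O) : quot γ (c • u).toFun =ᵐ[volume.prod volume]
    fun z => c * quot γ u.toFun z := by
  filter_upwards [ae_prod_of_ae (toFun_smul c u)] with z hz
  simp only [quot, hz.1, hz.2]
  ring

theorem memLp_quot {u : L2O O} (hu : gagliardoSq γ u.toFun < ∞) :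
    MemLp (quot γ u.toFun) 2 (volume.prod volume) := by
  refine ⟨(measurable_quot (measurable_toFun u)).aestronglyMeasurable, ?_⟩
  rw [eLpNorm_lt_top_iff_lintegral_rpow_enorm_lt_top (by norm_num) (by norm_num)]
  rw [gagliardoSq_eq] at hu
  simpa using hu

theorem exists_subseq_ae_tendsto {u : ℕ → L2O O} {v : L2O O} (h : Tendsto u atTop (𝓝 v)) :
    ∃ ns : ℕ → ℕ, StrictMono ns ∧
      ∀ᵐ x, Tendsto (fun k => (u (ns k)).toFun x) atTop (𝓝 (v.toFun x)) := by
  have h1 : Tendsto (fun n => (u n).1) atTop (𝓝 v.1) :=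
    (continuous_subtype_val.tendsto v).comp h
  exact (tendstoInMeasure_of_tendsto_Lp h1).exists_seq_tendsto_ae

/-- A functional on `ℍ` is lower semicontinuous if it is so along sequences that converge almost
everywhere. -/
theorem lowerSemicontinuous_of_ae {Φ : L2O O → ℝ≥0∞}
    (h : ∀ (u : ℕ → L2O O) (v : L2O O),
      (∀ᵐ x, Tendsto (fun k => (u k).toFun x) atTop (𝓝 (v.toFun x))) →
      Φ v ≤ liminf (fun k => Φ (u k)) atTop) : LowerSemicontinuous Φ := by
  rw [lowerSemicontinuous_iff_isClosed_preimage]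
  intro c
  refine IsSeqClosed.isClosed fun u v hu huv => ?_
  obtain ⟨ns, -, hae⟩ := exists_subseq_ae_tendsto huv
  refine (h _ v hae).trans ?_
  refine liminf_le_of_le (by isBoundedDefault) fun b hb => ?_
  obtain ⟨j, hj⟩ := hb.exists
  exact hj.trans (hu (ns j))

theorem lowerSemicontinuous_lintegral_comp {ψ : ℝ → ℝ≥0∞} (hψ : LowerSemicontinuous ψ) :
    LowerSemicontinuous fun u : L2O O => ∫⁻ x, ψ (u.toFun x) := by
  refine lowerSemicontinuous_of_ae fun u v hae => ?_
  calc ∫⁻ x, ψ (v.toFun x) ≤ ∫⁻ x, liminf (fun k => ψ ((u k).toFun x)) atTop := by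
        refine lintegral_mono_ae (hae.mono fun x hx => ?_)
        exact (hψ.le_liminf (v.toFun x)).trans (liminf_le_liminf_of_le hx)
    _ ≤ _ := lintegral_liminf_le fun k => hψ.measurable.comp (measurable_toFun (u k))

/-- Fatou along a sequence converging almost everywhere. The region S is arbitrary so that both the
seminorm and its tails are covered. -/
theorem lowerSemicontinuous_lintegral_quot
    (S : Set (EuclideanSpace ℝ (Fin d) × EuclideanSpace ℝ (Fin d))) :
    LowerSemicontinuous fun u : L2O O =>
      ∫⁻ z in S, ‖quot γ u.toFun z‖ₑ ^ 2 ∂(volume.prod volume) := by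
  refine lowerSemicontinuous_of_ae fun u v hae => ?_
  calc ∫⁻ z in S, ‖quot γ v.toFun z‖ₑ ^ 2 ∂(volume.prod volume)
      ≤ ∫⁻ z in S, liminf (fun k => ‖quot γ (u k).toFun z‖ₑ ^ 2) atTop ∂(volume.prod volume) := by
        refine lintegral_mono_ae (ae_restrict_of_ae ((ae_prod_of_ae hae).mono fun z hz => ?_))
        have h1 : Tendsto (fun k => ‖quot γ (u k).toFun z‖ₑ ^ 2) atTop
            (𝓝 (‖quot γ v.toFun z‖ₑ ^ 2)) :=
          ENNReal.Tendsto.pow (((hz.1.sub hz.2).div_const _).enorm)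
        exact h1.liminf_eq.symm.le
    _ ≤ _ := lintegral_liminf_le fun k =>
        ((measurable_quot (measurable_toFun (u k))).enorm.pow_const 2)

end Basic

section CauchySchwarz

variable {α : Type*} [MeasurableSpace α] {μ : Measure α} {f g : α → ℝ}

theorem abs_integral_mul_le (hf : MemLp f 2 μ) (hg : MemLp g 2 μ) :
    |∫ x, f x * g x ∂μ| ≤ √(∫ x, f x ^ 2 ∂μ) * √(∫ x, g x ^ 2 ∂μ) := by
  have h1 : ∀ {f g : α → ℝ} (hf : MemLp f 2 μ) (hg : MemLp g 2 μ),
      inner ℝ (hf.toLp f) (hg.toLp g) = ∫ x, f x * g x ∂μ := by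
    intro f g hf hg
    rw [L2.inner_def]
    refine integral_congr_ae ?_
    filter_upwards [hf.coeFn_toLp, hg.coeFn_toLp] with x h1 h2
    rw [h1, h2, real_inner_eq_re_inner]
    simp [mul_comm]
  have h2 : ∀ {f : α → ℝ} (hf : MemLp f 2 μ), ‖hf.toLp f‖ = √(∫ x, f x ^ 2 ∂μ) := by
    intro f hf
    have : ‖hf.toLp f‖ ^ 2 = ∫ x, f x ^ 2 ∂μ := by
      rw [← real_inner_self_eq_norm_sq, h1 hf hf]
      simp_rw [pow_two]
    rw [← this, Real.sqrt_sq (norm_nonneg _)]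
  rw [← h1 hf hg, ← h2 hf, ← h2 hg]
  exact abs_real_inner_le_norm _ _

theorem abs_integral_mul_le_add (hf : MemLp f 2 μ) (hg : MemLp g 2 μ) {η : ℝ} (hη : 0 < η) :
    |∫ x, f x * g x ∂μ| ≤ η⁻¹ * ∫ x, f x ^ 2 ∂μ + η * ∫ x, g x ^ 2 ∂μ := by
  rw [← integral_const_mul, ← integral_const_mul, ← integral_add (hf.integrable_sq.const_mul _)
    (hg.integrable_sq.const_mul _)]
  refine (abs_integral_le_integral_abs).trans (integral_mono (hf.integrable_mul hg).abs
    ((hf.integrable_sq.const_mul _).add (hg.integrable_sq.const_mul _)) fun x => ?_)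
  have e : η⁻¹ * f x ^ 2 + η * g x ^ 2 = η⁻¹ * (f x ^ 2 + (η * g x) ^ 2) := by field_simp
  rw [e, abs_mul, inv_mul_eq_div, le_div_iff₀ hη]
  have h1 : |f x| * |g x| * η = |f x| * |η * g x| := by rw [abs_mul, abs_of_pos hη]; ring
  rw [h1, ← sq_abs (f x), ← sq_abs (η * g x)]
  nlinarith [sq_nonneg (|f x| - |η * g x|), abs_nonneg (f x), abs_nonneg (η * g x)]

end CauchySchwarz

end

end FracSkeleton

/-! ### Proximal points and the resolvent equation -/

namespace EvolEq

open Filter Topology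

noncomputable section

section Minimizer

variable {H : Type*} [NormedAddCommGroup H] [InnerProductSpace ℝ H]

theorem norm_midpoint_sub_sq (u v f : H) : ‖(2 : ℝ)⁻¹ • (u + v) - f‖ ^ 2
    = ‖u - f‖ ^ 2 / 2 + ‖v - f‖ ^ 2 / 2 - ‖u - v‖ ^ 2 / 4 := by
  have e : (2 : ℝ)⁻¹ • (u + v) - f = (2 : ℝ)⁻¹ • ((u - f) + (v - f)) := by
    rw [← sub_eq_zero]
    module
  have h := parallelogram_law_with_norm ℝ (u - f) (v - f)
  rw [sub_sub_sub_cancel_right] at h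
  rw [e, norm_smul, mul_pow, Real.norm_of_nonneg (by norm_num)]
  linarith

/-- A lower semicontinuous midpoint convex functional has a proximal point. -/
theorem exists_minimizer [CompleteSpace H] {J : H → ℝ≥0∞} (hJ : LowerSemicontinuous J)
    (hc : ∀ u v, J ((2 : ℝ)⁻¹ • (u + v)) ≤ (J u + J v) / 2) (h0 : J 0 < ∞) (f : H) :
    ∃ u, J u < ∞ ∧ ∀ v, J v < ∞ →
      ‖u - f‖ ^ 2 / 2 + (J u).toReal ≤ ‖v - f‖ ^ 2 / 2 + (J v).toReal := by
  set val : H → ℝ := fun v => ‖v - f‖ ^ 2 / 2 + (J v).toReal with hval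
  have hval0 : ∀ v, 0 ≤ val v := fun v => by simp only [hval]; positivity
  set m := sInf (val '' {v | J v < ∞}) with hm
  have hbdd : BddBelow (val '' {v | J v < ∞}) := ⟨0, by rintro _ ⟨v, -, rfl⟩; exact hval0 v⟩
  have hle : ∀ v, J v < ∞ → m ≤ val v := fun v hv => csInf_le hbdd ⟨v, hv, rfl⟩
  have hex : ∀ n : ℕ, ∃ v, J v < ∞ ∧ val v < m + 1 / ((n : ℝ) + 1) := by
    intro n
    obtain ⟨_, ⟨v, hv, rfl⟩, h⟩ := exists_lt_of_csInf_lt (⟨_, 0, h0, rfl⟩ :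
      (val '' {v | J v < ∞}).Nonempty) (lt_add_of_pos_right m (Nat.one_div_pos_of_nat (n := n)))
    exact ⟨v, hv, h⟩
  choose v hv hvm using hex
  -- The parallelogram law: the midpoint cannot have a value below m, so almost minimal points are
  -- close to each other. Minimising sequences are therefore Cauchy.
  have hmid : ∀ u w, J u < ∞ → J w < ∞ → ‖u - w‖ ^ 2 ≤ 4 * ((val u - m) + (val w - m)) := by
    intro u w hu hw
    have h1 : (J u + J w) / 2 ≠ ∞ :=
      ENNReal.div_ne_top (ENNReal.add_lt_top.2 ⟨hu, hw⟩).ne (by norm_num)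
    have h2 := ENNReal.toReal_mono h1 (hc u w)
    rw [ENNReal.toReal_div, ENNReal.toReal_add hu.ne hw.ne] at h2
    have h3 := hle _ ((hc u w).trans_lt h1.lt_top)
    simp only [hval] at h3 ⊢
    rw [norm_midpoint_sub_sq] at h3
    simp only [ENNReal.toReal_ofNat] at h2
    linarith
  have hcau : CauchySeq v := by
    rw [Metric.cauchySeq_iff']
    intro ε hε
    obtain ⟨N, hN⟩ := exists_nat_one_div_lt (show 0 < ε ^ 2 / 8 by positivity)
    refine ⟨N, fun n hn => ?_⟩
    have h1 := hmid _ _ (hv n) (hv N)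
    have h2 := hvm n
    have h3 := hvm N
    have h4 : 1 / ((n : ℝ) + 1) ≤ 1 / ((N : ℝ) + 1) := Nat.one_div_le_one_div hn
    rw [dist_eq_norm]
    refine lt_of_pow_lt_pow_left₀ 2 hε.le ?_
    linarith
  obtain ⟨u, hu⟩ := cauchySeq_tendsto_of_complete hcau
  have hlsc : LowerSemicontinuous fun w => ENNReal.ofReal (‖w - f‖ ^ 2 / 2) + J w := by
    refine LowerSemicontinuous.add ?_ hJ
    exact (ENNReal.continuous_ofReal.comp (by fun_prop)).lowerSemicontinuous
  have hsub : ∀ ε > 0, ENNReal.ofReal (‖u - f‖ ^ 2 / 2) + J u ≤ ENNReal.ofReal (m + ε) := by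
    intro ε hε
    have hcl := hlsc.isClosed_preimage (ENNReal.ofReal (m + ε))
    refine hcl.mem_of_tendsto hu ?_
    obtain ⟨N, hN⟩ := exists_nat_one_div_lt hε
    filter_upwards [eventually_ge_atTop N] with n hn
    have h4 : 1 / ((n : ℝ) + 1) ≤ 1 / ((N : ℝ) + 1) := Nat.one_div_le_one_div hn
    have h2 := hvm n
    simp only [mem_preimage, mem_Iic]
    rw [← ENNReal.ofReal_toReal (hv n).ne, ← ENNReal.ofReal_add (by positivity)
      ENNReal.toReal_nonneg]
    exact ENNReal.ofReal_le_ofReal (by simp only [hval] at h2; linarith)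
  have hJu : J u < ∞ := (le_add_self.trans (hsub 1 one_pos)).trans_lt ENNReal.ofReal_lt_top
  have hm0 : 0 ≤ m := le_csInf ⟨_, 0, h0, rfl⟩ (by rintro _ ⟨v, -, rfl⟩; exact hval0 v)
  refine ⟨u, hJu, fun w hw => le_trans ?_ (hle w hw)⟩
  refine le_of_forall_pos_le_add fun ε hε => ?_
  have h := hsub ε hε
  rw [← ENNReal.ofReal_toReal hJu.ne, ← ENNReal.ofReal_add (by positivity)
      ENNReal.toReal_nonneg, ENNReal.ofReal_le_ofReal_iff (by positivity)] at h
  exact h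

/-- If the form is the derivative of a convex potential `J`, its resolvent equation is solvable. -/
theorem exists_resolvent_of_potential [CompleteSpace H] {Lam J : H → ℝ≥0∞} {form : H → H → ℝ}
    (hJ : LowerSemicontinuous J)
    (hc : ∀ u v, J ((2 : ℝ)⁻¹ • (u + v)) ≤ (J u + J v) / 2) (h0 : Lam 0 < ∞)
    (hJLam : ∀ u, J u < ∞ ↔ Lam u < ∞)
    (htan : ∀ u w, Lam u < ∞ → Lam w < ∞ → (J w).toReal - (J u).toReal ≤ form w (w - u))
    (hsmul : ∀ u φ, ∀ c : ℝ, Lam u < ∞ → Lam φ < ∞ → form u (c • φ) = c * form u φ)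
    {K : ℝ≥0} (hadd : ∀ u v, Lam (u + v) ≤ K * (Lam u + Lam v))
    (hLs : ∀ u, ∀ c : ℝ, |c| ≤ 1 → Lam (c • u) ≤ Lam u)
    (hmod : ∀ φ, Lam φ < ∞ → ∀ η > 0, ∃ C : ℝ, 0 ≤ C ∧ ∀ u v, Lam u < ∞ → Lam v < ∞ →
      |form u φ - form v φ| ≤ C * ‖u - v‖ + η * (1 + (Lam u).toReal + (Lam v).toReal))
    {τ : ℝ} (hτ : 0 < τ) (f : H) :
    ∃ u, Lam u < ∞ ∧ ∀ φ, Lam φ < ∞ → inner ℝ u φ + τ * form u φ = inner ℝ f φ := by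
  have ht : ENNReal.ofReal τ ≠ ∞ := ENNReal.ofReal_ne_top
  have ht0 : ENNReal.ofReal τ ≠ 0 := by simpa using hτ
  have hfin : ∀ u, ENNReal.ofReal τ * J u < ∞ ↔ Lam u < ∞ := fun u => by
    rw [← hJLam]
    exact ⟨fun h => ENNReal.lt_top_of_mul_ne_top_right h.ne ht0,
      fun h => ENNReal.mul_lt_top ht.lt_top h⟩
  obtain ⟨u, hu, hmin⟩ := exists_minimizer (J := fun u => ENNReal.ofReal τ * J u)
    ((ENNReal.continuous_const_mul ht).comp_lowerSemicontinuous hJ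
      fun a b hab => mul_le_mul_right hab _)
    (fun u v => by
      rw [← mul_add, mul_div_assoc]; exact mul_le_mul_right (hc u v) _)
    ((hfin 0).2 h0) f
  rw [hfin] at hu
  -- First variation at the minimiser. The point u + ε φ is compared with u, and ε tends to zero.
  have key : ∀ φ, Lam φ < ∞ → 0 ≤ inner ℝ (u - f) φ + τ * form u φ := by
    intro φ hφ
    -- Bounds `Lam` of u plus that of u + ε φ for all ε ≤ 1, so that the tolerance passed to `hmod`
    -- can be fixed before ε.
    set M := (Lam u).toReal + (K * (Lam u + Lam φ) : ℝ≥0∞).toReal with hM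
    have hMfin : (K * (Lam u + Lam φ) : ℝ≥0∞) < ∞ :=
      ENNReal.mul_lt_top ENNReal.coe_lt_top (ENNReal.add_lt_top.2 ⟨hu, hφ⟩)
    have hM0 : 0 ≤ M := by positivity
    refine le_of_forall_pos_le_add fun η hη => ?_
    obtain ⟨C, hC, hmodC⟩ := hmod φ hφ (η / 2 / (τ * (1 + M))) (by positivity)
    set c := ‖φ‖ ^ 2 + τ * C * ‖φ‖ with hcdef
    have hc0 : 0 ≤ c := by positivity
    obtain ⟨ε, hε, hε1, hεc⟩ : ∃ ε : ℝ, 0 < ε ∧ ε ≤ 1 ∧ ε * c ≤ η / 2 := by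
      refine ⟨min 1 (η / 2 / (c + 1)), by positivity, min_le_left _ _, ?_⟩
      calc _ ≤ η / 2 / (c + 1) * (c + 1) := by
            gcongr
            · exact min_le_right _ _
            · linarith
        _ = η / 2 := by field_simp
    set w := u + ε • φ with hw
    have hLw : Lam w ≤ K * (Lam u + Lam φ) := (hadd _ _).trans
      (mul_le_mul_right (add_le_add le_rfl (hLs φ ε (by rw [abs_of_pos hε]; exact hε1))) _)
    have hwfin : Lam w < ∞ := hLw.trans_lt hMfin
    have h1 := hmin w ((hfin w).2 hwfin)
    simp only [ENNReal.toReal_mul, ENNReal.toReal_ofReal hτ.le] at h1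
    -- The subgradient inequality is used at the moved point w, not at u. J is never differentiated;
    -- the modulus of continuity brings form w φ back to form u φ.
    have h2 := htan u w hu hwfin
    have hwu : w - u = ε • φ := by rw [hw, add_sub_cancel_left]
    rw [hwu, hsmul w φ ε hwfin hφ] at h2
    have h3 : ‖w - f‖ ^ 2 = ‖u - f‖ ^ 2 + 2 * (ε * inner ℝ (u - f) φ) + ε ^ 2 * ‖φ‖ ^ 2 := by
      have : w - f = (u - f) + ε • φ := by rw [hw]; abel
      rw [this, norm_add_sq_real, real_inner_smul_right, norm_smul, mul_pow, Real.norm_eq_abs,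
        sq_abs]
    have h4 := (abs_le.1 (hmodC w u hwfin hu)).2
    rw [hwu, norm_smul, Real.norm_of_nonneg hε.le] at h4
    have h5 : (Lam w).toReal ≤ (K * (Lam u + Lam φ) : ℝ≥0∞).toReal :=
      ENNReal.toReal_mono hMfin.ne hLw
    have h6 : η / 2 / (τ * (1 + M)) * (1 + (Lam w).toReal + (Lam u).toReal) ≤ η / 2 / τ := by
      calc _ ≤ η / 2 / (τ * (1 + M)) * (1 + M) :=
            mul_le_mul_of_nonneg_left (by rw [hM]; linarith) (by positivity)
        _ = η / 2 / τ := by field_simp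
    have h7 : τ * (form w φ - form u φ) ≤ τ * (C * (ε * ‖φ‖)) + η / 2 := by
      calc τ * (form w φ - form u φ) ≤ τ * (C * (ε * ‖φ‖) + η / 2 / τ) := by
            gcongr; linarith
        _ = _ := by field_simp
    have h8 : 0 ≤ ε * (inner ℝ (u - f) φ + ε * ‖φ‖ ^ 2 / 2 + τ * form w φ) := by
      have := mul_le_mul_of_nonneg_left h2 hτ.le
      rw [h3] at h1
      ring_nf at h1 this ⊢
      linarith
    have h9 := nonneg_of_mul_nonneg_right h8 hε
    have h10 : ε * ‖φ‖ ^ 2 / 2 ≤ ε * ‖φ‖ ^ 2 := by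
      have : 0 ≤ ε * ‖φ‖ ^ 2 := by positivity
      linarith
    have h11 : ε * c = ε * ‖φ‖ ^ 2 + τ * (C * (ε * ‖φ‖)) := by rw [hcdef]; ring
    linarith
  refine ⟨u, hu, fun φ hφ => ?_⟩
  -- The variational inequality for φ and for -φ gives equality.
  have hφ' : Lam ((-1 : ℝ) • φ) < ∞ := (hLs φ (-1) (by norm_num)).trans_lt hφ
  have h1 := key φ hφ
  have h2 := key _ hφ'
  rw [hsmul u φ _ hu hφ, real_inner_smul_right] at h2
  rw [inner_sub_left] at h1 h2
  linarith

end Minimizer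

end

end EvolEq

/-! ### The quadratic form of the fractional Laplacian -/

namespace FracSkeleton

open Filter Topology

noncomputable section

section General

variable {α : Type*} [MeasurableSpace α] {μ : Measure α}

theorem toReal_lintegral_enorm_rpow {f : α → ℝ} (hf : AEStronglyMeasurable f μ) {q : ℝ}
    (hq : 0 < q) : (∫⁻ x, ‖f x‖ₑ ^ q ∂μ).toReal = ∫ x, |f x| ^ q ∂μ := by
  rw [integral_eq_lintegral_of_nonneg_ae (Eventually.of_forall fun x => by positivity)
    ((continuous_abs.comp_aestronglyMeasurable hf).aemeasurable.pow_const q).aestronglyMeasurable]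
  congr 1
  refine lintegral_congr fun x => ?_
  rw [Real.enorm_eq_ofReal_abs, ENNReal.ofReal_rpow_of_nonneg (abs_nonneg _) hq.le]

theorem integrable_rpow_of_lintegral {f : α → ℝ} (hf : AEStronglyMeasurable f μ) {q : ℝ}
    (hq : 0 < q) (h : ∫⁻ x, ‖f x‖ₑ ^ q ∂μ < ∞) : Integrable (fun x => |f x| ^ q) μ := by
  refine ⟨((continuous_abs.comp_aestronglyMeasurable hf).aemeasurable.pow_const
    q).aestronglyMeasurable, ?_⟩
  rw [HasFiniteIntegral]
  refine lt_of_eq_of_lt (lintegral_congr fun x => ?_) h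
  rw [Real.enorm_eq_ofReal_abs, Real.enorm_eq_ofReal_abs,
    ENNReal.ofReal_rpow_of_nonneg (abs_nonneg _) hq.le, abs_of_nonneg (by positivity)]

theorem toReal_lintegral_enorm_sq {f : α → ℝ} (hf : AEStronglyMeasurable f μ) :
    (∫⁻ x, ‖f x‖ₑ ^ 2 ∂μ).toReal = ∫ x, f x ^ 2 ∂μ := by
  have h := toReal_lintegral_enorm_rpow hf (q := 2) two_pos
  simpa [sq_abs] using h

end General

section Quadratic

variable {d : ℕ} {O : Set (EuclideanSpace ℝ (Fin d))} {γ : ℝ}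

/-- Pairs of points that are neither close to each other nor far away. -/
def nearSet (d k : ℕ) : Set (EuclideanSpace ℝ (Fin d) × EuclideanSpace ℝ (Fin d)) :=
  {z | 1 / ((k : ℝ) + 1) < ‖z.1 - z.2‖ ∧ ‖z.1‖ ≤ k ∧ ‖z.2‖ ≤ k}

theorem measurableSet_nearSet (k : ℕ) : MeasurableSet (nearSet d k) := by
  have h1 : MeasurableSet {z : EuclideanSpace ℝ (Fin d) × EuclideanSpace ℝ (Fin d) |
      1 / ((k : ℝ) + 1) < ‖z.1 - z.2‖} := measurableSet_lt (by fun_prop) (by fun_prop)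
  have h2 : MeasurableSet {z : EuclideanSpace ℝ (Fin d) × EuclideanSpace ℝ (Fin d) |
      ‖z.1‖ ≤ k} := measurableSet_le (by fun_prop) (by fun_prop)
  have h3 : MeasurableSet {z : EuclideanSpace ℝ (Fin d) × EuclideanSpace ℝ (Fin d) |
      ‖z.2‖ ≤ k} := measurableSet_le (by fun_prop) (by fun_prop)
  exact h1.inter (h2.inter h3)

theorem eventually_mem_nearSet {z : EuclideanSpace ℝ (Fin d) × EuclideanSpace ℝ (Fin d)}
    (hz : z.1 ≠ z.2) : ∀ᶠ k in atTop, z ∈ nearSet d k := by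
  have h0 : 0 < ‖z.1 - z.2‖ := norm_pos_iff.2 (sub_ne_zero.2 hz)
  have h1 := tendsto_one_div_add_atTop_nhds_zero_nat (𝕜 := ℝ)
  have h2 := tendsto_natCast_atTop_atTop (R := ℝ)
  filter_upwards [h1.eventually_lt_const h0, h2.eventually_ge_atTop ‖z.1‖,
    h2.eventually_ge_atTop ‖z.2‖] with k a b c
  exact ⟨a, b, c⟩

/-- On this set the kernel is at most (k+1)^(d+2γ), and both points lie in a fixed ball, so the
seminorm restricted to it is dominated by the L² norm. -/
theorem lintegral_nearSet_le (hγ : 0 < γ) (k : ℕ) : ∃ C : ℝ≥0, ∀ u : L2O O,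
    ∫⁻ z in nearSet d k, ‖quot γ u.toFun z‖ₑ ^ 2 ∂(volume.prod volume) ≤ C * ‖u‖ₑ ^ 2 := by
  set B := Metric.closedBall (0 : EuclideanSpace ℝ (Fin d)) (k : ℝ)
  have hB : volume B ≠ ∞ := (isCompact_closedBall _ _).measure_lt_top.ne
  set c : ℝ≥0∞ := ENNReal.ofReal (2 * ((k : ℝ) + 1) ^ ((d : ℝ) + 2 * γ)) with hcdef
  refine ⟨(2 * c * volume B).toNNReal, fun u => ?_⟩
  rw [ENNReal.coe_toNNReal (ENNReal.mul_ne_top (ENNReal.mul_ne_top (by norm_num)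
    ENNReal.ofReal_ne_top) hB)]
  have hsub : nearSet d k ⊆ B ×ˢ B := fun z hz => by
    simp only [B, mem_prod, mem_closedBall_zero_iff]
    exact hz.2
  have hpt : ∀ z ∈ nearSet d k, ‖quot γ u.toFun z‖ₑ ^ 2 ≤
      c * (‖u.toFun z.1‖ₑ ^ 2 + ‖u.toFun z.2‖ₑ ^ 2) := by
    intro z hz
    have hz1 := hz.1
    have hk : (0 : ℝ) < (k : ℝ) + 1 := by positivity
    have hr : 0 < ‖z.1 - z.2‖ := lt_trans (by positivity) hz1
    have h1 : quot γ u.toFun z ^ 2 ≤ 2 * ((k : ℝ) + 1) ^ ((d : ℝ) + 2 * γ) *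
        (u.toFun z.1 ^ 2 + u.toFun z.2 ^ 2) := by
      have e : quot γ u.toFun z ^ 2 =
          (u.toFun z.1 - u.toFun z.2) ^ 2 * (‖z.1 - z.2‖⁻¹) ^ ((d : ℝ) + 2 * γ) := by
        rw [pow_two, ← quot_mul_quot, Real.inv_rpow hr.le, ← pow_two, div_eq_mul_inv]
      have h2 : (‖z.1 - z.2‖⁻¹) ^ ((d : ℝ) + 2 * γ) ≤ ((k : ℝ) + 1) ^ ((d : ℝ) + 2 * γ) := by
        refine Real.rpow_le_rpow (by positivity) ?_ (by positivity)
        rw [inv_le_comm₀ hr hk, ← one_div]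
        exact hz1.le
      have h3 : (u.toFun z.1 - u.toFun z.2) ^ 2 ≤ 2 * (u.toFun z.1 ^ 2 + u.toFun z.2 ^ 2) := by
        nlinarith [sq_nonneg (u.toFun z.1 + u.toFun z.2)]
      rw [e]
      calc _ ≤ 2 * (u.toFun z.1 ^ 2 + u.toFun z.2 ^ 2) * ((k : ℝ) + 1) ^ ((d : ℝ) + 2 * γ) := by
            gcongr
        _ = _ := by ring
    have hs : ∀ r : ℝ, ‖r‖ₑ ^ 2 = ENNReal.ofReal (r ^ 2) := fun r => by
      rw [Real.enorm_eq_ofReal_abs, ← ENNReal.ofReal_pow (abs_nonneg _), sq_abs]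
    rw [hs, hs, hs, ← ENNReal.ofReal_add (by positivity) (by positivity), hcdef,
      ← ENNReal.ofReal_mul (by positivity)]
    exact ENNReal.ofReal_le_ofReal h1
  have hm := measurable_toFun u
  have hu2 : ∫⁻ x in B, ‖u.toFun x‖ₑ ^ 2 ≤ ‖u‖ₑ ^ 2 := by
    rw [enorm_sq_eq_lintegral]; exact setLIntegral_le_lintegral _ _
  have e1 : ∫⁻ z, ‖u.toFun z.1‖ₑ ^ 2 ∂((volume.restrict B).prod (volume.restrict B))
      = (∫⁻ x in B, ‖u.toFun x‖ₑ ^ 2) * volume B := by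
    have := lintegral_prod_mul (μ := volume.restrict B) (ν := volume.restrict B)
      (f := fun x => ‖u.toFun x‖ₑ ^ 2) (g := fun _ => 1) (hm.enorm.pow_const 2).aemeasurable
      aemeasurable_const
    simpa using this
  have e2 : ∫⁻ z, ‖u.toFun z.2‖ₑ ^ 2 ∂((volume.restrict B).prod (volume.restrict B))
      = volume B * (∫⁻ x in B, ‖u.toFun x‖ₑ ^ 2) := by
    have := lintegral_prod_mul (μ := volume.restrict B) (ν := volume.restrict B)
      (g := fun x => ‖u.toFun x‖ₑ ^ 2) (f := fun _ => 1) aemeasurable_const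
      (hm.enorm.pow_const 2).aemeasurable
    simpa using this
  calc ∫⁻ z in nearSet d k, ‖quot γ u.toFun z‖ₑ ^ 2 ∂(volume.prod volume)
      ≤ ∫⁻ z in nearSet d k, c * (‖u.toFun z.1‖ₑ ^ 2 + ‖u.toFun z.2‖ₑ ^ 2)
          ∂(volume.prod volume) := setLIntegral_mono' (measurableSet_nearSet k) hpt
    _ ≤ ∫⁻ z in B ×ˢ B, c * (‖u.toFun z.1‖ₑ ^ 2 + ‖u.toFun z.2‖ₑ ^ 2)
          ∂(volume.prod volume) := lintegral_mono_set hsub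
    _ = c * (2 * ((∫⁻ x in B, ‖u.toFun x‖ₑ ^ 2) * volume B)) := by
        rw [← Measure.prod_restrict, lintegral_const_mul _ (by fun_prop),
          lintegral_add_left (by fun_prop), e1, e2, mul_comm (volume B), two_mul]
    _ ≤ c * (2 * (‖u‖ₑ ^ 2 * volume B)) := by gcongr
    _ = _ := by ring

/-- Dominated convergence: pairs off the diagonal eventually belong to `nearSet`, and on the
diagonal the difference quotient is zero. -/
theorem tendsto_lintegral_nearSet_compl {u : L2O O}
    (hu : gagliardoSq γ u.toFun < ∞) :
    Tendsto (fun k => ∫⁻ z in (nearSet d k)ᶜ, ‖quot γ u.toFun z‖ₑ ^ 2 ∂(volume.prod volume))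
      atTop (𝓝 0) := by
  rw [gagliardoSq_eq] at hu
  have hm : Measurable fun z => ‖quot γ u.toFun z‖ₑ ^ 2 :=
    (measurable_quot (measurable_toFun u)).enorm.pow_const 2
  simp_rw [← lintegral_indicator (measurableSet_nearSet _).compl]
  have h := tendsto_lintegral_of_dominated_convergence (μ := volume.prod volume)
    (F := fun k => (nearSet d k)ᶜ.indicator fun z => ‖quot γ u.toFun z‖ₑ ^ 2) (f := fun _ => 0)
    (fun z => ‖quot γ u.toFun z‖ₑ ^ 2)
    (fun k => hm.indicator (measurableSet_nearSet k).compl)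
    (fun k => Eventually.of_forall fun z => indicator_le_self _ _ z) hu.ne
    (Eventually.of_forall fun z => ?_)
  · simpa using h
  · rcases eq_or_ne z.1 z.2 with hz | hz
    · have : ∀ k, (nearSet d k)ᶜ.indicator (fun z => ‖quot γ u.toFun z‖ₑ ^ 2) z = 0 := by
        intro k
        simp [quot, hz]
      simp [this]
    · refine tendsto_const_nhds.congr' ?_
      filter_upwards [eventually_mem_nearSet hz] with k hk
      simp [hk]

theorem toReal_gagliardoSq (u : L2O O) :
    (gagliardoSq γ u.toFun).toReal = ∫ z, quot γ u.toFun z ^ 2 ∂(volume.prod volume) := by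
  rw [gagliardoSq_eq, toReal_lintegral_enorm_sq
    (measurable_quot (measurable_toFun u)).aestronglyMeasurable]

theorem integrable_quot_mul {u v : L2O O} (hu : gagliardoSq γ u.toFun < ∞)
    (hv : gagliardoSq γ v.toFun < ∞) :
    Integrable (fun z => quot γ u.toFun z * quot γ v.toFun z) (volume.prod volume) :=
  (memLp_quot hu).integrable_mul (memLp_quot hv)

/-- Cauchy-Schwarz on `nearSet`, where L² norms suffice, and Young's inequality with weight η on the
complement, where only the tail of u and the full seminorm of ψ remain. -/
theorem abs_integral_quot_mul_le (hγ : 0 < γ) {η : ℝ} (hη : 0 < η) (k : ℕ) :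
    ∃ C : ℝ, 0 ≤ C ∧ ∀ u ψ : L2O O, gagliardoSq γ u.toFun < ∞ → gagliardoSq γ ψ.toFun < ∞ →
      |∫ z, quot γ u.toFun z * quot γ ψ.toFun z ∂(volume.prod volume)| ≤ C * (‖u‖ * ‖ψ‖)
        + η⁻¹ * (∫⁻ z in (nearSet d k)ᶜ, ‖quot γ u.toFun z‖ₑ ^ 2 ∂(volume.prod volume)).toReal
        + η * (gagliardoSq γ ψ.toFun).toReal := by
  obtain ⟨C, hC⟩ := lintegral_nearSet_le (O := O) hγ k
  refine ⟨C, C.2, fun u ψ hu hψ => ?_⟩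
  have hmu := memLp_quot hu
  have hmψ := memLp_quot hψ
  have hint := integrable_quot_mul hu hψ
  have hnear : ∀ w : L2O O, √(∫ z in nearSet d k, quot γ w.toFun z ^ 2 ∂(volume.prod volume))
      ≤ √C * ‖w‖ := by
    intro w
    have h1 := ENNReal.toReal_mono (by finiteness) (hC w)
    rw [toReal_lintegral_enorm_sq (measurable_quot (measurable_toFun w)).aestronglyMeasurable,
      ENNReal.toReal_mul, ENNReal.toReal_pow, toReal_enorm, ENNReal.coe_toReal] at h1
    calc _ ≤ √(C * ‖w‖ ^ 2) := Real.sqrt_le_sqrt h1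
      _ = _ := by rw [Real.sqrt_mul C.coe_nonneg, Real.sqrt_sq (norm_nonneg _)]
  rw [← integral_add_compl (measurableSet_nearSet k) hint]
  have h1 := abs_integral_mul_le (hmu.restrict (nearSet d k)) (hmψ.restrict (nearSet d k))
  have h2 := abs_integral_mul_le_add (hmu.restrict (nearSet d k)ᶜ) (hmψ.restrict (nearSet d k)ᶜ) hη
  have h3 : √(∫ z in nearSet d k, quot γ u.toFun z ^ 2 ∂(volume.prod volume)) *
      √(∫ z in nearSet d k, quot γ ψ.toFun z ^ 2 ∂(volume.prod volume)) ≤ C * (‖u‖ * ‖ψ‖) := by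
    calc _ ≤ (√C * ‖u‖) * (√C * ‖ψ‖) := by gcongr <;> exact hnear _
      _ = (√C * √C) * (‖u‖ * ‖ψ‖) := by ring
      _ = _ := by rw [Real.mul_self_sqrt C.coe_nonneg]
  have h4 : ∫ z in (nearSet d k)ᶜ, quot γ ψ.toFun z ^ 2 ∂(volume.prod volume)
      ≤ (gagliardoSq γ ψ.toFun).toReal := by
    rw [toReal_gagliardoSq]
    exact setIntegral_le_integral hmψ.integrable_sq (Eventually.of_forall fun z => sq_nonneg _)
  rw [toReal_lintegral_enorm_sq (measurable_quot (measurable_toFun u)).aestronglyMeasurable]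
  have h5 := mul_le_mul_of_nonneg_left h4 hη.le
  refine (abs_add_le _ _).trans ?_
  linarith

theorem gagliardoSq_add_le (u v : L2O O) : gagliardoSq γ (u + v).toFun
    ≤ 2 * (gagliardoSq γ u.toFun + gagliardoSq γ v.toFun) := by
  simp only [gagliardoSq_eq]
  have hm : ∀ w : L2O O, Measurable fun z => ‖quot γ w.toFun z‖ₑ ^ 2 := fun w =>
    (measurable_quot (measurable_toFun w)).enorm.pow_const 2
  rw [← lintegral_add_left (hm u), ← lintegral_const_mul _ (by fun_prop)]
  refine lintegral_mono_ae ((quot_add (γ := γ) u v).mono fun z hz => ?_)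
  have hs : ∀ r : ℝ, ‖r‖ₑ ^ 2 = ENNReal.ofReal (r ^ 2) := fun r => by
    rw [Real.enorm_eq_ofReal_abs, ← ENNReal.ofReal_pow (abs_nonneg _), sq_abs]
  have h2 : (2 : ℝ≥0∞) = ENNReal.ofReal 2 := by simp
  rw [hz, hs, hs, hs, ← ENNReal.ofReal_add (by positivity) (by positivity), h2,
    ← ENNReal.ofReal_mul (by norm_num)]
  refine ENNReal.ofReal_le_ofReal ?_
  nlinarith [sq_nonneg (quot γ u.toFun z - quot γ v.toFun z)]

theorem gagliardoSq_smul (c : ℝ) (u : L2O O) : gagliardoSq γ (c • u).toFun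
    = ‖c‖ₑ ^ 2 * gagliardoSq γ u.toFun := by
  simp only [gagliardoSq_eq]
  rw [← lintegral_const_mul _ ((measurable_quot (measurable_toFun u)).enorm.pow_const 2)]
  refine lintegral_congr_ae ((quot_smul (γ := γ) c u).mono fun z hz => ?_)
  simp only
  rw [hz, enorm_mul, mul_pow]

theorem gagliardoSq_zero : gagliardoSq γ (0 : L2O O).toFun = 0 := by
  have := gagliardoSq_smul (γ := γ) 0 (0 : L2O O)
  simpa using this

theorem gagliardoSq_neg (u : L2O O) :
    gagliardoSq γ (-u).toFun = gagliardoSq γ u.toFun := by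
  have := gagliardoSq_smul (γ := γ) (-1) u
  simpa using this

theorem gagliardoSq_sub_le (u v : L2O O) : gagliardoSq γ (u - v).toFun
    ≤ 2 * (gagliardoSq γ u.toFun + gagliardoSq γ v.toFun) := by
  have := gagliardoSq_add_le (γ := γ) u (-v)
  rwa [gagliardoSq_neg, ← sub_eq_add_neg] at this

theorem gagliardoSq_sub_lt {u v : L2O O} (hu : gagliardoSq γ u.toFun < ∞)
    (hv : gagliardoSq γ v.toFun < ∞) : gagliardoSq γ (u - v).toFun < ∞ :=
  (gagliardoSq_sub_le u v).trans_lt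
    (ENNReal.mul_lt_top (by norm_num) (ENNReal.add_lt_top.2 ⟨hu, hv⟩))

theorem integral_quot_sub_mul {u v φ : L2O O} (hu : gagliardoSq γ u.toFun < ∞)
    (hv : gagliardoSq γ v.toFun < ∞) (hφ : gagliardoSq γ φ.toFun < ∞) :
    ∫ z, quot γ (u - v).toFun z * quot γ φ.toFun z ∂(volume.prod volume)
      = (∫ z, quot γ u.toFun z * quot γ φ.toFun z ∂(volume.prod volume))
        - ∫ z, quot γ v.toFun z * quot γ φ.toFun z ∂(volume.prod volume) := by
  rw [← integral_sub (integrable_quot_mul hu hφ) (integrable_quot_mul hv hφ)]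
  refine integral_congr_ae ((quot_sub (γ := γ) u v).mono fun z hz => ?_)
  simp only
  rw [hz]
  ring

theorem formA_comm (δ : ℝ) (u v : L2O O) : formA γ δ u v = formA γ δ v u := by
  rw [formA_eq, formA_eq, real_inner_comm]
  simp_rw [mul_comm (quot γ u.toFun _)]

theorem formA_sub_left (δ : ℝ) {u v φ : L2O O} (hu : gagliardoSq γ u.toFun < ∞)
    (hv : gagliardoSq γ v.toFun < ∞) (hφ : gagliardoSq γ φ.toFun < ∞) :
    formA γ δ (u - v) φ = formA γ δ u φ - formA γ δ v φ := by
  rw [formA_eq, formA_eq, formA_eq, integral_quot_sub_mul hu hv hφ, inner_sub_left]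
  ring

theorem formA_sub_right (δ : ℝ) {u v φ : L2O O} (hu : gagliardoSq γ u.toFun < ∞)
    (hv : gagliardoSq γ v.toFun < ∞) (hφ : gagliardoSq γ φ.toFun < ∞) :
    formA γ δ φ (u - v) = formA γ δ φ u - formA γ δ φ v := by
  rw [formA_comm, formA_sub_left δ hu hv hφ, formA_comm δ u, formA_comm δ v]

theorem formA_smul_right (δ : ℝ) (u φ : L2O O) (c : ℝ) :
    formA γ δ u (c • φ) = c * formA γ δ u φ := by
  have : ∫ z, quot γ u.toFun z * quot γ (c • φ).toFun z ∂(volume.prod volume)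
      = c * ∫ z, quot γ u.toFun z * quot γ φ.toFun z ∂(volume.prod volume) := by
    rw [← integral_const_mul]
    refine integral_congr_ae ((quot_smul (γ := γ) c φ).mono fun z hz => ?_)
    simp only
    rw [hz]
    ring
  have h2 : inner ℝ u (c • φ) = c * inner ℝ u φ := real_inner_smul_right (F := L2O O) u φ c
  rw [formA_eq, formA_eq, this, h2]
  ring

theorem formA_self (δ : ℝ) (u : L2O O) : formA γ δ u u
    = δ * ‖u‖ ^ 2 + fracConst d γ / 2 * (gagliardoSq γ u.toFun).toReal := by
  rw [formA_eq, toReal_gagliardoSq, real_inner_self_eq_norm_sq]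
  simp_rw [← pow_two]

theorem fracConst_pos (d : ℕ) (hγ : γ ∈ Ioo (0 : ℝ) 1) : 0 < fracConst d γ := by
  have h1 := hγ.1
  have h2 := hγ.2
  have h3 : 0 < Real.Gamma (((d : ℝ) + 2 * γ) / 2) := Real.Gamma_pos_of_pos (by positivity)
  have h4 : 0 < Real.Gamma (1 - γ) := Real.Gamma_pos_of_pos (by linarith)
  unfold fracConst
  positivity

/-- The preceding estimate in the form required by `MonotoneForm.bound`; the factor a does not
depend on k. -/
theorem formA_bound (hγ : γ ∈ Ioo (0 : ℝ) 1) {δ : ℝ} (hδ : 0 < δ) {η : ℝ} (hη : 0 < η) :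
    ∃ a : ℝ, 0 ≤ a ∧ ∀ k, ∃ C : ℝ, 0 ≤ C ∧ ∀ u ψ : L2O O,
      gagliardoSq γ u.toFun < ∞ → gagliardoSq γ ψ.toFun < ∞ →
      |formA γ δ u ψ| ≤ C * (‖u‖ * ‖ψ‖)
        + a * (∫⁻ z in (nearSet d k)ᶜ, ‖quot γ u.toFun z‖ₑ ^ 2 ∂(volume.prod volume)).toReal
        + η * (gagliardoSq γ ψ.toFun).toReal := by
  have hc := fracConst_pos d hγ
  set c := fracConst d γ / 2 with hcdef
  have hc0 : 0 < c := by positivity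
  refine ⟨c * (η / c)⁻¹, by positivity, fun k => ?_⟩
  obtain ⟨C, hC, h⟩ := abs_integral_quot_mul_le (O := O) hγ.1 (show 0 < η / c by positivity) k
  refine ⟨δ + c * C, by positivity, fun u ψ hu hψ => ?_⟩
  rw [formA_eq, ← hcdef]
  have h1 := mul_le_mul_of_nonneg_left (h u ψ hu hψ) hc0.le
  have h2 := mul_le_mul_of_nonneg_left (abs_real_inner_le_norm u ψ) hδ.le
  refine (abs_add_le _ _).trans ?_
  rw [abs_mul, abs_mul, abs_of_pos hδ, abs_of_pos hc0]
  refine (add_le_add h2 h1).trans (le_of_eq ?_)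
  field_simp
  ring

/-- By symmetry and linearity the difference is the form at (φ, u - v). Putting φ into the first
slot of `formA_bound` leaves the tail of the fixed function φ, which a suitable k makes smaller than
η. -/
theorem formA_modulus (hγ : γ ∈ Ioo (0 : ℝ) 1) {δ : ℝ} (hδ : 0 < δ) {φ : L2O O}
    (hφ : gagliardoSq γ φ.toFun < ∞) {η : ℝ} (hη : 0 < η) :
    ∃ C : ℝ, 0 ≤ C ∧ ∀ u v : L2O O, gagliardoSq γ u.toFun < ∞ → gagliardoSq γ v.toFun < ∞ →
      |formA γ δ u φ - formA γ δ v φ| ≤ C * ‖u - v‖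
        + η * (1 + (gagliardoSq γ u.toFun).toReal + (gagliardoSq γ v.toFun).toReal) := by
  obtain ⟨a, ha, hb⟩ := formA_bound (O := O) hγ hδ (show 0 < η / 2 by positivity)
  have ht := (ENNReal.tendsto_toReal ENNReal.zero_ne_top).comp
    (tendsto_lintegral_nearSet_compl hφ)
  have ht2 := ht.const_mul a
  rw [ENNReal.toReal_zero, mul_zero] at ht2
  obtain ⟨k, hk⟩ := (ht2.eventually_lt_const hη).exists
  simp only [Function.comp] at hk
  obtain ⟨C, hC, h⟩ := hb k
  refine ⟨C * ‖φ‖, by positivity, fun u v hu hv => ?_⟩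
  have hw := gagliardoSq_sub_lt (γ := γ) hu hv
  have h1 := h φ (u - v) hφ hw
  rw [formA_sub_right δ hu hv hφ, formA_comm δ φ u, formA_comm δ φ v] at h1
  have h2 := ENNReal.toReal_mono (ENNReal.mul_lt_top (by norm_num)
    (ENNReal.add_lt_top.2 ⟨hu, hv⟩)).ne (gagliardoSq_sub_le u v)
  rw [ENNReal.toReal_mul, ENNReal.toReal_add hu.ne hv.ne] at h2
  simp only [ENNReal.toReal_ofNat] at h2
  have h3 := mul_le_mul_of_nonneg_left h2 (show 0 ≤ η / 2 by positivity)
  refine h1.trans ?_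
  linarith

end Quadratic

end

end FracSkeleton

/-! ### The monotone nonlinearity on L^{p+1} -/

namespace FracSkeleton

open Filter Topology

noncomputable section

/-- Monotone, locally Lipschitz functions with growth of order `p` and coercivity of
order `p + 1`. -/
structure Nonlin (p k₁ k₂ k₃ : ℝ) (f : ℝ → ℝ) : Prop where
  one_lt : 1 < p
  pos₁ : 0 < k₁
  pos₂ : 0 < k₂
  pos₃ : 0 < k₃
  cont : Continuous f
  mono : Monotone f
  map_zero : f 0 = 0
  lipschitz : ∀ R, ∃ L, 0 ≤ L ∧ ∀ r s, |r| ≤ R → |s| ≤ R → |f r - f s| ≤ L * |r - s|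
  growth : ∀ r, |f r| ≤ k₁ * (1 + |r| ^ p)
  coercive : ∀ r, k₃ * |r| ^ (p + 1) - k₂ ≤ r * f r

/-- Young's inequality without sharp constants, by comparing a with θ b. -/
theorem rpow_mul_le_add {a b θ p : ℝ} (ha : 0 ≤ a) (hb : 0 ≤ b) (hθ : 0 < θ) (hp : 0 < p) :
    a ^ p * b ≤ θ⁻¹ * a ^ (p + 1) + θ ^ p * b ^ (p + 1) := by
  have h1 : 0 ≤ θ⁻¹ * a ^ (p + 1) := by positivity
  have h2 : 0 ≤ θ ^ p * b ^ (p + 1) := by positivity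
  rcases le_total (b * θ) a with h | h
  · have : a ^ p * b ≤ θ⁻¹ * a ^ (p + 1) := by
      rw [Real.rpow_add_one' ha (by positivity), inv_mul_eq_div, le_div_iff₀ hθ, mul_assoc]
      gcongr
    linarith
  · have : a ^ p * b ≤ θ ^ p * b ^ (p + 1) := by
      rw [Real.rpow_add_one' hb (by positivity), ← mul_assoc, ← Real.mul_rpow hθ.le hb]
      gcongr
      rwa [mul_comm]
    linarith

section Lq

variable {d : ℕ} {O : Set (EuclideanSpace ℝ (Fin d))} {q : ℝ}

/-- The functional `∫ |u|^q`. -/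
def lqInt (q : ℝ) (u : L2O O) : ℝ≥0∞ := ∫⁻ x, ‖u.toFun x‖ₑ ^ q

/-- The functional `∫_{|u| > k} |u|^q`. -/
def lqTail (q : ℝ) (k : ℕ) (u : L2O O) : ℝ≥0∞ :=
  ∫⁻ x, {r : ℝ | (k : ℝ) < |r|}.indicator (fun r => ‖r‖ₑ ^ q) (u.toFun x)

theorem isOpen_abs_gt (k : ℝ) : IsOpen {r : ℝ | k < |r|} := isOpen_lt (by fun_prop) (by fun_prop)

/-- The tails are cut at the strict inequality k < |r| so that the cut-off set is open and this
applies. -/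
theorem lowerSemicontinuous_indicator_of_isOpen {ψ : ℝ → ℝ≥0∞} (hψ : Continuous ψ) {S : Set ℝ}
    (hS : IsOpen S) : LowerSemicontinuous (S.indicator ψ) := by
  intro r y hy
  by_cases hr : r ∈ S
  · rw [indicator_of_mem hr] at hy
    filter_upwards [hS.mem_nhds hr, hψ.continuousAt.eventually_const_lt hy] with s hs h
    rwa [indicator_of_mem hs]
  · rw [indicator_of_notMem hr] at hy
    exact absurd hy not_lt_zero

theorem lowerSemicontinuous_lqInt : LowerSemicontinuous (lqInt (O := O) q) :=
  lowerSemicontinuous_lintegral_comp (ψ := fun r => ‖r‖ₑ ^ q)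
    ((ENNReal.continuous_rpow_const).comp continuous_enorm).lowerSemicontinuous

theorem lowerSemicontinuous_lqTail (k : ℕ) :
    LowerSemicontinuous (lqTail (O := O) q k) :=
  lowerSemicontinuous_lintegral_comp (lowerSemicontinuous_indicator_of_isOpen
    ((ENNReal.continuous_rpow_const).comp continuous_enorm) (isOpen_abs_gt k))

theorem lqTail_le (k : ℕ) (u : L2O O) : lqTail q k u ≤ lqInt q u :=
  lintegral_mono fun _ => indicator_le_self _ (fun r : ℝ => ‖r‖ₑ ^ q) _

theorem tendsto_lqTail {u : L2O O} (hu : lqInt q u < ∞) :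
    Tendsto (fun k => lqTail q k u) atTop (𝓝 0) := by
  have h := tendsto_lintegral_of_dominated_convergence (μ := volume)
    (F := fun k x => {r : ℝ | ((k : ℕ) : ℝ) < |r|}.indicator (fun r => ‖r‖ₑ ^ q) (u.toFun x))
    (f := fun _ => 0) (fun x => ‖u.toFun x‖ₑ ^ q)
    (fun k => ((measurable_enorm.pow_const q).indicator (isOpen_abs_gt k).measurableSet).comp
      (measurable_toFun u))
    (fun k => Eventually.of_forall fun x => indicator_le_self _ (fun r : ℝ => ‖r‖ₑ ^ q) _) hu.ne
    (Eventually.of_forall fun x => ?_)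
  · rw [lintegral_zero] at h
    exact h
  · refine tendsto_const_nhds.congr' ?_
    filter_upwards [(tendsto_natCast_atTop_atTop (R := ℝ)).eventually_ge_atTop |u.toFun x|]
      with k hk
    rw [indicator_of_notMem]
    simpa using hk

theorem toReal_lqInt (hq : 0 < q) (u : L2O O) : (lqInt q u).toReal = ∫ x, |u.toFun x| ^ q :=
  toReal_lintegral_enorm_rpow (measurable_toFun u).aestronglyMeasurable hq

theorem integrable_rpow (hq : 0 < q) {u : L2O O} (hu : lqInt q u < ∞) :
    Integrable fun x => |u.toFun x| ^ q :=
  integrable_rpow_of_lintegral (measurable_toFun u).aestronglyMeasurable hq hu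

theorem measurableSet_abs_gt (u : L2O O) (k : ℝ) : MeasurableSet {x | k < |u.toFun x|} :=
  measurable_toFun u (isOpen_abs_gt k).measurableSet

theorem toReal_lqTail (hq : 0 < q) (k : ℕ) (u : L2O O) : (lqTail q k u).toReal
    = ∫ x, {x | (k : ℝ) < |u.toFun x|}.indicator (fun x => |u.toFun x| ^ q) x := by
  have e : lqTail q k u = ∫⁻ x in {x | (k : ℝ) < |u.toFun x|}, ‖u.toFun x‖ₑ ^ q := by
    rw [← lintegral_indicator (measurableSet_abs_gt u k)]
    rfl
  rw [e, toReal_lintegral_enorm_rpow (measurable_toFun u).aestronglyMeasurable hq,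
    integral_indicator (measurableSet_abs_gt u k)]

theorem lqInt_smul_le (hq : 0 < q) (u : L2O O) {c : ℝ} (hc : |c| ≤ 1) :
    lqInt q (c • u) ≤ lqInt q u := by
  refine lintegral_mono_ae ((toFun_smul c u).mono fun x hx => ?_)
  rw [hx]
  refine ENNReal.rpow_le_rpow ?_ hq.le
  rw [Real.enorm_eq_ofReal_abs, Real.enorm_eq_ofReal_abs, abs_mul]
  exact ENNReal.ofReal_le_ofReal (mul_le_of_le_one_left (abs_nonneg _) hc)

theorem lqInt_add_le (hq : 1 ≤ q) (u v : L2O O) :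
    lqInt q (u + v) ≤ 2 ^ q * (lqInt q u + lqInt q v) := by
  unfold lqInt
  have hm : ∀ w : L2O O, Measurable fun x => ‖w.toFun x‖ₑ ^ q := fun w =>
    (measurable_toFun w).enorm.pow_const q
  have hm2 : Measurable fun x => ‖u.toFun x‖ₑ ^ q + ‖v.toFun x‖ₑ ^ q := (hm u).add (hm v)
  rw [← lintegral_add_left (hm u), ← lintegral_const_mul _ hm2]
  refine lintegral_mono_ae ((toFun_add u v).mono fun x hx => ?_)
  rw [hx]
  calc ‖u.toFun x + v.toFun x‖ₑ ^ q ≤ (‖u.toFun x‖ₑ + ‖v.toFun x‖ₑ) ^ q :=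
        ENNReal.rpow_le_rpow (enorm_add_le _ _) (by linarith)
    _ ≤ (2 * max ‖u.toFun x‖ₑ ‖v.toFun x‖ₑ) ^ q := by
        refine ENNReal.rpow_le_rpow ?_ (by linarith)
        rw [two_mul]
        exact add_le_add (le_max_left _ _) (le_max_right _ _)
    _ = 2 ^ q * max ‖u.toFun x‖ₑ ‖v.toFun x‖ₑ ^ q := ENNReal.mul_rpow_of_nonneg _ _ (by linarith)
    _ ≤ _ := by
        gcongr
        rcases le_total ‖u.toFun x‖ₑ ‖v.toFun x‖ₑ with h | h
        · rw [max_eq_right h]; exact le_add_self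
        · rw [max_eq_left h]; exact le_self_add

theorem lqInt_zero (hq : 0 < q) : lqInt q (0 : L2O O) = 0 := by
  unfold lqInt
  rw [lintegral_eq_zero_iff ((measurable_toFun _).enorm.pow_const q)]
  filter_upwards [toFun_zero (O := O)] with x hx
  simp [hx, hq]

theorem lqInt_neg (u : L2O O) : lqInt q (-u) = lqInt q u := by
  refine lintegral_congr_ae ((toFun_neg u).mono fun x hx => ?_)
  simp only [hx, enorm_neg]

theorem memLp_indicator_one (hO : MeasurableSet O) (hOf : volume O < ∞) :
    MemLp (O.indicator fun _ => (1 : ℝ)) 2 volume :=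
  memLp_indicator_const 2 hO 1 (Or.inr hOf.ne)

theorem integrable_abs_toFun (hO : MeasurableSet O) (hOf : volume O < ∞) (u : L2O O) :
    Integrable fun x => |u.toFun x| := by
  have h := ((memLp_indicator_one hO hOf).integrable_mul (memLp_toFun u)).abs
  refine h.congr ((toFun_eq_zero u).mono fun x hx => ?_)
  by_cases hxO : x ∈ O
  · simp [hxO]
  · simp [hx hxO]

theorem integral_abs_toFun_le (hO : MeasurableSet O) (hOf : volume O < ∞) (u : L2O O) :
    ∫ x, |u.toFun x| ≤ √(volume.real O) * ‖u‖ := by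
  have h := abs_integral_mul_le (memLp_indicator_one hO hOf) (memLp_toFun u).abs
  have e1 : ∫ x, O.indicator (fun _ => (1 : ℝ)) x * |u.toFun x| = ∫ x, |u.toFun x| := by
    refine integral_congr_ae ((toFun_eq_zero u).mono fun x hx => ?_)
    by_cases hxO : x ∈ O
    · simp [hxO]
    · simp [hx hxO]
  have e2 : ∫ x, (O.indicator (fun _ => (1 : ℝ)) x) ^ 2 = volume.real O := by
    have : ∀ x, (O.indicator (fun _ => (1 : ℝ)) x) ^ 2 = O.indicator (fun _ => (1 : ℝ)) x := by
      intro x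
      by_cases hxO : x ∈ O <;> simp [hxO]
    simp_rw [this]
    rw [integral_indicator hO]
    simp
  have e3 : ∫ x, |u.toFun x| ^ 2 = ‖u‖ ^ 2 := by
    rw [norm_sq_eq_integral]
    simp_rw [sq_abs]
  have e4 : ∀ x, |u.toFun| x = |u.toFun x| := fun x => rfl
  simp only [e4] at h
  rw [e1, e2, e3, Real.sqrt_sq (norm_nonneg _)] at h
  exact (le_abs_self _).trans h

end Lq

namespace Nonlin

variable {p k₁ k₂ k₃ : ℝ} {f : ℝ → ℝ} (hf : Nonlin p k₁ k₂ k₃ f)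
variable {d : ℕ} {O : Set (EuclideanSpace ℝ (Fin d))}

include hf

theorem abs_mul_le (r s : ℝ) : |f r * s| ≤ k₁ * |s| + k₁ * |r| ^ (p + 1) + k₁ * |s| ^ (p + 1) := by
  have hp := hf.one_lt
  have h1 := rpow_mul_le_add (abs_nonneg r) (abs_nonneg s) one_pos (by linarith : 0 < p)
  rw [abs_mul]
  have h2 := mul_le_mul_of_nonneg_right (hf.growth r) (abs_nonneg s)
  have h3 := mul_le_mul_of_nonneg_left h1 hf.pos₁.le
  rw [inv_one, Real.one_rpow] at h3
  linarith

theorem integrable_mul (hO : MeasurableSet O) (hOf : volume O < ∞) {u φ : L2O O}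
    (hu : lqInt (p + 1) u < ∞) (hφ : lqInt (p + 1) φ < ∞) :
    Integrable fun x => f (u.toFun x) * φ.toFun x := by
  have hp := hf.one_lt
  have hq : 0 < p + 1 := by linarith
  refine ((((integrable_abs_toFun hO hOf φ).const_mul k₁).add
    ((integrable_rpow hq hu).const_mul k₁)).add
    ((integrable_rpow hq hφ).const_mul k₁)).mono' ?_
    (Eventually.of_forall fun x => hf.abs_mul_le _ _)
  exact ((hf.cont.measurable.comp (measurable_toFun u)).mul
    (measurable_toFun φ)).aestronglyMeasurable

/-- Where |u| ≤ k, f(u) is bounded and the L¹ norm of ψ is controlled by its L² norm on the finite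
measure set 𝒪. Where |u| > k, Young's inequality separates the tail of u from a small multiple of
|ψ|^{p+1}. -/
theorem bound (hO : MeasurableSet O) (hOf : volume O < ∞) {η : ℝ} (hη : 0 < η) :
    ∃ a : ℝ, 0 ≤ a ∧ ∀ k, ∃ C : ℝ, 0 ≤ C ∧ ∀ u ψ : L2O O,
      lqInt (p + 1) u < ∞ → lqInt (p + 1) ψ < ∞ →
      |∫ x, f (u.toFun x) * ψ.toFun x| ≤ C * ‖ψ‖ + a * (lqTail (p + 1) k u).toReal
        + η * (lqInt (p + 1) ψ).toReal := by
  have hp := hf.one_lt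
  have hk := hf.pos₁
  have hq : 0 < p + 1 := by linarith
  -- As θ ≤ 1 and p > 1, θ^p ≤ θ, so that k₁ θ^p ≤ η.
  set θ := min 1 (η / k₁) with hθdef
  have hθ : 0 < θ := by positivity
  have hθp : k₁ * θ ^ p ≤ η := by
    calc k₁ * θ ^ p ≤ k₁ * θ ^ (1 : ℝ) := by
          gcongr 1
          exact Real.rpow_le_rpow_of_exponent_ge hθ (min_le_left _ _) hp.le
      _ ≤ k₁ * (η / k₁) := by rw [Real.rpow_one]; gcongr; exact min_le_right _ _
      _ = η := by field_simp
  refine ⟨k₁ * θ⁻¹, by positivity, fun k => ?_⟩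
  refine ⟨k₁ * (1 + (k : ℝ) ^ p) * √(volume.real O), by positivity, fun u ψ hu hψ => ?_⟩
  have hpt : ∀ x, |f (u.toFun x) * ψ.toFun x| ≤ k₁ * (1 + (k : ℝ) ^ p) * |ψ.toFun x|
      + k₁ * θ⁻¹ * {x | (k : ℝ) < |u.toFun x|}.indicator (fun x => |u.toFun x| ^ (p + 1)) x
      + η * |ψ.toFun x| ^ (p + 1) := by
    intro x
    have h0 : 0 ≤ η * |ψ.toFun x| ^ (p + 1) := by positivity
    have h2 := mul_le_mul_of_nonneg_right (hf.growth (u.toFun x)) (abs_nonneg (ψ.toFun x))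
    rw [abs_mul]
    by_cases hx : (k : ℝ) < |u.toFun x|
    · rw [indicator_of_mem (by exact hx)]
      have h1 := mul_le_mul_of_nonneg_left (rpow_mul_le_add (abs_nonneg (u.toFun x))
        (abs_nonneg (ψ.toFun x)) hθ (by linarith : 0 < p)) hk.le
      have h3 := mul_le_mul_of_nonneg_right hθp
        (show 0 ≤ |ψ.toFun x| ^ (p + 1) by positivity)
      have h4 : 0 ≤ k₁ * (k : ℝ) ^ p * |ψ.toFun x| := by positivity
      linarith
    · rw [indicator_of_notMem (by exact hx), mul_zero, add_zero]
      have h1 : |u.toFun x| ^ p ≤ (k : ℝ) ^ p :=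
        Real.rpow_le_rpow (abs_nonneg _) (not_lt.1 hx) (by linarith)
      have h3 : k₁ * (1 + |u.toFun x| ^ p) * |ψ.toFun x| ≤
        k₁ * (1 + (k : ℝ) ^ p) * |ψ.toFun x| := by gcongr
      linarith
  have i1 := (integrable_abs_toFun hO hOf ψ).const_mul (k₁ * (1 + (k : ℝ) ^ p))
  have i2 := ((integrable_rpow hq hu).indicator (measurableSet_abs_gt u k)).const_mul (k₁ * θ⁻¹)
  have i3 := (integrable_rpow hq hψ).const_mul η
  have h1 := (abs_integral_le_integral_abs (f := fun x => f (u.toFun x) * ψ.toFun x)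
    (μ := volume)).trans (integral_mono (hf.integrable_mul hO hOf hu hψ).abs
      ((i1.add i2).add i3) hpt)
  rw [integral_add' (i1.add i2) i3, integral_add' i1 i2, integral_const_mul, integral_const_mul,
    integral_const_mul, ← toReal_lqTail hq, ← toReal_lqInt hq] at h1
  have h2 := mul_le_mul_of_nonneg_left (integral_abs_toFun_le hO hOf ψ)
    (show 0 ≤ k₁ * (1 + (k : ℝ) ^ p) by positivity)
  linarith

/-- If r and s are moderate, f is Lipschitz. If one of them is large and |t| > M, Young's inequality
applies. If one is large and |t| ≤ M, the power p of the large value times M is absorbed by η times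
its power p + 1. The constant c does not depend on M, so the tail of a fixed φ can be made small
afterwards. -/
theorem abs_sub_mul_le {η : ℝ} (hη : 0 < η) : ∃ c : ℝ, 0 ≤ c ∧ ∀ M : ℝ, 0 < M →
    ∃ L : ℝ, 0 ≤ L ∧ ∀ r s t : ℝ, |(f r - f s) * t| ≤ L * (|r - s| * |t|)
      + η * (|r| ^ (p + 1) + |s| ^ (p + 1))
      + c * {x : ℝ | M < |x|}.indicator (fun x => |x| ^ (p + 1)) t := by
  have hp := hf.one_lt
  have hk := hf.pos₁
  -- Makes the Young factor 4 k₁ θ⁻¹ equal to η.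
  set θ := 4 * k₁ / η with hθdef
  have hθ : 0 < θ := by positivity
  refine ⟨4 * k₁ * θ ^ p, by positivity, fun M hM => ?_⟩
  -- Beyond R one has 4 k₁ M ≤ η m. The lower bound 1 lets m^p dominate the constant in the growth
  -- condition.
  set R := max 1 (4 * k₁ * M / η) with hR
  have hR0 : 0 < R := by positivity
  obtain ⟨L, hL, hLip⟩ := hf.lipschitz R
  refine ⟨L, hL, fun r s t => ?_⟩
  have hind : 0 ≤ {x : ℝ | M < |x|}.indicator (fun x => |x| ^ (p + 1)) t :=
    indicator_nonneg (fun x _ => by positivity) _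
  have hc : 0 ≤ 4 * k₁ * θ ^ p * {x : ℝ | M < |x|}.indicator (fun x => |x| ^ (p + 1)) t := by
    positivity
  have hrs : 0 ≤ η * (|r| ^ (p + 1) + |s| ^ (p + 1)) := by positivity
  have hl : 0 ≤ L * (|r - s| * |t|) := by positivity
  rw [abs_mul]
  by_cases hm : max |r| |s| ≤ R
  · have h1 := mul_le_mul_of_nonneg_right (hLip r s ((le_max_left _ _).trans hm)
      ((le_max_right _ _).trans hm)) (abs_nonneg t)
    linarith
  · push Not at hm
    set m := max |r| |s| with hmdef
    have hm1 : 1 ≤ m := (le_max_left _ _).trans hm.le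
    have hm0 : 0 < m := by linarith
    have hmq : m ^ (p + 1) ≤ |r| ^ (p + 1) + |s| ^ (p + 1) := by
      have a1 : 0 ≤ |r| ^ (p + 1) := by positivity
      have a2 : 0 ≤ |s| ^ (p + 1) := by positivity
      rcases max_choice |r| |s| with h | h <;> rw [hmdef, h] <;> linarith
    have hD : |f r - f s| ≤ 4 * k₁ * m ^ p := by
      have h1 := hf.growth r
      have h2 := hf.growth s
      have h3 : |r| ^ p ≤ m ^ p :=
        Real.rpow_le_rpow (abs_nonneg _) (le_max_left _ _) (by linarith)
      have h4 : |s| ^ p ≤ m ^ p :=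
        Real.rpow_le_rpow (abs_nonneg _) (le_max_right _ _) (by linarith)
      have h5 : 1 ≤ m ^ p := Real.one_le_rpow hm1 (by linarith)
      have h6 : k₁ * (1 + |r| ^ p) ≤ k₁ * (2 * m ^ p) := by gcongr; linarith
      have h7 : k₁ * (1 + |s| ^ p) ≤ k₁ * (2 * m ^ p) := by gcongr; linarith
      have h8 := abs_sub (f r) (f s)
      linarith
    have hDt := mul_le_mul_of_nonneg_right hD (abs_nonneg t)
    by_cases ht : M < |t|
    · have e : {x : ℝ | M < |x|}.indicator (fun x => |x| ^ (p + 1)) t = |t| ^ (p + 1) :=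
        indicator_of_mem (by exact ht) _
      rw [e]
      have h1 := mul_le_mul_of_nonneg_left (rpow_mul_le_add hm0.le (abs_nonneg t) hθ
        (by linarith : 0 < p)) (show 0 ≤ 4 * k₁ by positivity)
      have h2 : 4 * k₁ * (θ⁻¹ * m ^ (p + 1)) = η * m ^ (p + 1) := by
        rw [hθdef]; field_simp
      have h3 := mul_le_mul_of_nonneg_left hmq hη.le
      linarith
    · push Not at ht
      have h1 : 4 * k₁ * m ^ p * |t| ≤ η * m ^ (p + 1) := by
        rw [Real.rpow_add_one' hm0.le (by linarith)]
        have h2 : 4 * k₁ * M ≤ η * m := by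
          have : 4 * k₁ * M / η ≤ m := (le_max_right _ _).trans hm.le
          rw [div_le_iff₀ hη] at this
          linarith
        calc 4 * k₁ * m ^ p * |t| ≤ 4 * k₁ * m ^ p * M := by gcongr
          _ = m ^ p * (4 * k₁ * M) := by ring
          _ ≤ m ^ p * (η * m) := by gcongr
          _ = _ := by ring
      have h3 := mul_le_mul_of_nonneg_left hmq hη.le
      linarith

/-- The pointwise estimate with t = φ(x), integrated. The level k is chosen so large that c times
the tail of φ is below η. -/
theorem modulus (hO : MeasurableSet O) (hOf : volume O < ∞) {φ : L2O O}
    (hφ : lqInt (p + 1) φ < ∞) {η : ℝ} (hη : 0 < η) :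
    ∃ C : ℝ, 0 ≤ C ∧ ∀ u v : L2O O, lqInt (p + 1) u < ∞ → lqInt (p + 1) v < ∞ →
      |(∫ x, f (u.toFun x) * φ.toFun x) - ∫ x, f (v.toFun x) * φ.toFun x| ≤ C * ‖u - v‖
        + η * (1 + (lqInt (p + 1) u).toReal + (lqInt (p + 1) v).toReal) := by
  have hp := hf.one_lt
  have hq : 0 < p + 1 := by linarith
  obtain ⟨c, hc, hcM⟩ := hf.abs_sub_mul_le hη
  have ht := ((ENNReal.tendsto_toReal ENNReal.zero_ne_top).comp (tendsto_lqTail hφ)).const_mul c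
  rw [ENNReal.toReal_zero, mul_zero] at ht
  obtain ⟨k, hk, hk0⟩ := ((ht.eventually_lt_const hη).and (eventually_gt_atTop 0)).exists
  simp only [Function.comp] at hk
  obtain ⟨L, hL, hpt⟩ := hcM k (by exact_mod_cast hk0)
  refine ⟨L * ‖φ‖, by positivity, fun u v hu hv => ?_⟩
  rw [← integral_sub (hf.integrable_mul hO hOf hu hφ) (hf.integrable_mul hO hOf hv hφ)]
  have i1 := ((memLp_toFun (u - v)).abs.integrable_mul (memLp_toFun φ).abs).const_mul L
  have i2 := ((integrable_rpow hq hu).add (integrable_rpow hq hv)).const_mul η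
  have i3 := ((integrable_rpow hq hφ).indicator (measurableSet_abs_gt φ k)).const_mul c
  have h1 := (abs_integral_le_integral_abs (f := fun x => f (u.toFun x) * φ.toFun x
    - f (v.toFun x) * φ.toFun x) (μ := volume)).trans (integral_mono_ae
      ((hf.integrable_mul hO hOf hu hφ).sub (hf.integrable_mul hO hOf hv hφ)).abs
      ((i1.add i2).add i3) ((toFun_sub u v).mono fun x hx => by
        have := hpt (u.toFun x) (v.toFun x) (φ.toFun x)
        rw [sub_mul] at this
        simp only [Pi.add_apply, Pi.mul_apply, Pi.abs_apply]
        rw [hx]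
        exact this))
  rw [integral_add' (i1.add i2) i3, integral_add' i1 i2, integral_const_mul, integral_const_mul,
    integral_const_mul, ← toReal_lqTail hq, integral_add' (integrable_rpow hq hu)
      (integrable_rpow hq hv), ← toReal_lqInt hq, ← toReal_lqInt hq] at h1
  have h2 := abs_integral_mul_le (memLp_toFun (u - v)).abs (memLp_toFun φ).abs
  have e : ∀ w : L2O O, √(∫ x, |w.toFun| x ^ 2) = ‖w‖ := by
    intro w
    rw [← Real.sqrt_sq (norm_nonneg w), norm_sq_eq_integral]
    congr 2
    ext x
    exact sq_abs _
  rw [e, e] at h2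
  have h3 := mul_le_mul_of_nonneg_left ((le_abs_self _).trans h2) hL
  simp only [Pi.mul_apply] at h1
  linarith

theorem integral_mul_sub (hO : MeasurableSet O) (hOf : volume O < ∞) {u φ ψ : L2O O}
    (hu : lqInt (p + 1) u < ∞) (hφ : lqInt (p + 1) φ < ∞) (hψ : lqInt (p + 1) ψ < ∞) :
    ∫ x, f (u.toFun x) * (φ - ψ).toFun x
      = (∫ x, f (u.toFun x) * φ.toFun x) - ∫ x, f (u.toFun x) * ψ.toFun x := by
  rw [← integral_sub (hf.integrable_mul hO hOf hu hφ) (hf.integrable_mul hO hOf hu hψ)]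
  refine integral_congr_ae ((toFun_sub φ ψ).mono fun x hx => ?_)
  simp only
  rw [hx]
  ring

end Nonlin

theorem integral_mul_smul {d : ℕ} {O : Set (EuclideanSpace ℝ (Fin d))} (f : ℝ → ℝ) (u φ : L2O O)
    (c : ℝ) : ∫ x, f (u.toFun x) * (c • φ).toFun x = c * ∫ x, f (u.toFun x) * φ.toFun x := by
  rw [← integral_const_mul]
  refine integral_congr_ae ((toFun_smul c φ).mono fun x hx => ?_)
  simp only
  rw [hx]
  ring

end

end FracSkeleton

/-! ### Completeness and separability of ℍ, density of finite-energy functions -/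

namespace FracSkeleton

open Filter Topology

noncomputable section

section Space

variable {d : ℕ} {O : Set (EuclideanSpace ℝ (Fin d))}

theorem isClosed_l2Sub : IsClosed (l2Sub O : Set (Lp ℝ 2 (volume : Measure
    (EuclideanSpace ℝ (Fin d))))) := by
  refine IsSeqClosed.isClosed fun u v hu huv => ?_
  obtain ⟨ns, -, hae⟩ := (tendstoInMeasure_of_tendsto_Lp huv).exists_seq_tendsto_ae
  have h0 : ∀ᵐ x, ∀ k, x ∉ O → (u (ns k) : EuclideanSpace ℝ (Fin d) → ℝ) x = 0 :=
    ae_all_iff.2 fun k => hu (ns k)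
  change ∀ᵐ x, x ∉ O → (v : EuclideanSpace ℝ (Fin d) → ℝ) x = 0
  filter_upwards [hae, h0] with x hx h hxO
  have : Tendsto (fun k => (u (ns k) : EuclideanSpace ℝ (Fin d) → ℝ) x) atTop (𝓝 0) := by
    simp_rw [fun k => h k hxO]
    exact tendsto_const_nhds
  exact tendsto_nhds_unique hx this

instance : CompleteSpace (L2O O) := isClosed_l2Sub.completeSpace_coe

instance : SecondCountableTopology (L2O O) := by
  have : Fact ((2 : ℝ≥0∞) ≠ ∞) := ⟨by norm_num⟩
  have : SecondCountableTopology (Lp ℝ 2 (volume : Measure (EuclideanSpace ℝ (Fin d)))) :=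
    UniformSpace.secondCountable_of_separable _
  exact TopologicalSpace.Subtype.secondCountableTopology _

end Space

section Kernel

variable {d : ℕ} {γ : ℝ}

/-- In polar coordinates the radial integrand is r^(1-2γ) near 0 and r^(-1-2γ) at infinity,
integrable because γ < 1 and γ > 0 respectively. -/
theorem integrable_kernel (hd : 1 ≤ d) (hγ : γ ∈ Ioo (0 : ℝ) 1) :
    Integrable fun x : EuclideanSpace ℝ (Fin d) =>
      min (‖x‖ ^ 2) 1 * ‖x‖ ^ (-((d : ℝ) + 2 * γ)) := by
  have h1 := hγ.1
  have h2 := hγ.2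
  have : NeZero d := ⟨by lia⟩
  have : Nontrivial (EuclideanSpace ℝ (Fin d)) := inferInstance
  rw [integrable_fun_norm_addHaar volume
    (f := fun r : ℝ => min (r ^ 2) 1 * r ^ (-((d : ℝ) + 2 * γ)))]
  have hdim : ((d - 1 : ℕ) : ℝ) = (d : ℝ) - 1 := by push_cast [Nat.cast_sub hd]; ring
  have e : ∀ r : ℝ, 0 < r → r ^ (Module.finrank ℝ (EuclideanSpace ℝ (Fin d)) - 1) •
      (min (r ^ 2) 1 * r ^ (-((d : ℝ) + 2 * γ))) = min (r ^ 2) 1 * r ^ (-1 - 2 * γ) := by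
    intro r hr
    rw [finrank_euclideanSpace_fin, smul_eq_mul, ← Real.rpow_natCast, mul_left_comm,
      ← Real.rpow_add hr, hdim]
    congr 2
    ring
  rw [← Ioc_union_Ioi_eq_Ioi (zero_le_one (α := ℝ))]
  refine IntegrableOn.union ?_ ?_
  · have h : IntegrableOn (fun r : ℝ => r ^ (1 - 2 * γ)) (Ioc 0 1) := by
      have := intervalIntegral.intervalIntegrable_rpow' (a := 0) (b := 1)
        (r := 1 - 2 * γ) (by linarith)
      rwa [intervalIntegrable_iff_integrableOn_Ioc_of_le zero_le_one] at this
    refine h.congr_fun (fun r hr => ?_) measurableSet_Ioc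
    have hr0 : 0 < r := hr.1
    rw [e r hr0, min_eq_left (pow_le_one₀ hr0.le hr.2), ← Real.rpow_natCast, ← Real.rpow_add hr0]
    change r ^ (1 - 2 * γ) = _
    congr 1
    push_cast
    ring
  · have h := integrableOn_Ioi_rpow_of_lt (a := -1 - 2 * γ) (by linarith) one_pos
    refine h.congr_fun (fun r hr => ?_) measurableSet_Ioi
    have hr1 : 1 < r := hr
    rw [e r (by linarith), min_eq_right (one_le_pow₀ hr1.le), one_mul]

/-- The squared increment is at most c min(|x - y|², 1), and it vanishes unless one of the points
lies in S. Fubini then gives a multiple of |S| times the integral of the kernel. -/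
theorem gagliardoSq_lt_top_of_lipschitz (hd : 1 ≤ d) (hγ : γ ∈ Ioo (0 : ℝ) 1)
    {u : EuclideanSpace ℝ (Fin d) → ℝ} {L : ℝ≥0} (hL : LipschitzWith L u) {M : ℝ}
    (hM : ∀ x, |u x| ≤ M) {S : Set (EuclideanSpace ℝ (Fin d))} (hS : MeasurableSet S)
    (hSf : volume S < ∞) (hu : ∀ x, x ∉ S → u x = 0) : gagliardoSq γ u < ∞ := by
  set K : EuclideanSpace ℝ (Fin d) → ℝ := fun x =>
    min (‖x‖ ^ 2) 1 * ‖x‖ ^ (-((d : ℝ) + 2 * γ)) with hK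
  have hKm : Measurable K := by rw [hK]; fun_prop
  have hKf : ∫⁻ x, ‖K x‖ₑ < ∞ := (integrable_kernel hd hγ).2
  set c : ℝ := (L : ℝ) ^ 2 + (2 * M) ^ 2 with hc
  have hc0 : 0 ≤ c := by positivity
  set χ : EuclideanSpace ℝ (Fin d) → ℝ≥0∞ := S.indicator 1 with hχ
  have hχm : Measurable χ := measurable_one.indicator hS
  have hnum : ∀ x y, (u x - u y) ^ 2 ≤ c * min (‖x - y‖ ^ 2) 1 := by
    intro x y
    have h1 : |u x - u y| ≤ L * ‖x - y‖ := by
      have := hL.dist_le_mul x y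
      rwa [Real.dist_eq, dist_eq_norm] at this
    have h2 : |u x - u y| ≤ 2 * M := by
      have := abs_sub (u x) (u y)
      linarith [hM x, hM y]
    have h3 : (u x - u y) ^ 2 ≤ (L : ℝ) ^ 2 * ‖x - y‖ ^ 2 := by
      rw [← sq_abs, ← mul_pow]; gcongr
    have h4 : (u x - u y) ^ 2 ≤ (2 * M) ^ 2 := by
      rw [← sq_abs]; gcongr
    have h5 : 0 ≤ (2 * M) ^ 2 := by positivity
    have h6 : 0 ≤ (L : ℝ) ^ 2 := by positivity
    rcases min_choice (‖x - y‖ ^ 2) 1 with h | h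
    · rw [h]
      have : 0 ≤ (2 * M) ^ 2 * ‖x - y‖ ^ 2 := by positivity
      rw [hc, add_mul]; linarith
    · rw [h, hc]; linarith
  have hpt : ∀ z : EuclideanSpace ℝ (Fin d) × EuclideanSpace ℝ (Fin d),
      ‖quot γ u z‖ₑ ^ 2 ≤ ENNReal.ofReal c * (χ z.1 * ‖K (z.1 - z.2)‖ₑ)
        + ENNReal.ofReal c * (χ z.2 * ‖K (z.1 - z.2)‖ₑ) := by
    intro z
    have hq : ‖quot γ u z‖ₑ ^ 2 ≤ ENNReal.ofReal c * ‖K (z.1 - z.2)‖ₑ := by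
      have hK0 : 0 ≤ K (z.1 - z.2) := by simp only [hK]; positivity
      rw [Real.enorm_eq_ofReal_abs, ← ENNReal.ofReal_pow (abs_nonneg _), sq_abs,
        Real.enorm_of_nonneg hK0, ← ENNReal.ofReal_mul hc0]
      refine ENNReal.ofReal_le_ofReal ?_
      rw [pow_two, ← quot_mul_quot, ← pow_two, div_eq_mul_inv, ← Real.rpow_neg (norm_nonneg _)]
      simp only [hK]
      rw [← mul_assoc]
      exact mul_le_mul_of_nonneg_right (hnum _ _) (by positivity)
    by_cases h1 : z.1 ∈ S
    · have : χ z.1 = 1 := by simp [hχ, h1]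
      rw [this, one_mul]
      exact hq.trans le_self_add
    · by_cases h2 : z.2 ∈ S
      · have : χ z.2 = 1 := by simp [hχ, h2]
        rw [this, one_mul]
        exact hq.trans le_add_self
      · simp [quot, hu _ h1, hu _ h2]
  have e0 : ∫⁻ x, χ x = volume S := by rw [hχ, lintegral_indicator_one hS]
  have hm1 : Measurable fun z : EuclideanSpace ℝ (Fin d) × EuclideanSpace ℝ (Fin d) =>
      χ z.1 * ‖K (z.1 - z.2)‖ₑ := by fun_prop
  have hm2 : Measurable fun z : EuclideanSpace ℝ (Fin d) × EuclideanSpace ℝ (Fin d) =>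
      χ z.2 * ‖K (z.1 - z.2)‖ₑ := by fun_prop
  have e1 : ∫⁻ z : EuclideanSpace ℝ (Fin d) × EuclideanSpace ℝ (Fin d),
      χ z.1 * ‖K (z.1 - z.2)‖ₑ ∂(volume.prod volume) = volume S * ∫⁻ x, ‖K x‖ₑ := by
    rw [lintegral_prod _ hm1.aemeasurable, ← e0, ← lintegral_mul_const _ hχm]
    refine lintegral_congr fun x => ?_
    simp only
    rw [lintegral_const_mul _ (by fun_prop), lintegral_sub_left_eq_self (fun y => ‖K y‖ₑ) x]
  have e2 : ∫⁻ z : EuclideanSpace ℝ (Fin d) × EuclideanSpace ℝ (Fin d),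
      χ z.2 * ‖K (z.1 - z.2)‖ₑ ∂(volume.prod volume) = volume S * ∫⁻ x, ‖K x‖ₑ := by
    rw [lintegral_prod_symm _ hm2.aemeasurable, ← e0, ← lintegral_mul_const _ hχm]
    refine lintegral_congr fun x => ?_
    simp only
    rw [lintegral_const_mul _ (by fun_prop), lintegral_sub_right_eq_self (fun y => ‖K y‖ₑ) x]
  rw [gagliardoSq_eq]
  refine (lintegral_mono hpt).trans_lt ?_
  rw [lintegral_add_left (hm1.const_mul _), lintegral_const_mul _ hm1, lintegral_const_mul _ hm2,
    e1, e2]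
  exact ENNReal.add_lt_top.2 ⟨ENNReal.mul_lt_top ENNReal.ofReal_lt_top
    (ENNReal.mul_lt_top hSf hKf), ENNReal.mul_lt_top ENNReal.ofReal_lt_top
    (ENNReal.mul_lt_top hSf hKf)⟩

end Kernel

section Dense

variable {d : ℕ} {O : Set (EuclideanSpace ℝ (Fin d))} {γ q : ℝ}

theorem gagliardoSq_congr_ae {u v : EuclideanSpace ℝ (Fin d) → ℝ} (h : u =ᵐ[volume] v) :
    gagliardoSq γ u = gagliardoSq γ v :=
  lintegral_congr_ae ((ae_prod_of_ae h).mono fun z hz => by simp only [hz.1, hz.2])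

/-- Test functions belong to `𝕍 ∩ L^q`. -/
theorem exists_testFunction (hd : 1 ≤ d) (hγ : γ ∈ Ioo (0 : ℝ) 1) (hq : 0 < q)
    {f : EuclideanSpace ℝ (Fin d) → ℝ} (hf : ContDiff ℝ ((⊤ : ℕ∞) : WithTop ℕ∞) f) (hfc : HasCompactSupport f)
    (hfO : tsupport f ⊆ O) : ∃ φ : L2O O, φ.toFun =ᵐ[volume] f ∧
      gagliardoSq γ φ.toFun < ∞ ∧ lqInt q φ < ∞ := by
  have hmem : ∀ r : ℝ≥0∞, MemLp f r volume := fun r => hf.continuous.memLp_of_hasCompactSupport hfc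
  have hz : ∀ x, x ∉ tsupport f → f x = 0 := fun x hx => image_eq_zero_of_notMem_tsupport hx
  have hco := (hmem 2).coeFn_toLp
  let φ : L2O O := ⟨(hmem 2).toLp f, by
    change ∀ᵐ x, x ∉ O → _ = 0
    filter_upwards [hco] with x hx hxO
    rw [hx]
    exact hz x fun h => hxO (hfO h)⟩
  have hφ : φ.toFun =ᵐ[volume] f := hco
  refine ⟨φ, hφ, ?_, ?_⟩
  · rw [gagliardoSq_congr_ae hφ]
    obtain ⟨L, hL⟩ := ContDiff.lipschitzWith_of_hasCompactSupport hfc hf (by simp)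
    obtain ⟨M, hM⟩ := hfc.exists_bound_of_continuous hf.continuous
    exact gagliardoSq_lt_top_of_lipschitz hd hγ hL hM (isClosed_tsupport f).measurableSet
      hfc.isCompact.measure_lt_top hz
  · have h := (hmem (ENNReal.ofReal q)).2
    rw [eLpNorm_lt_top_iff_lintegral_rpow_enorm_lt_top (by simpa using hq) (by simp),
      ENNReal.toReal_ofReal hq.le] at h
    refine lt_of_eq_of_lt (lintegral_congr_ae (hφ.mono fun x hx => ?_)) h
    simp only [hx]

/-- A vector orthogonal to the subspace is orthogonal to all test functions of the open set 𝒪, hence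
zero almost everywhere in 𝒪. It vanishes outside 𝒪 by definition of ℍ, so no regularity of the
boundary enters. -/
theorem dense_finite (hd : 1 ≤ d) (hO : IsOpen O) (hγ : γ ∈ Ioo (0 : ℝ) 1) (hq : 1 ≤ q) :
    Dense {u : L2O O | gagliardoSq γ u.toFun + lqInt q u < ∞} := by
  have hq0 : 0 < q := by linarith
  let W : Submodule ℝ (L2O O) :=
    { carrier := {u : L2O O | gagliardoSq γ u.toFun + lqInt q u < ∞}
      zero_mem' := by
        simp only [mem_ofPred_eq, gagliardoSq_zero, lqInt_zero hq0, add_zero,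
          ENNReal.zero_lt_top]
      add_mem' := by
        intro u v hu hv
        simp only [mem_ofPred_eq, ENNReal.add_lt_top] at hu hv ⊢
        refine ⟨(gagliardoSq_add_le u v).trans_lt (ENNReal.mul_lt_top (by norm_num)
          (ENNReal.add_lt_top.2 ⟨hu.1, hv.1⟩)), (lqInt_add_le hq u v).trans_lt
          (ENNReal.mul_lt_top (by finiteness) (ENNReal.add_lt_top.2 ⟨hu.2, hv.2⟩))⟩
      smul_mem' := by
        intro c u hu
        simp only [mem_ofPred_eq, ENNReal.add_lt_top] at hu ⊢
        refine ⟨?_, ?_⟩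
        · rw [gagliardoSq_smul]
          exact ENNReal.mul_lt_top (by finiteness) hu.1
        · have e : lqInt q (c • u) = ‖c‖ₑ ^ q * lqInt q u := by
            unfold lqInt
            rw [← lintegral_const_mul _ ((measurable_toFun u).enorm.pow_const q)]
            refine lintegral_congr_ae ((toFun_smul c u).mono fun x hx => ?_)
            simp only
            rw [hx, enorm_mul, ENNReal.mul_rpow_of_nonneg _ _ hq0.le]
          rw [e]
          exact ENNReal.mul_lt_top (by finiteness) hu.2 }
  change Dense (W : Set (L2O O))
  rw [Submodule.dense_iff_topologicalClosure_eq_top, Submodule.topologicalClosure_eq_top_iff,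
    Submodule.eq_bot_iff]
  intro w hw
  have hw0 : ∀ᵐ x, x ∈ O → w.toFun x = 0 := by
    refine hO.ae_eq_zero_of_integral_contDiff_smul_eq_zero ?_ fun f hf hfc hfO => ?_
    · exact ((memLp_toFun w).locallyIntegrable (by norm_num)).locallyIntegrableOn _
    · obtain ⟨φ, hφ, h1, h2⟩ := exists_testFunction hd hγ hq0 hf hfc hfO
      have h3 := (Submodule.mem_orthogonal _ _).1 hw φ (ENNReal.add_lt_top.2 ⟨h1, h2⟩)
      rw [inner_eq_integral] at h3
      rw [← h3]
      refine integral_congr_ae (hφ.mono fun x hx => ?_)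
      simp only [hx, smul_eq_mul]
  have : ‖w‖ ^ 2 = 0 := by
    rw [norm_sq_eq_integral]
    refine integral_eq_zero_of_ae ?_
    filter_upwards [hw0, toFun_eq_zero w] with x h1 h2
    by_cases hx : x ∈ O
    · simp [h1 hx]
    · simp [h2 hx]
  exact norm_eq_zero.1 (pow_eq_zero_iff two_ne_zero |>.1 this)

end Dense

end

end FracSkeleton

/-! ### The convex potential and the monotone form of A + f -/

namespace FracSkeleton

open Filter Topology

noncomputable section

/-- The primitive of `f` that vanishes at `0`. -/
def primitive (f : ℝ → ℝ) (r : ℝ) : ℝ := ∫ s in (0 : ℝ)..r, f s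

namespace Nonlin

variable {p k₁ k₂ k₃ : ℝ} {f : ℝ → ℝ} (hf : Nonlin p k₁ k₂ k₃ f)
variable {d : ℕ} {O : Set (EuclideanSpace ℝ (Fin d))}

include hf

/-- Between u and w the monotone function f stays on one side of f w. This is the tangent inequality
at w; convexity and coercivity of the primitive are derived from it. -/
theorem primitive_sub_le (u w : ℝ) : primitive f w - primitive f u ≤ f w * (w - u) := by
  have hi : ∀ a b, IntervalIntegrable f volume a b := fun a b => hf.cont.intervalIntegrable a b
  unfold primitive
  rw [intervalIntegral.integral_interval_sub_left (hi _ _) (hi _ _)]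
  rcases le_total u w with h | h
  · have h1 := intervalIntegral.integral_mono_on h (hi u w)
      (intervalIntegrable_const (c := f w)) fun x hx => hf.mono hx.2
    rw [intervalIntegral.integral_const, smul_eq_mul] at h1
    linarith
  · have h1 := intervalIntegral.integral_mono_on h (intervalIntegrable_const (c := f w))
      (hi w u) fun x hx => hf.mono hx.1
    rw [intervalIntegral.integral_const, smul_eq_mul] at h1
    rw [intervalIntegral.integral_symm]
    linarith

theorem primitive_nonneg (u : ℝ) : 0 ≤ primitive f u := by
  have h := hf.primitive_sub_le u 0
  rw [hf.map_zero, zero_mul] at h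
  have h0 : primitive f 0 = 0 := by simp [primitive]
  linarith

/-- The tangent at the midpoint, compared with both ends: the linear terms cancel. -/
theorem primitive_midpoint_le (u v : ℝ) :
    primitive f (2⁻¹ * (u + v)) ≤ (primitive f u + primitive f v) / 2 := by
  have h1 := hf.primitive_sub_le u (2⁻¹ * (u + v))
  have h2 := hf.primitive_sub_le v (2⁻¹ * (u + v))
  linarith

theorem primitive_le (u : ℝ) : primitive f u ≤ k₁ * |u| + 2 * k₁ * |u| ^ (p + 1) := by
  have h := hf.primitive_sub_le 0 u
  have h0 : primitive f 0 = 0 := by simp [primitive]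
  have h1 := hf.abs_mul_le u u
  have h2 := le_abs_self (f u * u)
  rw [sub_zero] at h
  linarith

/-- The tangent at u/2 gives primitive(u) ≥ primitive(u/2) + (u/2) f(u/2). The first term is
nonnegative, and the second is bounded below by coercivity. -/
theorem le_primitive (u : ℝ) : k₃ * |2⁻¹ * u| ^ (p + 1) - k₂ ≤ primitive f u := by
  have h := hf.primitive_sub_le u (2⁻¹ * u)
  have h1 := hf.coercive (2⁻¹ * u)
  have h2 := hf.primitive_nonneg (2⁻¹ * u)
  linarith

theorem continuous_primitive : Continuous (primitive f) :=
  intervalIntegral.continuous_primitive (fun a b => hf.cont.intervalIntegrable a b) 0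

theorem integrable_primitive (hO : MeasurableSet O) (hOf : volume O < ∞) {u : L2O O}
    (hu : lqInt (p + 1) u < ∞) : Integrable fun x => primitive f (u.toFun x) := by
  have hq : 0 < p + 1 := by linarith [hf.one_lt]
  refine (((integrable_abs_toFun hO hOf u).const_mul k₁).add
    ((integrable_rpow hq hu).const_mul (2 * k₁))).mono'
    (hf.continuous_primitive.measurable.comp (measurable_toFun u)).aestronglyMeasurable
    (Eventually.of_forall fun x => ?_)
  rw [Real.norm_of_nonneg (hf.primitive_nonneg _)]
  exact hf.primitive_le _

/-- Ensures that finite energy means exactly finite `Lam`. The additive constant in the coercivity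
is integrated over 𝒪 only, since u vanishes outside. -/
theorem lqInt_lt_top_of_primitive (hO : MeasurableSet O) (hOf : volume O < ∞) {u : L2O O}
    (hu : ∫⁻ x, ENNReal.ofReal (primitive f (u.toFun x)) < ∞) : lqInt (p + 1) u < ∞ := by
  have hq : 0 < p + 1 := by linarith [hf.one_lt]
  have hk := hf.pos₃
  set c : ℝ := (2 : ℝ) ^ (p + 1) / k₃ with hc
  have hc0 : 0 ≤ c := by positivity
  have hpt : ∀ᵐ x, ‖u.toFun x‖ₑ ^ (p + 1) ≤ ENNReal.ofReal c *
      (ENNReal.ofReal (primitive f (u.toFun x)) + O.indicator (fun _ => ENNReal.ofReal k₂) x) := by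
    filter_upwards [toFun_eq_zero u] with x hx
    by_cases hxO : x ∈ O
    · rw [indicator_of_mem hxO, ← ENNReal.ofReal_add (hf.primitive_nonneg _) hf.pos₂.le,
        ← ENNReal.ofReal_mul hc0, Real.enorm_eq_ofReal_abs,
        ENNReal.ofReal_rpow_of_nonneg (abs_nonneg _) hq.le]
      refine ENNReal.ofReal_le_ofReal ?_
      have h1 := hf.le_primitive (u.toFun x)
      rw [abs_mul, Real.mul_rpow (abs_nonneg _) (abs_nonneg _), abs_of_pos (by norm_num),
        Real.inv_rpow (by norm_num)] at h1
      have h2 : (2 : ℝ) ^ (p + 1) > 0 := by positivity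
      calc |u.toFun x| ^ (p + 1)
          = c * (k₃ * (((2 : ℝ) ^ (p + 1))⁻¹ * |u.toFun x| ^ (p + 1))) := by
            rw [hc]; field_simp
        _ ≤ _ := by gcongr; linarith
    · simp [hx hxO, hq]
  refine (lintegral_mono_ae hpt).trans_lt ?_
  have hm : Measurable fun x => ENNReal.ofReal (primitive f (u.toFun x)) :=
    (hf.continuous_primitive.measurable.comp (measurable_toFun u)).ennreal_ofReal
  have hm2 : Measurable fun x => ENNReal.ofReal (primitive f (u.toFun x))
      + O.indicator (fun _ => ENNReal.ofReal k₂) x := hm.add (measurable_const.indicator hO)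
  rw [lintegral_const_mul _ hm2, lintegral_add_left hm,
    lintegral_indicator hO, lintegral_const, Measure.restrict_apply_univ]
  exact ENNReal.mul_lt_top ENNReal.ofReal_lt_top (ENNReal.add_lt_top.2 ⟨hu,
    ENNReal.mul_lt_top ENNReal.ofReal_lt_top hOf⟩)

theorem integral_mul_self_ge (hO : MeasurableSet O) (hOf : volume O < ∞) {u : L2O O}
    (hu : lqInt (p + 1) u < ∞) :
    k₃ * (lqInt (p + 1) u).toReal - k₂ * volume.real O ≤ ∫ x, f (u.toFun x) * u.toFun x := by
  have hq : 0 < p + 1 := by linarith [hf.one_lt]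
  have i1 := (integrable_rpow hq hu).const_mul k₃
  have i2 : Integrable (O.indicator fun _ => k₂) (volume : Measure (EuclideanSpace ℝ (Fin d))) :=
    (integrable_indicator_iff hO).2 (integrableOn_const hOf.ne)
  have h : ∫ x, (k₃ * |u.toFun x| ^ (p + 1) - O.indicator (fun _ => k₂) x)
      ≤ ∫ x, f (u.toFun x) * u.toFun x := by
    refine integral_mono_ae (i1.sub i2) (hf.integrable_mul hO hOf hu hu) ?_
    filter_upwards [toFun_eq_zero u] with x hx
    by_cases hxO : x ∈ O
    · rw [indicator_of_mem hxO, mul_comm (f _)]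
      exact hf.coercive _
    · simp [hx hxO, hxO, hq.ne']
  rw [integral_sub i1 i2, integral_const_mul, ← toReal_lqInt hq, integral_indicator hO,
    setIntegral_const, smul_eq_mul, mul_comm (volume.real O)] at h
  exact h

theorem integral_mul_sub_nonneg (hO : MeasurableSet O) (hOf : volume O < ∞) {u v : L2O O}
    (hu : lqInt (p + 1) u < ∞) (hv : lqInt (p + 1) v < ∞) (huv : lqInt (p + 1) (u - v) < ∞) :
    0 ≤ (∫ x, f (u.toFun x) * (u - v).toFun x) - ∫ x, f (v.toFun x) * (u - v).toFun x := by
  rw [← integral_sub (hf.integrable_mul hO hOf hu huv) (hf.integrable_mul hO hOf hv huv)]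
  refine integral_nonneg_of_ae ((toFun_sub u v).mono fun x hx => ?_)
  simp only [Pi.zero_apply]
  rw [hx, ← sub_mul]
  rcases le_total (u.toFun x) (v.toFun x) with h | h
  · exact mul_nonneg_of_nonpos_of_nonpos (sub_nonpos.2 (hf.mono h)) (sub_nonpos.2 h)
  · exact mul_nonneg (sub_nonneg.2 (hf.mono h)) (sub_nonneg.2 h)

end Nonlin

section Potential

variable {d : ℕ} {O : Set (EuclideanSpace ℝ (Fin d))}

/-- The convex energy whose derivative is `A u + f(u)`. -/
def energy (γ δ : ℝ) (f : ℝ → ℝ) (u : L2O O) : ℝ≥0∞ :=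
  ENNReal.ofReal (δ / 2) * ‖u‖ₑ ^ 2 + ENNReal.ofReal (fracConst d γ / 4) * gagliardoSq γ u.toFun
    + ∫⁻ x, ENNReal.ofReal (primitive f (u.toFun x))

variable {p k₁ k₂ k₃ γ δ : ℝ} {f : ℝ → ℝ}

theorem lowerSemicontinuous_gagliardoSq :
    LowerSemicontinuous fun u : L2O O => gagliardoSq γ u.toFun := by
  have := lowerSemicontinuous_lintegral_quot (γ := γ) (O := O) univ
  simp_rw [Measure.restrict_univ, ← gagliardoSq_eq] at this
  exact this

theorem lowerSemicontinuous_energy (hf : Nonlin p k₁ k₂ k₃ f) :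
    LowerSemicontinuous (energy (O := O) γ δ f) := by
  refine LowerSemicontinuous.add (LowerSemicontinuous.add ?_ ?_) ?_
  · refine Continuous.lowerSemicontinuous ?_
    exact (ENNReal.continuous_const_mul ENNReal.ofReal_ne_top).comp
      ((ENNReal.continuous_pow 2).comp continuous_enorm)
  · exact (ENNReal.continuous_const_mul ENNReal.ofReal_ne_top).comp_lowerSemicontinuous
      (lowerSemicontinuous_gagliardoSq) fun a b hab => mul_le_mul_right hab _
  · exact lowerSemicontinuous_lintegral_comp (ψ := fun r => ENNReal.ofReal (primitive f r))
      (ENNReal.continuous_ofReal.comp hf.continuous_primitive).lowerSemicontinuous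

theorem energy_midpoint_le (hf : Nonlin p k₁ k₂ k₃ f) (u v : L2O O) :
    energy γ δ f ((2 : ℝ)⁻¹ • (u + v)) ≤ (energy γ δ f u + energy γ δ f v) / 2 := by
  have h1 : ‖(2 : ℝ)⁻¹ • (u + v)‖ₑ ^ 2 ≤ (‖u‖ₑ ^ 2 + ‖v‖ₑ ^ 2) / 2 := by
    have h := EvolEq.norm_midpoint_sub_sq u v 0
    simp only [sub_zero] at h
    have h' : ‖(2 : ℝ)⁻¹ • (u + v)‖ ^ 2 ≤ (‖u‖ ^ 2 + ‖v‖ ^ 2) / 2 := by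
      have := sq_nonneg ‖u - v‖
      linarith
    simp only [← ofReal_norm, ← ENNReal.ofReal_pow (norm_nonneg _)]
    rw [← ENNReal.ofReal_add (by positivity) (by positivity)]
    calc _ ≤ ENNReal.ofReal ((‖u‖ ^ 2 + ‖v‖ ^ 2) / 2) := ENNReal.ofReal_le_ofReal h'
      _ = _ := by rw [ENNReal.ofReal_div_of_pos two_pos]; simp
  have h2 : gagliardoSq γ ((2 : ℝ)⁻¹ • (u + v)).toFun ≤
      (gagliardoSq γ u.toFun + gagliardoSq γ v.toFun) / 2 := by
    rw [gagliardoSq_smul]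
    refine (mul_le_mul_right (gagliardoSq_add_le u v) _).trans (le_of_eq ?_)
    have e : ‖(2 : ℝ)⁻¹‖ₑ ^ 2 * 2 = (2 : ℝ≥0∞)⁻¹ := by
      have : ‖(2 : ℝ)⁻¹‖ₑ = (2 : ℝ≥0∞)⁻¹ := by
        rw [Real.enorm_of_nonneg (by norm_num), ENNReal.ofReal_inv_of_pos two_pos]
        simp
      rw [this, pow_two, mul_assoc, ENNReal.inv_mul_cancel (by norm_num) (by norm_num), mul_one]
    rw [← mul_assoc, e, ENNReal.div_eq_inv_mul]
  have hm : ∀ w : L2O O, Measurable fun x => ENNReal.ofReal (primitive f (w.toFun x)) := fun w =>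
    (hf.continuous_primitive.measurable.comp (measurable_toFun w)).ennreal_ofReal
  have h3 : ∫⁻ x, ENNReal.ofReal (primitive f (((2 : ℝ)⁻¹ • (u + v)).toFun x)) ≤
      ((∫⁻ x, ENNReal.ofReal (primitive f (u.toFun x)))
        + ∫⁻ x, ENNReal.ofReal (primitive f (v.toFun x))) / 2 := by
    have hm2 : Measurable fun x => ENNReal.ofReal (primitive f (u.toFun x))
      + ENNReal.ofReal (primitive f (v.toFun x)) := (hm u).add (hm v)
    rw [ENNReal.div_eq_inv_mul, ← lintegral_add_left (hm u), ← lintegral_const_mul _ hm2]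
    refine lintegral_mono_ae ?_
    filter_upwards [toFun_smul (2 : ℝ)⁻¹ (u + v), toFun_add u v] with x e1 e2
    rw [e1, e2, ← ENNReal.div_eq_inv_mul,
      ← ENNReal.ofReal_add (hf.primitive_nonneg _) (hf.primitive_nonneg _)]
    calc _ ≤ ENNReal.ofReal ((primitive f (u.toFun x) + primitive f (v.toFun x)) / 2) :=
          ENNReal.ofReal_le_ofReal (hf.primitive_midpoint_le _ _)
      _ = _ := by rw [ENNReal.ofReal_div_of_pos two_pos]; simp
  unfold energy
  refine (add_le_add (add_le_add (mul_le_mul_right h1 _) (mul_le_mul_right h2 _)) h3).trans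
    (le_of_eq ?_)
  simp only [ENNReal.div_eq_inv_mul]
  ring

theorem energy_lt_top_iff (hγ : γ ∈ Ioo (0 : ℝ) 1) (hf : Nonlin p k₁ k₂ k₃ f)
    (hO : MeasurableSet O) (hOf : volume O < ∞) (u : L2O O) :
    energy γ δ f u < ∞ ↔ gagliardoSq γ u.toFun + lqInt (p + 1) u < ∞ := by
  have hc := fracConst_pos d hγ
  have hc' : ENNReal.ofReal (fracConst d γ / 4) ≠ 0 := by
    rw [Ne, ENNReal.ofReal_eq_zero, not_le]; positivity
  unfold energy
  simp only [ENNReal.add_lt_top]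
  constructor
  · rintro ⟨⟨-, h2⟩, h3⟩
    exact ⟨ENNReal.lt_top_of_mul_ne_top_right h2.ne hc', hf.lqInt_lt_top_of_primitive hO hOf h3⟩
  · rintro ⟨h1, h2⟩
    refine ⟨⟨by finiteness, ENNReal.mul_lt_top ENNReal.ofReal_lt_top h1⟩, ?_⟩
    have := (hf.integrable_primitive hO hOf h2).2
    rw [hasFiniteIntegral_iff_ofReal (Eventually.of_forall fun x => hf.primitive_nonneg _)] at this
    exact this

theorem toReal_energy (hγ : γ ∈ Ioo (0 : ℝ) 1) (hδ : 0 < δ) (hf : Nonlin p k₁ k₂ k₃ f)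
    (hO : MeasurableSet O) (hOf : volume O < ∞) {u : L2O O}
    (hu : gagliardoSq γ u.toFun < ∞) (hu' : lqInt (p + 1) u < ∞) :
    (energy γ δ f u).toReal = formA γ δ u u / 2 + ∫ x, primitive f (u.toFun x) := by
  have hfin := (energy_lt_top_iff (δ := δ) hγ hf hO hOf u).2 (ENNReal.add_lt_top.2 ⟨hu, hu'⟩)
  have hc := fracConst_pos d hγ
  have hi := hf.integrable_primitive hO hOf hu'
  rw [integral_eq_lintegral_of_nonneg_ae (Eventually.of_forall fun x => hf.primitive_nonneg _)
    hi.aestronglyMeasurable, formA_self]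
  unfold energy at hfin ⊢
  simp only [ENNReal.add_lt_top] at hfin
  rw [ENNReal.toReal_add (ENNReal.add_lt_top.2 hfin.1).ne hfin.2.ne,
    ENNReal.toReal_add hfin.1.1.ne hfin.1.2.ne, ENNReal.toReal_mul, ENNReal.toReal_mul,
    ENNReal.toReal_ofReal (by positivity), ENNReal.toReal_ofReal (by positivity),
    ENNReal.toReal_pow, toReal_enorm]
  ring

/-- The tangent inequality at w for both parts of the energy: the quadratic part uses that the form
is nonnegative at w - u, the potential part is pointwise. -/
theorem energy_sub_le (hγ : γ ∈ Ioo (0 : ℝ) 1) (hδ : 0 < δ) (hf : Nonlin p k₁ k₂ k₃ f)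
    (hO : MeasurableSet O) (hOf : volume O < ∞) {u w : L2O O}
    (hu : gagliardoSq γ u.toFun < ∞) (hu' : lqInt (p + 1) u < ∞)
    (hw : gagliardoSq γ w.toFun < ∞) (hw' : lqInt (p + 1) w < ∞) :
    (energy γ δ f w).toReal - (energy γ δ f u).toReal
      ≤ formA γ δ w (w - u) + ∫ x, f (w.toFun x) * (w - u).toFun x := by
  rw [toReal_energy hγ hδ hf hO hOf hu hu', toReal_energy hγ hδ hf hO hOf hw hw']
  have hc := fracConst_pos d hγ
  have hq : 1 ≤ p + 1 := by linarith [hf.one_lt]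
  have hwu := gagliardoSq_sub_lt (γ := γ) hw hu
  have hwu' : lqInt (p + 1) (w - u) < ∞ := by
    have := lqInt_add_le hq w (-u)
    rw [lqInt_neg, ← sub_eq_add_neg] at this
    exact this.trans_lt (ENNReal.mul_lt_top (by finiteness) (ENNReal.add_lt_top.2 ⟨hw', hu'⟩))
  have h1 : formA γ δ w w / 2 - formA γ δ u u / 2 ≤ formA γ δ w (w - u) := by
    have h0 : 0 ≤ formA γ δ (w - u) (w - u) := by rw [formA_self]; positivity
    rw [formA_sub_left δ hw hu hwu, formA_sub_right δ hw hu hw,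
      formA_sub_right δ hw hu hu, formA_comm δ u w] at h0
    rw [formA_sub_right δ hw hu hw]
    linarith
  have h2 : (∫ x, primitive f (w.toFun x)) - ∫ x, primitive f (u.toFun x)
      ≤ ∫ x, f (w.toFun x) * (w - u).toFun x := by
    have i1 := hf.integrable_primitive hO hOf hw'
    have i2 := hf.integrable_primitive hO hOf hu'
    rw [← integral_sub i1 i2]
    refine integral_mono_ae (i1.sub i2) (hf.integrable_mul hO hOf hw' hwu')
      ((toFun_sub w u).mono fun x hx => ?_)
    simp only
    rw [hx]
    exact hf.primitive_sub_le _ _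
  linarith

end Potential

section MonotoneForm

variable {d : ℕ} {O : Set (EuclideanSpace ℝ (Fin d))} {p k₁ k₂ k₃ γ δ : ℝ} {f : ℝ → ℝ}

theorem toReal_add_le_left {a b : ℝ≥0∞} (h : a + b < ∞) : a.toReal ≤ (a + b).toReal :=
  ENNReal.toReal_mono h.ne le_self_add

theorem lam_add_le (hp : 1 < p) (u v : L2O O) :
    gagliardoSq γ (u + v).toFun + lqInt (p + 1) (u + v) ≤ ((2 : ℝ≥0) ^ (p + 1) : ℝ≥0) *
      (gagliardoSq γ u.toFun + lqInt (p + 1) u + (gagliardoSq γ v.toFun + lqInt (p + 1) v)) := by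
  have h1 := gagliardoSq_add_le (γ := γ) u v
  have h2 := lqInt_add_le (by linarith : 1 ≤ p + 1) u v
  have h3 : (2 : ℝ≥0∞) ≤ 2 ^ (p + 1) := by
    calc (2 : ℝ≥0∞) = 2 ^ (1 : ℝ) := by simp
      _ ≤ _ := ENNReal.rpow_le_rpow_of_exponent_le (by norm_num) (by linarith)
  rw [ENNReal.coe_rpow_of_nonneg _ (by linarith), ENNReal.coe_ofNat]
  calc _ ≤ 2 ^ (p + 1) * (gagliardoSq γ u.toFun + gagliardoSq γ v.toFun) +
        2 ^ (p + 1) * (lqInt (p + 1) u + lqInt (p + 1) v) :=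
        add_le_add (h1.trans (mul_le_mul_left h3 _)) h2
    _ = _ := by ring

theorem form_modulus (hO : MeasurableSet O) (hOf : volume O < ∞)
    (hγ : γ ∈ Ioo (0 : ℝ) 1) (hδ : 0 < δ) (hf : Nonlin p k₁ k₂ k₃ f) (φ : L2O O)
    (hφ : gagliardoSq γ φ.toFun + lqInt (p + 1) φ < ∞) {η : ℝ} (hη : 0 < η) :
    ∃ C : ℝ, 0 ≤ C ∧ ∀ u v : L2O O, gagliardoSq γ u.toFun + lqInt (p + 1) u < ∞ →
      gagliardoSq γ v.toFun + lqInt (p + 1) v < ∞ →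
      |(formA γ δ u φ + ∫ x, f (u.toFun x) * φ.toFun x)
        - (formA γ δ v φ + ∫ x, f (v.toFun x) * φ.toFun x)| ≤ C * ‖u - v‖
        + η * (1 + (gagliardoSq γ u.toFun + lqInt (p + 1) u).toReal
          + (gagliardoSq γ v.toFun + lqInt (p + 1) v).toReal) := by
  obtain ⟨hφ1, hφ2⟩ := ENNReal.add_lt_top.1 hφ
  obtain ⟨C₂, hC₂, h₂⟩ := hf.modulus hO hOf hφ2 (show 0 < η / 2 by positivity)
  obtain ⟨C₁, hC₁, h₁⟩ := formA_modulus (O := O) hγ hδ hφ1 (show 0 < η / 2 by positivity)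
  refine ⟨C₁ + C₂, by positivity, fun u v hu hv => ?_⟩
  obtain ⟨hu1, hu2⟩ := ENNReal.add_lt_top.1 hu
  obtain ⟨hv1, hv2⟩ := ENNReal.add_lt_top.1 hv
  have a := h₁ u v hu1 hv1
  have b := h₂ u v hu2 hv2
  rw [ENNReal.toReal_add hu1.ne hu2.ne, ENNReal.toReal_add hv1.ne hv2.ne]
  have c1 : 0 ≤ (gagliardoSq γ u.toFun).toReal := ENNReal.toReal_nonneg
  have c2 : 0 ≤ (gagliardoSq γ v.toFun).toReal := ENNReal.toReal_nonneg
  have c3 : 0 ≤ (lqInt (p + 1) u).toReal := ENNReal.toReal_nonneg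
  have c4 : 0 ≤ (lqInt (p + 1) v).toReal := ENNReal.toReal_nonneg
  rw [add_sub_add_comm]
  refine (abs_add_le _ _).trans ?_
  have c5 : 0 ≤ η / 2 * ((gagliardoSq γ u.toFun).toReal + (gagliardoSq γ v.toFun).toReal
    + (lqInt (p + 1) u).toReal + (lqInt (p + 1) v).toReal) := by positivity
  linarith

/-- The monotone form of `A u + f(u)` with `A = (-Δ)^γ + δ`. -/
def monotoneForm (hd : 1 ≤ d) (hO : IsOpen O) (hOf : volume O < ∞)
    (hγ : γ ∈ Ioo (0 : ℝ) 1) (hδ : 0 < δ) (hf : Nonlin p k₁ k₂ k₃ f) :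
    EvolEq.MonotoneForm (L2O O) where
  Lam u := gagliardoSq γ u.toFun + lqInt (p + 1) u
  form u φ := formA γ δ u φ + ∫ x, f (u.toFun x) * φ.toFun x
  -- The two tails match the two bounds: difference quotients off `nearSet`, and values above k.
  tail k u := (∫⁻ z in (nearSet d k)ᶜ, ‖quot γ u.toFun z‖ₑ ^ 2 ∂(volume.prod volume))
    + lqTail (p + 1) k u
  addConst := (2 : ℝ≥0) ^ (p + 1)
  coer := min δ (min (fracConst d γ / 2) k₃)
  coerConst := k₂ * volume.real O
  coer_pos := lt_min hδ (lt_min (by have := fracConst_pos d hγ; positivity) hf.pos₃)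
  Lam_lsc := (lowerSemicontinuous_gagliardoSq).add lowerSemicontinuous_lqInt
  Lam_zero := by
    rw [gagliardoSq_zero, lqInt_zero (by linarith [hf.one_lt]), add_zero]
  Lam_neg u := by rw [gagliardoSq_neg, lqInt_neg]
  Lam_add := lam_add_le hf.one_lt
  form_sub u φ ψ hu hφ hψ := by
    obtain ⟨hu1, hu2⟩ := ENNReal.add_lt_top.1 hu
    obtain ⟨hφ1, hφ2⟩ := ENNReal.add_lt_top.1 hφ
    obtain ⟨hψ1, hψ2⟩ := ENNReal.add_lt_top.1 hψ
    rw [formA_sub_right δ hφ1 hψ1 hu1, hf.integral_mul_sub hO.measurableSet hOf hu2 hφ2 hψ2]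
    ring
  tail_lsc k := (lowerSemicontinuous_lintegral_quot _).add (lowerSemicontinuous_lqTail k)
  tail_le k u := by
    refine add_le_add ?_ (lqTail_le k u)
    rw [gagliardoSq_eq]
    exact setLIntegral_le_lintegral _ _
  tail_tendsto u hu := by
    obtain ⟨hu1, hu2⟩ := ENNReal.add_lt_top.1 hu
    have := (tendsto_lintegral_nearSet_compl hu1).add (tendsto_lqTail hu2)
    rwa [add_zero] at this
  bound η hη := by
    obtain ⟨a₁, ha₁, h₁⟩ := formA_bound (O := O) hγ hδ hη
    obtain ⟨a₂, ha₂, h₂⟩ := hf.bound hO.measurableSet hOf hη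
    refine ⟨a₁ + a₂, by positivity, fun k => ?_⟩
    obtain ⟨C₁, hC₁, b₁⟩ := h₁ k
    obtain ⟨C₂, hC₂, b₂⟩ := h₂ k
    refine ⟨C₁ + C₂, by positivity, fun u ψ hu hψ => ?_⟩
    obtain ⟨hu1, hu2⟩ := ENNReal.add_lt_top.1 hu
    obtain ⟨hψ1, hψ2⟩ := ENNReal.add_lt_top.1 hψ
    have c1 := b₁ u ψ hu1 hψ1
    have c2 := b₂ u ψ hu2 hψ2
    have ht1 : ∫⁻ z in (nearSet d k)ᶜ, ‖quot γ u.toFun z‖ₑ ^ 2 ∂(volume.prod volume) < ∞ := by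
      rw [gagliardoSq_eq] at hu1
      exact (setLIntegral_le_lintegral _ _).trans_lt hu1
    have ht2 : lqTail (p + 1) k u < ∞ := (lqTail_le k u).trans_lt hu2
    rw [ENNReal.toReal_add ht1.ne ht2.ne, ENNReal.toReal_add hψ1.ne hψ2.ne]
    refine (abs_add_le _ _).trans ((add_le_add c1 c2).trans ?_)
    have e1 : 0 ≤ (∫⁻ z in (nearSet d k)ᶜ, ‖quot γ u.toFun z‖ₑ ^ 2 ∂(volume.prod volume)).toReal :=
      ENNReal.toReal_nonneg
    have e2 : 0 ≤ (lqTail (p + 1) k u).toReal := ENNReal.toReal_nonneg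
    have e3 := mul_nonneg ha₁ e2
    have e4 := mul_nonneg ha₂ e1
    have e5 : 0 ≤ C₁ * ‖ψ‖ := by positivity
    have e6 : 0 ≤ C₂ * (‖u‖ * ‖ψ‖) := by positivity
    linarith
  modulus φ hφ η hη := form_modulus hO.measurableSet hOf hγ hδ hf φ hφ hη
  mono u v hu hv := by
    obtain ⟨hu1, hu2⟩ := ENNReal.add_lt_top.1 hu
    obtain ⟨hv1, hv2⟩ := ENNReal.add_lt_top.1 hv
    have hw := gagliardoSq_sub_lt (γ := γ) hu1 hv1
    have hw' : lqInt (p + 1) (u - v) < ∞ := by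
      have := lqInt_add_le (by linarith [hf.one_lt]) u (-v) (q := p + 1)
      rw [lqInt_neg, ← sub_eq_add_neg] at this
      exact this.trans_lt (ENNReal.mul_lt_top (by finiteness) (ENNReal.add_lt_top.2 ⟨hu2, hv2⟩))
    have h1 := hf.integral_mul_sub_nonneg hO.measurableSet hOf hu2 hv2 hw'
    have h2 : 0 ≤ formA γ δ (u - v) (u - v) := by
      have := fracConst_pos d hγ
      rw [formA_self]
      positivity
    rw [formA_sub_left δ hu1 hv1 hw] at h2
    linarith
  coercive u hu := by
    obtain ⟨hu1, hu2⟩ := ENNReal.add_lt_top.1 hu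
    have h1 := hf.integral_mul_self_ge hO.measurableSet hOf hu2
    rw [ENNReal.toReal_add hu1.ne hu2.ne, formA_self]
    have c1 : min δ (min (fracConst d γ / 2) k₃) ≤ δ := min_le_left _ _
    have c2 : min δ (min (fracConst d γ / 2) k₃) ≤ fracConst d γ / 2 :=
      (min_le_right _ _).trans (min_le_left _ _)
    have c3 : min δ (min (fracConst d γ / 2) k₃) ≤ k₃ := (min_le_right _ _).trans (min_le_right _ _)
    have e1 := mul_le_mul_of_nonneg_right c1 (sq_nonneg ‖u‖)
    have e2 := mul_le_mul_of_nonneg_right c2 (ENNReal.toReal_nonneg (a := gagliardoSq γ u.toFun))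
    have e3 := mul_le_mul_of_nonneg_right c3 (ENNReal.toReal_nonneg (a := lqInt (p + 1) u))
    linarith
  -- A + f is the derivative of the convex `energy`, so its resolvent equation is solved by
  -- minimisation.
  resolvent τ hτ f' := by
    refine EvolEq.exists_resolvent_of_potential (J := energy γ δ f)
      (Lam := fun u => gagliardoSq γ u.toFun + lqInt (p + 1) u)
      (form := fun u φ => formA γ δ u φ + ∫ x, f (u.toFun x) * φ.toFun x)
      (lowerSemicontinuous_energy hf) (energy_midpoint_le hf) ?_
      (energy_lt_top_iff hγ hf hO.measurableSet hOf) ?_ ?_ (lam_add_le hf.one_lt) ?_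
      (fun φ hφ η hη => form_modulus hO.measurableSet hOf hγ hδ hf φ hφ hη) hτ f'
    · rw [gagliardoSq_zero, lqInt_zero (by linarith [hf.one_lt]), add_zero]
      exact ENNReal.zero_lt_top
    · intro u w hu hw
      obtain ⟨hu1, hu2⟩ := ENNReal.add_lt_top.1 hu
      obtain ⟨hw1, hw2⟩ := ENNReal.add_lt_top.1 hw
      exact energy_sub_le hγ hδ hf hO.measurableSet hOf hu1 hu2 hw1 hw2
    · intro u φ c _ _
      have h1 := formA_smul_right (γ := γ) δ u φ c
      have h2 := integral_mul_smul f u φ c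
      rw [mul_add, ← h1, ← h2]
    · intro u c hc
      refine add_le_add ?_ (lqInt_smul_le (by linarith [hf.one_lt]) u hc)
      refine (gagliardoSq_smul c u).le.trans ?_
      refine mul_le_of_le_one_left (zero_le) (pow_le_one₀ (zero_le) ?_)
      rw [Real.enorm_eq_ofReal_abs]
      exact ENNReal.ofReal_le_one.2 hc
  dense := dense_finite hd hO hγ (by linarith [hf.one_lt])

end MonotoneForm

end

end FracSkeleton

/-! ### Entropy inequalities and uniform exponential integrability -/

namespace FracSkeleton

open Filter Topology InformationTheory

noncomputable section

section Scalar

/-- With s = √x one has klFun x = (s - 1)² + 2 s klFun s, and the last term is nonnegative. -/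
theorem sqrt_sub_one_sq_le_klFun {x : ℝ} (hx : 0 ≤ x) : (√x - 1) ^ 2 ≤ klFun x := by
  rcases hx.eq_or_lt with rfl | hx
  · simp [klFun_zero]
  have h0 : 0 < √x := Real.sqrt_pos.2 hx
  have h1 := klFun_nonneg h0.le
  have h2 := mul_nonneg h0.le h1
  have h3 : √x ^ 2 = x := Real.sq_sqrt hx.le
  have h4 : Real.log x = 2 * Real.log √x := by
    rw [Real.log_sqrt hx.le]; ring
  rw [klFun_apply] at h2 ⊢
  rw [h4]
  nlinarith

/-- (x - 1)² = (√x - 1)² (√x + 1)², and (√2 + 1)² is just below 6. -/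
theorem sub_one_sq_le_klFun {x : ℝ} (hx : 0 ≤ x) (hx2 : x ≤ 2) : (x - 1) ^ 2 ≤ 6 * klFun x := by
  have h1 := sqrt_sub_one_sq_le_klFun hx
  have h0 := Real.sqrt_nonneg x
  have h3 : √x ^ 2 = x := Real.sq_sqrt hx
  have e : (x - 1) ^ 2 = (√x - 1) ^ 2 * (√x + 1) ^ 2 := by
    rw [← mul_pow]; congr 1; nlinarith
  have h4 : √x ≤ 1.42 := by
    rw [Real.sqrt_le_left (by norm_num)]
    norm_num
    linarith
  have h5 : (√x + 1) ^ 2 ≤ 6 := by nlinarith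
  rw [e]
  nlinarith [sq_nonneg (√x - 1)]

theorem one_le_klFun {x : ℝ} (hx : 2 ≤ x) : 1 ≤ 6 * klFun x := by
  have h1 := sqrt_sub_one_sq_le_klFun (by linarith : 0 ≤ x)
  have h2 : (1.41 : ℝ) ≤ √x := by
    rw [Real.le_sqrt (by norm_num) (by linarith)]
    norm_num
    linarith
  have h3 : √2 ≤ √x := Real.sqrt_le_sqrt hx
  have h4 : (1.4142 : ℝ) ≤ √2 := by
    rw [Real.le_sqrt (by norm_num) (by norm_num)]
    norm_num
  nlinarith

/-- Convex duality between klFun and exp x - 1, obtained from t + 1 ≤ exp t at t = x - log y. -/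
theorem mul_le_klFun_add_exp {x y : ℝ} (hy : 0 < y) : y * x ≤ klFun y + Real.exp x - 1 := by
  have h := Real.add_one_le_exp (x - Real.log y)
  rw [Real.exp_sub, Real.exp_log hy, le_div_iff₀ hy] at h
  rw [klFun_apply]
  linarith

/-- Completing the square in x ≤ 1/(4κ) + κ x² lets a Gaussian exponential with any κ > 0 replace
exp x. -/
theorem mul_le_klFun_add_exp_sq {κ : ℝ} (hκ : 0 < κ) {x y : ℝ} (hy : 0 < y) :
    y * x ≤ klFun y + Real.exp (1 / (4 * κ)) * Real.exp (κ * x ^ 2) := by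
  have h := mul_le_klFun_add_exp (x := x) hy
  have h1 : x ≤ 1 / (4 * κ) + κ * x ^ 2 := by
    have : 0 ≤ κ * (x - 1 / (2 * κ)) ^ 2 := by positivity
    have e : κ * (x - 1 / (2 * κ)) ^ 2 = 1 / (4 * κ) + κ * x ^ 2 - x := by field_simp; ring
    linarith
  have h2 := Real.exp_le_exp.2 h1
  rw [Real.exp_add] at h2
  linarith

/-- The Gaussian exponential `exp (κ n²)` with values in `[0, ∞]`. -/
def gexp (κ : ℝ) (n : ℝ≥0∞) : ℝ≥0∞ := EReal.exp ((ENNReal.ofReal κ * n ^ 2 : ℝ≥0∞) : EReal)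

theorem gexp_top {κ : ℝ} (hκ : 0 < κ) : gexp κ ∞ = ∞ := by
  have : ENNReal.ofReal κ * ∞ ^ 2 = ∞ := by
    rw [ENNReal.top_pow two_ne_zero, ENNReal.mul_top (by simpa using hκ)]
  rw [gexp, this, EReal.coe_ennreal_top, EReal.exp_top]

theorem gexp_ofReal {κ : ℝ} (hκ : 0 < κ) {m : ℝ} (hm : 0 ≤ m) :
    gexp κ (ENNReal.ofReal m) = ENNReal.ofReal (Real.exp (κ * m ^ 2)) := by
  rw [gexp, ← ENNReal.ofReal_pow hm, ← ENNReal.ofReal_mul hκ.le, EReal.coe_ennreal_ofReal,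
    max_eq_left (by positivity), EReal.exp_coe]

theorem measurable_gexp (κ : ℝ) : Measurable (gexp κ) :=
  EReal.exp_monotone.measurable.comp
    (measurable_coe_ennreal_ereal.comp ((measurable_id.pow_const 2).const_mul _))

/-- The part of the weight that comes from the large values of the control. -/
def bigJump (κ : ℝ) (n : ℝ≥0∞) (r : ℝ≥0) : ℝ≥0∞ :=
  {r : ℝ≥0 | 2 < r}.indicator (fun _ => ENNReal.ofReal (Real.exp (1 / (4 * κ))) * gexp κ n) r

/-- The pointwise estimate for both jump bounds: a is a size or an increment of h, D is 1 + |x| or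
|x - y|, and n is the corresponding supremum norm. Values r > 2 are handled by duality. For r ≤ 2,
(r - 1)² is an entropy, and the remaining a²/D is what the mean square conditions on h control. -/
theorem enorm_sub_one_mul_le {κ : ℝ} (hκ : 0 < κ) (r : ℝ≥0) {a n D : ℝ≥0∞} (hD0 : D ≠ 0)
    (hD : D ≠ ∞) (ha : a ≤ n * D) : ‖(r : ℝ) - 1‖ₑ * a ≤
      D * (6 * ENNReal.ofReal (klFun r) + bigJump κ n r) + a ^ 2 / D := by
  have h6 : (6 : ℝ≥0∞) * ENNReal.ofReal (klFun r) = ENNReal.ofReal (6 * klFun r) := by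
    rw [ENNReal.ofReal_mul (by norm_num)]; simp
  by_cases hr : 2 < r
  · have hr' : (2 : ℝ) < r := by exact_mod_cast hr
    have hb : bigJump κ n r = ENNReal.ofReal (Real.exp (1 / (4 * κ))) * gexp κ n :=
      indicator_of_mem (by exact hr) _
    rw [hb]
    rcases eq_or_ne n ∞ with rfl | hn
    · rw [gexp_top hκ, ENNReal.mul_top (by simp [Real.exp_pos]), add_top, ENNReal.mul_top hD0,
        top_add]
      exact le_top
    · refine le_trans ?_ le_self_add
      have hk := klFun_nonneg (by linarith : (0 : ℝ) ≤ r)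
      have h1 := mul_le_klFun_add_exp_sq hκ (x := n.toReal) (by linarith : (0 : ℝ) < r)
      have h2 : ENNReal.ofReal r * n ≤ 6 * ENNReal.ofReal (klFun r)
          + ENNReal.ofReal (Real.exp (1 / (4 * κ))) * gexp κ n := by
        rw [h6]
        conv_lhs => rw [← ENNReal.ofReal_toReal hn]
        conv_rhs => rw [← ENNReal.ofReal_toReal hn]
        rw [gexp_ofReal hκ ENNReal.toReal_nonneg, ← ENNReal.ofReal_mul (by linarith),
          ← ENNReal.ofReal_mul (by positivity), ← ENNReal.ofReal_add (by positivity)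
          (by positivity)]
        exact ENNReal.ofReal_le_ofReal (by linarith)
      calc ‖(r : ℝ) - 1‖ₑ * a ≤ ENNReal.ofReal r * (n * D) := by
            gcongr
            rw [Real.enorm_of_nonneg (by linarith)]
            exact ENNReal.ofReal_le_ofReal (by linarith)
        _ = D * (ENNReal.ofReal r * n) := by ring
        _ ≤ _ := by gcongr
  · have hr' : (r : ℝ) ≤ 2 := by exact_mod_cast not_lt.1 hr
    have hx : ‖(r : ℝ) - 1‖ₑ ^ 2 ≤ 6 * ENNReal.ofReal (klFun r) := by
      rw [h6, Real.enorm_eq_ofReal_abs, ← ENNReal.ofReal_pow (abs_nonneg _), sq_abs]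
      exact ENNReal.ofReal_le_ofReal (sub_one_sq_le_klFun r.2 hr')
    set x := ‖(r : ℝ) - 1‖ₑ
    -- Young's inequality by cases: x a is at most D x² or at most a²/D.
    rcases le_total a (D * x) with h | h
    · calc x * a ≤ x * (D * x) := by gcongr
        _ = D * x ^ 2 := by ring
        _ ≤ D * (6 * ENNReal.ofReal (klFun r) + bigJump κ n r) := by
            gcongr; exact hx.trans le_self_add
        _ ≤ _ := le_self_add
    · have h1 : x ≤ a / D := by
        rw [ENNReal.le_div_iff_mul_le (Or.inl hD0) (Or.inl hD), mul_comm]; exact h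
      calc x * a ≤ a / D * a := by gcongr
        _ = a ^ 2 / D := by rw [pow_two, ENNReal.mul_div_right_comm]
        _ ≤ _ := le_add_self

end Scalar

section Uniform

variable {E : Type*} [MeasurableSpace E] {T : ℝ} {ν : Measure E} [SigmaFinite ν]

theorem timeMeasure_strip_le (s t : ℝ) (B : Set E) :
    timeMeasure T ν (Ioc s t ×ˢ B) ≤ ENNReal.ofReal (t - s) * ν B := by
  rw [timeMeasure, Measure.prod_prod]
  gcongr
  refine (Measure.restrict_apply_le _ _).trans ?_
  rw [Real.volume_Ioc]

/-- The measure `λ_T` has no atoms: sets of infinite measure have subsets of any finite measure. -/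
theorem exists_subset_timeMeasure_eq {S : Set (ℝ × E)} (hS : MeasurableSet S)
    (hSt : timeMeasure T ν S = ∞) {r : ℝ≥0∞} (hr : r < ∞) :
    ∃ Y ⊆ S, MeasurableSet Y ∧ timeMeasure T ν Y = r := by
  set μ := timeMeasure T ν with hμ
  have hmono : Monotone fun m => S ∩ (univ ×ˢ spanningSets ν m) := fun m n hmn =>
    inter_subset_inter_right _ (prod_mono_right (monotone_spanningSets ν hmn))
  have hunion : ⋃ m, S ∩ (univ ×ˢ spanningSets ν m) = S := by
    rw [← inter_iUnion, ← prod_iUnion, iUnion_spanningSets, univ_prod_univ, inter_univ]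
  have htend := tendsto_measure_iUnion_atTop (μ := μ) hmono
  rw [hunion, hSt] at htend
  obtain ⟨m, hm⟩ := (htend.eventually_const_lt hr).exists
  set B := spanningSets ν m with hB
  have hBm : MeasurableSet B := measurableSet_spanningSets ν m
  have hBf : ν B < ∞ := measure_spanningSets_lt_top ν m
  set S' := S ∩ (univ ×ˢ B) with hS'
  have hS'm : MeasurableSet S' := hS.inter (MeasurableSet.univ.prod hBm)
  have hS'f : μ S' < ∞ := by
    refine (measure_mono (inter_subset_right)).trans_lt ?_
    rw [hμ, timeMeasure, Measure.prod_prod]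
    refine ENNReal.mul_lt_top ?_ hBf
    rw [Measure.restrict_apply_univ, Real.volume_Icc]
    exact ENNReal.ofReal_lt_top
  -- After a reduction to finite measure, the set is cut at time t. Since the time marginal is
  -- Lebesgue measure, the measure of the cut is Lipschitz in t, and the intermediate value theorem
  -- applies.
  set V : ℝ → Set (ℝ × E) := fun t => S' ∩ (Iic t ×ˢ univ) with hV
  have hVf : ∀ t, μ (V t) < ∞ := fun t => (measure_mono inter_subset_left).trans_lt hS'f
  have hlip : LipschitzWith (ν B).toNNReal fun t => (μ (V t)).toReal := by
    refine LipschitzWith.of_le_add_mul _ fun x y => ?_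
    have hsub : V x ⊆ V y ∪ (Ioc y (max x y) ×ˢ B) := by
      rintro z ⟨hz, hzx⟩
      by_cases hzy : z.1 ≤ y
      · exact Or.inl ⟨hz, hzy, mem_univ _⟩
      · exact Or.inr ⟨⟨not_le.1 hzy, le_max_of_le_left hzx.1⟩, hz.2.2⟩
    have h1 : μ (V x) ≤ μ (V y) + ENNReal.ofReal (dist x y) * ν B := by
      refine (measure_mono hsub).trans ((measure_union_le _ _).trans ?_)
      gcongr
      refine (timeMeasure_strip_le _ _ B).trans ?_
      gcongr
      rw [Real.dist_eq]
      rcases max_choice x y with h | h <;> rw [h]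
      · exact le_abs_self _
      · simp
    have h2 := ENNReal.toReal_mono (by finiteness) h1
    rw [ENNReal.toReal_add (hVf y).ne (by finiteness), ENNReal.toReal_mul,
      ENNReal.toReal_ofReal dist_nonneg, mul_comm (dist x y)] at h2
    exact h2
  have hlow : μ (V (-1)) = 0 := by
    refine measure_mono_null (t := Iic (-1 : ℝ) ×ˢ univ) inter_subset_right ?_
    rw [hμ, timeMeasure, Measure.prod_prod, Measure.restrict_apply measurableSet_Iic]
    have : Iic (-1 : ℝ) ∩ Icc 0 T = ∅ := by
      ext x
      simp only [mem_inter_iff, mem_Iic, mem_Icc, mem_empty_iff_false, iff_false, not_and]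
      intro h1 h2
      linarith
    rw [this, measure_empty, zero_mul]
  have hhigh : μ (V (max T 0)) = μ S' := by
    have hnull : μ (Ioi (max T 0) ×ˢ univ) = 0 := by
      rw [hμ, timeMeasure, Measure.prod_prod, Measure.restrict_apply measurableSet_Ioi]
      have : Ioi (max T 0) ∩ Icc 0 T = ∅ := by
        ext x
        simp only [mem_inter_iff, mem_Ioi, mem_Icc, mem_empty_iff_false, iff_false, not_and,
          max_lt_iff]
        intro h1 h2
        linarith
      rw [this, measure_empty, zero_mul]
    refine le_antisymm (measure_mono inter_subset_left) ?_
    calc μ S' ≤ μ (V (max T 0) ∪ Ioi (max T 0) ×ˢ univ) := by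
          refine measure_mono fun z hz => ?_
          by_cases h : z.1 ≤ max T 0
          · exact Or.inl ⟨hz, h, mem_univ _⟩
          · exact Or.inr ⟨not_le.1 h, mem_univ _⟩
      _ ≤ _ := (measure_union_le _ _).trans (by rw [hnull, add_zero])
  have hivt := intermediate_value_Icc (show (-1 : ℝ) ≤ max T 0 from
    (by norm_num : (-1 : ℝ) ≤ 0).trans (le_max_right _ _)) hlip.continuous.continuousOn
  obtain ⟨t, -, ht⟩ := hivt (show r.toReal ∈ _ by
    rw [hlow, hhigh]
    exact ⟨by simp, ENNReal.toReal_mono hS'f.ne hm.le⟩)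
  refine ⟨V t, inter_subset_left.trans inter_subset_left,
    hS'm.inter (measurableSet_Iic.prod MeasurableSet.univ), ?_⟩
  exact (ENNReal.toReal_eq_toReal_iff' (hVf t).ne hr.ne).1 ht

/-- Otherwise each set {f > 4ʲ} contains a piece of measure 2⁻ʲ. The union of the pieces has finite
measure, while the integral of f over it is at least 2ʲ for every j. -/
theorem exists_level_lt_top {f : ℝ × E → ℝ≥0∞} (hfm : Measurable f)
    (hf : ∀ X, MeasurableSet X → timeMeasure T ν X < ∞ → ∫⁻ z in X, f z ∂(timeMeasure T ν) < ∞) :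
    ∃ N : ℕ, timeMeasure T ν {z | (4 : ℝ≥0∞) ^ N < f z} < ∞ := by
  set μ := timeMeasure T ν with hμ
  by_contra hcon
  push Not at hcon
  have hex : ∀ j : ℕ, ∃ Y ⊆ {z | (4 : ℝ≥0∞) ^ j < f z}, MeasurableSet Y ∧ μ Y = (2⁻¹ : ℝ≥0∞) ^ j :=
    fun j => exists_subset_timeMeasure_eq (measurableSet_lt measurable_const hfm)
      (top_le_iff.1 (hcon j)) (by finiteness)
  choose Y hYs hYm hYμ using hex
  have hfin : μ (⋃ j, Y j) < ∞ := by
    refine (measure_iUnion_le _).trans_lt ?_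
    simp_rw [hYμ]
    rw [ENNReal.tsum_geometric, ENNReal.one_sub_inv_two, inv_inv]
    norm_num
  have h := hf _ (MeasurableSet.iUnion hYm) hfin
  refine h.ne (ENNReal.eq_top_of_forall_nnreal_le fun r => ?_)
  obtain ⟨j, hj⟩ := exists_nat_gt (r : ℝ≥0)
  calc (r : ℝ≥0∞) ≤ (j : ℝ≥0∞) := by exact_mod_cast hj.le
    _ ≤ (2 : ℝ≥0∞) ^ j := by exact_mod_cast Nat.lt_two_pow_self.le
    _ = 4 ^ j * μ (Y j) := by
        rw [hYμ, ← mul_pow]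
        congr 1
        have : (4 : ℝ≥0∞) = 2 * 2 := by norm_num
        rw [this, mul_assoc, ENNReal.mul_inv_cancel (by norm_num) (by norm_num), mul_one]
    _ = ∫⁻ _ in Y j, 4 ^ j ∂μ := by rw [setLIntegral_const]
    _ ≤ ∫⁻ z in Y j, f z ∂μ := setLIntegral_mono' (hYm j) fun z hz => (hYs j hz).le
    _ ≤ ∫⁻ z in ⋃ j, Y j, f z ∂μ := lintegral_mono_set (subset_iUnion _ _)

/-- Split at a level whose superlevel set A has finite measure: A contributes a fixed finite
integral, and off A the function is bounded, hence contributes at most a multiple of the measure of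
X. The uniformity is needed because X = {ρ > 2} varies with the control. -/
theorem ExpIntegrable.uniform {n : ℝ → E → ℝ≥0∞} (hn : ExpIntegrable T ν n) :
    ∃ κ : ℝ, 0 < κ ∧ ∀ K : ℝ≥0∞, K < ∞ → ∃ M : ℝ≥0∞, M < ∞ ∧ ∀ X : Set (ℝ × E),
      timeMeasure T ν X ≤ K → ∫⁻ z in X, gexp κ (n z.1 z.2) ∂(timeMeasure T ν) ≤ M := by
  obtain ⟨hnm, κ, hκ, hint⟩ := hn
  refine ⟨κ, hκ, fun K hK => ?_⟩
  set f : ℝ × E → ℝ≥0∞ := fun z => gexp κ (hnm.mk _ z) with hf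
  have hfm : Measurable f := (measurable_gexp κ).comp hnm.measurable_mk
  have hae : (fun z : ℝ × E => gexp κ (n z.1 z.2)) =ᵐ[timeMeasure T ν] f :=
    hnm.ae_eq_mk.mono fun z hz => by
      simp only [hf]
      rw [← hz]
      rfl
  have heq : ∀ X : Set (ℝ × E), ∫⁻ z in X, gexp κ (n z.1 z.2) ∂(timeMeasure T ν)
      = ∫⁻ z in X, f z ∂(timeMeasure T ν) := fun X =>
    lintegral_congr_ae (ae_restrict_of_ae hae)
  have hint' : ∀ X, MeasurableSet X → timeMeasure T ν X < ∞ →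
      ∫⁻ z in X, f z ∂(timeMeasure T ν) < ∞ := fun X hX hXf => by
    rw [← heq]; exact hint X hX hXf
  obtain ⟨N, hN⟩ := exists_level_lt_top hfm hint'
  set A := {z | (4 : ℝ≥0∞) ^ N < f z} with hA
  have hAm : MeasurableSet A := measurableSet_lt measurable_const hfm
  refine ⟨(∫⁻ z in A, f z ∂(timeMeasure T ν)) + 4 ^ N * K, ENNReal.add_lt_top.2
    ⟨hint' A hAm hN, ENNReal.mul_lt_top (by finiteness) hK⟩, fun X hX => ?_⟩
  rw [heq]
  calc ∫⁻ z in X, f z ∂(timeMeasure T ν)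
      ≤ ∫⁻ z in X, (A.indicator f z + 4 ^ N) ∂(timeMeasure T ν) := by
        refine lintegral_mono fun z => ?_
        by_cases hz : z ∈ A
        · rw [indicator_of_mem hz]; exact le_self_add
        · rw [indicator_of_notMem hz, zero_add]; exact not_lt.1 hz
    _ = (∫⁻ z in X, A.indicator f z ∂(timeMeasure T ν)) + 4 ^ N * timeMeasure T ν X := by
        rw [lintegral_add_left (hfm.indicator hAm), setLIntegral_const]
    _ ≤ (∫⁻ z, A.indicator f z ∂(timeMeasure T ν)) + 4 ^ N * K := by
        gcongr
        exact Measure.restrict_le_self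
    _ = _ := by rw [lintegral_indicator hAm]

end Uniform

end

end FracSkeleton

/-! ### Sums of perturbations and the affine term -/

namespace EvolEq

noncomputable section

theorem IsPerturbation.add {H : Type*} [NormedAddCommGroup H] {T : ℝ} {b₁ b₂ : ℝ → ℝ}
    {G₁ G₂ : ℝ → H → H} (h₁ : IsPerturbation T b₁ G₁) (h₂ : IsPerturbation T b₂ G₂) :
    IsPerturbation T (fun s => b₁ s + b₂ s) (fun s x => G₁ s x + G₂ s x) where
  nonneg s := add_nonneg (h₁.nonneg s) (h₂.nonneg s)
  integrable := h₁.integrable.add h₂.integrable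
  meas u hu := (h₁.meas u hu).add (h₂.meas u hu)
  growth := by
    filter_upwards [h₁.growth, h₂.growth] with s a b x
    refine (norm_add_le _ _).trans ((add_le_add (a x) (b x)).trans (le_of_eq ?_))
    ring
  lipschitz R hR := by
    obtain ⟨L₁, hL₁, l₁⟩ := h₁.lipschitz R hR
    obtain ⟨L₂, hL₂, l₂⟩ := h₂.lipschitz R hR
    refine ⟨L₁ + L₂, by positivity, ?_⟩
    filter_upwards [l₁, l₂] with s a b x y hx hy
    rw [add_sub_add_comm]
    refine (norm_add_le _ _).trans ((add_le_add (a x y hx hy) (b x y hx hy)).trans ?_)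
    have c₁ : 0 ≤ L₂ * b₁ s * ‖x - y‖ :=
      mul_nonneg (mul_nonneg hL₂.le (h₁.nonneg s)) (norm_nonneg _)
    have c₂ : 0 ≤ L₁ * b₂ s * ‖x - y‖ :=
      mul_nonneg (mul_nonneg hL₁.le (h₂.nonneg s)) (norm_nonneg _)
    linarith

/-- Covers the term k u - F(0) 1_𝒪 that appears when F is replaced by its monotone modification. -/
theorem isPerturbation_affine {H : Type*} [NormedAddCommGroup H] [NormedSpace ℝ H] {T k : ℝ}
    (hk : 0 ≤ k) (e : H) : IsPerturbation T (fun _ => k + ‖e‖) (fun _ x => k • x + e) where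
  nonneg _ := by positivity
  integrable := integrableOn_const (by simp)
  meas u hu := ((hu.const_smul k).add continuousOn_const).aestronglyMeasurable measurableSet_Icc
  growth := by
    refine Filter.Eventually.of_forall fun _ x => (norm_add_le _ _).trans ?_
    rw [norm_smul, Real.norm_of_nonneg hk]
    have h1 : 0 ≤ k := hk
    have h2 : 0 ≤ ‖e‖ * ‖x‖ := by positivity
    linarith
  lipschitz R hR := by
    refine ⟨1, one_pos, Filter.Eventually.of_forall fun _ x y _ _ => ?_⟩
    rw [add_sub_add_right_eq_sub, ← smul_sub, norm_smul, Real.norm_of_nonneg hk, one_mul]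
    gcongr
    linarith [norm_nonneg e]

end

end EvolEq

/-! ### The controlled noise term and the rate of the jump term -/

namespace FracSkeleton

open Filter Topology InformationTheory

noncomputable section

section Noise

variable {ι U H : Type*} [NormedAddCommGroup U] [InnerProductSpace ℝ U]
  [NormedAddCommGroup H] [InnerProductSpace ℝ H]

/-- The operator norm is at most the Hilbert-Schmidt norm: expand x in the basis and apply
Cauchy-Schwarz to the coefficients, using Bessel's inequality. -/
theorem norm_apply_le_of_hsNormSq_le (a : HilbertBasis ι ℝ U) {S : U →L[ℝ] H} {C : ℝ} (hC : 0 ≤ C)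
    (hS : hsNormSq a S ≤ ENNReal.ofReal C) (x : U) : ‖S x‖ ≤ √C * ‖x‖ := by
  have hsum := (a.hasSum_repr x).mapL S
  refine le_of_tendsto hsum.norm (Eventually.of_forall fun s => ?_)
  have h1 : ∑ i ∈ s, ‖S (a i)‖ ^ 2 ≤ C := by
    have h := (ENNReal.sum_le_tsum s).trans hS
    have e : ∑ i ∈ s, ‖S (a i)‖ₑ ^ 2 = ENNReal.ofReal (∑ i ∈ s, ‖S (a i)‖ ^ 2) := by
      rw [ENNReal.ofReal_sum_of_nonneg fun i _ => by positivity]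
      refine Finset.sum_congr rfl fun i _ => ?_
      rw [← ofReal_norm, ENNReal.ofReal_pow (norm_nonneg _)]
    rw [e, ENNReal.ofReal_le_ofReal_iff hC] at h
    exact h
  have h2 : ∑ i ∈ s, |a.repr x i| ^ 2 ≤ ‖x‖ ^ 2 := by
    have := a.orthonormal.sum_inner_products_le (x := x) (s := s)
    simpa [HilbertBasis.repr_apply_apply] using this
  calc ‖∑ i ∈ s, S (a.repr x i • a i)‖ ≤ ∑ i ∈ s, ‖S (a.repr x i • a i)‖ := norm_sum_le _ _
    _ = ∑ i ∈ s, |a.repr x i| * ‖S (a i)‖ := by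
        refine Finset.sum_congr rfl fun i _ => ?_
        rw [map_smul, norm_smul, Real.norm_eq_abs]
    _ ≤ √(∑ i ∈ s, |a.repr x i| ^ 2) * √(∑ i ∈ s, ‖S (a i)‖ ^ 2) :=
        Real.sum_mul_le_sqrt_mul_sqrt _ _ _
    _ ≤ √(‖x‖ ^ 2) * √C := by gcongr
    _ = √C * ‖x‖ := by rw [Real.sqrt_sq (norm_nonneg _), mul_comm]

variable [MeasurableSpace H] {T : ℝ} {a : HilbertBasis ι ℝ U} {g : ℝ → H → U →L[ℝ] H}

theorem CondG.continuous_apply (hg : CondG T a g) {t : ℝ} (ht : t ∈ Icc 0 T) :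
    Continuous fun z : H × U => g t z.1 z.2 := by
  have hc : Continuous fun x => g t x := by
    rw [continuous_iff_continuousAt]
    intro x
    obtain ⟨L, hL, hlip⟩ := hg.1 (‖x‖ + 1) (by positivity)
    rw [Metric.continuousAt_iff]
    intro ε hε
    have hε' : 0 < ε / (√L + 1) := by positivity
    refine ⟨min 1 (ε / (√L + 1)), by positivity, fun {y} hy => ?_⟩
    rw [dist_eq_norm] at hy ⊢
    have hy1 : ‖y‖ ≤ ‖x‖ + 1 := by
      have := norm_le_norm_add_norm_sub x y
      have h2 := hy.le.trans (min_le_left _ _)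
      rw [norm_sub_rev] at h2
      linarith
    have h1 : ‖g t y - g t x‖ ≤ √L * ‖y - x‖ := by
      refine ContinuousLinearMap.opNorm_le_bound _ (by positivity) fun v => ?_
      have := norm_apply_le_of_hsNormSq_le a (by positivity)
        (hlip t ht y x hy1 (by linarith)) v
      rwa [Real.sqrt_mul hL.le, Real.sqrt_sq (norm_nonneg _)] at this
    have h3 : ‖y - x‖ < ε / (√L + 1) := hy.trans_le (min_le_right _ _)
    rw [lt_div_iff₀ (by positivity)] at h3
    have h4 : √L * ‖y - x‖ ≤ ‖y - x‖ * (√L + 1) := by linarith [norm_nonneg (y - x)]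
    linarith
  exact (hc.comp continuous_fst).clm_apply continuous_snd

/-- Measurability of s ↦ g s (u s) (σ s) is of Carathéodory type: joint continuity in the last two
arguments and measurability in time. -/
theorem CondG.isPerturbation [TopologicalSpace.SeparableSpace U] [SecondCountableTopology H]
    [BorelSpace H] (hT : 0 ≤ T) (hg : CondG T a g) : ∃ c : ℝ, 0 ≤ c ∧
    ∀ σ : ℝ → U, MemLp σ 2 (volume.restrict (Icc 0 T)) →
      EvolEq.IsPerturbation T (fun s => c * ‖σ s‖) (fun s x => g s x (σ s)) := by
  obtain ⟨C, hC, hgr⟩ := hg.2.1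
  -- The extra 1 makes the rate dominate ‖σ‖, so the Lipschitz estimate is also a multiple of it.
  refine ⟨√C + 1, by positivity, fun σ hσ => ?_⟩
  have hσi : IntegrableOn (fun s => ‖σ s‖) (Icc 0 T) :=
    (hσ.integrable (by norm_num)).norm
  refine ⟨fun s => by positivity, hσi.const_mul _, fun u hu => ?_, ?_, fun R hR => ?_⟩
  · have hU : SecondCountableTopology U := UniformSpace.secondCountable_of_separable U
    borelize U
    -- The measurability of g is given on the time interval only; the projection extends it to the
    -- line without changing values on [0, T].
    let π : ℝ → Icc (0 : ℝ) T := projIcc 0 T hT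
    have hπ : Continuous π := continuous_projIcc
    have hsm : StronglyMeasurable (Function.uncurry
        fun (z : H × U) (t : ℝ) => g (π t) z.1 z.2) := by
      refine stronglyMeasurable_uncurry_of_continuous_of_stronglyMeasurable (fun t => ?_)
        fun z => ?_
      · exact hg.continuous_apply (π t).2
      · exact ((hg.2.2 z.1 z.2).comp hπ.measurable).stronglyMeasurable
    have hu' : Continuous fun t => u (π t) :=
      hu.comp_continuous (continuous_subtype_val.comp hπ) fun t => (π t).2
    have hσm := hσ.1
    have hcomp : StronglyMeasurable fun t => g (π t) (u (π t)) (hσm.mk σ t) :=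
      hsm.comp_measurable (g := fun t => ((u (π t), hσm.mk σ t), t))
        ((hu'.measurable.prodMk hσm.stronglyMeasurable_mk.measurable).prodMk measurable_id)
    refine ⟨_, hcomp, ?_⟩
    filter_upwards [hσm.ae_eq_mk, ae_restrict_mem measurableSet_Icc] with t h1 h2
    have : (π t : ℝ) = t := by simp only [π]; rw [projIcc_of_mem hT h2]
    simp only [this]
    rw [← h1]
  · filter_upwards [ae_restrict_mem measurableSet_Icc] with s hs x
    have h1 := norm_apply_le_of_hsNormSq_le a (by positivity) (hgr s hs x) (σ s)
    have h2 : √(C * (1 + ‖x‖ ^ 2)) ≤ √C * (1 + ‖x‖) := by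
      rw [Real.sqrt_mul hC.le]
      gcongr
      rw [Real.sqrt_le_left (by positivity)]
      nlinarith [norm_nonneg x]
    calc _ ≤ √C * (1 + ‖x‖) * ‖σ s‖ := h1.trans (by gcongr)
      _ ≤ (√C + 1) * (1 + ‖x‖) * ‖σ s‖ := by gcongr; linarith
      _ = _ := by ring
  · obtain ⟨L, hL, hlip⟩ := hg.1 R hR
    refine ⟨√L + 1, by positivity, ?_⟩
    filter_upwards [ae_restrict_mem measurableSet_Icc] with s hs x y hx hy
    have h1 := norm_apply_le_of_hsNormSq_le a (by positivity) (hlip s hs x y hx hy) (σ s)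
    rw [Real.sqrt_mul hL.le, Real.sqrt_sq (norm_nonneg _)] at h1
    rw [← sub_apply]
    have h2 : 0 ≤ √C := Real.sqrt_nonneg _
    calc _ ≤ √L * ‖x - y‖ * ‖σ s‖ := h1
      _ ≤ (√L + 1) * ‖x - y‖ * ((√C + 1) * ‖σ s‖) := by
          gcongr
          · linarith
          · exact le_mul_of_one_le_left (norm_nonneg _) (by linarith)
      _ = _ := by ring

end Noise

section Jump

variable {E : Type*} [MeasurableSpace E] {T : ℝ} {ν : Measure E}

/-- The time-dependent rate of the jump term under the control `ρ`. -/
def jumpRate (ν : Measure E) (κ₀ κ₁ : ℝ) (n₀ n₁ : ℝ → E → ℝ≥0∞) (ρ : ℝ → E → ℝ≥0) (s : ℝ) :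
    ℝ≥0∞ :=
  ∫⁻ ξ, (6 * ENNReal.ofReal (klFun (ρ s ξ)) + bigJump κ₀ (n₀ s ξ) (ρ s ξ)
    + bigJump κ₁ (n₁ s ξ) (ρ s ξ)) ∂ν

theorem measurable_bigJump (κ : ℝ) :
    Measurable fun z : ℝ≥0∞ × ℝ≥0 => bigJump κ z.1 z.2 := by
  have : (fun z : ℝ≥0∞ × ℝ≥0 => bigJump κ z.1 z.2) = {z : ℝ≥0∞ × ℝ≥0 | 2 < z.2}.indicator
      (fun z => ENNReal.ofReal (Real.exp (1 / (4 * κ))) * gexp κ z.1) := by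
    ext z
    rfl
  rw [this]
  exact (((measurable_gexp κ).comp measurable_fst).const_mul _).indicator
    (measurableSet_lt measurable_const measurable_snd)

/-- By Markov's inequality {ρ > 2} has measure at most 6Υ, since 6 klFun ≥ 1 there. The uniform
bound on the exponential then applies to this set. -/
theorem lintegral_bigJump_le {κ : ℝ} {n : ℝ → E → ℝ≥0∞} {ρ : ℝ → E → ℝ≥0}
    {M Υ : ℝ≥0∞} (hM : ∀ X : Set (ℝ × E), timeMeasure T ν X ≤ 6 * Υ →
      ∫⁻ z in X, gexp κ (n z.1 z.2) ∂(timeMeasure T ν) ≤ M)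
    (hρ : AEMeasurable (Function.uncurry ρ) (timeMeasure T ν))
    (hΥ : ∫⁻ z, ENNReal.ofReal (klFun (ρ z.1 z.2)) ∂(timeMeasure T ν) ≤ Υ) :
    ∫⁻ z, bigJump κ (n z.1 z.2) (ρ z.1 z.2) ∂(timeMeasure T ν)
      ≤ ENNReal.ofReal (Real.exp (1 / (4 * κ))) * M := by
  set X : Set (ℝ × E) := {z | 2 < ρ z.1 z.2} with hX
  have hXΥ : timeMeasure T ν X ≤ 6 * Υ := by
    have hm : AEMeasurable (fun z : ℝ × E => 6 * ENNReal.ofReal (klFun (ρ z.1 z.2)))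
        (timeMeasure T ν) :=
      ((measurable_klFun.comp measurable_coe_nnreal_real).ennreal_ofReal.comp_aemeasurable
        hρ).const_mul 6
    have h1 := mul_meas_ge_le_lintegral₀ hm 1
    rw [one_mul, lintegral_const_mul' _ _ (by norm_num)] at h1
    refine (measure_mono fun z hz => ?_).trans (h1.trans (by gcongr))
    have hz' : (2 : ℝ) ≤ ρ z.1 z.2 := by exact_mod_cast (le_of_lt hz : (2 : ℝ≥0) ≤ ρ z.1 z.2)
    have h2 := one_le_klFun hz'
    change (1 : ℝ≥0∞) ≤ 6 * ENNReal.ofReal (klFun (ρ z.1 z.2))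
    have h6 : (6 : ℝ≥0∞) = ENNReal.ofReal 6 := by simp
    rw [h6, ← ENNReal.ofReal_mul (by norm_num)]
    exact ENNReal.one_le_ofReal.2 h2
  have e : ∀ z : ℝ × E, bigJump κ (n z.1 z.2) (ρ z.1 z.2) = X.indicator (fun z =>
      ENNReal.ofReal (Real.exp (1 / (4 * κ))) * gexp κ (n z.1 z.2)) z := fun z => rfl
  simp_rw [e]
  refine (lintegral_indicator_le _ _).trans ?_
  rw [lintegral_const_mul' _ _ ENNReal.ofReal_ne_top]
  gcongr
  exact hM X hXΥ

theorem aemeasurable_jumpIntegrand {κ₀ κ₁ : ℝ} {n₀ n₁ : ℝ → E → ℝ≥0∞} {ρ : ℝ → E → ℝ≥0}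
    (h₀ : AEMeasurable (Function.uncurry n₀) (timeMeasure T ν))
    (h₁ : AEMeasurable (Function.uncurry n₁) (timeMeasure T ν))
    (hρ : AEMeasurable (Function.uncurry ρ) (timeMeasure T ν)) :
    AEMeasurable (fun z : ℝ × E => 6 * ENNReal.ofReal (klFun (ρ z.1 z.2)) ) (timeMeasure T ν) ∧
    AEMeasurable (fun z : ℝ × E => bigJump κ₀ (n₀ z.1 z.2) (ρ z.1 z.2)) (timeMeasure T ν) ∧
    AEMeasurable (fun z : ℝ × E => bigJump κ₁ (n₁ z.1 z.2) (ρ z.1 z.2)) (timeMeasure T ν) := by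
  refine ⟨?_, ?_, ?_⟩
  · have h : AEMeasurable (fun z : ℝ × E => ENNReal.ofReal (klFun (ρ z.1 z.2))) (timeMeasure T ν) :=
      (measurable_klFun.comp measurable_coe_nnreal_real).ennreal_ofReal.comp_aemeasurable hρ
    exact h.const_mul 6
  · exact (measurable_bigJump κ₀).comp_aemeasurable
      (f := fun z : ℝ × E => (n₀ z.1 z.2, ρ z.1 z.2)) (h₀.prodMk hρ)
  · exact (measurable_bigJump κ₁).comp_aemeasurable
      (f := fun z : ℝ × E => (n₁ z.1 z.2, ρ z.1 z.2)) (h₁.prodMk hρ)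

variable [SigmaFinite ν]

theorem aemeasurable_jumpRate {κ₀ κ₁ : ℝ} {n₀ n₁ : ℝ → E → ℝ≥0∞} {ρ : ℝ → E → ℝ≥0}
    (h₀ : AEMeasurable (Function.uncurry n₀) (timeMeasure T ν))
    (h₁ : AEMeasurable (Function.uncurry n₁) (timeMeasure T ν))
    (hρ : AEMeasurable (Function.uncurry ρ) (timeMeasure T ν)) :
    AEMeasurable (jumpRate ν κ₀ κ₁ n₀ n₁ ρ) (volume.restrict (Icc 0 T)) := by
  obtain ⟨m1, m2, m3⟩ := aemeasurable_jumpIntegrand (κ₀ := κ₀) (κ₁ := κ₁) h₀ h₁ hρ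
  exact ((m1.add m2).add m3).lintegral_prod_right'

/-- The bound M depends on the control only through Υ, while κ₀ and κ₁ depend on h alone. -/
theorem lintegral_jumpRate_le {n₀ n₁ : ℝ → E → ℝ≥0∞}
    (h₀ : ExpIntegrable T ν n₀) (h₁ : ExpIntegrable T ν n₁) :
    ∃ κ₀ κ₁ : ℝ, 0 < κ₀ ∧ 0 < κ₁ ∧ ∀ Υ : ℕ, ∃ M : ℝ≥0∞, M < ∞ ∧ ∀ ρ : ℝ → E → ℝ≥0,
      AEMeasurable (Function.uncurry ρ) (timeMeasure T ν) →
      ∫⁻ z, ENNReal.ofReal (klFun (ρ z.1 z.2)) ∂(timeMeasure T ν) ≤ Υ →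
      ∫⁻ s in Icc 0 T, jumpRate ν κ₀ κ₁ n₀ n₁ ρ s ≤ M := by
  obtain ⟨κ₀, hκ₀, u₀⟩ := h₀.uniform
  obtain ⟨κ₁, hκ₁, u₁⟩ := h₁.uniform
  refine ⟨κ₀, κ₁, hκ₀, hκ₁, fun Υ => ?_⟩
  obtain ⟨M₀, hM₀, b₀⟩ := u₀ (6 * Υ) (by finiteness)
  obtain ⟨M₁, hM₁, b₁⟩ := u₁ (6 * Υ) (by finiteness)
  refine ⟨6 * Υ + ENNReal.ofReal (Real.exp (1 / (4 * κ₀))) * M₀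
    + ENNReal.ofReal (Real.exp (1 / (4 * κ₁))) * M₁, by finiteness, fun ρ hρ hΥ => ?_⟩
  obtain ⟨m1, m2, m3⟩ := aemeasurable_jumpIntegrand (κ₀ := κ₀) (κ₁ := κ₁) h₀.1 h₁.1 hρ
  have e := lintegral_prod (μ := volume.restrict (Icc 0 T)) (ν := ν) _ ((m1.add m2).add m3)
  simp only [Pi.add_apply] at e
  unfold jumpRate
  rw [← e]
  change ∫⁻ z, _ ∂(timeMeasure T ν) ≤ _
  rw [lintegral_add_right' _ m3, lintegral_add_right' _ m2,
    lintegral_const_mul' _ _ (by norm_num)]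
  gcongr
  · exact lintegral_bigJump_le b₀ hρ hΥ
  · exact lintegral_bigJump_le b₁ hρ hΥ

end Jump

end

end FracSkeleton

/-! ### The jump integral as a perturbation -/

namespace FracSkeleton

open Filter Topology InformationTheory

noncomputable section

section JumpTerm

variable {E : Type*} {H : Type*} [NormedAddCommGroup H] {h : ℝ → H → E → H}

theorem enorm_le_hNorm0_mul (t : ℝ) (x : H) (ξ : E) :
    ‖h t x ξ‖ₑ ≤ hNorm0 h t ξ * (1 + ‖x‖ₑ) := by
  have h1 : ‖h t x ξ‖ₑ / (1 + ‖x‖ₑ) ≤ hNorm0 h t ξ :=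
    le_iSup (fun u : H => ‖h t u ξ‖ₑ / (1 + ‖u‖ₑ)) x
  rwa [ENNReal.div_le_iff (by simp) (by finiteness)] at h1

theorem enorm_sub_le_hNorm1_mul (t : ℝ) {x y : H} (hxy : x ≠ y) (ξ : E) :
    ‖h t x ξ - h t y ξ‖ₑ ≤ hNorm1 h t ξ * ‖x - y‖ₑ := by
  have h1 : ‖h t x ξ - h t y ξ‖ₑ / ‖x - y‖ₑ ≤ hNorm1 h t ξ := by
    unfold hNorm1
    exact le_iSup_of_le x (le_iSup_of_le y (le_iSup_of_le hxy le_rfl))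
  rwa [ENNReal.div_le_iff (by simpa [sub_eq_zero] using hxy) (by finiteness)] at h1

variable [MeasurableSpace E] {T : ℝ} {ν : Measure E}

/-- The common part of the growth and Lipschitz estimates of the jump term. -/
theorem lintegral_jump_le {κ : ℝ} (hκ : 0 < κ) {r : E → ℝ≥0} {a n : E → ℝ≥0∞}
    (ha : Measurable a) {C D : ℝ≥0∞} (hD0 : D ≠ 0) (hD : D ≠ ∞) (han : ∀ ξ, a ξ ≤ n ξ * D)
    (hC : ∫⁻ ξ, a ξ ^ 2 ∂ν ≤ C * D ^ 2) :
    ∫⁻ ξ, ‖(r ξ : ℝ) - 1‖ₑ * a ξ ∂ν ≤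
      D * ((∫⁻ ξ, (6 * ENNReal.ofReal (klFun (r ξ)) + bigJump κ (n ξ) (r ξ)) ∂ν) + C) := by
  calc ∫⁻ ξ, ‖(r ξ : ℝ) - 1‖ₑ * a ξ ∂ν
      ≤ ∫⁻ ξ, (D * (6 * ENNReal.ofReal (klFun (r ξ)) + bigJump κ (n ξ) (r ξ))
          + a ξ ^ 2 / D) ∂ν :=
        lintegral_mono fun ξ => enorm_sub_one_mul_le hκ (r ξ) hD0 hD (han ξ)
    _ = D * (∫⁻ ξ, (6 * ENNReal.ofReal (klFun (r ξ)) + bigJump κ (n ξ) (r ξ)) ∂ν)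
          + (∫⁻ ξ, a ξ ^ 2 ∂ν) / D := by
        rw [lintegral_add_right _ ((ha.pow_const 2).div_const D), lintegral_const_mul' _ _ hD]
        simp_rw [div_eq_mul_inv]
        rw [lintegral_mul_const' _ _ (ENNReal.inv_ne_top.2 hD0)]
    _ ≤ D * (∫⁻ ξ, (6 * ENNReal.ofReal (klFun (r ξ)) + bigJump κ (n ξ) (r ξ)) ∂ν)
          + (C * D ^ 2) / D := by gcongr
    _ = _ := by
        rw [pow_two, ← mul_assoc, ENNReal.mul_div_cancel_right hD0 hD, mul_add, mul_comm C]

variable [MeasurableSpace H]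

theorem CondH.measurable_section (hh : CondH T ν h) {t : ℝ} (ht : t ∈ Icc 0 T) (x : H) :
    Measurable (h t x) :=
  hh.1.comp (f := fun ξ : E => ((⟨t, ht⟩ : Icc (0 : ℝ) T), x, ξ)) (by fun_prop)

variable [BorelSpace H] [InnerProductSpace ℝ H]

/-- `lintegral_jump_le` with D = 1 + |x| and n = `hNorm0`; the squared integral is absorbed through
1 + |x|² ≤ (1 + |x|)². -/
theorem lintegral_jump_growth (hh : CondH T ν h) {κ₀ κ₁ : ℝ} (hκ₀ : 0 < κ₀) {C : ℝ} (hC : 0 < C)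
    {t : ℝ} (ht : t ∈ Icc 0 T)
    (hgr : ∀ u : H, ∫⁻ ξ, ‖h t u ξ‖ₑ ^ 2 ∂ν ≤ ENNReal.ofReal (C * (1 + ‖u‖ ^ 2)))
    (ρ : ℝ → E → ℝ≥0) (x : H) :
    ∫⁻ ξ, ‖((ρ t ξ : ℝ) - 1) • h t x ξ‖ₑ ∂ν ≤ ENNReal.ofReal (1 + ‖x‖)
      * (jumpRate ν κ₀ κ₁ (hNorm0 h) (hNorm1 h) ρ t + ENNReal.ofReal C) := by
  have hDe : ENNReal.ofReal (1 + ‖x‖) = 1 + ‖x‖ₑ := by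
    rw [ENNReal.ofReal_add zero_le_one (norm_nonneg _), ENNReal.ofReal_one, ofReal_norm]
  simp_rw [enorm_smul]
  refine (lintegral_jump_le hκ₀ (hh.measurable_section ht x).enorm (C := ENNReal.ofReal C)
    (D := ENNReal.ofReal (1 + ‖x‖)) (n := hNorm0 h t) ?_ ENNReal.ofReal_ne_top (fun ξ => ?_)
    ?_).trans ?_
  · rw [hDe]; simp
  · rw [hDe]; exact enorm_le_hNorm0_mul t x ξ
  · refine (hgr x).trans ?_
    rw [← ENNReal.ofReal_pow (by positivity), ← ENNReal.ofReal_mul hC.le]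
    refine ENNReal.ofReal_le_ofReal ?_
    gcongr
    nlinarith [norm_nonneg x]
  · gcongr
    exact lintegral_mono fun ξ => le_self_add

variable [SecondCountableTopology H]

/-- The same with D = |x - y| and n = `hNorm1`. Here D must be nonzero, so x = y is treated apart.
-/
theorem lintegral_jump_lipschitz (hh : CondH T ν h) {κ₀ κ₁ : ℝ} (hκ₁ : 0 < κ₁) {L : ℝ} (hL : 0 < L)
    {t : ℝ} (ht : t ∈ Icc 0 T)
    (hlip : ∀ u v : H, ∫⁻ ξ, ‖h t u ξ - h t v ξ‖ₑ ^ 2 ∂ν ≤ ENNReal.ofReal (L * ‖u - v‖ ^ 2))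
    (ρ : ℝ → E → ℝ≥0) (x y : H) :
    ∫⁻ ξ, ‖((ρ t ξ : ℝ) - 1) • (h t x ξ - h t y ξ)‖ₑ ∂ν ≤ ‖x - y‖ₑ
      * (jumpRate ν κ₀ κ₁ (hNorm0 h) (hNorm1 h) ρ t + ENNReal.ofReal L) := by
  rcases eq_or_ne x y with rfl | hxy
  · simp
  simp_rw [enorm_smul]
  refine (lintegral_jump_le hκ₁ ((hh.measurable_section ht x).sub
    (hh.measurable_section ht y)).enorm (C := ENNReal.ofReal L) (D := ‖x - y‖ₑ)
    (n := hNorm1 h t) ?_ (by finiteness) (fun ξ => enorm_sub_le_hNorm1_mul t hxy ξ) ?_).trans ?_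
  · simpa [sub_eq_zero] using hxy
  · refine (hlip x y).trans (le_of_eq ?_)
    rw [ENNReal.ofReal_mul hL.le, ENNReal.ofReal_pow (norm_nonneg _), ofReal_norm]
  · gcongr
    refine lintegral_mono fun ξ => ?_
    gcongr
    exact le_self_add

theorem aestronglyMeasurable_jump (hT : 0 ≤ T) (hh : CondH T ν h) {ρ : ℝ → E → ℝ≥0}
    (hρ : AEMeasurable (Function.uncurry ρ) (timeMeasure T ν)) {u : ℝ → H}
    (hu : ContinuousOn u (Icc 0 T)) :
    AEStronglyMeasurable (fun z : ℝ × E => ((ρ z.1 z.2 : ℝ) - 1) • h z.1 (u z.1) z.2)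
      (timeMeasure T ν) := by
  let π : ℝ → Icc (0 : ℝ) T := projIcc 0 T hT
  have hπ : Continuous π := continuous_projIcc
  have hu' : Continuous fun t => u (π t) :=
    hu.comp_continuous (continuous_subtype_val.comp hπ) fun t => (π t).2
  have hm : Measurable fun z : ℝ × E => h (π z.1) (u (π z.1)) z.2 :=
    hh.1.comp (f := fun z : ℝ × E => (π z.1, u (π z.1), z.2))
      ((hπ.measurable.comp measurable_fst).prodMk
        ((hu'.measurable.comp measurable_fst).prodMk measurable_snd))
  have hmem : ∀ᵐ z : ℝ × E ∂(timeMeasure T ν), z.1 ∈ Icc 0 T :=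
    Measure.quasiMeasurePreserving_fst.ae (ae_restrict_mem measurableSet_Icc)
  have h1 : AEStronglyMeasurable (fun z : ℝ × E => h z.1 (u z.1) z.2) (timeMeasure T ν) := by
    refine ⟨_, hm.stronglyMeasurable, hmem.mono fun z hz => ?_⟩
    have : (π z.1 : ℝ) = z.1 := by simp only [π]; rw [projIcc_of_mem hT hz]
    simp only [this]
  have h2 : AEStronglyMeasurable (fun z : ℝ × E => (ρ z.1 z.2 : ℝ) - 1) (timeMeasure T ν) := by
    have h3 : AEMeasurable (fun z : ℝ × E => (ρ z.1 z.2 : ℝ)) (timeMeasure T ν) :=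
      measurable_coe_nnreal_real.comp_aemeasurable hρ
    exact (h3.sub_const 1).aestronglyMeasurable
  exact h2.smul h1

variable [SigmaFinite ν]

/-- M is fixed before ρ. The exceptional set of times does not depend on x, because all estimates
hold wherever the rate is finite. -/
theorem CondH.exists_isPerturbation (hT : 0 ≤ T) (hh : CondH T ν h)
    (hh0 : ExpIntegrable T ν (hNorm0 h)) (hh1 : ExpIntegrable T ν (hNorm1 h)) (Υ : ℕ) :
    ∃ M : ℝ, ∀ ρ : ℝ → E → ℝ≥0, AEMeasurable (Function.uncurry ρ) (timeMeasure T ν) →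
      ∫⁻ z, ENNReal.ofReal (klFun (ρ z.1 z.2)) ∂(timeMeasure T ν) ≤ Υ →
      (∀ᵐ s ∂(volume.restrict (Icc 0 T)), ∀ x : H,
        Integrable (fun ξ => ((ρ s ξ : ℝ) - 1) • h s x ξ) ν) ∧
      ∃ b : ℝ → ℝ, ∫ s in Icc 0 T, b s ≤ M ∧ EvolEq.IsPerturbation T b
        (fun s x => ∫ ξ, ((ρ s ξ : ℝ) - 1) • h s x ξ ∂ν) := by
  obtain ⟨κ₀, κ₁, hκ₀, hκ₁, hrate⟩ := lintegral_jumpRate_le hh0 hh1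
  obtain ⟨M, hM, hMρ⟩ := hrate Υ
  obtain ⟨L, hL, hlip⟩ := hh.2.1
  obtain ⟨C, hC, hgr⟩ := hh.2.2
  refine ⟨M.toReal + (C + L) * T, fun ρ hρ hΥ => ?_⟩
  set W := jumpRate ν κ₀ κ₁ (hNorm0 h) (hNorm1 h) ρ with hW
  have hWm : AEMeasurable W (volume.restrict (Icc 0 T)) := aemeasurable_jumpRate hh0.1 hh1.1 hρ
  have hWM : ∫⁻ s in Icc 0 T, W s ≤ M := hMρ ρ hρ hΥ
  have hWfin : ∀ᵐ s ∂(volume.restrict (Icc 0 T)), W s < ∞ :=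
    ae_lt_top' hWm (hWM.trans_lt hM).ne
  have hWi : IntegrableOn (fun s => (W s).toReal) (Icc 0 T) :=
    integrable_toReal_of_lintegral_ne_top hWm (hWM.trans_lt hM).ne
  have hρm : ∀ᵐ s ∂(volume.restrict (Icc 0 T)),
      AEStronglyMeasurable (fun ξ => Function.uncurry ρ (s, ξ)) ν :=
    AEStronglyMeasurable.prodMk_left (f := Function.uncurry ρ) hρ.aestronglyMeasurable
  have hint : ∀ᵐ s ∂(volume.restrict (Icc 0 T)), ∀ x : H,
      Integrable (fun ξ => ((ρ s ξ : ℝ) - 1) • h s x ξ) ν := by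
    filter_upwards [hWfin, hρm, ae_restrict_mem measurableSet_Icc] with s h1 h2 h3 x
    refine ⟨?_, ?_⟩
    · have h4 : AEMeasurable (fun ξ => (ρ s ξ : ℝ)) ν :=
        measurable_coe_nnreal_real.comp_aemeasurable h2.aemeasurable
      exact (h4.sub_const 1).aestronglyMeasurable.smul
        (hh.measurable_section h3 x).stronglyMeasurable.aestronglyMeasurable
    · refine (lintegral_jump_growth (κ₁ := κ₁) hh hκ₀ hC h3 (hgr s h3) ρ x).trans_lt ?_
      exact ENNReal.mul_lt_top ENNReal.ofReal_lt_top
        (ENNReal.add_lt_top.2 ⟨h1, ENNReal.ofReal_lt_top⟩)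
  have hconst : IntegrableOn (fun _ : ℝ => C + L) (Icc 0 T) := integrableOn_const (by simp)
  -- The entropy rate, increased by both constants, serves growth and Lipschitz continuity at once;
  -- the Lipschitz constant on every ball is then 1.
  refine ⟨hint, fun s => (W s).toReal + (C + L), ?_, fun s => by positivity, hWi.add hconst,
    fun u hu => ?_, ?_, fun R hR => ⟨1, one_pos, ?_⟩⟩
  · rw [integral_add hWi hconst, setIntegral_const, smul_eq_mul, Real.volume_real_Icc_of_le hT,
      sub_zero, mul_comm T, integral_toReal hWm hWfin]
    gcongr
    exact hM.ne
  · exact (aestronglyMeasurable_jump hT hh hρ hu).integral_prod_right'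
  · filter_upwards [hWfin, ae_restrict_mem measurableSet_Icc] with s h1 h3 x
    have h4 := (enorm_integral_le_lintegral_enorm _).trans
      (lintegral_jump_growth (κ₁ := κ₁) hh hκ₀ hC h3 (hgr s h3) ρ x)
    have h5 : (W s + ENNReal.ofReal C) < ∞ := ENNReal.add_lt_top.2 ⟨h1, ENNReal.ofReal_lt_top⟩
    have h6 := ENNReal.toReal_mono (ENNReal.mul_lt_top ENNReal.ofReal_lt_top h5).ne h4
    rw [toReal_enorm, ENNReal.toReal_mul, ENNReal.toReal_ofReal (by positivity),
      ENNReal.toReal_add h1.ne ENNReal.ofReal_ne_top, ENNReal.toReal_ofReal hC.le] at h6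
    refine h6.trans ?_
    rw [mul_comm]
    gcongr
    linarith
  · filter_upwards [hWfin, hint, ae_restrict_mem measurableSet_Icc] with s h1 h2 h3 x y _ _
    rw [← integral_sub (h2 x) (h2 y)]
    simp_rw [← smul_sub]
    have h4 := (enorm_integral_le_lintegral_enorm _).trans
      (lintegral_jump_lipschitz (κ₀ := κ₀) hh hκ₁ hL h3 (hlip s h3) ρ x y)
    have h5 : (W s + ENNReal.ofReal L) < ∞ := ENNReal.add_lt_top.2 ⟨h1, ENNReal.ofReal_lt_top⟩
    have h6 := ENNReal.toReal_mono (ENNReal.mul_lt_top (by finiteness) h5).ne h4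
    rw [toReal_enorm, ENNReal.toReal_mul, toReal_enorm,
      ENNReal.toReal_add h1.ne ENNReal.ofReal_ne_top, ENNReal.toReal_ofReal hL.le] at h6
    refine h6.trans ?_
    rw [mul_comm, one_mul]
    gcongr
    linarith

end JumpTerm

end

end FracSkeleton

/-! ### Reduction of the equation to the abstract problem -/

namespace FracSkeleton

open Filter Topology InformationTheory

noncomputable section

/-- Adding a linear term and a constant turns `F` into a monotone nonlinearity. -/
theorem CondF.exists_nonlin {p : ℝ} (hp : 1 < p) {F : ℝ → ℝ} (hF : CondF p F) :
    ∃ k k₁ k₂ k₃ : ℝ, 0 < k ∧ Nonlin p k₁ k₂ k₃ fun r => F r + k * r - F 0 := by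
  obtain ⟨hC, ⟨k₁, hk₁, hgr⟩, ⟨k₂, hk₂, k₃, hk₃, hco⟩, k, hk, hder⟩ := hF
  have hd : Differentiable ℝ F := hC.differentiable (by norm_num)
  have hdf : ∀ r, HasDerivAt (fun r => F r + k * r - F 0) (deriv F r + k * 1) r := fun r =>
    (((hd r).hasDerivAt).add ((hasDerivAt_id r).const_mul k)).sub_const _
  have hF0 : |F 0| ≤ k₁ := by
    have := hgr 0
    rwa [abs_zero, Real.zero_rpow (by linarith), add_zero, mul_one] at this
  -- Growth: |F(0)| ≤ k₁ and k |r| ≤ k (1 + |r|^p). Coercivity: the term -r F(0) is absorbed by k r²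
  -- after completing the square, at the cost F(0)²/(4k).
  refine ⟨k, 2 * k₁ + k, k₂ + F 0 ^ 2 / (4 * k), k₃, hk, hp, by positivity, by positivity, hk₃,
    ?_, ?_, ?_, fun R => ?_, fun r => ?_, fun r => ?_⟩
  · exact (hC.continuous.add (by fun_prop)).sub continuous_const
  · refine monotone_of_deriv_nonneg (fun r => (hdf r).differentiableAt) fun r => ?_
    rw [(hdf r).deriv]
    linarith [hder r]
  · simp
  · have hc : ContinuousOn (deriv fun r => F r + k * r - F 0) (Icc (-R) R) := by
      have e : (deriv fun r => F r + k * r - F 0) = fun r => deriv F r + k * 1 :=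
        funext fun r => (hdf r).deriv
      rw [e]
      exact ((hC.continuous_deriv le_rfl).add continuous_const).continuousOn
    obtain ⟨L, hL⟩ := isCompact_Icc.exists_bound_of_continuousOn hc
    refine ⟨max L 0, le_max_right _ _, fun r s hr hs => ?_⟩
    exact Convex.norm_image_sub_le_of_norm_deriv_le (s := Icc (-R) R)
      (fun x _ => (hdf x).differentiableAt) (fun x hx => (hL x hx).trans (le_max_left _ _))
      (convex_Icc _ _) (abs_le.1 hs) (abs_le.1 hr)
  · have h1 := hgr r
    have h2 : |r| ≤ 1 + |r| ^ p := by
      rcases le_total |r| 1 with h | h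
      · have : 0 ≤ |r| ^ p := by positivity
        linarith
      · have := Real.self_le_rpow_of_one_le h hp.le
        linarith
    have h3 : |F r + k * r - F 0| ≤ |F r| + k * |r| + |F 0| := by
      refine (abs_sub _ _).trans ?_
      gcongr
      refine (abs_add_le _ _).trans ?_
      rw [abs_mul, abs_of_pos hk]
    have h4 := mul_le_mul_of_nonneg_left h2 hk.le
    have h5 : 0 ≤ k₁ * |r| ^ p := by positivity
    linarith
  · have h1 := hco r
    have h2 : -(F 0 ^ 2 / (4 * k)) ≤ k * r ^ 2 - r * F 0 := by
      have : 0 ≤ k * (r - F 0 / (2 * k)) ^ 2 := by positivity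
      have e : k * (r - F 0 / (2 * k)) ^ 2 = k * r ^ 2 - r * F 0 + F 0 ^ 2 / (4 * k) := by
        field_simp
        ring
      linarith
    linarith

section Equation

variable {d : ℕ} {O : Set (EuclideanSpace ℝ (Fin d))}

/-- The element `c 1_𝒪` of `ℍ`. -/
theorem exists_const (hO : MeasurableSet O) (hOf : volume O < ∞) (c : ℝ) :
    ∃ e : L2O O, ∀ φ : L2O O, inner ℝ e φ = ∫ x, c * φ.toFun x := by
  have hm : MemLp (O.indicator fun _ => c) 2 (volume : Measure (EuclideanSpace ℝ (Fin d))) :=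
    memLp_indicator_const 2 hO c (Or.inr hOf.ne)
  have hco := hm.coeFn_toLp
  let e : L2O O := ⟨hm.toLp _, by
    change ∀ᵐ x, x ∉ O → _ = 0
    filter_upwards [hco] with x hx hxO
    rw [hx, indicator_of_notMem hxO]⟩
  have he : e.toFun =ᵐ[volume] O.indicator fun _ => c := hco
  refine ⟨e, fun φ => ?_⟩
  rw [inner_eq_integral]
  refine integral_congr_ae ?_
  filter_upwards [he, toFun_eq_zero φ] with x h1 h2
  rw [h1]
  by_cases hx : x ∈ O
  · rw [indicator_of_mem hx]
  · rw [h2 hx, mul_zero, mul_zero]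

variable {p k k₁ k₂ k₃ γ δ T : ℝ} {F : ℝ → ℝ}

/-- F(u) = f(u) - k u + F(0), where the vector e stands for -F(0) 1_𝒪. The constant must be cut off
to 𝒪 to lie in ℍ, which is harmless because φ vanishes outside. -/
theorem integral_F_mul (hO : MeasurableSet O) (hOf : volume O < ∞)
    (hf : Nonlin p k₁ k₂ k₃ fun r => F r + k * r - F 0) {e : L2O O}
    (he : ∀ φ : L2O O, inner ℝ e φ = ∫ x, (-F 0) * φ.toFun x) {u φ : L2O O}
    (hu : lqInt (p + 1) u < ∞) (hφ : lqInt (p + 1) φ < ∞) :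
    ∫ x, F (u.toFun x) * φ.toFun x
      = (∫ x, (F (u.toFun x) + k * u.toFun x - F 0) * φ.toFun x) - inner ℝ (k • u + e) φ := by
  have i1 := hf.integrable_mul hO hOf hu hφ
  have i2 : Integrable fun x => k * (u.toFun x * φ.toFun x) :=
    ((memLp_toFun u).integrable_mul (memLp_toFun φ)).const_mul k
  have i3 : Integrable fun x => (-F 0) * φ.toFun x := by
    refine Integrable.const_mul ?_ _
    exact (integrable_norm_iff (measurable_toFun φ).aestronglyMeasurable).1
      (integrable_abs_toFun hO hOf φ)
  have h1 : inner ℝ (k • u + e) φ = (∫ x, k * (u.toFun x * φ.toFun x))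
      + ∫ x, (-F 0) * φ.toFun x := by
    rw [inner_add_left, he]
    congr 1
    rw [integral_const_mul, ← inner_eq_integral]
    exact real_inner_smul_left (F := L2O O) u φ k
  have i23 : Integrable fun x => k * (u.toFun x * φ.toFun x) + (-F 0) * φ.toFun x := i2.add i3
  rw [h1, ← integral_add i2 i3, ← integral_sub i1 i23]
  refine integral_congr_ae (Eventually.of_forall fun x => ?_)
  simp only
  ring

variable (hd : 1 ≤ d) (hO : IsOpen O) (hOf : volume O < ∞) (hγ : γ ∈ Ioo (0 : ℝ) 1) (hδ : 0 < δ)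
  (hf : Nonlin p k₁ k₂ k₃ fun r => F r + k * r - F 0)

include hd hO hOf hγ hδ hf

/-- The equation separates the linear form from F, so the linear part needs its own integrability,
derived from its own modulus of continuity. -/
theorem integrableOn_formA {u : ℝ → L2O O} (hu : ContinuousOn u (Icc 0 T))
    (hΛ : ∫⁻ t in Icc 0 T, (monotoneForm hd hO hOf hγ hδ hf).Lam (u t) < ∞) {φ : L2O O}
    (hφ : gagliardoSq γ φ.toFun < ∞) : IntegrableOn (fun t => formA γ δ (u t) φ) (Icc 0 T) := by
  refine EvolEq.MonotoneForm.integrableOn_of_modulus hu hΛ (L := fun v => formA γ δ v φ)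
    fun η hη => ?_
  obtain ⟨C, hC, h⟩ := formA_modulus hγ hδ hφ hη
  refine ⟨C, hC, fun v w hv hw => ?_⟩
  have hv' : gagliardoSq γ v.toFun + lqInt (p + 1) v < ∞ := hv
  have hw' : gagliardoSq γ w.toFun + lqInt (p + 1) w < ∞ := hw
  refine (h v w (ENNReal.add_lt_top.1 hv').1 (ENNReal.add_lt_top.1 hw').1).trans ?_
  have h1 := toReal_add_le_left hv'
  have h2 := toReal_add_le_left hw'
  change _ ≤ C * ‖v - w‖ + η * (1 + (gagliardoSq γ v.toFun + lqInt (p + 1) v).toReal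
    + (gagliardoSq γ w.toFun + lqInt (p + 1) w).toReal)
  gcongr

/-- The right-hand side of the equation, written with the monotone form. -/
theorem equation_eq {e : L2O O} (he : ∀ φ : L2O O, inner ℝ e φ = ∫ x, (-F 0) * φ.toFun x)
    {u G₁ G₂ : ℝ → L2O O} (hu : ContinuousOn u (Icc 0 T))
    (hΛ : ∫⁻ t in Icc 0 T, (monotoneForm hd hO hOf hγ hδ hf).Lam (u t) < ∞)
    (hG₁ : IntegrableOn G₁ (Icc 0 T)) (hG₂ : IntegrableOn G₂ (Icc 0 T)) {φ : L2O O}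
    (hφ : (monotoneForm hd hO hOf hγ hδ hf).Lam φ < ∞) (c : ℝ) {t : ℝ} (ht : t ∈ Icc 0 T) :
    c - (∫ s in (0 : ℝ)..t, formA γ δ (u s) φ)
      - (∫ s in (0 : ℝ)..t, ∫ x, F ((u s).toFun x) * φ.toFun x)
      + (∫ s in (0 : ℝ)..t, inner ℝ (G₁ s) φ) + ∫ s in (0 : ℝ)..t, inner ℝ (G₂ s) φ
    = c - (∫ s in (0 : ℝ)..t, (monotoneForm hd hO hOf hγ hδ hf).form (u s) φ)
      + ∫ s in (0 : ℝ)..t, inner ℝ (G₁ s + G₂ s + (k • u s + e)) φ := by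
  have hφ' : gagliardoSq γ φ.toFun + lqInt (p + 1) φ < ∞ := hφ
  obtain ⟨hφ1, hφ2⟩ := ENNReal.add_lt_top.1 hφ'
  have h0 : (0 : ℝ) ∈ Icc 0 T := ⟨le_rfl, ht.1.trans ht.2⟩
  have hae := EvolEq.MonotoneForm.ae_Lam_lt hu hΛ
  have hG₃ : IntegrableOn (fun s => k • u s + e) (Icc 0 T) :=
    ((hu.const_smul k).add continuousOn_const).integrableOn_Icc
  have j1 := EvolEq.MonotoneForm.intervalIntegrable_of_Icc
    (integrableOn_formA hd hO hOf hγ hδ hf hu hΛ hφ1) h0 ht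
  have j2 := EvolEq.MonotoneForm.intervalIntegrable_of_Icc
    (EvolEq.MonotoneForm.integrableOn_form hu hΛ hφ) h0 ht
  have j3 := EvolEq.MonotoneForm.intervalIntegrable_of_Icc (hG₁.inner_const φ) h0 ht
  have j4 := EvolEq.MonotoneForm.intervalIntegrable_of_Icc (hG₂.inner_const φ) h0 ht
  have j5 := EvolEq.MonotoneForm.intervalIntegrable_of_Icc (hG₃.inner_const φ) h0 ht
  have e1 : ∫ s in (0 : ℝ)..t, ∫ x, F ((u s).toFun x) * φ.toFun x
      = ∫ s in (0 : ℝ)..t, ((monotoneForm hd hO hOf hγ hδ hf).form (u s) φ - formA γ δ (u s) φ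
        - inner ℝ (k • u s + e) φ) := by
    refine intervalIntegral.integral_congr_ae ?_
    have hae' := (ae_restrict_iff' measurableSet_Icc).1 hae
    filter_upwards [hae'] with s hs hst
    rw [uIoc_of_le ht.1] at hst
    have hs' : gagliardoSq γ (u s).toFun + lqInt (p + 1) (u s) < ∞ :=
      hs ⟨hst.1.le, hst.2.trans ht.2⟩
    rw [integral_F_mul hO.measurableSet hOf hf he (ENNReal.add_lt_top.1 hs').2 hφ2]
    change _ = formA γ δ (u s) φ
      + (∫ x, (F ((u s).toFun x) + k * (u s).toFun x - F 0) * φ.toFun x) - _ - _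
    ring
  have e2 : ∫ s in (0 : ℝ)..t, inner ℝ (G₁ s + G₂ s + (k • u s + e)) φ
      = (∫ s in (0 : ℝ)..t, inner ℝ (G₁ s) φ) + (∫ s in (0 : ℝ)..t, inner ℝ (G₂ s) φ)
        + ∫ s in (0 : ℝ)..t, inner ℝ (k • u s + e) φ := by
    rw [← intervalIntegral.integral_add j3 j4, ← intervalIntegral.integral_add (j3.add j4) j5]
    refine intervalIntegral.integral_congr fun s _ => ?_
    simp only [inner_add_left]
  rw [e1, e2, intervalIntegral.integral_sub (j2.sub j1) j5, intervalIntegral.integral_sub j2 j1]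
  ring

variable {E U : Type*} [MeasurableSpace E] [NormedAddCommGroup U] [InnerProductSpace ℝ U]
  {g : ℝ → L2O O → U →L[ℝ] L2O O} {h : ℝ → L2O O → E → L2O O} {ν : Measure E}
  {u₀ : L2O O} {σ : ℝ → U} {ρ : ℝ → E → ℝ≥0} {u : ℝ → L2O O}

/-- Carries uniqueness and the bound from weak solutions of the abstract problem to solutions of the
equation; existence uses the converse below. -/
theorem IsSolution.isWeakSol {e : L2O O}
    (he : ∀ φ : L2O O, inner ℝ e φ = ∫ x, (-F 0) * φ.toFun x)
    (hu : IsSolution γ δ p T F g h ν u₀ σ ρ u) :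
    (monotoneForm hd hO hOf hγ hδ hf).IsWeakSol T (fun s => g s (u s) (σ s)
      + (∫ ξ, ((ρ s ξ : ℝ) - 1) • h s (u s) ξ ∂ν) + (k • u s + e)) u₀ u := by
  have hm : AEMeasurable (fun t => lqInt (p + 1) (u t)) (volume.restrict (Icc 0 T)) :=
    lowerSemicontinuous_lqInt.measurable.comp_aemeasurable
      (hu.continuousOn.aemeasurable measurableSet_Icc)
  have hΛ : ∫⁻ t in Icc 0 T, (monotoneForm hd hO hOf hγ hδ hf).Lam (u t) < ∞ := by
    change ∫⁻ t in Icc 0 T, (gagliardoSq γ (u t).toFun + lqInt (p + 1) (u t)) < ∞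
    rw [lintegral_add_right' _ hm]
    refine ENNReal.add_lt_top.2 ⟨(lintegral_mono fun t => ?_).trans_lt hu.memL2V, hu.memLp⟩
    exact le_add_self
  refine ⟨hu.continuousOn, hΛ, fun φ hφ t ht => ?_⟩
  have hφ' : gagliardoSq γ φ.toFun + lqInt (p + 1) φ < ∞ := hφ
  rw [hu.equation φ (ENNReal.add_lt_top.1 hφ').1 (ENNReal.add_lt_top.1 hφ').2 t ht]
  exact equation_eq hd hO hOf hγ hδ hf he hu.continuousOn hΛ hu.integrable_g
    hu.integrable_integral_h hφ _ ht

theorem isSolution_of_isWeakSol {e : L2O O}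
    (he : ∀ φ : L2O O, inner ℝ e φ = ∫ x, (-F 0) * φ.toFun x)
    (hu : (monotoneForm hd hO hOf hγ hδ hf).IsWeakSol T (fun s => g s (u s) (σ s)
      + (∫ ξ, ((ρ s ξ : ℝ) - 1) • h s (u s) ξ ∂ν) + (k • u s + e)) u₀ u)
    (i1 : IntegrableOn (fun s => g s (u s) (σ s)) (Icc 0 T))
    (i2 : ∀ᵐ s ∂(volume.restrict (Icc 0 T)),
      Integrable (fun ξ => ((ρ s ξ : ℝ) - 1) • h s (u s) ξ) ν)
    (i3 : IntegrableOn (fun s => ∫ ξ, ((ρ s ξ : ℝ) - 1) • h s (u s) ξ ∂ν) (Icc 0 T)) :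
    IsSolution γ δ p T F g h ν u₀ σ ρ u := by
  have hΛ : ∫⁻ t in Icc 0 T, (gagliardoSq γ (u t).toFun + lqInt (p + 1) (u t)) < ∞ := hu.lam
  refine ⟨hu.cont, ?_, ?_, i1, i2, i3, fun φ hφ1 hφ2 t ht => ?_⟩
  · have hm : AEMeasurable (fun t => ‖u t‖ₑ ^ 2) (volume.restrict (Icc 0 T)) :=
      ((hu.cont.aemeasurable measurableSet_Icc).enorm).pow_const 2
    unfold vNormSq
    rw [lintegral_add_left' hm]
    refine ENNReal.add_lt_top.2 ⟨?_, (lintegral_mono fun t => le_self_add).trans_lt hΛ⟩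
    have hi : IntegrableOn (fun t => ‖u t‖ ^ 2) (Icc 0 T) := (hu.cont.norm.pow 2).integrableOn_Icc
    refine lt_of_eq_of_lt (lintegral_congr fun t => ?_) hi.2
    rw [Real.enorm_of_nonneg (by positivity), ENNReal.ofReal_pow (norm_nonneg _), ofReal_norm]
  · exact (lintegral_mono fun t => le_add_self).trans_lt hΛ
  · have hφ : (monotoneForm hd hO hOf hγ hδ hf).Lam φ < ∞ := ENNReal.add_lt_top.2 ⟨hφ1, hφ2⟩
    rw [hu.eqn φ hφ t ht]
    exact (equation_eq hd hO hOf hγ hδ hf he hu.cont hu.lam i1 i3 hφ _ ht).symm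

/-- The abstract bound with the integral part divided by the coercivity constant; the 𝕍 norm is
dominated by |u|² + `Lam`. -/
theorem enorm_bound_of_isWeakSol (hT : 0 ≤ T) {G : ℝ → L2O O → L2O O} {b : ℝ → ℝ}
    (hG : EvolEq.IsPerturbation T b G) {B : ℝ} (hB : ∫ s in Icc 0 T, b s ≤ B)
    (hu : (monotoneForm hd hO hOf hγ hδ hf).IsWeakSol T (fun s => G s (u s)) u₀ u) :
    (⨆ t ∈ Icc (0 : ℝ) T, ‖u t‖ₑ ^ 2) + ∫⁻ t in Icc (0 : ℝ) T, vNormSq γ (u t)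
      ≤ ENNReal.ofReal (2 * (‖u₀‖ ^ 2 + 2 * |k₂ * volume.real O| * T + 2 * B) * Real.exp (8 * B))
        + ENNReal.ofReal ((min δ (min (fracConst d γ / 2) k₃))⁻¹ *
          (‖u₀‖ ^ 2 / 2 + |k₂ * volume.real O| * T + B * (1 + 2 * (2 * (‖u₀‖ ^ 2
            + 2 * |k₂ * volume.real O| * T + 2 * B) * Real.exp (8 * B))))) := by
  obtain ⟨h1, h2⟩ := hu.bound hT hG hB
  have hc : 0 < min δ (min (fracConst d γ / 2) k₃) :=
    (monotoneForm hd hO hOf hγ hδ hf).coer_pos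
  refine add_le_add (iSup₂_le fun t ht => ?_) ?_
  · rw [← ofReal_norm, ← ENNReal.ofReal_pow (norm_nonneg _)]
    exact ENNReal.ofReal_le_ofReal (h1 t ht)
  · have hi : IntegrableOn (fun s => ‖u s‖ ^ 2
        + ((monotoneForm hd hO hOf hγ hδ hf).Lam (u s)).toReal) (Icc 0 T) :=
      (hu.cont.norm.pow 2).integrableOn_Icc.add
        (EvolEq.MonotoneForm.integrableOn_Lam hu.cont hu.lam)
    have h3 : ∫ s in Icc 0 T, (‖u s‖ ^ 2
        + ((monotoneForm hd hO hOf hγ hδ hf).Lam (u s)).toReal) ≤ _ :=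
      (le_inv_mul_iff₀ hc).2 h2
    refine le_trans ?_ (ENNReal.ofReal_le_ofReal h3)
    rw [ofReal_integral_eq_lintegral_ofReal hi (Eventually.of_forall fun s => by positivity)]
    refine lintegral_mono_ae ?_
    filter_upwards [EvolEq.MonotoneForm.ae_Lam_lt hu.cont hu.lam] with s hs
    have hs' : gagliardoSq γ (u s).toFun + lqInt (p + 1) (u s) < ∞ := hs
    change ‖u s‖ₑ ^ 2 + gagliardoSq γ (u s).toFun ≤ ENNReal.ofReal (‖u s‖ ^ 2
      + (gagliardoSq γ (u s).toFun + lqInt (p + 1) (u s)).toReal)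
    rw [ENNReal.ofReal_add (by positivity) ENNReal.toReal_nonneg, ENNReal.ofReal_toReal hs'.ne,
      ENNReal.ofReal_pow (norm_nonneg _), ofReal_norm]
    gcongr
    exact le_self_add

end Equation

end

end FracSkeleton

/-! ### Well-posedness of the controlled equation -/

theorem theorem6p12
    {d : ℕ} (hd : 2 ≤ d)
    (O : Set (EuclideanSpace ℝ (Fin d))) (hO : IsOpen O) (hOb : Bornology.IsBounded O)
    (γ : ℝ) (hγ : γ ∈ Ioo (0 : ℝ) 1) (δ : ℝ) (hδ : 0 < δ)
    (p : ℝ) (hp : 2 < p + 1) (hp' : p + 1 ≤ 2 * d / (d - 2 * γ))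
    (T : ℝ) (hT : 0 < T)
    {U : Type*} [NormedAddCommGroup U] [InnerProductSpace ℝ U] [CompleteSpace U]
    [TopologicalSpace.SeparableSpace U] {ι : Type*} (a : HilbertBasis ι ℝ U)
    {E : Type*} [TopologicalSpace E] [PolishSpace E] [LocallyCompactSpace E]
    [MeasurableSpace E] [BorelSpace E] (ν : Measure E) [IsFiniteMeasureOnCompacts ν]
    (F : ℝ → ℝ) (hF : CondF p F)
    (g : ℝ → L2O O → U →L[ℝ] L2O O) (hg : CondG T a g)
    (h : ℝ → L2O O → E → L2O O) (hh : CondH T ν h)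
    (hh0 : ExpIntegrable T ν (hNorm0 h)) (hh1 : ExpIntegrable T ν (hNorm1 h))
    (u₀ : L2O O) :
    (∀ (σ : ℝ → U) (ρ : ℝ → E → ℝ≥0), (∃ Υ : ℕ, IsControl T ν Υ σ ρ) →
      ∃ u : ℝ → L2O O, IsSolution γ δ p T F g h ν u₀ σ ρ u ∧
        ∀ v : ℝ → L2O O, IsSolution γ δ p T F g h ν u₀ σ ρ v → EqOn v u (Icc 0 T)) ∧
    (∀ Υ : ℕ, ∃ C : ℝ, 0 < C ∧
      ∀ (σ : ℝ → U) (ρ : ℝ → E → ℝ≥0), IsControl T ν Υ σ ρ →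
        ∀ u : ℝ → L2O O, IsSolution γ δ p T F g h ν u₀ σ ρ u →
          (⨆ t ∈ Icc (0 : ℝ) T, ‖u t‖ₑ ^ 2) + ∫⁻ t in Icc (0 : ℝ) T, vNormSq γ (u t)
            ≤ ENNReal.ofReal C) := by
  have hOf : volume O < ∞ := hOb.measure_lt_top
  have hd1 : 1 ≤ d := by lia
  obtain ⟨k, k₁, k₂, k₃, hk, hf⟩ := hF.exists_nonlin (by linarith)
  obtain ⟨e, he⟩ := exists_const hO.measurableSet hOf (-F 0)
  obtain ⟨c, hc, hpg⟩ := hg.isPerturbation hT.le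
  -- For each Υ, one B bounds the integral of the total rate for all controls in S^Υ. This is all
  -- the uniform estimate needs.
  have hpert : ∀ Υ : ℕ, ∃ B : ℝ, ∀ (σ : ℝ → U) (ρ : ℝ → E → ℝ≥0), IsControl T ν Υ σ ρ →
      EvolEq.IsPerturbation T (fun s => c * ‖σ s‖) (fun s x => g s x (σ s)) ∧
      (∀ᵐ s ∂(volume.restrict (Icc 0 T)), ∀ x : L2O O,
        Integrable (fun ξ => ((ρ s ξ : ℝ) - 1) • h s x ξ) ν) ∧
      ∃ b : ℝ → ℝ, EvolEq.IsPerturbation T b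
          (fun s x => ∫ ξ, ((ρ s ξ : ℝ) - 1) • h s x ξ ∂ν) ∧
        ∫ s in Icc 0 T, (c * ‖σ s‖ + b s + (k + ‖e‖)) ≤ B := by
    intro Υ
    obtain ⟨M, hM⟩ := hh.exists_isPerturbation hT.le hh0 hh1 Υ
    -- ‖σ‖ ≤ 1 + ‖σ‖² and ∫ ‖σ‖² ≤ 2Υ give the first summand; the jump rate contributes M, the
    -- affine term the last.
    refine ⟨c * (T + 2 * Υ) + M + (k + ‖e‖) * T, fun σ ρ hc' => ?_⟩
    obtain ⟨hσ, hσΥ, hρ, hρΥ⟩ := hc'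
    obtain ⟨hint, b, hbM, hb⟩ := hM ρ hρ hρΥ
    have hG := hpg σ hσ
    refine ⟨hG, hint, b, hb, ?_⟩
    have hσ2 : IntegrableOn (fun s => ‖σ s‖ ^ 2) (Icc 0 T) := hσ.integrable_norm_pow (by norm_num)
    have h1 : IntegrableOn (fun _ : ℝ => (1 : ℝ)) (Icc 0 T) := integrableOn_const (by simp)
    have hle : ∫ s in Icc 0 T, c * ‖σ s‖ ≤ c * (T + 2 * Υ) := by
      have h2 : ∫ s in Icc 0 T, c * ‖σ s‖ ≤ ∫ s in Icc 0 T, c * (1 + ‖σ s‖ ^ 2) := by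
        refine integral_mono hG.integrable ((h1.add hσ2).const_mul c) fun s => ?_
        refine mul_le_mul_of_nonneg_left ?_ hc
        change ‖σ s‖ ≤ 1 + ‖σ s‖ ^ 2
        nlinarith [sq_nonneg (‖σ s‖ - 1), norm_nonneg (σ s)]
      refine h2.trans ?_
      rw [integral_const_mul, integral_add h1 hσ2, setIntegral_const, smul_eq_mul,
        Real.volume_real_Icc_of_le hT.le, sub_zero, mul_one]
      gcongr
      linarith
    have h3 : IntegrableOn (fun _ : ℝ => k + ‖e‖) (Icc 0 T) := integrableOn_const (by simp)
    have h4 : IntegrableOn (fun s => c * ‖σ s‖ + b s) (Icc 0 T) := hG.integrable.add hb.integrable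
    rw [integral_add h4 h3, integral_add hG.integrable hb.integrable, setIntegral_const,
      smul_eq_mul, Real.volume_real_Icc_of_le hT.le, sub_zero, mul_comm T]
    linarith
  have haff := EvolEq.isPerturbation_affine (T := T) hk.le e
  refine ⟨fun σ ρ hσρ => ?_, fun Υ => ?_⟩
  · obtain ⟨Υ, hΥ⟩ := hσρ
    obtain ⟨B, hB⟩ := hpert Υ
    obtain ⟨hp1, hint, b, hp2, -⟩ := hB σ ρ hΥ
    have hG := (hp1.add hp2).add haff
    obtain ⟨u, hu⟩ := EvolEq.MonotoneForm.exists_isWeakSol_perturbation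
      (A := monotoneForm hd1 hO hOf hγ hδ hf) hT.le hG u₀
    refine ⟨u, isSolution_of_isWeakSol hd1 hO hOf hγ hδ hf he hu (hp1.integrableOn hu.cont)
      (hint.mono fun s hs => hs _) (hp2.integrableOn hu.cont), fun v hv => ?_⟩
    exact (hv.isWeakSol hd1 hO hOf hγ hδ hf he).unique hG hu
  · obtain ⟨B, hB⟩ := hpert Υ
    -- The constant of `enorm_bound_of_isWeakSol` with B = B(Υ). The maxima with 0 and the added 1
    -- only serve positivity, as B comes without a sign.
    refine ⟨max 0 (2 * (‖u₀‖ ^ 2 + 2 * |k₂ * volume.real O| * T + 2 * B) * Real.exp (8 * B))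
      + max 0 ((min δ (min (fracConst d γ / 2) k₃))⁻¹ *
          (‖u₀‖ ^ 2 / 2 + |k₂ * volume.real O| * T + B * (1 + 2 * (2 * (‖u₀‖ ^ 2
            + 2 * |k₂ * volume.real O| * T + 2 * B) * Real.exp (8 * B))))) + 1,
      by positivity, fun σ ρ hσρ u hu => ?_⟩
    obtain ⟨hp1, -, b, hp2, hbB⟩ := hB σ ρ hσρ
    refine (enorm_bound_of_isWeakSol hd1 hO hOf hγ hδ hf hT.le ((hp1.add hp2).add haff) hbB
      (hu.isWeakSol hd1 hO hOf hγ hδ hf he)).trans ?_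
    rw [ENNReal.ofReal_add (by positivity) zero_le_one, ENNReal.ofReal_add (le_max_left _ _)
      (le_max_left _ _)]
    refine le_trans ?_ le_self_add
    gcongr <;> exact le_max_right _ _
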